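/- Let $d\ge 3$. All manifolds, metrics and functions are $C^\infty$. For a Riemannian metric $g$ on a $d$-manifold $M$ write $\nabla$ for its Levi-Civita connection, $\Delta$ for its Laplacian, ${\rm Sc}$ for its scalar curvature and $R$ for its Riemann tensor. A conformal structure $\boldsymbol c$ is a class of metrics modulo $g\sim\Omega^2g$, $0<\Omega\in C^\infty(M)$; a density of weight $w$ on $(M,\boldsymbol c)$ is a family of smooth functions $(f_g)_{g\in\boldsymbol c}$ with $f_{\Omega^2g}=\Omega^wf_g$. A defining function is an $s\in C^\infty(M)$ with $ds\ne0$ along its zero locus $\Sigma=\mathcal Z(s)$, and $\Sigma$ is oriented by the conormal $ds$. A defining density for $\Sigma$ is a weight $1$ density $\sigma$ such that each $\sigma_g$ is a defining function with zero locus $\Sigma$, and $d\sigma_g$ is a positive multiple of $ds$ along $\Sigma$. Put $$S(\sigma)_g=|\nabla\sigma_g|_g^2-\tfrac2d\,\sigma_g\Big(\Delta+\frac{{\rm Sc}}{2(d-1)}\Big)\sigma_g .$$ A scalar Riemannian pre-invariant is an assignment $(M,g,s)\mapsto P(s;g)$, a function on $M$ for each Riemannian $d$-manifold and defining function $s$,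 such that (i) $P(\phi^*s;\phi^*g)=\phi^*P(s;g)$ for diffeomorphisms $\phi$; (ii) $P(s;g)|_\Sigma=P(s';g)|_\Sigma$ if $s,s'$ have the same zero locus $\Sigma$ and orient it in the same way; (iii) there is one universal real polynomial giving $P(s;g)$, in all local coordinates and wherever $ds\neq0$, in terms of the coordinate derivatives (of order $\geq 0$) of the components $g_{ab}$ and of $s$, $(\det g)^{-1}$, and $|ds|_g^{-1}$. Then $P(\Sigma;g):=P(s;g)|_\Sigma$ is a Riemannian hypersurface invariant; it is a conformal hypersurface invariant of weight $w$ if moreover $P(\Sigma;\Omega^2g)=\Omega^wP(\Sigma;g)$ for all smooth $\Omega>0$. **Theorem.** (a) For every conformal $d$-manifold $(M,\boldsymbol c)$ and every defining function $s$ with zero locus $\Sigma$ there are a defining density $\sigma$ for $\Sigma$ and a smooth density $B$ of weight $-d$ with $S(\sigma)=1+\sigma^dB$, and $\mathcal B:=B|_\Sigma$, the obstruction density, does not depend on their choice. (b) $\mathcal B$ is a conformal hypersurface invariant of weight $-d$: there is such an invariant $P$ (depending only on $d$) with $\mathcal B_g=P(\Sigma;g)$ for all $(M,\boldsymbol c)$,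 $\Sigma$ and $g\in\boldsymbol c$. (c) There is one universal formula (depending only on $d$), a real linear combination of complete contractions, by means of the inverse metric, of tensor products of the unit conormal $n$, the derivatives $\bar\nabla^\ell {\rm I\!I}$, $0\le\ell\le d-1$, of the second fundamental form with respect to the Levi-Civita connection $\bar\nabla$ of $\Sigma$, the derivatives $\nabla^kR$, $0\le k\le d-2$, of the ambient curvature, and the metric, that gives $\mathcal B_g$ along $\Sigma$ for all $(M,\boldsymbol c)$, $\Sigma$ and $g\in\boldsymbol c$. -/

import Mathlib

open scoped Manifold ContDiff
open Bundle

universe u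

noncomputable section

namespace HypersurfaceInvariants

/-! ## Tensor calculus in a coordinate patch

A (covariant) tensor field of rank `k` on a patch of `ℝ^d` is the family of its components. -/

/-- The model space `ℝ^d`. -/
abbrev Model (d : ℕ) : Type := EuclideanSpace ℝ (Fin d)

/-- A field of `d × d` matrices (the components `g_{ab}` of a metric). -/
abbrev MatrixField (d : ℕ) : Type := Model d → Matrix (Fin d) (Fin d) ℝ

/-- The components `T_{a₁ … a_k}` of a covariant tensor field. -/
abbrev TensorField (d k : ℕ) : Type := (Fin k → Fin d) → Model d → ℝ

/-- The coordinate derivative `∂_a f`. -/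
def partialDeriv {d : ℕ} (a : Fin d) (f : Model d → ℝ) (y : Model d) : ℝ :=
  fderiv ℝ f y (EuclideanSpace.single a 1)

/-- The iterated coordinate derivative `∂_{a₁} ⋯ ∂_{a_k} f`. -/
def partialDerivs {d : ℕ} : List (Fin d) → (Model d → ℝ) → Model d → ℝ
  | [], f => f
  | a :: L, f => partialDeriv a (partialDerivs L f)

/-- The components `g^{ab}` of the inverse metric. -/
def inverseMetric {d : ℕ} (G : MatrixField d) (y : Model d) : Matrix (Fin d) (Fin d) ℝ :=
  (G y)⁻¹

/-- The Christoffel symbols `Γ^c_{ab}` of the Levi-Civita connection. -/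
def christoffel {d : ℕ} (G : MatrixField d) (c a b : Fin d) (y : Model d) : ℝ :=
  (1 / 2) * ∑ e, inverseMetric G y c e *
    (partialDeriv a (fun z => G z b e) y + partialDeriv b (fun z => G z a e) y
      - partialDeriv e (fun z => G z a b) y)

/-- The covariant derivative `∇_a T_{b₁ … b_k}`; the index of the derivative comes first. -/
def covDeriv {d k : ℕ} (G : MatrixField d) (T : TensorField d k) : TensorField d (k + 1) :=
  fun I y => partialDeriv (I 0) (T (Fin.tail I)) y
    - ∑ j : Fin k, ∑ c, christoffel G c (I 0) (Fin.tail I j) y *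
        T (Function.update (Fin.tail I) j c) y

/-- The components `R_{ab}{}^c{}_d` of `R(u,v)w = ∇_u ∇_v w - ∇_v ∇_u w - ∇_{[u,v]} w`, where
`(R(u,v)w)^c = u^a v^b w^d R_{ab}{}^c{}_d`. -/
def riemannUp {d : ℕ} (G : MatrixField d) (a b c e : Fin d) (y : Model d) : ℝ :=
  partialDeriv a (christoffel G c b e) y - partialDeriv b (christoffel G c a e) y
    + ∑ f, (christoffel G c a f y * christoffel G f b e y
      - christoffel G c b f y * christoffel G f a e y)

/-- The Riemann tensor `R_{abcd}`. -/
def riemann {d : ℕ} (G : MatrixField d) : TensorField d 4 :=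
  fun I y => ∑ e, G y (I 2) e * riemannUp G (I 0) (I 1) e (I 3) y

/-- The iterated covariant derivative `∇^k R`. -/
def riemannDeriv {d : ℕ} (G : MatrixField d) : (k : ℕ) → TensorField d (4 + k)
  | 0 => riemann G
  | k + 1 => covDeriv G (riemannDeriv G k)

/-- The Ricci tensor `Ric_{ab} = R_{ca}{}^c{}_b`. -/
def ricci {d : ℕ} (G : MatrixField d) (a b : Fin d) (y : Model d) : ℝ :=
  ∑ c, riemannUp G c a c b y

/-- The scalar curvature `Sc`. -/
def scalarCurvature {d : ℕ} (G : MatrixField d) (y : Model d) : ℝ :=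
  ∑ a, ∑ b, inverseMetric G y a b * ricci G a b y

/-- The Laplacian `Δ f = g^{ab} ∇_a ∇_b f`. -/
def laplacian {d : ℕ} (G : MatrixField d) (f : Model d → ℝ) (y : Model d) : ℝ :=
  ∑ a, ∑ b, inverseMetric G y a b *
    (partialDeriv a (partialDeriv b f) y - ∑ c, christoffel G c a b y * partialDeriv c f y)

/-- The square `|df|²_g` of the length of the differential. -/
def gradSq {d : ℕ} (G : MatrixField d) (f : Model d → ℝ) (y : Model d) : ℝ :=
  ∑ a, ∑ b, inverseMetric G y a b * partialDeriv a f y * partialDeriv b f y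

/-- `|∇f|² - (2/d) f (Δ + Sc / (2(d-1))) f`, in coordinates. -/
def coordS {d : ℕ} (G : MatrixField d) (f : Model d → ℝ) (y : Model d) : ℝ :=
  gradSq G f y - (2 / (d : ℝ)) * f y *
    (laplacian G f y + scalarCurvature G y / (2 * ((d : ℝ) - 1)) * f y)

/-! ### The hypersurface `s = 0` in a coordinate patch

All fields are given on the open set where `ds ≠ 0`; there they are the corresponding objects of
the level sets of `s`, and on `s = 0` those of the hypersurface. -/

/-- The unit conormal `n_a = ∂_a s / |ds|`. -/
def conormal {d : ℕ} (G : MatrixField d) (s : Model d → ℝ) : TensorField d 1 :=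
  fun I y => partialDeriv (I 0) s y / Real.sqrt (gradSq G s y)

/-- The tangential projection `δ_a^b - n_a n^b`. -/
def tangProj {d : ℕ} (G : MatrixField d) (s : Model d → ℝ) (a b : Fin d) (y : Model d) : ℝ :=
  (if a = b then 1 else 0) -
    conormal G s (fun _ => a) y * ∑ c, inverseMetric G y b c * conormal G s (fun _ => c) y

/-- The second fundamental form `II_{ab} = ∇^⊤_a n_b = (δ_a^c - n_a n^c) ∇_c n_b`. -/
def secondFF {d : ℕ} (G : MatrixField d) (s : Model d → ℝ) : TensorField d 2 :=
  fun I y => ∑ c, tangProj G s (I 0) c y * covDeriv G (conormal G s) ![c, I 1] y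

/-- The Levi-Civita connection `∇̄` of the hypersurface on tangential tensors: by the Gauss formula
it is `∇` followed by the tangential projection of all indices. -/
def hypDeriv {d k : ℕ} (G : MatrixField d) (s : Model d → ℝ) (T : TensorField d k) :
    TensorField d (k + 1) :=
  fun I y => ∑ J : Fin (k + 1) → Fin d, (∏ j, tangProj G s (I j) (J j) y) * covDeriv G T J y

/-- The iterated hypersurface derivative `∇̄^ℓ II`. -/
def secondFFDeriv {d : ℕ} (G : MatrixField d) (s : Model d → ℝ) :
    (l : ℕ) → TensorField d (2 + l)
  | 0 => secondFF G s
  | l + 1 => hypDeriv G s (secondFFDeriv G s l)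

/-! ### Universal formulas -/

/-- Formal linear combinations of partial contractions, by means of the inverse metric, of tensor
products of the conormal `n`, the derivatives `∇̄^ℓ II` of the second fundamental form, the
derivatives `∇^k R` of the curvature of the ambient metric, and that metric. `HypExpr k` are the
expressions with `k` free indices. -/
inductive HypExpr : ℕ → Type
  | const (c : ℝ) : HypExpr 0
  | metric : HypExpr 2
  | conormal : HypExpr 1
  | secondFF (l : ℕ) : HypExpr (2 + l)
  | curvature (k : ℕ) : HypExpr (4 + k)
  | add {k : ℕ} (e f : HypExpr k) : HypExpr k
  | mul {k l : ℕ} (e : HypExpr k) (f : HypExpr l) : HypExpr (k + l)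
  | permute {k : ℕ} (p : Equiv.Perm (Fin k)) (e : HypExpr k) : HypExpr k
  | contract {k : ℕ} (e : HypExpr (k + 2)) : HypExpr k

/-- The value of an expression for a metric `G` and the hypersurface `s = 0`. -/
def HypExpr.eval {d : ℕ} (G : MatrixField d) (s : Model d → ℝ) :
    {k : ℕ} → HypExpr k → TensorField d k
  | _, .const c => fun _ _ => c
  | _, .metric => fun I y => G y (I 0) (I 1)
  | _, .conormal => HypersurfaceInvariants.conormal G s
  | _, .secondFF l => secondFFDeriv G s l
  | _, .curvature k => riemannDeriv G k
  | _, .add e f => fun I y => e.eval G s I y + f.eval G s I y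
  | _, .mul e f => fun I y =>
      e.eval G s (fun i => I (Fin.castAdd _ i)) y * f.eval G s (fun j => I (Fin.natAdd _ j)) y
  | _, .permute p e => fun I y => e.eval G s (fun i => I (p i)) y
  | _, .contract e => fun I y =>
      ∑ a, ∑ b, inverseMetric G y a b * e.eval G s (Fin.cons a (Fin.cons b I)) y

/-- The expression contains only `∇̄^ℓ II` with `ℓ ≤ p` and `∇^k R` with `k ≤ q`. -/
def HypExpr.OrderLE (p q : ℕ) : {k : ℕ} → HypExpr k → Prop
  | _, .const _ => True
  | _, .metric => True
  | _, .conormal => True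
  | _, .secondFF l => l ≤ p
  | _, .curvature k => k ≤ q
  | _, .add e f => e.OrderLE p q ∧ f.OrderLE p q
  | _, .mul e f => e.OrderLE p q ∧ f.OrderLE p q
  | _, .permute _ e => e.OrderLE p q
  | _, .contract e => e.OrderLE p q

/-- The variables `∂_{a₁} ⋯ ∂_{a_m} g_{bc}`, `(det g)⁻¹`, `∂_{a₁} ⋯ ∂_{a_m} s`, `|ds|_g⁻¹`
(with `m ≥ 0`). -/
inductive JetVar (d : ℕ) : Type
  | metric (L : List (Fin d)) (b c : Fin d) : JetVar d
  | detInv : JetVar d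
  | func (L : List (Fin d)) : JetVar d
  | normInv : JetVar d

/-- The value of the variables at a point. -/
def JetVar.val {d : ℕ} (G : MatrixField d) (s : Model d → ℝ) (y : Model d) : JetVar d → ℝ
  | .metric L b c => partialDerivs L (fun z => G z b c) y
  | .detInv => ((G y).det)⁻¹
  | .func L => partialDerivs L s y
  | .normInv => (Real.sqrt (gradSq G s y))⁻¹

/-! ## Manifolds -/

/-- A smooth Riemannian metric on the smooth `d`-manifold `M`. -/
abbrev Metric (d : ℕ) (M : Type u) [TopologicalSpace M] [ChartedSpace (Model d) M]
    [IsManifold (𝓡 d) ∞ M] : Type u :=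
  ContMDiffRiemannianMetric (𝓡 d) ∞ (Model d) (fun x : M => TangentSpace (𝓡 d) x)

section Manifold

variable {d : ℕ} {M : Type u} [TopologicalSpace M] [ChartedSpace (Model d) M]
  [IsManifold (𝓡 d) ∞ M]

/-- The components `g(∂_a, ∂_b)` of a metric in a chart. -/
def coordMetric (g : Metric d M) (φ : OpenPartialHomeomorph M (Model d)) : MatrixField d :=
  fun y => Matrix.of fun a b =>
    g.inner (φ.symm y)
      (mfderiv (𝓡 d) (𝓡 d) φ.symm y (EuclideanSpace.single a 1 : Model d))
      (mfderiv (𝓡 d) (𝓡 d) φ.symm y (EuclideanSpace.single b 1 : Model d))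

/-- A function read in a chart. -/
def coordFun (f : M → ℝ) (φ : OpenPartialHomeomorph M (Model d)) : Model d → ℝ :=
  fun y => f (φ.symm y)

/-- `|∇f|² - (2/d) f (Δ + Sc / (2(d-1))) f`, a scalar on the Riemannian manifold `(M, g)`. -/
def yamabeS (g : Metric d M) (f : M → ℝ) (x : M) : ℝ :=
  coordS (coordMetric g (chartAt (Model d) x)) (coordFun f (chartAt (Model d) x))
    (chartAt (Model d) x x)

/-- The differential `ds` at a point. -/
def differential (d : ℕ) {M : Type u} [TopologicalSpace M] [ChartedSpace (Model d) M]
    (s : M → ℝ) (x : M) : TangentSpace (𝓡 d) x →L[ℝ] ℝ :=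
  mfderiv (𝓡 d) 𝓘(ℝ, ℝ) s x

/-- `s` is a defining function of the hypersurface `{s = 0}`. -/
structure IsDefiningFunction (d : ℕ) {M : Type u} [TopologicalSpace M] [ChartedSpace (Model d) M]
    (s : M → ℝ) : Prop where
  smooth : ContMDiff (𝓡 d) 𝓘(ℝ, ℝ) ∞ s
  regular : ∀ x, s x = 0 → differential d s x ≠ 0

/-- `s` and `s'` have the same zero locus and induce the same (co)orientation on it. -/
structure CompatiblyOriented (d : ℕ) {M : Type u} [TopologicalSpace M] [ChartedSpace (Model d) M]
    (s s' : M → ℝ) : Prop where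
  zeroLocus : ∀ x, s x = 0 ↔ s' x = 0
  orientation : ∀ x, s x = 0 → ∃ r : ℝ, 0 < r ∧ differential d s' x = r • differential d s x

/-- `g' = Ω² g` with `Ω` smooth and positive. -/
structure IsRescaling (Ω : M → ℝ) (g g' : Metric d M) : Prop where
  smooth : ContMDiff (𝓡 d) 𝓘(ℝ, ℝ) ∞ Ω
  pos : ∀ x, 0 < Ω x
  eq : ∀ (x : M) (v w : TangentSpace (𝓡 d) x), g'.inner x v w = Ω x ^ 2 * g.inner x v w

variable (d M) in
/-- A conformal structure: a conformal class of metrics. -/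
structure ConformalStructure where
  metrics : Set (Metric d M)
  isClass : ∃ g, metrics = {g' | ∃ Ω, IsRescaling Ω g g'}

/-- A smooth conformal density of weight `w`, i.e. a section of `𝓔[w]`: a smooth function in each
scale `g` of the conformal class, with `f_{Ω² g} = Ω^w f_g`. -/
structure Density (c : ConformalStructure d M) (w : ℝ) where
  toFun : c.metrics → M → ℝ
  smooth : ∀ g, ContMDiff (𝓡 d) 𝓘(ℝ, ℝ) ∞ (toFun g)
  rescale : ∀ (g g' : c.metrics) (Ω : M → ℝ), IsRescaling Ω g.1 g'.1 →
    ∀ x, toFun g' x = Ω x ^ w * toFun g x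

/-- A weight `1` density is a defining density for the hypersurface `{s = 0}` (with the orientation
given by `s`). -/
def IsDefiningDensity {c : ConformalStructure d M} (s : M → ℝ) (σ : Density c 1) : Prop :=
  ∀ g, IsDefiningFunction d (σ.toFun g) ∧ CompatiblyOriented d s (σ.toFun g)

/-- `b` is the obstruction density of the hypersurface `Σ = {s = 0}` in `(M, c)`: there is a
defining density `σ` of `Σ` with `S(σ) = 1 + σ^d B`, where `B` is a smooth density of weight `-d`,
and `b` is the restriction of `B` to `Σ`. -/
def IsObstructionDensity (c : ConformalStructure d M) (s : M → ℝ)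
    (b : c.metrics → {x : M // s x = 0} → ℝ) : Prop :=
  ∃ (σ : Density c 1) (B : Density c (-(d : ℝ))),
    IsDefiningDensity s σ ∧
    (∀ g x, yamabeS g.1 (σ.toFun g) x = 1 + σ.toFun g x ^ d * B.toFun g x) ∧
    ∀ g x, b g x = B.toFun g x.1

end Manifold

/-! ## Hypersurface invariants -/

/-- An assignment of a function `P(s; g)` to every Riemannian `d`-manifold `(M, g)` and every
function `s` on `M` (only defining functions `s` will matter). -/
abbrev ScalarAssignment (d : ℕ) : Type (u + 1) :=
  ∀ (M : Type u) [TopologicalSpace M] [ChartedSpace (Model d) M] [IsManifold (𝓡 d) ∞ M],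
    Metric d M → (M → ℝ) → M → ℝ

/-- Scalar Riemannian pre-invariants of hypersurfaces. The universal polynomial has to give
`P(s; g)` wherever `ds ≠ 0`, so that `|ds|⁻¹` makes sense. No volume form occurs among its
variables. -/
structure IsPreInvariant {d : ℕ} (P : ScalarAssignment.{u} d) : Prop where
  /-- `P(φ^* s; φ^* g) = φ^* P(s; g)` for diffeomorphisms `φ`; here `g' = φ^* g`. -/
  natural : ∀ (M N : Type u) [TopologicalSpace M] [ChartedSpace (Model d) M]
    [IsManifold (𝓡 d) ∞ M] [TopologicalSpace N] [ChartedSpace (Model d) N]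
    [IsManifold (𝓡 d) ∞ N] (φ : M ≃ₘ^∞⟮𝓡 d, 𝓡 d⟯ N) (g : Metric d N) (g' : Metric d M),
    (∀ (x : M) (v w : TangentSpace (𝓡 d) x), g'.inner x v w =
      g.inner (φ x) (mfderiv (𝓡 d) (𝓡 d) φ x v) (mfderiv (𝓡 d) (𝓡 d) φ x w)) →
    ∀ s : N → ℝ, IsDefiningFunction d s → ∀ x, P M g' (fun z => s (φ z)) x = P N g s (φ x)
  /-- On the hypersurface, `P(s; g)` is independent of the oriented defining function. -/
  independent : ∀ (M : Type u) [TopologicalSpace M] [ChartedSpace (Model d) M]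
    [IsManifold (𝓡 d) ∞ M] (g : Metric d M) (s s' : M → ℝ),
    IsDefiningFunction d s → IsDefiningFunction d s' → CompatiblyOriented d s s' →
    ∀ x, s x = 0 → P M g s x = P M g s' x
  /-- `P(s; g)` is given by a universal polynomial in local coordinates. -/
  polynomial : ∃ p : MvPolynomial (JetVar d) ℝ,
    ∀ (M : Type u) [TopologicalSpace M] [ChartedSpace (Model d) M] [IsManifold (𝓡 d) ∞ M]
      (g : Metric d M) (s : M → ℝ), IsDefiningFunction d s →
    ∀ φ ∈ IsManifold.maximalAtlas (𝓡 d) ∞ M, ∀ x ∈ φ.source,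
      differential d s x ≠ 0 →
      P M g s x = MvPolynomial.eval (JetVar.val (coordMetric g φ) (coordFun s φ) (φ x)) p

/-- The hypersurface invariant `P(Σ; g)` given by a pre-invariant `P` is a conformal covariant of
weight `w`: `P(Σ; Ω² g) = Ω^w P(Σ; g)`. -/
structure IsConformalCovariant {d : ℕ} (w : ℝ) (P : ScalarAssignment.{u} d) : Prop where
  preInvariant : IsPreInvariant P
  covariant : ∀ (M : Type u) [TopologicalSpace M] [ChartedSpace (Model d) M]
    [IsManifold (𝓡 d) ∞ M] (g g' : Metric d M) (Ω : M → ℝ), IsRescaling Ω g g' →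
    ∀ s : M → ℝ, IsDefiningFunction d s → ∀ x, s x = 0 → P M g' s x = Ω x ^ w * P M g s x

end HypersurfaceInvariants

end

/-! Existence. The equation `S(σ) = 1` is solved order by order at the hypersurface. If `S(σ) = 1 +
σ^(j+1) E`, then replacing `σ` by `σ (1 + C σ^(j+1))` adds `(2/d)(j+2)(d-j-1) C` to the coefficient
of `σ^(j+1)` along the hypersurface. This factor is nonzero for `j + 1 < d` and vanishes for `j + 1
= d`, so the recursion stops with an error `σ^d B` (`LaplaceAlg.exists_step`,
`LaplaceAlg.exists_solution`). Since `S` is invariant when the metric and the weight 1 density are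
rescaled together (`MetricAlg.yam_conf`), a solution in one scale is a solution in all.

Universal formula. The same computation is read backwards for an arbitrary solution `σ`. Components
of `∇^(k+2) σ` with a tangential slot come, up to curvature terms from the Ricci identity, from
tangential derivatives of `∇^(k+1) σ`; and tangential derivatives of `n`, `∇̄^ℓ II`, `∇^k R` are
again expressions in these fields, by the Weingarten formula. There remains the purely normal
component `y` of `∇^(k+2) σ`. Differentiating `S(σ)` along the gradient `k + 1` times gives `(2 -
2(k+1)/d) y` plus known terms along the hypersurface (`nab_iter_yamU_mod`). For `k + 1 < d` these
derivatives of `1 + σ^d B` vanish there and the coefficient is nonzero, so `y` is determined: the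
jets of order at most `d` are universal expressions (`On.jetU`). For `k + 1 = d` the coefficient is
zero, the unknown jet of order `d + 1` drops out, and the derivative is a nonzero multiple of `B`
(`On.obstruction`). Hence `B` is a universal expression along the hypersurface, which gives both
uniqueness and the formula. The orders are controlled by a weight: `∇̄^ℓ II` has weight `ℓ + 2`,
`∇^k R` has weight `k + 3`, and `B` has weight at most `d + 1`.

Universality is made precise algebraically. Tensor calculus takes place over a commutative
`ℝ`-algebra with commuting derivations (`MetricAlg`), and restriction to the hypersurface is
reduction modulo an ideal (`Geom`). A universal field is a family over all such models, and `Gen`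
records how it was built, so that the expression found at the end does not depend on the geometry.
Smooth functions on a patch form such a model (`patchGeom`).

Invariance. That the expression is independent of the chart is not checked term by term. At a point
where `ds ≠ 0` its value is the obstruction of the level set of `s` through that point, computed
from a local solution; `S` is invariant under changes of coordinates, hence so is this value
(`IsObstructionExpr.eval_comp`). Independence of the defining function and the conformal weight are
inherited from `B`. The polynomial form holds because jet polynomials are closed under
differentiation (`HypExpr.isJetPolynomial`). -/

namespace HypersurfaceInvariants

noncomputable section

/-! ## Metrics over algebras with commuting derivations -/

/-- A metric `G` with inverse `H` over an `ℝ`-algebra `A` with commuting derivations, which play the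
role of the coordinate derivatives. -/
structure MetricAlg (d : ℕ) (A : Type*) [CommRing A] [Algebra ℝ A] where
  D : Fin d → Derivation ℝ A A
  comm : ∀ a b f, D a (D b f) = D b (D a f)
  G : Matrix (Fin d) (Fin d) A
  H : Matrix (Fin d) (Fin d) A
  symm : ∀ a b, G a b = G b a
  mul_inv : G * H = 1

namespace MetricAlg

variable {d : ℕ} {A : Type*} [CommRing A] [Algebra ℝ A] (X : MetricAlg d A)

lemma G_transpose : X.G.transpose = X.G := by
  ext a b; exact X.symm b a

lemma inv_mul : X.H * X.G = 1 := mul_eq_one_comm.mp X.mul_inv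

lemma H_transpose : X.H.transpose = X.H := by
  have h1 : X.H.transpose * X.G = 1 := by
    have := congrArg Matrix.transpose X.mul_inv
    rwa [Matrix.transpose_mul, X.G_transpose, Matrix.transpose_one] at this
  calc X.H.transpose = X.H.transpose * (X.G * X.H) := by rw [X.mul_inv, mul_one]
    _ = X.H := by rw [← mul_assoc, h1, one_mul]

lemma H_symm (a b : Fin d) : X.H a b = X.H b a := by
  conv_lhs => rw [← X.H_transpose]
  rfl

lemma sum_H_G (a b : Fin d) : ∑ c, X.H a c * X.G c b = if a = b then 1 else 0 := by
  have := congrFun (congrFun X.inv_mul a) b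
  rwa [Matrix.mul_apply, Matrix.one_apply] at this

lemma sum_G_H (a b : Fin d) : ∑ c, X.G a c * X.H c b = if a = b then 1 else 0 := by
  have := congrFun (congrFun X.mul_inv a) b
  rwa [Matrix.mul_apply, Matrix.one_apply] at this

/-- The lowered Christoffel symbols, times two. -/
def chrLow (a b e : Fin d) : A := X.D a (X.G b e) + X.D b (X.G a e) - X.D e (X.G a b)

/-- The Christoffel symbols `Γ^c_{ab}`. -/
def chr (c a b : Fin d) : A :=
  algebraMap ℝ A (1 / 2) * ∑ e, X.H c e * X.chrLow a b e

lemma half_add_half : algebraMap ℝ A (1 / 2) + algebraMap ℝ A (1 / 2) = 1 := by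
  rw [← map_add]; norm_num

lemma chr_symm (c a b : Fin d) : X.chr c a b = X.chr c b a := by
  simp only [chr, chrLow]
  congr 1
  refine Finset.sum_congr rfl fun e _ => ?_
  rw [X.symm a b]; ring

lemma sum_G_mul_sum_H (v : Fin d → A) (e : Fin d) :
    ∑ c, X.G e c * ∑ f, X.H c f * v f = v e := by
  simp_rw [Finset.mul_sum, ← mul_assoc]
  rw [Finset.sum_comm]
  simp_rw [← Finset.sum_mul, sum_G_H]
  simp

lemma sum_H_mul_sum_G (v : Fin d → A) (e : Fin d) :
    ∑ c, X.H e c * ∑ f, X.G c f * v f = v e := by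
  simp_rw [Finset.mul_sum, ← mul_assoc]
  rw [Finset.sum_comm]
  simp_rw [← Finset.sum_mul, sum_H_G]
  simp

lemma sum_G_chr (a b e : Fin d) :
    ∑ c, X.G e c * X.chr c a b = algebraMap ℝ A (1 / 2) * X.chrLow a b e := by
  rw [← X.sum_G_mul_sum_H (fun e => X.chrLow a b e) e, Finset.mul_sum]
  refine Finset.sum_congr rfl fun c _ => ?_
  rw [chr]; ring

lemma chr_compat (c a b : Fin d) :
    X.D c (X.G a b) = ∑ e, X.chr e c a * X.G e b + ∑ e, X.chr e c b * X.G a e := by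
  have h1 : ∑ e, X.chr e c a * X.G e b = algebraMap ℝ A (1 / 2) * X.chrLow c a b := by
    rw [← sum_G_chr]
    refine Finset.sum_congr rfl fun e _ => ?_
    rw [X.symm e b, mul_comm]
  have h2 : ∑ e, X.chr e c b * X.G a e = algebraMap ℝ A (1 / 2) * X.chrLow c b a := by
    rw [← sum_G_chr]
    refine Finset.sum_congr rfl fun e _ => ?_
    rw [mul_comm]
  rw [h1, h2, chrLow, chrLow, X.symm b a]
  linear_combination (-X.D c (X.G a b)) * half_add_half (A := A)

/-- The Levi-Civita connection is the unique symmetric metric connection. -/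
lemma chr_unique (C : Fin d → Fin d → Fin d → A) (hs : ∀ c a b, C c a b = C c b a)
    (hc : ∀ c a b, X.D c (X.G a b) = ∑ e, C e c a * X.G e b + ∑ e, C e c b * X.G a e)
    (c a b : Fin d) : X.chr c a b = C c a b := by
  -- Koszul's argument: in the combination `chrLow` of three compatibility equations, the symmetry
  -- `hs` cancels everything but twice the wanted term.
  have key : ∀ e, algebraMap ℝ A (1 / 2) * X.chrLow a b e = ∑ f, X.G e f * C f a b := by
    intro e
    have hL : ∀ a b e, ∑ f, C f a b * X.G e f = ∑ f, C f a b * X.G f e := by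
      intro a b e
      refine Finset.sum_congr rfl fun f _ => ?_
      rw [X.symm e f]
    have h3 : ∑ f, X.G e f * C f a b = ∑ f, C f a b * X.G f e := by
      refine Finset.sum_congr rfl fun f _ => ?_
      rw [X.symm e f, mul_comm]
    rw [chrLow, hc, hc, hc, h3, hL, hL, hL]
    have e1 : ∑ f, C f a e * X.G f b = ∑ f, C f e a * X.G f b :=
      Finset.sum_congr rfl fun f _ => by rw [hs]
    have e2 : ∑ f, C f b e * X.G f a = ∑ f, C f e b * X.G f a :=
      Finset.sum_congr rfl fun f _ => by rw [hs]
    have e3 : ∑ f, C f b a * X.G f e = ∑ f, C f a b * X.G f e :=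
      Finset.sum_congr rfl fun f _ => by rw [hs]
    rw [e1, e2, e3]
    linear_combination (∑ f, C f a b * X.G f e) * half_add_half (A := A)
  rw [chr, Finset.mul_sum]
  rw [← X.sum_H_mul_sum_G (fun f => C f a b) c]
  refine Finset.sum_congr rfl fun e _ => ?_
  rw [← key]; ring

/-- The inverse metric is parallel. -/
lemma D_H (a p q : Fin d) :
    X.D a (X.H p q) = - ∑ f, X.chr p a f * X.H f q - ∑ f, X.chr q a f * X.H p f := by
  -- Differentiating `G * H = 1` yields the derivative of `H` multiplied by `G`; the factor is
  -- removed at the end by `sum_H_mul_sum_G`.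
  have h0 : ∀ r, ∑ c, X.G r c * X.D a (X.H c q) = - ∑ c, X.D a (X.G r c) * X.H c q := by
    intro r
    have := congrArg (X.D a) (X.sum_G_H r q)
    have hz : X.D a (if r = q then (1 : A) else 0) = 0 := by split_ifs <;> simp
    rw [hz, map_sum] at this
    simp only [Derivation.leibniz, smul_eq_mul] at this
    rw [Finset.sum_add_distrib] at this
    rw [eq_neg_iff_add_eq_zero, ← this]
    congr 1
    exact Finset.sum_congr rfl fun c _ => mul_comm _ _
  have h1 : ∀ r, ∑ c, X.D a (X.G r c) * X.H c q
      = X.chr q a r + ∑ c, X.G r c * ∑ f, X.chr c a f * X.H f q := by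
    intro r
    simp_rw [X.chr_compat a r]
    simp_rw [add_mul, Finset.sum_add_distrib]
    congr 1
    · simp_rw [Finset.sum_mul]
      rw [Finset.sum_comm]
      simp_rw [mul_assoc, ← Finset.mul_sum, sum_G_H]
      simp
    · simp_rw [Finset.sum_mul, Finset.mul_sum]
      rw [Finset.sum_comm]
      refine Finset.sum_congr rfl fun c _ => Finset.sum_congr rfl fun f _ => ?_
      ring
  rw [← X.sum_H_mul_sum_G (fun c => X.D a (X.H c q)) p]
  simp_rw [h0, h1]
  simp_rw [mul_neg, mul_add, Finset.sum_neg_distrib, Finset.sum_add_distrib]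
  rw [X.sum_H_mul_sum_G (fun c => ∑ f, X.chr c a f * X.H f q) p]
  have : ∑ x, X.H p x * X.chr q a x = ∑ f, X.chr q a f * X.H p f :=
    Finset.sum_congr rfl fun f _ => mul_comm _ _
  rw [this]; ring

/-! ### Covariant derivatives -/

/-- The covariant derivative `∇_a T`. -/
def cd {k : ℕ} (a : Fin d) (T : (Fin k → Fin d) → A) (J : Fin k → Fin d) : A :=
  X.D a (T J) - ∑ j, ∑ c, X.chr c a (J j) * T (Function.update J j c)

/-- The covariant derivative `∇ T`; the index of the derivative comes first. -/
def cov {k : ℕ} (T : (Fin k → Fin d) → A) : (Fin (k + 1) → Fin d) → A :=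
  fun I => X.cd (I 0) T (Fin.tail I)

lemma cov_cons {k : ℕ} (T : (Fin k → Fin d) → A) (a : Fin d) (J : Fin k → Fin d) :
    X.cov T (Fin.cons a J : Fin (k + 1) → Fin d) = X.cd a T J := by
  simp [cov]

lemma cd_add {k : ℕ} (a : Fin d) (T T' : (Fin k → Fin d) → A) (J : Fin k → Fin d) :
    X.cd a (fun J => T J + T' J) J = X.cd a T J + X.cd a T' J := by
  simp only [cd, map_add, mul_add, Finset.sum_add_distrib]; ring

lemma cd_sub {k : ℕ} (a : Fin d) (T T' : (Fin k → Fin d) → A) (J : Fin k → Fin d) :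
    X.cd a (fun J => T J - T' J) J = X.cd a T J - X.cd a T' J := by
  simp only [cd, map_sub, mul_sub, Finset.sum_sub_distrib]; ring

lemma cd_scalar (a : Fin d) (T : (Fin 0 → Fin d) → A) (J : Fin 0 → Fin d) :
    X.cd a T J = X.D a (T J) := by
  simp [cd]

lemma cd_comp_equiv {k l : ℕ} (ε : Fin k ≃ Fin l) (a : Fin d) (T : (Fin k → Fin d) → A)
    (J : Fin l → Fin d) :
    X.cd a (fun J => T (J ∘ ε)) J = X.cd a T (J ∘ ε) := by
  simp only [cd]
  congr 1
  rw [← ε.sum_comp]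
  refine Finset.sum_congr rfl fun j _ => Finset.sum_congr rfl fun c _ => ?_
  rw [Function.update_comp_eq_of_injective _ ε.injective]
  rfl

/-- The indices of the two factors may be interleaved arbitrarily: `α` and `β` tell where they sit
among the indices of the product. Each connection term acts on a slot of exactly one factor, which
is what the bijectivity of `Sum.elim α β` expresses. -/
lemma cd_mul {k l n : ℕ} (α : Fin k → Fin n) (β : Fin l → Fin n)
    (h : Function.Bijective (Sum.elim α β)) (a : Fin d)
    (T : (Fin k → Fin d) → A) (T' : (Fin l → Fin d) → A) (J : Fin n → Fin d) :
    X.cd a (fun J => T (J ∘ α) * T' (J ∘ β)) J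
      = X.cd a T (J ∘ α) * T' (J ∘ β) + T (J ∘ α) * X.cd a T' (J ∘ β) := by
  have hα : Function.Injective α := (Sum.elim_injective.mp h.1).1
  have hβ : Function.Injective β := (Sum.elim_injective.mp h.1).2.1
  have hne : ∀ i j, α i ≠ β j := (Sum.elim_injective.mp h.1).2.2
  simp only [cd, Derivation.leibniz, smul_eq_mul]
  have e1 : ∑ j, ∑ c, X.chr c a (J j) * (T (Function.update J j c ∘ α)
      * T' (Function.update J j c ∘ β))
      = (∑ j, ∑ c, X.chr c a ((J ∘ α) j) * T (Function.update (J ∘ α) j c)) * T' (J ∘ β)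
      + T (J ∘ α) * ∑ j, ∑ c, X.chr c a ((J ∘ β) j) * T' (Function.update (J ∘ β) j c) := by
    rw [← (Equiv.ofBijective _ h).sum_comp, Fintype.sum_sum_type]
    congr 1
    · rw [Finset.sum_mul]
      refine Finset.sum_congr rfl fun j _ => ?_
      rw [Finset.sum_mul]
      refine Finset.sum_congr rfl fun c _ => ?_
      simp only [Equiv.ofBijective_apply, Sum.elim_inl, Function.comp_apply]
      rw [Function.update_comp_eq_of_injective _ hα,
        Function.update_comp_eq_of_notMem_range _ _ (by rintro ⟨i, hi⟩; exact hne j i hi.symm)]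
      ring
    · rw [Finset.mul_sum]
      refine Finset.sum_congr rfl fun j _ => ?_
      rw [Finset.mul_sum]
      refine Finset.sum_congr rfl fun c _ => ?_
      simp only [Equiv.ofBijective_apply, Sum.elim_inr, Function.comp_apply]
      rw [Function.update_comp_eq_of_injective _ hβ,
        Function.update_comp_eq_of_notMem_range _ _ (by rintro ⟨i, hi⟩; exact hne i j hi)]
      ring
  rw [e1]; ring

/-- Holds because the inverse metric is parallel: by `D_H` the derivative of `H` supplies exactly
the connection terms of the two contracted slots. -/
lemma cd_contract {k : ℕ} (a : Fin d) (T : (Fin (k + 2) → Fin d) → A) (J : Fin k → Fin d) :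
    X.cd a (fun J => ∑ p, ∑ q, X.H p q * T (Fin.cons p (Fin.cons q J))) J
      = ∑ p, ∑ q, X.H p q * X.cd a T (Fin.cons p (Fin.cons q J)) := by
  have hu0 : ∀ p q c : Fin d, Function.update (Fin.cons p (Fin.cons q J) : Fin (k + 2) → Fin d) 0 c
      = Fin.cons c (Fin.cons q J) := fun p q c => Fin.update_cons_zero _ _ _
  have hu1 : ∀ p q c : Fin d, Function.update (Fin.cons p (Fin.cons q J) : Fin (k + 2) → Fin d)
      (Fin.succ 0) c = Fin.cons p (Fin.cons c J) := fun p q c => by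
    rw [← Fin.cons_update, Fin.update_cons_zero]
  have hu2 : ∀ (p q c : Fin d) (j : Fin k),
      Function.update (Fin.cons p (Fin.cons q J) : Fin (k + 2) → Fin d) j.succ.succ c
        = Fin.cons p (Fin.cons q (Function.update J j c)) := fun p q c j => by
    rw [← Fin.cons_update, ← Fin.cons_update]
  simp only [cd, Fin.sum_univ_succ (n := k + 1), Fin.sum_univ_succ (n := k), hu0, hu1, hu2,
    Fin.cons_zero, Fin.cons_succ, map_sum, Derivation.leibniz, smul_eq_mul, X.D_H]
  have e0 : ∑ p, ∑ q, X.H p q * ∑ c, X.chr c a p * T (Fin.cons c (Fin.cons q J))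
      = ∑ p, ∑ q, T (Fin.cons p (Fin.cons q J)) * ∑ f, X.chr p a f * X.H f q := by
    simp only [Finset.mul_sum]
    rw [Finset.sum_comm]
    conv_rhs => rw [Finset.sum_comm]
    refine Finset.sum_congr rfl fun q _ => ?_
    rw [Finset.sum_comm]
    refine Finset.sum_congr rfl fun p _ => Finset.sum_congr rfl fun f _ => ?_
    ring
  have e1 : ∑ p, ∑ q, X.H p q * ∑ c, X.chr c a q * T (Fin.cons p (Fin.cons c J))
      = ∑ p, ∑ q, T (Fin.cons p (Fin.cons q J)) * ∑ f, X.chr q a f * X.H p f := by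
    simp only [Finset.mul_sum]
    refine Finset.sum_congr rfl fun p _ => ?_
    rw [Finset.sum_comm]
    refine Finset.sum_congr rfl fun q _ => Finset.sum_congr rfl fun f _ => ?_
    ring
  have e2 : ∑ j : Fin k, ∑ c, X.chr c a (J j) *
        ∑ p, ∑ q, X.H p q * T (Fin.cons p (Fin.cons q (Function.update J j c)))
      = ∑ p, ∑ q, X.H p q * ∑ j : Fin k, ∑ c, X.chr c a (J j) *
        T (Fin.cons p (Fin.cons q (Function.update J j c))) := by
    simp only [Finset.mul_sum]
    have : ∀ j : Fin k, ∑ c, ∑ p, ∑ q, X.chr c a (J j) * (X.H p q *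
        T (Fin.cons p (Fin.cons q (Function.update J j c))))
        = ∑ p, ∑ q, ∑ c, X.H p q * (X.chr c a (J j) *
        T (Fin.cons p (Fin.cons q (Function.update J j c)))) := by
      intro j
      rw [Finset.sum_comm]
      refine Finset.sum_congr rfl fun p _ => ?_
      rw [Finset.sum_comm]
      refine Finset.sum_congr rfl fun q _ => Finset.sum_congr rfl fun c _ => ?_
      ring
    simp_rw [this]
    rw [Finset.sum_comm]
    refine Finset.sum_congr rfl fun p _ => ?_
    rw [Finset.sum_comm]
  rw [e2]
  simp only [mul_sub, mul_add, mul_neg, Finset.sum_add_distrib, Finset.sum_sub_distrib,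
    Finset.sum_neg_distrib]
  rw [e0, e1]
  ring

/-! ### Curvature -/

/-- The components `R_{ab}{}^c{}_e` of the curvature. -/
def riemUp (a b c e : Fin d) : A :=
  X.D a (X.chr c b e) - X.D b (X.chr c a e)
    + ∑ f, (X.chr c a f * X.chr f b e - X.chr c b f * X.chr f a e)

/-- The Riemann tensor `R_{abcd}`. -/
def riem : (Fin 4 → Fin d) → A :=
  fun I => ∑ e, X.G (I 2) e * X.riemUp (I 0) (I 1) e (I 3)

/-- The iterated covariant derivative `∇^k R`. -/
def riemDeriv : (k : ℕ) → (Fin (4 + k) → Fin d) → A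
  | 0 => X.riem
  | k + 1 => X.cov (riemDeriv k)

/-- The Ricci tensor. -/
def ric (a b : Fin d) : A := ∑ c, X.riemUp c a c b

/-- The scalar curvature. -/
def sc : A := ∑ a, ∑ b, X.H a b * X.ric a b

/-- The Laplacian. -/
def lap (f : A) : A :=
  ∑ a, ∑ b, X.H a b * (X.D a (X.D b f) - ∑ c, X.chr c a b * X.D c f)

/-- The inner product of the differentials of two functions. -/
def gr (f g : A) : A := ∑ a, ∑ b, X.H a b * X.D a f * X.D b g

lemma riemUp_eq (a b c e : Fin d) :
    X.riemUp a b c e = ∑ f, X.H c f * X.riem ![a, b, f, e] := by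
  simp only [riem, Matrix.cons_val]
  rw [X.sum_H_mul_sum_G (fun f => X.riemUp a b f e) c]

/-- The Ricci identity. -/
lemma cov_cov_sub {k : ℕ} (T : (Fin k → Fin d) → A) (a b : Fin d) (J : Fin k → Fin d) :
    X.cov (X.cov T) (Fin.cons a (Fin.cons b J)) - X.cov (X.cov T) (Fin.cons b (Fin.cons a J))
      = - ∑ j, ∑ e, X.riemUp a b e (J j) * T (Function.update J j e) := by
  have h1 : ∀ a b, X.cov (X.cov T) (Fin.cons a (Fin.cons b J))
      = X.D a (X.cd b T J) - ∑ c, X.chr c a b * X.cd c T J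
        - ∑ j, ∑ c, X.chr c a (J j) * X.cd b T (Function.update J j c) := by
    intro a b
    rw [cov_cons, cd, cov_cons, Fin.sum_univ_succ]
    simp only [Fin.cons_zero, Fin.cons_succ, Fin.update_cons_zero, ← Fin.cons_update, cov_cons]
    ring
  -- Products of two Christoffel symbols are split according to whether they act on the same slot,
  -- which yields the quadratic part of the curvature, or on different slots.
  have hoff : ∀ a b, ∑ j, ∑ c, X.chr c a (J j) * ∑ i, ∑ e,
        X.chr e b (Function.update J j c i) * T (Function.update (Function.update J j c) i e)
      = ∑ j, ∑ e, (∑ c, X.chr c a (J j) * X.chr e b c) * T (Function.update J j e)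
        + ∑ j, ∑ i, ∑ c, ∑ e, if i = j then 0 else X.chr c a (J j) * X.chr e b (J i)
            * T (Function.update (Function.update J j c) i e) := by
    intro a b
    rw [← Finset.sum_add_distrib]
    refine Finset.sum_congr rfl fun j _ => ?_
    simp_rw [Finset.mul_sum]
    rw [Finset.sum_comm]
    rw [← Finset.add_sum_erase _ _ (Finset.mem_univ j)]
    congr 1
    · rw [Finset.sum_comm]
      refine Finset.sum_congr rfl fun e _ => ?_
      rw [Finset.sum_mul]
      refine Finset.sum_congr rfl fun c _ => ?_
      simp; ring
    · rw [← Finset.add_sum_erase (a := j) _ (fun i => ∑ c, ∑ e, if i = j then 0 else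
            X.chr c a (J j) * X.chr e b (J i)
            * T (Function.update (Function.update J j c) i e)) (Finset.mem_univ j)]
      simp only [if_true, Finset.sum_const_zero, zero_add]
      refine Finset.sum_congr rfl fun i hi => ?_
      have hij : i ≠ j := (Finset.mem_erase.mp hi).1
      refine Finset.sum_congr rfl fun c _ => Finset.sum_congr rfl fun e _ => ?_
      rw [if_neg hij, Function.update_of_ne hij]; ring
  -- Terms acting on two different slots are symmetric in `a` and `b`, so they drop out of the
  -- commutator.
  have hsym : ∀ a b, (∑ j, ∑ i, ∑ c, ∑ e, if i = j then 0 else X.chr c a (J j) * X.chr e b (J i)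
            * T (Function.update (Function.update J j c) i e))
      = ∑ j, ∑ i, ∑ c, ∑ e, if i = j then 0 else X.chr c b (J j) * X.chr e a (J i)
            * T (Function.update (Function.update J j c) i e) := by
    intro a b
    rw [Finset.sum_comm]
    refine Finset.sum_congr rfl fun i _ => Finset.sum_congr rfl fun j _ => ?_
    rw [Finset.sum_comm]
    refine Finset.sum_congr rfl fun e _ => Finset.sum_congr rfl fun c _ => ?_
    by_cases hij : i = j
    · simp [hij]
    · rw [if_neg hij, if_neg (Ne.symm hij), Function.update_comm hij]; ring
  have h2 : ∀ a b, X.D a (X.cd b T J)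
        - ∑ j, ∑ c, X.chr c a (J j) * X.cd b T (Function.update J j c)
      = X.D a (X.D b (T J)) - (∑ j, ∑ e, X.D a (X.chr e b (J j)) * T (Function.update J j e))
        - (∑ j, ∑ c, X.chr c b (J j) * X.D a (T (Function.update J j c)))
        - (∑ j, ∑ c, X.chr c a (J j) * X.D b (T (Function.update J j c)))
        + (∑ j, ∑ c, X.chr c a (J j) * ∑ i, ∑ e,
        X.chr e b (Function.update J j c i) * T (Function.update (Function.update J j c) i e)) := by
    intro a b
    simp only [cd, map_sub, map_sum, Derivation.leibniz, smul_eq_mul, mul_sub,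
      Finset.sum_sub_distrib, Finset.sum_add_distrib]
    have : ∀ (u v : Fin k → Fin d → A), ∑ j, ∑ c, u j c * v j c = ∑ j, ∑ c, v j c * u j c :=
      fun u v => Finset.sum_congr rfl fun j _ => Finset.sum_congr rfl fun c _ => mul_comm _ _
    rw [this (fun j c => T (Function.update J j c)) (fun j c => X.D a (X.chr c b (J j)))]
    ring
  have h3 : ∑ j, ∑ e, X.riemUp a b e (J j) * T (Function.update J j e)
      = (∑ j, ∑ e, X.D a (X.chr e b (J j)) * T (Function.update J j e))
      - (∑ j, ∑ e, X.D b (X.chr e a (J j)) * T (Function.update J j e))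
      + (∑ j, ∑ e, (∑ c, X.chr c b (J j) * X.chr e a c) * T (Function.update J j e))
      - (∑ j, ∑ e, (∑ c, X.chr c a (J j) * X.chr e b c) * T (Function.update J j e)) := by
    simp only [← Finset.sum_add_distrib, ← Finset.sum_sub_distrib]
    refine Finset.sum_congr rfl fun j _ => Finset.sum_congr rfl fun e _ => ?_
    rw [riemUp, Finset.sum_sub_distrib]
    have : ∀ (u v : Fin d → A), ∑ c, u c * v c = ∑ c, v c * u c :=
      fun u v => Finset.sum_congr rfl fun c _ => mul_comm _ _
    rw [this (fun f => X.chr e a f), this (fun f => X.chr e b f)]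
    ring
  have h4 : ∑ c, X.chr c a b * X.cd c T J = ∑ c, X.chr c b a * X.cd c T J :=
    Finset.sum_congr rfl fun c _ => by rw [chr_symm]
  rw [h1, h1, h4, h3]
  have e1 := h2 a b
  have e2 := h2 b a
  rw [hoff] at e1 e2
  rw [hsym b a] at e2
  rw [X.comm b a] at e2
  linear_combination e1 - e2

end MetricAlg

end

end HypersurfaceInvariants

/-! ### The operator `S` over an algebra: coordinate changes and conformal covariance -/

namespace HypersurfaceInvariants

noncomputable section

namespace MetricAlg

variable {d : ℕ} {A A' : Type*} [CommRing A] [Algebra ℝ A] [CommRing A'] [Algebra ℝ A']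

/-- The operator `|df|² - (2/d) f (Δ + Sc / (2(d-1))) f`. -/
def yam (X : MetricAlg d A) (f : A) : A :=
  X.gr f f - algebraMap ℝ A (2 / d) * f *
    (X.lap f + algebraMap ℝ A (1 / (2 * ((d : ℝ) - 1))) * X.sc * f)

/-! ### Change of coordinates -/

/-- A map `h` of algebras with metrics that is a change of coordinates with Jacobian `J`. -/
structure FrameChange (X : MetricAlg d A) (X' : MetricAlg d A') (h : A' →ₐ[ℝ] A) where
  J : Matrix (Fin d) (Fin d) A
  K : Matrix (Fin d) (Fin d) A
  JK : J * K = 1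
  hD : ∀ a f, X.D a (h f) = ∑ b, J a b * h (X'.D b f)
  hG : X.G = J * X'.G.map h * J.transpose
  hJ : ∀ a b c, X.D a (J b c) = X.D b (J a c)

/-- The entrywise derivative of a matrix. -/
def dm (X : MetricAlg d A) (a : Fin d) (M : Matrix (Fin d) (Fin d) A) : Matrix (Fin d) (Fin d) A :=
  M.map (X.D a)

/-- The connection matrices: `chrMat a b c = Γ^c_{ab}`. -/
def chrMat (X : MetricAlg d A) (a : Fin d) : Matrix (Fin d) (Fin d) A :=
  Matrix.of fun b c => X.chr c a b

lemma dm_mul (X : MetricAlg d A) (a : Fin d) (M N : Matrix (Fin d) (Fin d) A) :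
    X.dm a (M * N) = X.dm a M * N + M * X.dm a N := by
  ext i j
  simp only [dm, Matrix.map_apply, Matrix.mul_apply, Matrix.add_apply, map_sum,
    Derivation.leibniz, smul_eq_mul, ← Finset.sum_add_distrib]
  exact Finset.sum_congr rfl fun _ _ => by ring

lemma dm_add (X : MetricAlg d A) (a : Fin d) (M N : Matrix (Fin d) (Fin d) A) :
    X.dm a (M + N) = X.dm a M + X.dm a N := by
  ext i j; simp [dm]

lemma dm_comm (X : MetricAlg d A) (a b : Fin d) (M : Matrix (Fin d) (Fin d) A) :
    X.dm a (X.dm b M) = X.dm b (X.dm a M) := by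
  ext i j; simp [dm, X.comm a b]

lemma dm_G (X : MetricAlg d A) (a : Fin d) :
    X.dm a X.G = X.chrMat a * X.G + X.G * (X.chrMat a).transpose := by
  ext i j
  simp only [dm, Matrix.map_apply, X.chr_compat, Matrix.add_apply, Matrix.mul_apply, chrMat,
    Matrix.of_apply, Matrix.transpose_apply]
  congr 1
  exact Finset.sum_congr rfl fun _ _ => mul_comm _ _

/-- The curvature matrices: `curvMat a b e c = R_{ab}{}^c{}_e`. -/
def curvMat (X : MetricAlg d A) (a b : Fin d) : Matrix (Fin d) (Fin d) A :=
  X.dm a (X.chrMat b) - X.dm b (X.chrMat a) + X.chrMat b * X.chrMat a - X.chrMat a * X.chrMat b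

lemma curvMat_apply (X : MetricAlg d A) (a b e c : Fin d) :
    X.curvMat a b e c = X.riemUp a b c e := by
  simp only [curvMat, riemUp, dm, chrMat, Matrix.sub_apply, Matrix.add_apply, Matrix.map_apply,
    Matrix.of_apply, Matrix.mul_apply, Finset.sum_sub_distrib]
  have : ∀ (u v : Fin d → A), ∑ c, u c * v c = ∑ c, v c * u c :=
      fun u v => Finset.sum_congr rfl fun c _ => mul_comm _ _
  rw [this (fun x => X.chr x b e), this (fun x => X.chr x a e)]
  ring

namespace FrameChange

variable {X : MetricAlg d A} {X' : MetricAlg d A'} {h : A' →ₐ[ℝ] A} (F : FrameChange X X' h)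
include F

lemma KJ : F.K * F.J = 1 := mul_eq_one_comm.mp F.JK

/-- The connection matrices of the new coordinates in the old ones. -/
def chrT (a : Fin d) : Matrix (Fin d) (Fin d) A :=
  ∑ p, F.J a p • (X'.chrMat p).map h

lemma dm_map (a : Fin d) (M : Matrix (Fin d) (Fin d) A') :
    X.dm a (M.map h) = ∑ p, F.J a p • (X'.dm p M).map h := by
  ext i j
  simp [dm, F.hD, Matrix.sum_apply]

/-- By uniqueness of the Levi-Civita connection: the right side times `K` is a connection that is
torsion-free because the Jacobian is closed (`hJ`, giving `hN`), and metric because the connection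
in the other coordinates is (`hdG`). -/
lemma chrMat_mul_J (a : Fin d) : X.chrMat a * F.J = X.dm a F.J + F.J * F.chrT a := by
  set M : Fin d → Matrix (Fin d) (Fin d) A := fun a => (X.dm a F.J + F.J * F.chrT a) * F.K with hM
  have hN : ∀ a b x, (X.dm a F.J + F.J * F.chrT a) b x = (X.dm b F.J + F.J * F.chrT b) a x := by
    intro a b x
    simp only [Matrix.add_apply, dm, Matrix.map_apply, F.hJ a b, Matrix.mul_apply, chrT,
      Matrix.sum_apply, Matrix.smul_apply, smul_eq_mul, chrMat, Matrix.of_apply, Finset.mul_sum]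
    congr 1
    rw [Finset.sum_comm]
    refine Finset.sum_congr rfl fun y _ => Finset.sum_congr rfl fun p _ => ?_
    rw [X'.chr_symm]; ring
  have hGM : ∀ c, M c * X.G = (X.dm c F.J + F.J * F.chrT c) * X'.G.map h * F.J.transpose := by
    intro c
    simp only [hM]
    rw [F.hG]
    simp only [Matrix.mul_assoc]
    rw [← Matrix.mul_assoc F.K F.J, F.KJ, Matrix.one_mul]
  have hGt : (X'.G.map h).transpose = X'.G.map h := by
    rw [← Matrix.transpose_map, X'.G_transpose]
  have hdG' : ∀ c, X.dm c (X'.G.map h)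
      = F.chrT c * X'.G.map h + X'.G.map h * (F.chrT c).transpose := by
    intro c
    rw [F.dm_map]
    simp only [chrT, X'.dm_G, Finset.sum_mul, Finset.mul_sum, Matrix.transpose_sum,
      Matrix.transpose_smul, Matrix.smul_mul, Matrix.mul_smul, ← Finset.sum_add_distrib, ← smul_add]
    refine Finset.sum_congr rfl fun p _ => ?_
    congr 1
    rw [← Matrix.transpose_map]
    rw [Matrix.map_add _ (map_add h), Matrix.map_mul, Matrix.map_mul]
  have hdG : ∀ c, X.dm c X.G = M c * X.G + X.G * (M c).transpose := by
    intro c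
    have e2 : X.G * (M c).transpose = (M c * X.G).transpose := by
      rw [Matrix.transpose_mul (M c), X.G_transpose]
    rw [e2, hGM, F.hG, dm_mul, dm_mul, hdG']
    have : X.dm c F.J.transpose = (X.dm c F.J).transpose := by ext i j; rfl
    rw [this]
    simp only [Matrix.transpose_mul, Matrix.transpose_add, Matrix.transpose_transpose, hGt]
    noncomm_ring
  have hchr : ∀ a, X.chrMat a = M a := by
    intro a
    ext b c
    refine X.chr_unique (fun c a b => M a b c) ?_ ?_ c a b
    · intro c a b
      simp only [hM, Matrix.mul_apply (N := F.K)]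
      exact Finset.sum_congr rfl fun x _ => by rw [hN]
    · intro c a b
      have := congrFun (congrFun (hdG c) a) b
      simp only [dm, Matrix.map_apply, Matrix.add_apply, Matrix.mul_apply,
        Matrix.transpose_apply] at this
      rw [this]
      congr 1
      exact Finset.sum_congr rfl fun _ _ => mul_comm _ _
  rw [hchr, hM, Matrix.mul_assoc, F.KJ, Matrix.mul_one]

/-- Differentiating `chrMat_mul_J` and antisymmetrizing removes the inhomogeneous term: second
derivatives of `J` cancel because derivations commute, and the first derivatives of `J` remaining in
`chrT` cancel by `hJ`. -/
lemma curvMat_mul_J (a b : Fin d) :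
    X.curvMat a b * F.J = F.J * ∑ p, ∑ q, (F.J a p * F.J b q) • (X'.curvMat p q).map h := by
  have h1 : X.curvMat a b * F.J = F.J * (X.dm a (F.chrT b) - X.dm b (F.chrT a)
      + F.chrT b * F.chrT a - F.chrT a * F.chrT b) := by
    have ha := F.chrMat_mul_J a
    have hb := F.chrMat_mul_J b
    have hab := congrArg (X.dm a) hb
    have hba := congrArg (X.dm b) ha
    rw [dm_mul, dm_add, dm_mul] at hab hba
    rw [X.dm_comm b a] at hba
    have e1 : X.dm a (X.chrMat b) * F.J = X.dm a (X.dm b F.J) + (X.dm a F.J * F.chrT b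
        + F.J * X.dm a (F.chrT b)) - X.chrMat b * X.dm a F.J := by rw [← hab]; abel
    have e2 : X.dm b (X.chrMat a) * F.J = X.dm a (X.dm b F.J) + (X.dm b F.J * F.chrT a
        + F.J * X.dm b (F.chrT a)) - X.chrMat a * X.dm b F.J := by rw [← hba]; abel
    have e3 : X.chrMat b * X.chrMat a * F.J = X.chrMat b * X.dm a F.J
        + (X.dm b F.J + F.J * F.chrT b) * F.chrT a := by
      rw [Matrix.mul_assoc, ha, Matrix.mul_add, ← Matrix.mul_assoc, hb]
    have e4 : X.chrMat a * X.chrMat b * F.J = X.chrMat a * X.dm b F.J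
        + (X.dm a F.J + F.J * F.chrT a) * F.chrT b := by
      rw [Matrix.mul_assoc, hb, Matrix.mul_add, ← Matrix.mul_assoc, ha]
    rw [curvMat, Matrix.sub_mul, Matrix.add_mul, Matrix.sub_mul, e1, e2, e3, e4]
    noncomm_ring
  rw [h1]
  congr 1
  have h2 : ∀ a b, X.dm a (F.chrT b) = ∑ q, X.D a (F.J b q) • (X'.chrMat q).map h
      + ∑ p, ∑ q, (F.J a p * F.J b q) • (X'.dm p (X'.chrMat q)).map h := by
    intro a b
    ext i j
    simp only [dm, chrT, Matrix.map_apply, Matrix.add_apply, Matrix.sum_apply, Matrix.smul_apply,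
      smul_eq_mul, map_sum, Derivation.leibniz, F.hD, Finset.sum_add_distrib, Finset.mul_sum]
    rw [add_comm]
    congr 1
    · exact Finset.sum_congr rfl fun _ _ => mul_comm _ _
    · rw [Finset.sum_comm]
      exact Finset.sum_congr rfl fun _ _ => Finset.sum_congr rfl fun _ _ => by ring
  have h3 : ∀ a b, F.chrT a * F.chrT b
      = ∑ p, ∑ q, (F.J a p * F.J b q) • (X'.chrMat p * X'.chrMat q).map h := by
    intro a b
    simp only [chrT, Finset.sum_mul, Finset.mul_sum, Matrix.smul_mul, Matrix.mul_smul, smul_smul,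
      Matrix.map_mul]
    rw [Finset.sum_comm]
    exact Finset.sum_congr rfl fun _ _ => Finset.sum_congr rfl fun _ _ => by rw [mul_comm]
  have h4 : ∀ (Z : Fin d → Fin d → Matrix (Fin d) (Fin d) A),
      ∑ p, ∑ q, (F.J b p * F.J a q) • Z p q = ∑ p, ∑ q, (F.J a p * F.J b q) • Z q p := by
    intro Z
    rw [Finset.sum_comm]
    exact Finset.sum_congr rfl fun _ _ => Finset.sum_congr rfl fun _ _ => by rw [mul_comm]
  rw [h2 a b, h2 b a, h3, h3, h4, h4]
  simp only [F.hJ a b]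
  rw [add_sub_add_left_eq_sub]
  simp only [← Finset.sum_sub_distrib, ← Finset.sum_add_distrib, ← smul_sub, ← smul_add]
  refine Finset.sum_congr rfl fun p _ => Finset.sum_congr rfl fun q _ => ?_
  congr 1
  ext i j
  simp only [curvMat, Matrix.sub_apply, Matrix.add_apply, Matrix.map_apply, map_sub, map_add]

lemma ric_eq (a b : Fin d) :
    X.ric a b = ∑ p, ∑ q, F.J a p * F.J b q * h (X'.ric p q) := by
  have h1 : ∀ c, X.curvMat c a
      = F.J * (∑ p, ∑ q, (F.J c p * F.J a q) • (X'.curvMat p q).map h) * F.K := by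
    intro c
    rw [← F.curvMat_mul_J, Matrix.mul_assoc, F.JK, Matrix.mul_one]
  have hKJ : ∀ x p, ∑ c, F.K x c * F.J c p = if x = p then 1 else 0 := by
    intro x p
    have := congrFun (congrFun F.KJ x) p
    rwa [Matrix.mul_apply, Matrix.one_apply] at this
  simp only [ric, ← curvMat_apply, h1]
  simp only [Matrix.mul_apply, Matrix.sum_apply, Matrix.smul_apply, Matrix.map_apply, smul_eq_mul,
    Finset.sum_mul, Finset.mul_sum, map_sum]
  have e1 : ∀ c x : Fin d, ∑ p, ∑ q, ∑ y,
      F.J b y * (F.J c p * F.J a q * h (X'.curvMat p q y x)) * F.K x c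
      = ∑ p, (F.K x c * F.J c p) * ∑ q, ∑ y, F.J a q * F.J b y * h (X'.curvMat p q y x) := by
    intro c x
    refine Finset.sum_congr rfl fun p _ => ?_
    simp only [Finset.mul_sum]
    refine Finset.sum_congr rfl fun y _ => Finset.sum_congr rfl fun q _ => ?_
    ring
  simp_rw [e1]
  rw [Finset.sum_comm]
  have e2 : ∀ x : Fin d, ∑ c, ∑ p, (F.K x c * F.J c p) *
        ∑ q, ∑ y, F.J a q * F.J b y * h (X'.curvMat p q y x)
      = ∑ q, ∑ y, F.J a q * F.J b y * h (X'.curvMat x q y x) := by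
    intro x
    rw [Finset.sum_comm]
    simp_rw [← Finset.sum_mul, hKJ]
    simp
  simp_rw [e2]
  rw [Finset.sum_comm]
  refine Finset.sum_congr rfl fun y _ => ?_
  rw [Finset.sum_comm]

lemma H_eq : X.H = F.K.transpose * X'.H.map h * F.K := by
  have h1 : X.G * (F.K.transpose * X'.H.map h * F.K) = 1 := by
    have e1 : F.J.transpose * F.K.transpose = 1 := by
      rw [← Matrix.transpose_mul, F.KJ, Matrix.transpose_one]
    have e2 : X'.G.map h * X'.H.map h = 1 := by
      rw [← Matrix.map_mul, X'.mul_inv, Matrix.map_one _ (map_zero h) (map_one h)]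
    rw [F.hG]
    calc F.J * X'.G.map h * F.J.transpose * (F.K.transpose * X'.H.map h * F.K)
        = F.J * X'.G.map h * (F.J.transpose * F.K.transpose) * X'.H.map h * F.K := by
          simp only [Matrix.mul_assoc]
      _ = F.J * (X'.G.map h * X'.H.map h) * F.K := by
          rw [e1, Matrix.mul_one]; simp only [Matrix.mul_assoc]
      _ = 1 := by rw [e2, Matrix.mul_one, F.JK]
  calc X.H = X.H * (X.G * (F.K.transpose * X'.H.map h * F.K)) := by rw [h1, mul_one]
    _ = _ := by rw [← mul_assoc, X.inv_mul, one_mul]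

lemma trace_eq (t : Fin d → Fin d → A) :
    ∑ a, ∑ b, X.H a b * ∑ p, ∑ q, F.J a p * F.J b q * t p q
      = ∑ p, ∑ q, h (X'.H p q) * t p q := by
  have e2 : F.J.transpose * X.H * F.J = X'.H.map h := by
    have e1 : F.J.transpose * F.K.transpose = 1 := by
      rw [← Matrix.transpose_mul, F.KJ, Matrix.transpose_one]
    rw [F.H_eq]
    calc F.J.transpose * (F.K.transpose * X'.H.map h * F.K) * F.J
        = (F.J.transpose * F.K.transpose) * X'.H.map h * (F.K * F.J) := by
          simp only [Matrix.mul_assoc]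
      _ = _ := by rw [e1, F.KJ, Matrix.one_mul, Matrix.mul_one]
  have e3 : ∀ p q, h (X'.H p q) = ∑ b, ∑ a, F.J a p * X.H a b * F.J b q := by
    intro p q
    have := congrFun (congrFun e2 p) q
    simp only [Matrix.mul_apply, Matrix.map_apply, Matrix.transpose_apply, Finset.sum_mul] at this
    exact this.symm
  simp_rw [e3, Finset.mul_sum, Finset.sum_mul]
  have : ∀ (u : Fin d → Fin d → Fin d → Fin d → A), ∑ a, ∑ b, ∑ p, ∑ q, u a b p q
      = ∑ p, ∑ q, ∑ b, ∑ a, u a b p q := by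
    intro u
    simp_rw [Finset.sum_comm (s := Finset.univ (α := Fin d)) (t := Finset.univ (α := Fin d))
      (f := fun b p => ∑ q, u _ b p q)]
    rw [Finset.sum_comm]
    refine Finset.sum_congr rfl fun p _ => ?_
    rw [Finset.sum_comm]
    have : ∀ b, ∑ a, ∑ q, u a b p q = ∑ q, ∑ a, u a b p q := fun b => Finset.sum_comm
    simp_rw [this]
    rw [Finset.sum_comm]
  rw [this]
  exact Finset.sum_congr rfl fun p _ => Finset.sum_congr rfl fun q _ =>
    Finset.sum_congr rfl fun a _ => Finset.sum_congr rfl fun b _ => by ring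

lemma sc_eq : X.sc = h X'.sc := by
  simp only [sc, F.ric_eq, F.trace_eq, map_sum, map_mul]

lemma gr_eq (f g : A') : X.gr (h f) (h g) = h (X'.gr f g) := by
  simp only [gr, map_sum, map_mul]
  have := F.trace_eq (fun p q => h (X'.D p f) * h (X'.D q g))
  simp only [← mul_assoc] at this
  rw [← this]
  refine Finset.sum_congr rfl fun a _ => Finset.sum_congr rfl fun b _ => ?_
  rw [F.hD, F.hD, mul_assoc, Finset.sum_mul_sum]
  congr 1
  refine Finset.sum_congr rfl fun p _ => Finset.sum_congr rfl fun q _ => ?_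
  ring

/-- The Hessian is tensorial: the derivative of `J` from the chain rule cancels against the
inhomogeneous part of `chrMat_mul_J`. Then both sides are traced. -/
lemma lap_eq (f : A') : X.lap (h f) = h (X'.lap f) := by
  have key : ∀ a b, X.D a (X.D b (h f)) - ∑ c, X.chr c a b * X.D c (h f)
      = ∑ p, ∑ q, F.J a p * F.J b q *
        h (X'.D p (X'.D q f) - ∑ c, X'.chr c p q * X'.D c f) := by
    intro a b
    have e1 : ∑ c, X.chr c a b * X.D c (h f)
        = ∑ x, X.D a (F.J b x) * h (X'.D x f)
        + ∑ p, ∑ q, F.J a p * F.J b q * ∑ c, h (X'.chr c p q) * h (X'.D c f) := by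
      simp_rw [F.hD, Finset.mul_sum, ← mul_assoc]
      rw [Finset.sum_comm]
      have e0 : ∀ x, ∑ c, X.chr c a b * F.J c x * h (X'.D x f)
          = (X.dm a F.J + F.J * F.chrT a) b x * h (X'.D x f) := by
        intro x
        rw [← F.chrMat_mul_J, Matrix.mul_apply, Finset.sum_mul]
        rfl
      simp_rw [e0, Matrix.add_apply, add_mul, Finset.sum_add_distrib]
      congr 1
      simp only [Matrix.mul_apply, chrT, Matrix.sum_apply, Matrix.smul_apply, Matrix.map_apply,
        smul_eq_mul, Finset.mul_sum, Finset.sum_mul, chrMat, Matrix.of_apply]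
      rw [Finset.sum_comm]
      conv_rhs => rw [Finset.sum_comm]
      refine Finset.sum_congr rfl fun q _ => ?_
      rw [Finset.sum_comm]
      exact Finset.sum_congr rfl fun p _ => Finset.sum_congr rfl fun c _ => by ring
    rw [e1, F.hD]
    simp only [map_sum, Derivation.leibniz, smul_eq_mul, F.hD, map_sub, map_mul, mul_sub,
      Finset.sum_sub_distrib, Finset.sum_add_distrib]
    have e2 : ∑ x, F.J b x * ∑ p, F.J a p * h (X'.D p (X'.D x f))
        = ∑ p, ∑ q, F.J a p * F.J b q * h (X'.D p (X'.D q f)) := by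
      simp only [Finset.mul_sum]
      rw [Finset.sum_comm]
      exact Finset.sum_congr rfl fun p _ => Finset.sum_congr rfl fun c _ => by ring
    have e3 : ∑ x, h (X'.D x f) * X.D a (F.J b x) = ∑ x, X.D a (F.J b x) * h (X'.D x f) :=
      Finset.sum_congr rfl fun _ _ => mul_comm _ _
    rw [e2, e3]; ring
  rw [lap]
  simp_rw [key]
  rw [F.trace_eq, lap]
  simp only [map_sum, map_mul]

end FrameChange

/-! ### Conformal rescaling -/

section Conformal

variable (X Y : MetricAlg d A) (hD : Y.D = X.D) (Ω κ : A) (hΩ : Ω * κ = 1)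
  (hG : ∀ a b, Y.G a b = Ω ^ 2 * X.G a b)

/-- The logarithmic derivative of the scale. -/
def ups (X : MetricAlg d A) (Ω κ : A) (a : Fin d) : A := κ * X.D a Ω

/-- Its gradient. -/
def upsUp (X : MetricAlg d A) (Ω κ : A) (c : Fin d) : A := ∑ e, X.H c e * X.ups Ω κ e

/-- Its covariant derivative. -/
def dups (X : MetricAlg d A) (Ω κ : A) (a b : Fin d) : A :=
  X.D a (X.ups Ω κ b) - ∑ f, X.chr f a b * X.ups Ω κ f

/-- The change of the Christoffel symbols under a rescaling. -/
def confC (X : MetricAlg d A) (Ω κ : A) (c a b : Fin d) : A :=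
  (if c = a then X.ups Ω κ b else 0) + (if c = b then X.ups Ω κ a else 0)
    - X.G a b * X.upsUp Ω κ c

/-- The square of the length of the logarithmic derivative. -/
def upsSq (X : MetricAlg d A) (Ω κ : A) : A := ∑ c, X.ups Ω κ c * X.upsUp Ω κ c

/-- The divergence of the logarithmic derivative. -/
def upsDiv (X : MetricAlg d A) (Ω κ : A) : A := ∑ a, ∑ b, X.H a b * X.dups Ω κ a b

lemma sum_G_upsUp (a : Fin d) : ∑ c, X.G a c * X.upsUp Ω κ c = X.ups Ω κ a :=
  X.sum_G_mul_sum_H (fun e => X.ups Ω κ e) a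

lemma sum_G_upsUp' (a : Fin d) : ∑ c, X.G c a * X.upsUp Ω κ c = X.ups Ω κ a := by
  rw [← X.sum_G_upsUp]
  exact Finset.sum_congr rfl fun c _ => by rw [X.symm c a]

include hΩ in
-- `ups` plays the role of the differential of `log Ω`, hence is closed; the derivative of `κ` is
-- obtained from `Ω * κ = 1`.
lemma D_ups_symm (a b : Fin d) : X.D a (X.ups Ω κ b) = X.D b (X.ups Ω κ a) := by
  have h1 : ∀ a, X.D a κ = - κ * κ * X.D a Ω := by
    intro a
    have := congrArg (X.D a) hΩ
    rw [Derivation.leibniz, (X.D a).map_one_eq_zero] at this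
    simp only [smul_eq_mul] at this
    linear_combination κ * this - X.D a κ * hΩ
  simp only [ups, Derivation.leibniz, smul_eq_mul, h1]
  rw [X.comm a b]; ring

include hΩ in
lemma D_Omega (a : Fin d) : X.D a Ω = Ω * X.ups Ω κ a := by
  rw [ups, ← mul_assoc, hΩ, one_mul]

include hD hΩ hG in
-- The candidate is symmetric and compatible with `Ω² G`, so it is the connection by `chr_unique`;
-- no formula for the new inverse metric is needed.
lemma chr_conf (c a b : Fin d) : Y.chr c a b = X.chr c a b + X.confC Ω κ c a b := by
  refine Y.chr_unique (fun c a b => X.chr c a b + X.confC Ω κ c a b) ?_ ?_ c a b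
  · intro c a b
    simp only [confC]
    rw [X.chr_symm, X.symm a b]; ring
  · intro c a b
    simp only [hG, hD, Derivation.leibniz, Derivation.leibniz_pow, smul_eq_mul, X.chr_compat,
      X.D_Omega Ω κ hΩ]
    have e1 : ∀ a b, ∑ e, X.confC Ω κ e c a * (Ω ^ 2 * X.G e b)
        = Ω ^ 2 * (X.ups Ω κ a * X.G c b + X.ups Ω κ c * X.G a b - X.G c a * X.ups Ω κ b) := by
      intro a b
      simp only [confC, sub_mul, add_mul, ite_mul, zero_mul, Finset.sum_sub_distrib,
        Finset.sum_add_distrib, Finset.sum_ite_eq', Finset.mem_univ, if_true]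
      rw [← X.sum_G_upsUp' Ω κ b]
      simp only [mul_sub, Finset.mul_sum, mul_add]
      congr 1
      · ring
      · exact Finset.sum_congr rfl fun _ _ => by ring
    have e2 : ∑ e, (X.chr e c b + X.confC Ω κ e c b) * (Ω ^ 2 * X.G a e)
        = Ω ^ 2 * ∑ e, X.chr e c b * X.G a e + ∑ e, X.confC Ω κ e c b * (Ω ^ 2 * X.G e a) := by
      rw [Finset.mul_sum, ← Finset.sum_add_distrib]
      exact Finset.sum_congr rfl fun e _ => by rw [X.symm a e]; ring
    have e3 : ∑ e, (X.chr e c a + X.confC Ω κ e c a) * (Ω ^ 2 * X.G e b)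
        = Ω ^ 2 * ∑ e, X.chr e c a * X.G e b + ∑ e, X.confC Ω κ e c a * (Ω ^ 2 * X.G e b) := by
      rw [Finset.mul_sum, ← Finset.sum_add_distrib]
      exact Finset.sum_congr rfl fun e _ => by ring
    rw [e2, e3, e1, e1]
    rw [X.symm b a]
    simp only [nsmul_eq_mul]
    push_cast
    ring

lemma sum_confC (b : Fin d) : ∑ c, X.confC Ω κ c c b = d * X.ups Ω κ b := by
  simp only [confC, if_true, Finset.sum_sub_distrib, Finset.sum_add_distrib, Finset.sum_ite_eq',
    Finset.mem_univ, Finset.sum_const, Finset.card_univ, Fintype.card_fin, nsmul_eq_mul]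
  rw [X.sum_G_upsUp' Ω κ b]; ring

lemma sum_ups_confC (a b : Fin d) : ∑ f, X.ups Ω κ f * X.confC Ω κ f a b
    = 2 * X.ups Ω κ a * X.ups Ω κ b - X.G a b * X.upsSq Ω κ := by
  simp only [confC, mul_sub, mul_add, mul_ite, mul_zero, Finset.sum_sub_distrib,
    Finset.sum_add_distrib, Finset.sum_ite_eq', Finset.mem_univ, if_true, upsSq, Finset.mul_sum]
  have : ∑ x, X.ups Ω κ x * (X.G a b * X.upsUp Ω κ x) = ∑ x, X.G a b * (X.ups Ω κ x
    * X.upsUp Ω κ x) := Finset.sum_congr rfl fun _ _ => by ring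
  rw [this]; ring

lemma sum_confC_confC (a b : Fin d) : ∑ c, ∑ f, X.confC Ω κ c a f * X.confC Ω κ f c b
    = (2 + d) * X.ups Ω κ a * X.ups Ω κ b - 2 * X.G a b * X.upsSq Ω κ := by
  have h1 : ∀ c, ∑ f, X.confC Ω κ c a f * X.confC Ω κ f c b
      = (if c = a then ∑ f, X.ups Ω κ f * X.confC Ω κ f c b else 0)
        + X.ups Ω κ a * X.confC Ω κ c c b
        - X.upsUp Ω κ c * ∑ f, X.G a f * X.confC Ω κ f c b := by
    intro c
    conv_lhs => 
      enter [2, f]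
      rw [confC]
    simp only [sub_mul, add_mul, ite_mul, zero_mul, Finset.sum_sub_distrib, Finset.sum_add_distrib,
      Finset.sum_ite_eq, Finset.mem_univ, if_true, Finset.mul_sum]
    congr 1
    · congr 1
      split_ifs <;> simp
    · exact Finset.sum_congr rfl fun _ _ => by ring
  have h2 : ∀ c, ∑ f, X.G a f * X.confC Ω κ f c b
      = X.G a c * X.ups Ω κ b + X.G a b * X.ups Ω κ c - X.G c b * X.ups Ω κ a := by
    intro c
    simp only [confC, mul_sub, mul_add, mul_ite, mul_zero, Finset.sum_sub_distrib,
      Finset.sum_add_distrib, Finset.sum_ite_eq', Finset.mem_univ, if_true]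
    congr 1
    rw [← X.sum_G_upsUp Ω κ a, Finset.mul_sum]
    exact Finset.sum_congr rfl fun _ _ => by ring
  simp_rw [h1, h2, Finset.sum_sub_distrib, Finset.sum_add_distrib]
  rw [Finset.sum_ite_eq']
  simp only [Finset.mem_univ, if_true]
  rw [X.sum_ups_confC, ← Finset.mul_sum, X.sum_confC]
  simp only [mul_sub, mul_add, Finset.sum_sub_distrib, Finset.sum_add_distrib]
  have e1 : ∑ x, X.upsUp Ω κ x * (X.G a x * X.ups Ω κ b) = X.ups Ω κ a * X.ups Ω κ b := by
    rw [← X.sum_G_upsUp Ω κ a, Finset.sum_mul]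
    exact Finset.sum_congr rfl fun _ _ => by ring
  have e2 : ∑ x, X.upsUp Ω κ x * (X.G a b * X.ups Ω κ x) = X.G a b * X.upsSq Ω κ := by
    rw [upsSq, Finset.mul_sum]
    exact Finset.sum_congr rfl fun _ _ => by ring
  have e3 : ∑ x, X.upsUp Ω κ x * (X.G x b * X.ups Ω κ a) = X.ups Ω κ a * X.ups Ω κ b := by
    rw [← X.sum_G_upsUp' Ω κ b, Finset.mul_sum]
    exact Finset.sum_congr rfl fun _ _ => by ring
  rw [e1, e2, e3]
  ring

lemma sum_D_upsUp : ∑ c, X.D c (X.upsUp Ω κ c)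
    + ∑ c, ∑ f, X.chr c c f * X.upsUp Ω κ f = X.upsDiv Ω κ := by
  have h1 : ∀ c, X.D c (X.upsUp Ω κ c) = ∑ e, X.H c e * X.D c (X.ups Ω κ e)
      - ∑ f, X.chr c c f * X.upsUp Ω κ f
      - ∑ f, X.H c f * ∑ e, X.chr e c f * X.ups Ω κ e := by
    intro c
    simp only [upsUp, map_sum, Derivation.leibniz, smul_eq_mul, X.D_H, Finset.sum_add_distrib,
      mul_sub, mul_neg, Finset.sum_sub_distrib, Finset.sum_neg_distrib, Finset.mul_sum]
    have e1 : ∑ x, ∑ i, X.ups Ω κ x * (X.chr c c i * X.H i x)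
        = ∑ x, ∑ i, X.chr c c x * (X.H x i * X.ups Ω κ i) := by
      rw [Finset.sum_comm]
      exact Finset.sum_congr rfl fun _ _ => Finset.sum_congr rfl fun _ _ => by ring
    have e2 : ∑ x, ∑ i, X.ups Ω κ x * (X.chr x c i * X.H c i)
        = ∑ x, ∑ i, X.H c x * (X.chr i c x * X.ups Ω κ i) := by
      rw [Finset.sum_comm]
      exact Finset.sum_congr rfl fun _ _ => Finset.sum_congr rfl fun _ _ => by ring
    rw [e1, e2]; ring
  simp_rw [h1, upsDiv, dups, mul_sub, Finset.sum_sub_distrib]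
  ring

include hD hΩ hG in
-- Ricci is quadratic in the connection. After substituting `chr_conf`, the derivatives of `confC`
-- and the terms mixing `chr` with `confC` assemble into `dups` and `upsDiv`, while the pure squares
-- are evaluated by `sum_confC`, `sum_ups_confC` and `sum_confC_confC`.
lemma ric_conf (a b : Fin d) : Y.ric a b = X.ric a b
    - ((d : A) - 2) * (X.dups Ω κ a b - X.ups Ω κ a * X.ups Ω κ b)
    - (X.upsDiv Ω κ + ((d : A) - 2) * X.upsSq Ω κ) * X.G a b := by
  have h1 : Y.ric a b = X.ric a b + ∑ c, X.D c (X.confC Ω κ c a b)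
      - ∑ c, X.D a (X.confC Ω κ c c b)
      + ∑ c, ∑ f, X.confC Ω κ c c f * (X.chr f a b + X.confC Ω κ f a b)
      + ∑ c, ∑ f, X.chr c c f * X.confC Ω κ f a b
      - ∑ c, ∑ f, X.confC Ω κ c a f * X.confC Ω κ f c b
      - ∑ c, ∑ f, X.chr c a f * X.confC Ω κ f c b
      - ∑ c, ∑ f, X.confC Ω κ c a f * X.chr f c b := by
    simp only [ric, riemUp, ← Finset.sum_add_distrib, ← Finset.sum_sub_distrib]
    refine Finset.sum_congr rfl fun c _ => ?_
    simp only [X.chr_conf Y hD Ω κ hΩ hG, hD, map_add]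
    have : ∑ f, ((X.chr c c f + X.confC Ω κ c c f) * (X.chr f a b + X.confC Ω κ f a b)
          - (X.chr c a f + X.confC Ω κ c a f) * (X.chr f c b + X.confC Ω κ f c b))
        = ∑ f, (X.chr c c f * X.chr f a b - X.chr c a f * X.chr f c b)
        + ∑ f, X.confC Ω κ c c f * (X.chr f a b + X.confC Ω κ f a b)
        + ∑ f, X.chr c c f * X.confC Ω κ f a b
        - ∑ f, X.confC Ω κ c a f * X.confC Ω κ f c b
        - ∑ f, X.chr c a f * X.confC Ω κ f c b
        - ∑ f, X.confC Ω κ c a f * X.chr f c b := by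
      simp only [← Finset.sum_add_distrib, ← Finset.sum_sub_distrib]
      exact Finset.sum_congr rfl fun _ _ => by ring
    rw [this]; ring
  have s1 : ∑ c, X.D c (X.confC Ω κ c a b) = X.D a (X.ups Ω κ b) + X.D b (X.ups Ω κ a)
      - (∑ c, ∑ e, X.chr e c a * X.G e b * X.upsUp Ω κ c
        + ∑ c, ∑ e, X.chr e c b * X.G a e * X.upsUp Ω κ c)
      - X.G a b * ∑ c, X.D c (X.upsUp Ω κ c) := by
    have e0 : ∀ c, X.D c (X.confC Ω κ c a b) = (if c = a then X.D c (X.ups Ω κ b) else 0)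
        + (if c = b then X.D c (X.ups Ω κ a) else 0)
        - X.upsUp Ω κ c * (∑ e, X.chr e c a * X.G e b + ∑ e, X.chr e c b * X.G a e)
        - X.G a b * X.D c (X.upsUp Ω κ c) := by
      intro c
      rw [confC, map_sub, map_add, Derivation.leibniz, X.chr_compat]
      have : ∀ (p : Prop) [Decidable p] (x : A), X.D c (if p then x else 0)
          = if p then X.D c x else 0 := by
        intro p _ x; split_ifs <;> simp
      rw [this, this]
      simp only [smul_eq_mul]; ring
    simp_rw [e0, Finset.sum_sub_distrib, Finset.sum_add_distrib, Finset.sum_ite_eq',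
      Finset.mem_univ, if_true, Finset.mul_sum, mul_add, Finset.sum_add_distrib, Finset.mul_sum]
    congr 2
    congr 1 <;>
    exact Finset.sum_congr rfl fun _ _ => Finset.sum_congr rfl fun _ _ => by ring
  have s2 : ∑ c, X.D a (X.confC Ω κ c c b) = d * X.D a (X.ups Ω κ b) := by
    rw [← map_sum, X.sum_confC]
    simp
  have s3 : ∑ c, ∑ f, X.confC Ω κ c c f * (X.chr f a b + X.confC Ω κ f a b)
      = d * ∑ f, X.chr f a b * X.ups Ω κ f
        + d * (2 * X.ups Ω κ a * X.ups Ω κ b - X.G a b * X.upsSq Ω κ) := by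
    rw [Finset.sum_comm]
    simp_rw [← Finset.sum_mul, X.sum_confC]
    rw [← X.sum_ups_confC, Finset.mul_sum, Finset.mul_sum, ← Finset.sum_add_distrib]
    exact Finset.sum_congr rfl fun _ _ => by ring
  have s4 : ∑ c, ∑ f, X.chr c c f * X.confC Ω κ f a b = (∑ c, X.chr c c a) * X.ups Ω κ b
      + (∑ c, X.chr c c b) * X.ups Ω κ a
      - X.G a b * ∑ c, ∑ f, X.chr c c f * X.upsUp Ω κ f := by
    simp only [confC, mul_sub, mul_add, mul_ite, mul_zero, Finset.sum_sub_distrib,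
      Finset.sum_add_distrib, Finset.sum_ite_eq', Finset.mem_univ, if_true, Finset.sum_mul,
      Finset.mul_sum]
    congr 1
    exact Finset.sum_congr rfl fun _ _ => Finset.sum_congr rfl fun _ _ => by ring
  have s6 : ∑ c, ∑ f, X.chr c a f * X.confC Ω κ f c b = (∑ c, X.chr c c a) * X.ups Ω κ b
      + ∑ c, X.chr c a b * X.ups Ω κ c
      - ∑ c, ∑ e, X.chr e c a * X.G e b * X.upsUp Ω κ c := by
    simp only [confC, mul_sub, mul_add, mul_ite, mul_zero, Finset.sum_sub_distrib,
      Finset.sum_add_distrib, Finset.sum_ite_eq', Finset.mem_univ, if_true, Finset.sum_mul]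
    congr 1
    · congr 1
      exact Finset.sum_congr rfl fun _ _ => by rw [X.chr_symm]
    · rw [Finset.sum_comm]
      exact Finset.sum_congr rfl fun _ _ => Finset.sum_congr rfl fun _ _ => by
        rw [X.chr_symm]; ring
  have s7 : ∑ c, ∑ f, X.confC Ω κ c a f * X.chr f c b = ∑ c, X.chr c a b * X.ups Ω κ c
      + (∑ c, X.chr c c b) * X.ups Ω κ a
      - ∑ c, ∑ e, X.chr e c b * X.G a e * X.upsUp Ω κ c := by
    have e0 : ∀ c, ∑ f, X.confC Ω κ c a f * X.chr f c b
        = (if c = a then ∑ f, X.chr f c b * X.ups Ω κ f else 0) + X.chr c c b * X.ups Ω κ a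
        - ∑ e, X.chr e c b * X.G a e * X.upsUp Ω κ c := by
      intro c
      simp only [confC, sub_mul, add_mul, ite_mul, zero_mul, Finset.sum_sub_distrib,
        Finset.sum_add_distrib, Finset.sum_ite_eq, Finset.mem_univ, if_true]
      congr 1
      · congr 1
        · split_ifs
          · exact Finset.sum_congr rfl fun _ _ => by ring
          · simp
        · ring
      · exact Finset.sum_congr rfl fun _ _ => by ring
    simp_rw [e0, Finset.sum_sub_distrib, Finset.sum_add_distrib, Finset.sum_ite_eq',
      Finset.mem_univ, if_true, Finset.sum_mul]
  rw [h1, s1, s2, s3, s4, s6, s7, X.sum_confC_confC, dups, ← X.sum_D_upsUp,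
    X.D_ups_symm Ω κ hΩ b a]
  ring

include hΩ hG in
lemma H_conf (a b : Fin d) : Y.H a b = κ ^ 2 * X.H a b := by
  have h1 : Y.G * (κ ^ 2 • X.H) = 1 := by
    have : Y.G = Ω ^ 2 • X.G := by ext a b; simp [hG]
    rw [this, Matrix.smul_mul, Matrix.mul_smul, X.mul_inv, smul_smul, ← mul_pow, hΩ]
    simp
  have h2 : Y.H = κ ^ 2 • X.H := by
    calc Y.H = Y.H * (Y.G * (κ ^ 2 • X.H)) := by rw [h1, mul_one]
      _ = _ := by rw [← mul_assoc, Y.inv_mul, one_mul]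
  rw [h2]; simp

lemma sum_H_G_trace : ∑ a, ∑ b, X.H a b * X.G a b = d := by
  have : ∀ a, ∑ b, X.H a b * X.G a b = 1 := by
    intro a
    have := X.sum_H_G a a
    rw [if_pos rfl] at this
    rw [← this]
    exact Finset.sum_congr rfl fun b _ => by rw [X.symm a b]
  simp [this]

lemma sum_H_ups_ups : ∑ a, ∑ b, X.H a b * (X.ups Ω κ a * X.ups Ω κ b) = X.upsSq Ω κ := by
  simp only [upsSq, upsUp, Finset.mul_sum]
  exact Finset.sum_congr rfl fun _ _ => Finset.sum_congr rfl fun _ _ => by ring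

include hD hΩ hG in
lemma sc_conf : Y.sc = κ ^ 2 * (X.sc - 2 * ((d : A) - 1) * X.upsDiv Ω κ
    - ((d : A) - 2) * ((d : A) - 1) * X.upsSq Ω κ) := by
  have h1 : Y.sc = κ ^ 2 * (X.sc - ((d : A) - 2) * (X.upsDiv Ω κ
      - ∑ a, ∑ b, X.H a b * (X.ups Ω κ a * X.ups Ω κ b))
      - (X.upsDiv Ω κ + ((d : A) - 2) * X.upsSq Ω κ) * ∑ a, ∑ b, X.H a b * X.G a b) := by
    have e : ∀ a b, Y.H a b * Y.ric a b = κ ^ 2 * (X.H a b * X.ric a b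
        - ((d : A) - 2) * (X.H a b * X.dups Ω κ a b - X.H a b * (X.ups Ω κ a * X.ups Ω κ b))
        - (X.upsDiv Ω κ + ((d : A) - 2) * X.upsSq Ω κ) * (X.H a b * X.G a b)) := by
      intro a b
      rw [X.ric_conf Y hD Ω κ hΩ hG, X.H_conf Y Ω κ hΩ hG]; ring
    rw [sc]
    simp_rw [e, ← Finset.mul_sum, Finset.sum_sub_distrib, ← Finset.mul_sum,
      Finset.sum_sub_distrib]
    rfl
  rw [h1, X.sum_H_G_trace, X.sum_H_ups_ups]
  ring

include hD hΩ hG in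
lemma lap_conf (f : A) : Y.lap f = κ ^ 2 * (X.lap f
    + ((d : A) - 2) * ∑ c, X.upsUp Ω κ c * X.D c f) := by
  have e : ∀ a b, Y.H a b * (Y.D a (Y.D b f) - ∑ c, Y.chr c a b * Y.D c f)
      = κ ^ 2 * (X.H a b * (X.D a (X.D b f) - ∑ c, X.chr c a b * X.D c f)
        - ∑ c, X.H a b * X.confC Ω κ c a b * X.D c f) := by
    intro a b
    simp only [X.H_conf Y Ω κ hΩ hG, hD, X.chr_conf Y hD Ω κ hΩ hG, add_mul,
      Finset.sum_add_distrib, mul_assoc, ← Finset.mul_sum]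
    ring
  have e2 : ∀ c, ∑ a, ∑ b, X.H a b * X.confC Ω κ c a b = -((d : A) - 2) * X.upsUp Ω κ c := by
    intro c
    have e3 : ∀ a, ∑ b, X.H a b * X.confC Ω κ c a b = (if c = a then X.upsUp Ω κ c else 0)
        + X.H a c * X.ups Ω κ a - (∑ b, X.H a b * X.G a b) * X.upsUp Ω κ c := by
      intro a
      simp only [confC, mul_sub, mul_add, mul_ite, mul_zero, Finset.sum_sub_distrib,
        Finset.sum_add_distrib, Finset.sum_ite_eq, Finset.mem_univ, if_true, Finset.sum_mul,
        mul_assoc]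
      congr 2
      split_ifs with h
      · subst h; rfl
      · simp
    simp_rw [e3, Finset.sum_sub_distrib, Finset.sum_add_distrib, Finset.sum_ite_eq,
      Finset.mem_univ, if_true, ← Finset.sum_mul, X.sum_H_G_trace]
    have : ∑ a, X.H a c * X.ups Ω κ a = X.upsUp Ω κ c :=
      Finset.sum_congr rfl fun a _ => by rw [X.H_symm]
    rw [this]; ring
  rw [lap]
  simp_rw [e, ← Finset.mul_sum, Finset.sum_sub_distrib]
  have e4 : ∑ a, ∑ b, ∑ c, X.H a b * X.confC Ω κ c a b * X.D c f
      = ∑ c, (∑ a, ∑ b, X.H a b * X.confC Ω κ c a b) * X.D c f := by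
    simp_rw [Finset.sum_mul]
    conv_rhs => rw [Finset.sum_comm]
    exact Finset.sum_congr rfl fun _ _ => Finset.sum_comm
  rw [e4]
  simp_rw [e2, mul_assoc, ← Finset.mul_sum]
  rw [lap]; ring

end Conformal

lemma gr_comm (X : MetricAlg d A) (f g : A) : X.gr f g = X.gr g f := by
  rw [gr, gr, Finset.sum_comm]
  exact Finset.sum_congr rfl fun _ _ => Finset.sum_congr rfl fun _ _ => by
    rw [X.H_symm]; ring

lemma gr_add (X : MetricAlg d A) (f g k : A) : X.gr f (g + k) = X.gr f g + X.gr f k := by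
  simp only [gr, map_add, mul_add, Finset.sum_add_distrib]

lemma gr_mul (X : MetricAlg d A) (f g k : A) : X.gr f (g * k) = g * X.gr f k + k * X.gr f g := by
  simp only [gr, Derivation.leibniz, smul_eq_mul, mul_add, Finset.sum_add_distrib, Finset.mul_sum]
  congr 1 <;>
  exact Finset.sum_congr rfl fun _ _ => Finset.sum_congr rfl fun _ _ => by ring

lemma gr_algebraMap (X : MetricAlg d A) (f : A) (r : ℝ) : X.gr f (algebraMap ℝ A r) = 0 := by
  simp [gr]

lemma lap_add (X : MetricAlg d A) (f g : A) : X.lap (f + g) = X.lap f + X.lap g := by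
  simp only [lap, map_add, mul_add, mul_sub, Finset.sum_add_distrib, Finset.sum_sub_distrib]
  ring

lemma lap_algebraMap (X : MetricAlg d A) (r : ℝ) : X.lap (algebraMap ℝ A r) = 0 := by
  simp [lap]

lemma lap_mul (X : MetricAlg d A) (f g : A) :
    X.lap (f * g) = f * X.lap g + g * X.lap f + 2 * X.gr f g := by
  have h1 : X.lap (f * g) = f * X.lap g + g * X.lap f + X.gr f g + X.gr g f := by
    simp only [lap, gr, Finset.mul_sum, ← Finset.sum_add_distrib]
    refine Finset.sum_congr rfl fun a _ => Finset.sum_congr rfl fun b _ => ?_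
    simp only [Derivation.leibniz, smul_eq_mul, map_add, mul_add, Finset.sum_add_distrib]
    have : ∀ u v : A, ∑ c, X.chr c a b * (u * X.D c v) = u * ∑ c, X.chr c a b * X.D c v := by
      intro u v
      rw [Finset.mul_sum]
      exact Finset.sum_congr rfl fun _ _ => by ring
    rw [this, this]; ring
  rw [h1, X.gr_comm g f]; ring

/-- The operator `yam` is conformally covariant. -/
theorem yam_conf (X Y : MetricAlg d A) (hd : 2 ≤ d) (hD : Y.D = X.D) (Ω κ : A) (hΩ : Ω * κ = 1)
    (hG : ∀ a b, Y.G a b = Ω ^ 2 * X.G a b) (f : A) : Y.yam (Ω * f) = X.yam f := by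
  have hgr : ∀ u v, Y.gr u v = κ ^ 2 * X.gr u v := by
    intro u v
    simp only [gr, X.H_conf Y Ω κ hΩ hG, hD, Finset.mul_sum]
    exact Finset.sum_congr rfl fun _ _ => Finset.sum_congr rfl fun _ _ => by ring
  set T := ∑ c, X.upsUp Ω κ c * X.D c f with hT
  have g1 : ∀ v, X.gr Ω v = Ω * ∑ c, X.upsUp Ω κ c * X.D c v := by
    intro v
    rw [X.gr_comm, gr, Finset.mul_sum]
    simp only [upsUp, Finset.mul_sum, Finset.sum_mul, X.D_Omega Ω κ hΩ]
    exact Finset.sum_congr rfl fun _ _ => Finset.sum_congr rfl fun _ _ => by ring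
  have g2 : X.gr Ω Ω = Ω ^ 2 * X.upsSq Ω κ := by
    rw [g1, upsSq, Finset.mul_sum, Finset.mul_sum]
    exact Finset.sum_congr rfl fun _ _ => by rw [X.D_Omega Ω κ hΩ]; ring
  have l1 : X.lap Ω = Ω * (X.upsDiv Ω κ + X.upsSq Ω κ) := by
    rw [← X.sum_H_ups_ups, upsDiv, lap, ← Finset.sum_add_distrib, Finset.mul_sum]
    refine Finset.sum_congr rfl fun a _ => ?_
    rw [← Finset.sum_add_distrib, Finset.mul_sum]
    refine Finset.sum_congr rfl fun b _ => ?_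
    rw [X.D_Omega Ω κ hΩ b, Derivation.leibniz, X.D_Omega Ω κ hΩ a, dups]
    have : ∑ c, X.chr c a b * X.D c Ω = Ω * ∑ c, X.chr c a b * X.ups Ω κ c := by
      rw [Finset.mul_sum]
      exact Finset.sum_congr rfl fun c _ => by rw [X.D_Omega Ω κ hΩ c]; ring
    rw [this]; simp only [smul_eq_mul]; ring
  have s1 : ∑ c, X.upsUp Ω κ c * X.D c (Ω * f) = Ω * (T + f * X.upsSq Ω κ) := by
    rw [hT, upsSq, Finset.mul_sum, ← Finset.sum_add_distrib, Finset.mul_sum]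
    exact Finset.sum_congr rfl fun c _ => by
      rw [Derivation.leibniz, X.D_Omega Ω κ hΩ]; simp only [smul_eq_mul]; ring
  have g3 : X.gr (Ω * f) (Ω * f) = Ω ^ 2 * (X.gr f f + 2 * f * T + f ^ 2 * X.upsSq Ω κ) := by
    rw [gr_mul, X.gr_comm _ f, X.gr_comm _ Ω, gr_mul, gr_mul, g2, X.gr_comm f Ω, g1 f]; ring
  have hd0 : (d : ℝ) ≠ 0 := by positivity
  have hd1 : (d : ℝ) - 1 ≠ 0 := by
    have : (2 : ℝ) ≤ d := by exact_mod_cast hd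
    linarith
  have c1 : algebraMap ℝ A (2 / d) * (d : A) = 2 := by
    rw [← map_natCast (algebraMap ℝ A) d, ← map_mul, div_mul_cancel₀ _ hd0, map_ofNat]
  have c2 : algebraMap ℝ A (1 / (2 * ((d : ℝ) - 1))) * (2 * ((d : A) - 1)) = 1 := by
    rw [← map_natCast (algebraMap ℝ A) d, ← map_ofNat (algebraMap ℝ A) 2, ← map_one (algebraMap ℝ A),
      ← map_sub, ← map_mul, ← map_mul]
    congr 1
    field_simp
  have c3 := half_add_half (A := A)
  rw [yam, yam, hgr, g3, X.lap_conf Y hD Ω κ hΩ hG, X.sc_conf Y hD Ω κ hΩ hG, lap_mul, l1, g1 f, s1,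
    ← hT]
  generalize algebraMap ℝ A (2 / d) = p at *
  generalize algebraMap ℝ A (1 / (2 * ((d : ℝ) - 1))) = q at *
  generalize algebraMap ℝ A (1 / 2) = r at *
  -- With `p = 2/d`, `q = 1/(2(d-1))` and `r = 1/2`, the constants of `S` are the ones that make the
  -- corrections cancel: the terms in `T` by `p d = 2`, those in `upsDiv` by `2 q (d-1) = 1`, those
  -- in `upsSq` by both.
  have hq : q * ((d : A) - 1) = r := by linear_combination r * c2 - q * ((d:A)-1) * c3
  have hr : r * 2 = 1 := by linear_combination c3
  have hz : Ω ^ 2 * κ ^ 2 = 1 := by rw [← mul_pow, hΩ, one_pow]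
  linear_combination (X.gr f f + 2 * f * T + f ^ 2 * X.upsSq Ω κ - p * f * (X.lap f
    + f * (X.upsDiv Ω κ + X.upsSq Ω κ) + 2 * T + ((d : A) - 2) * (T + f * X.upsSq Ω κ)
    + q * (X.sc - 2 * ((d : A) - 1) * X.upsDiv Ω κ
    - ((d : A) - 2) * ((d : A) - 1) * X.upsSq Ω κ) * f)) * hz
    + p * f * (2 * f * X.upsDiv Ω κ + ((d : A) - 2) * f * X.upsSq Ω κ) * hq
    + (p * f ^ 2 * X.upsDiv Ω κ + f ^ 2 * X.upsSq Ω κ * (1 - p)) * hr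
    + (f ^ 2 * X.upsSq Ω κ * (r - 1) - f * T) * c1

end MetricAlg

end

end HypersurfaceInvariants

namespace HypersurfaceInvariants

noncomputable section

/-! ## Hypersurfaces over algebras with derivations -/

namespace MetricAlg

variable {d : ℕ} {A : Type*} [CommRing A] [Algebra ℝ A] (X : MetricAlg d A)

/-- The tangential projection `δ_a^b - n_a n^b`. -/
def tang (n : (Fin 1 → Fin d) → A) (a b : Fin d) : A :=
  (if a = b then 1 else 0) - n (fun _ => a) * ∑ c, X.H b c * n (fun _ => c)

/-- The second fundamental form. -/
def sff (n : (Fin 1 → Fin d) → A) : (Fin 2 → Fin d) → A :=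
  fun I => ∑ c, X.tang n (I 0) c * X.cov n ![c, I 1]

/-- The tangential covariant derivative. -/
def hyp (n : (Fin 1 → Fin d) → A) {k : ℕ} (T : (Fin k → Fin d) → A) :
    (Fin (k + 1) → Fin d) → A :=
  fun I => ∑ J : Fin (k + 1) → Fin d, (∏ j, X.tang n (I j) (J j)) * X.cov T J

/-- The iterated tangential derivatives of the second fundamental form. -/
def sffDeriv (n : (Fin 1 → Fin d) → A) : (l : ℕ) → (Fin (2 + l) → Fin d) → A
  | 0 => X.sff n
  | l + 1 => X.hyp n (sffDeriv n l)

end MetricAlg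

/-- The value of an expression over an algebra with derivations. -/
def HypExpr.ev {d : ℕ} {A : Type*} [CommRing A] [Algebra ℝ A] (X : MetricAlg d A)
    (n : (Fin 1 → Fin d) → A) : {k : ℕ} → HypExpr k → (Fin k → Fin d) → A
  | _, .const c => fun _ => algebraMap ℝ A c
  | _, .metric => fun I => X.G (I 0) (I 1)
  | _, .conormal => n
  | _, .secondFF l => X.sffDeriv n l
  | _, .curvature k => X.riemDeriv k
  | _, .add e f => fun I => e.ev X n I + f.ev X n I
  | _, .mul e f => fun I =>
      e.ev X n (fun i => I (Fin.castAdd _ i)) * f.ev X n (fun j => I (Fin.natAdd _ j))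
  | _, .permute p e => fun I => e.ev X n (fun i => I (p i))
  | _, .contract e => fun I => ∑ a, ∑ b, X.H a b * e.ev X n (Fin.cons a (Fin.cons b I))

/-! ### Matrices acting on the slots of a tensor -/

section Slots

variable {d k : ℕ} {A : Type*} [CommRing A]

/-- The action of a matrix on one slot. -/
def slotM (M : Matrix (Fin d) (Fin d) A) (j : Fin k) (T : (Fin k → Fin d) → A) :
    (Fin k → Fin d) → A :=
  fun J => ∑ c, M (J j) c * T (Function.update J j c)

/-- The action of a family of matrices on all slots. -/
def slotAct (M : Fin k → Matrix (Fin d) (Fin d) A) (T : (Fin k → Fin d) → A) :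
    (Fin k → Fin d) → A :=
  fun I => ∑ J : Fin k → Fin d, (∏ j, M j (I j) (J j)) * T J

lemma slotAct_slotAct (M N : Fin k → Matrix (Fin d) (Fin d) A) (T : (Fin k → Fin d) → A) :
    slotAct M (slotAct N T) = slotAct (fun j => M j * N j) T := by
  funext I
  simp only [slotAct, Matrix.mul_apply, Finset.prod_univ_sum, Fintype.piFinset_univ,
    Finset.mul_sum, Finset.sum_mul]
  rw [Finset.sum_comm]
  refine Finset.sum_congr rfl fun K _ => Finset.sum_congr rfl fun J _ => ?_
  rw [Finset.prod_mul_distrib]; ring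

lemma slotAct_one (T : (Fin k → Fin d) → A) : slotAct (fun _ => 1) T = T := by
  funext I
  rw [slotAct, Finset.sum_eq_single I]
  · simp
  · intro J _ hJ
    obtain ⟨j, hj⟩ := Function.ne_iff.mp hJ
    have h0 : (1 : Matrix (Fin d) (Fin d) A) (I j) (J j) = 0 := Matrix.one_apply_ne (Ne.symm hj)
    rw [Finset.prod_eq_zero (Finset.mem_univ j) h0, zero_mul]
  · simp

lemma slotAct_single (M : Matrix (Fin d) (Fin d) A) (j : Fin k) (T : (Fin k → Fin d) → A) :
    slotAct (fun i => if i = j then M else 1) T = slotM M j T := by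
  funext I
  simp only [slotAct, slotM]
  have himg : ∀ J : Fin k → Fin d, J ∉ Finset.univ.image (fun c => Function.update I j c) →
      (∏ i, (if i = j then M else 1) (I i) (J i)) * T J = 0 := by
    intro J hJ
    have : ∃ i, i ≠ j ∧ I i ≠ J i := by
      by_contra hcon
      push Not at hcon
      apply hJ
      refine Finset.mem_image.mpr ⟨J j, Finset.mem_univ _, ?_⟩
      funext i
      by_cases hi : i = j
      · subst hi; simp
      · rw [Function.update_of_ne hi, hcon i hi]
    obtain ⟨i, hij, hi⟩ := this
    rw [Finset.prod_eq_zero (Finset.mem_univ i) (by rw [if_neg hij]; exact Matrix.one_apply_ne hi),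
      zero_mul]
  rw [← Finset.sum_subset (Finset.subset_univ _) (fun J _ hJ => himg J hJ)]
  rw [Finset.sum_image]
  · refine Finset.sum_congr rfl fun c _ => ?_
    congr 1
    rw [Finset.prod_eq_single j]
    · simp
    · intro i _ hi
      rw [if_neg hi, Function.update_of_ne hi, Matrix.one_apply_eq]
    · simp
  · intro c _ c' _ h
    have := congrFun h j
    simpa using this

lemma slotM_slotAct {j : Fin k} {S : Finset (Fin k)} (hj : j ∉ S)
    (M : Matrix (Fin d) (Fin d) A) (T : (Fin k → Fin d) → A) :
    slotM M j (slotAct (fun i => if i ∈ S then M else 1) T)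
      = slotAct (fun i => if i ∈ insert j S then M else 1) T := by
  rw [← slotAct_single, slotAct_slotAct]
  congr 1
  funext i
  by_cases hi : i = j
  · subst hi; simp [hj]
  · simp [hi]

lemma slotM_sub (M : Matrix (Fin d) (Fin d) A) (j : Fin k) (T T' : (Fin k → Fin d) → A)
    (J : Fin k → Fin d) :
    slotM M j (fun J => T J - T' J) J = slotM M j T J - slotM M j T' J := by
  simp only [slotM, mul_sub, Finset.sum_sub_distrib]

end Slots

lemma bijective_of_injective {n : ℕ} {α : Type*} [Fintype α] {f : α → Fin n}
    (hf : Function.Injective f) (hc : Fintype.card α = n) : Function.Bijective f :=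
  (Fintype.bijective_iff_injective_and_card f).mpr ⟨hf, by simpa using hc⟩

/-- Index pattern for contracting a rank two tensor into slot `j`: the indices `0` and `1` are the
contracted pair, the first in the rank two tensor and the second in slot `j`, while the free index
of slot `j` goes to the rank two tensor. -/
lemma slot_bijective {k : ℕ} (j : Fin k) :
    Function.Bijective (Sum.elim (![j.succ.succ, 0] : Fin 2 → Fin (k + 2))
      (fun i : Fin k => if i = j then 1 else i.succ.succ)) := by
  refine bijective_of_injective ?_ (by simp [add_comm])
  rw [Sum.elim_injective]
  refine ⟨?_, ?_, ?_⟩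
  · intro a b h
    fin_cases a <;> fin_cases b <;> simp_all [Fin.ext_iff]
  · intro a b h
    simp only at h
    split_ifs at h <;> simp_all [Fin.ext_iff]
  · intro a b h
    fin_cases a <;> simp only [] at h <;> split_ifs at h <;> simp_all [Fin.ext_iff]

namespace MetricAlg

variable {d k : ℕ} {A : Type*} [CommRing A] [Algebra ℝ A] (X : MetricAlg d A)

/-- The matrix `m_a{}^c`. -/
def raise (m : (Fin 2 → Fin d) → A) : Matrix (Fin d) (Fin d) A :=
  fun a c => ∑ b, X.H b c * m ![a, b]

lemma slotM_raise (m : (Fin 2 → Fin d) → A) (j : Fin k) (T : (Fin k → Fin d) → A)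
    (J : Fin k → Fin d) : slotM (X.raise m) j T J = ∑ b, ∑ c, X.H b c *
      (m ((Fin.cons b (Fin.cons c J) : Fin (k + 2) → Fin d) ∘ ![j.succ.succ, 0]) *
      T ((Fin.cons b (Fin.cons c J) : Fin (k + 2) → Fin d) ∘
        (fun i : Fin k => if i = j then 1 else i.succ.succ))) := by
  simp only [slotM, raise, Finset.sum_mul]
  rw [Finset.sum_comm]
  refine Finset.sum_congr rfl fun b _ => Finset.sum_congr rfl fun c _ => ?_
  have e1 : (Fin.cons b (Fin.cons c J) : Fin (k + 2) → Fin d) ∘ ![j.succ.succ, 0] = ![J j, b] := by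
    funext i; fin_cases i <;> rfl
  have e2 : (Fin.cons b (Fin.cons c J) : Fin (k + 2) → Fin d) ∘
      (fun i : Fin k => if i = j then 1 else i.succ.succ) = Function.update J j c := by
    funext i
    by_cases hi : i = j
    · subst hi; simp [Fin.cons_one]
    · simp [hi]
  rw [e1, e2, mul_assoc]

lemma cd_slotM_raise (a : Fin d) (m : (Fin 2 → Fin d) → A) (j : Fin k) (T : (Fin k → Fin d) → A)
    (J : Fin k → Fin d) : X.cd a (slotM (X.raise m) j T) J
      = slotM (X.raise (X.cd a m)) j T J + slotM (X.raise m) j (X.cd a T) J := by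
  obtain ⟨W, hW⟩ : ∃ W : (Fin (k + 2) → Fin d) → A, W = fun J'' => m (J'' ∘ ![j.succ.succ, 0]) *
    T (J'' ∘ (fun i : Fin k => if i = j then 1 else i.succ.succ)) := ⟨_, rfl⟩
  have e : slotM (X.raise m) j T = fun J => ∑ b, ∑ c, X.H b c * W (Fin.cons b (Fin.cons c J)) := by
    funext J; rw [slotM_raise, hW]
  have hc : ∀ J, X.cd a W J = X.cd a m (J ∘ ![j.succ.succ, 0]) *
      T (J ∘ (fun i : Fin k => if i = j then 1 else i.succ.succ)) + m (J ∘ ![j.succ.succ, 0]) *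
      X.cd a T (J ∘ (fun i : Fin k => if i = j then 1 else i.succ.succ)) := by
    intro J
    rw [hW]
    exact X.cd_mul _ _ (slot_bijective j) a m T J
  have key := X.cd_contract a W J
  rw [e, key, slotM_raise, slotM_raise, ← Finset.sum_add_distrib]
  refine Finset.sum_congr rfl fun b _ => ?_
  rw [← Finset.sum_add_distrib]
  refine Finset.sum_congr rfl fun c _ => ?_
  rw [hc]; ring

end MetricAlg

/-! ### Universal fields -/

/-- An algebraic model of a conformal embedding: `I` is the ideal of the functions that vanish on
the hypersurface, `s` solves `S(s) = 1 + s^d B`, and `ρ` is the inverse of the length of `ds`. -/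
structure Geom (d : ℕ) where
  A : Type
  [ring : CommRing A]
  [alg : Algebra ℝ A]
  X : MetricAlg d A
  s : A
  ρ : A
  B : A
  I : Ideal A
  rho_sq : ρ ^ 2 * X.gr s s = 1
  rho_mem : ρ - 1 ∈ I
  s_mem : s ∈ I
  -- The only property of the hypersurface that is used beyond `s = 0` and `|ds| = 1`: functions
  -- vanishing on it have vanishing tangential derivatives there.
  tangential : ∀ f ∈ I, ∀ a, ∑ b, X.tang (fun J => ρ * X.D (J 0) s) a b * X.D b f ∈ I
  eqn : X.yam s = 1 + s ^ d * B

attribute [instance] Geom.ring Geom.alg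

/-- A universal tensor field. -/
abbrev UF (d k : ℕ) : Type 1 := ∀ Y : Geom d, (Fin k → Fin d) → Y.A

/-- The universal fields built from the given ones. -/
inductive Gen {d : ℕ} (At : ∀ {k : ℕ}, UF d k → Prop) : ∀ {k : ℕ}, UF d k → Prop
  | atom {k : ℕ} (T : UF d k) (h : At T) : Gen At T
  | const (c : ℝ) : Gen At (k := 0) (fun Y _ => algebraMap ℝ Y.A c)
  | metric : Gen At (k := 2) (fun Y I => Y.X.G (I 0) (I 1))
  | add {k : ℕ} (T T' : UF d k) : Gen At T → Gen At T' → Gen At (fun Y I => T Y I + T' Y I)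
  | mul {k l : ℕ} (T : UF d k) (T' : UF d l) : Gen At T → Gen At T' →
      Gen At (k := k + l) (fun Y I => T Y (fun i => I (Fin.castAdd l i))
        * T' Y (fun j => I (Fin.natAdd k j)))
  | permute {k : ℕ} (p : Equiv.Perm (Fin k)) (T : UF d k) : Gen At T →
      Gen At (fun Y I => T Y (fun i => I (p i)))
  | contract {k : ℕ} (T : UF d (k + 2)) : Gen At T →
      Gen At (fun Y I => ∑ a, ∑ b, Y.X.H a b * T Y (Fin.cons a (Fin.cons b I)))

namespace Gen

variable {d : ℕ} {At At' : ∀ {k : ℕ}, UF d k → Prop} {k l m n : ℕ}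

lemma bind (h : ∀ {k : ℕ} (T : UF d k), At T → Gen At' T) {T : UF d k} (hT : Gen At T) :
    Gen At' T := by
  induction hT with
  | atom T hT => exact h T hT
  | const c => exact const c
  | metric => exact metric
  | add T T' _ _ h1 h2 => exact add _ _ h1 h2
  | mul T T' _ _ h1 h2 => exact mul _ _ h1 h2
  | permute p T _ h1 => exact permute _ _ h1
  | contract T _ h1 => exact contract _ h1

lemma comp {T : UF d k} (hT : Gen At T) (α : Fin k → Fin l) (hα : Function.Bijective α) :
    Gen At (fun Y J => T Y (J ∘ α)) := by
  have hkl : k = l := by simpa using Fintype.card_of_bijective hα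
  subst hkl
  exact permute (Equiv.ofBijective α hα) T hT

lemma mul' {T : UF d k} {T' : UF d l} (hT : Gen At T) (hT' : Gen At T')
    (α : Fin k → Fin n) (β : Fin l → Fin n) (h : Function.Bijective (Sum.elim α β)) :
    Gen At (fun Y J => T Y (J ∘ α) * T' Y (J ∘ β)) := by
  have h1 := (mul _ _ hT hT').comp (Sum.elim α β ∘ finSumFinEquiv.symm)
    (h.comp finSumFinEquiv.symm.bijective)
  convert h1 using 5
  · funext i; simp
  · funext i; simp

lemma mul3 {T : UF d k} {T' : UF d l} {T'' : UF d m} (hT : Gen At T) (hT' : Gen At T')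
    (hT'' : Gen At T'') (α : Fin k → Fin n) (β : Fin l → Fin n) (γ : Fin m → Fin n)
    (h : Function.Bijective (Sum.elim α (Sum.elim β γ))) :
    Gen At (fun Y J => T Y (J ∘ α) * (T' Y (J ∘ β) * T'' Y (J ∘ γ))) := by
  have h1 := hT.mul' (mul _ _ hT' hT'') α (Sum.elim β γ ∘ finSumFinEquiv.symm) (by
    have e : Sum.elim α (Sum.elim β γ ∘ finSumFinEquiv.symm)
        = Sum.elim α (Sum.elim β γ) ∘ (Equiv.sumCongr (Equiv.refl _) finSumFinEquiv.symm) := by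
      funext i; rcases i with i | i <;> simp
    rw [e]
    exact h.comp (Equiv.bijective _))
  convert h1 using 6
  · funext i; simp
  · funext i; simp

lemma smul {T : UF d k} (c : ℝ) (hT : Gen At T) :
    Gen At (fun Y J => algebraMap ℝ Y.A c * T Y J) :=
  (const c).mul' hT Fin.elim0 id ⟨fun a b h => by
    rcases a with a | a
    · exact a.elim0
    · rcases b with b | b
      · exact b.elim0
      · simpa using h, fun b => ⟨Sum.inr b, rfl⟩⟩

/-- `Gen` has no constructor for zero, and constants and metrics alone generate only even ranks. So
a zero field of rank `k` is made from some field of that rank; this explains the zero fields passed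
as hypotheses below. -/
lemma zero_of {T : UF d k} (hT : Gen At T) : Gen At (k := k) (fun _ _ => 0) := by
  have := hT.smul 0
  simpa using this

lemma neg {T : UF d k} (hT : Gen At T) : Gen At (fun Y J => - T Y J) := by
  have := hT.smul (-1)
  simpa using this

lemma sub {T T' : UF d k} (hT : Gen At T) (hT' : Gen At T') :
    Gen At (fun Y J => T Y J - T' Y J) := by
  have := add _ _ hT hT'.neg
  simpa [sub_eq_add_neg] using this

lemma sum {ι : Type*} (S : Finset ι) {T : ι → UF d k} (h0 : Gen At (k := k) (fun _ _ => 0))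
    (hT : ∀ i ∈ S, Gen At (T i)) : Gen At (fun Y J => ∑ i ∈ S, T i Y J) := by
  classical
  induction S using Finset.induction_on with
  | empty => simpa using h0
  | insert i S hi ih =>
    simp only [Finset.sum_insert hi]
    exact add _ _ (hT i (Finset.mem_insert_self _ _))
      (ih fun j hj => hT j (Finset.mem_insert_of_mem hj))

lemma scalar_mul {f : UF d 0} {T : UF d k} (hf : Gen At f) (hT : Gen At T) :
    Gen At (fun Y J => f Y Fin.elim0 * T Y J) := by
  have h1 := hf.mul' hT Fin.elim0 id ⟨fun a b h => by
    rcases a with a | a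
    · exact a.elim0
    · rcases b with b | b
      · exact b.elim0
      · simpa using h, fun b => ⟨Sum.inr b, rfl⟩⟩
  convert h1 using 3 with Y J
  rw [Subsingleton.elim (J ∘ Fin.elim0) Fin.elim0]
  rfl

/-- Contraction of a field of rank two with a slot. -/
lemma slot {m : UF d 2} {T : UF d k} (hm : Gen At m) (hT : Gen At T) (j : Fin k) :
    Gen At (fun Y => slotM (Y.X.raise (m Y)) j (T Y)) := by
  have h1 := contract _ (hm.mul' hT _ _ (slot_bijective j))
  convert h1 using 3 with Y J
  rw [MetricAlg.slotM_raise]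

end Gen

/-- The derivative of a universal field in the directions of a matrix. -/
def dcov {d k : ℕ} (M : ∀ Y : Geom d, Fin d → Fin d → Y.A) (T : UF d k) : UF d (k + 1) :=
  fun Y I => ∑ c, M Y (I 0) c * Y.X.cd c (T Y) (Fin.tail I)

lemma cons_comp_cons {d k l : ℕ} (α : Fin k → Fin l) (I : Fin (l + 1) → Fin d) :
    I ∘ (Fin.cons 0 (Fin.succ ∘ α) : Fin (k + 1) → Fin (l + 1))
      = Fin.cons (I 0) (Fin.tail I ∘ α) := by
  funext i
  refine Fin.cases ?_ (fun i => ?_) i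
  · rfl
  · rfl

lemma cons_zero_injective {k l : ℕ} {α : Fin k → Fin l} (hα : Function.Injective α) :
    Function.Injective (Fin.cons 0 (Fin.succ ∘ α) : Fin (k + 1) → Fin (l + 1)) := by
  rw [Fin.cons_injective_iff]
  exact ⟨by rintro ⟨i, hi⟩; exact Fin.succ_ne_zero _ hi, (Fin.succ_injective _).comp hα⟩

/-- The map that moves the first index behind the next two. -/
def cycle3 (k : ℕ) : Fin (k + 3) → Fin (k + 3) :=
  Fin.cons 2 (Fin.cons 0 (Fin.cons 1 (fun i => i.succ.succ.succ)))

lemma cycle3_bijective (k : ℕ) : Function.Bijective (cycle3 k) := by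
  refine bijective_of_injective ?_ (by simp)
  rw [cycle3, Fin.cons_injective_iff, Fin.cons_injective_iff, Fin.cons_injective_iff]
  refine ⟨?_, ?_, ?_, fun a b h => Fin.succ_injective _ (Fin.succ_injective _
    (Fin.succ_injective _ h))⟩
  · rintro ⟨i, hi⟩
    have := congrArg Fin.val hi
    revert this
    refine Fin.cases ?_ (fun i => Fin.cases ?_ (fun i => ?_) i) i <;>
      simp [Nat.mod_eq_of_lt (show 2 < k + 3 by omega)]
  · rintro ⟨i, hi⟩
    have := congrArg Fin.val hi
    revert this
    refine Fin.cases ?_ (fun i => ?_) i <;> simp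
  · rintro ⟨i, hi⟩
    have := congrArg Fin.val hi
    simp at this

lemma cons_cons_comp_cycle3 {d k : ℕ} (p q : Fin d) (I : Fin (k + 1) → Fin d) :
    (Fin.cons p (Fin.cons q I) : Fin (k + 3) → Fin d) ∘ cycle3 k
      = Fin.cons (I 0) (Fin.cons p (Fin.cons q (Fin.tail I))) := by
  funext i
  refine Fin.cases ?_ (fun i => Fin.cases ?_ (fun i => Fin.cases ?_ (fun i => ?_) i) i) i <;> rfl

/-- The Leibniz rule for universal fields. -/
lemma Gen.dcov {d : ℕ} {At At' : ∀ {k : ℕ}, UF d k → Prop}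
    (M : ∀ Y : Geom d, Fin d → Fin d → Y.A)
    (h0 : Gen At' (k := 1) (fun _ _ => 0))
    (hs : ∀ {k : ℕ} (T : UF d k), At T → Gen At' T)
    (hd : ∀ {k : ℕ} (T : UF d k), At T → Gen At' (HypersurfaceInvariants.dcov M T))
    {k : ℕ} {T : UF d k} (hT : Gen At T) : Gen At' (HypersurfaceInvariants.dcov M T) := by
  induction hT with
  | atom T h => exact hd T h
  | const c =>
    convert h0 using 3 with Y I
    simp [HypersurfaceInvariants.dcov, MetricAlg.cd]
  | metric =>
    -- The metric is parallel, so its derivative is zero, realized in rank three as the zero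
    -- covector times the metric.
    have h1 := h0.mul' (metric (At := At')) (![0] : Fin 1 → Fin 3) ![1, 2] (by
      refine bijective_of_injective ?_ (by simp)
      rw [Sum.elim_injective]
      refine ⟨?_, ?_, ?_⟩
      · intro a b h; exact Subsingleton.elim _ _
      · intro a b h; fin_cases a <;> fin_cases b <;> simp_all
      · intro a b h; fin_cases a; fin_cases b <;> simp_all)
    convert h1 using 3 with Y I
    simp only [HypersurfaceInvariants.dcov, zero_mul]
    refine Finset.sum_eq_zero fun c _ => ?_
    rw [MetricAlg.cd, Y.X.chr_compat]
    simp [Fin.sum_univ_two, Function.update_of_ne]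
  | add T T' _ _ h1 h2 =>
    convert add _ _ h1 h2 using 3 with Y I
    simp only [HypersurfaceInvariants.dcov, MetricAlg.cd_add, mul_add, Finset.sum_add_distrib]
  | @mul k l T T' hT hT' h1 h2 =>
    have hinj : Function.Injective (Sum.elim (Fin.castAdd l) (Fin.natAdd k)) :=
      Sum.elim_injective.mpr ⟨Fin.castAdd_injective _ _, Fin.natAdd_injective _ _, fun a b h => by
        have := congrArg Fin.val h
        simp at this; omega⟩
    have hbij : Function.Bijective (Sum.elim (Fin.castAdd l) (Fin.natAdd k)) :=
      bijective_of_injective hinj (by simp)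
    have b1 : Function.Bijective (Sum.elim (Fin.cons 0 (Fin.succ ∘ Fin.castAdd l) :
        Fin (k + 1) → Fin (k + l + 1)) (Fin.succ ∘ Fin.natAdd k)) := by
      refine bijective_of_injective ?_ (by simp; omega)
      refine Sum.elim_injective.mpr ⟨cons_zero_injective (Fin.castAdd_injective _ _),
        (Fin.succ_injective _).comp (Fin.natAdd_injective _ _), fun a b => ?_⟩
      refine Fin.cases ?_ (fun a => ?_) a
      · exact (Fin.succ_ne_zero _).symm
      · intro h
        have := congrArg Fin.val h
        simp at this; omega
    have b2 : Function.Bijective (Sum.elim (Fin.succ ∘ Fin.castAdd l)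
        (Fin.cons 0 (Fin.succ ∘ Fin.natAdd k) : Fin (l + 1) → Fin (k + l + 1))) := by
      refine bijective_of_injective ?_ (by simp; omega)
      refine Sum.elim_injective.mpr ⟨(Fin.succ_injective _).comp (Fin.castAdd_injective _ _),
        cons_zero_injective (Fin.natAdd_injective _ _), fun a b => ?_⟩
      refine Fin.cases ?_ (fun a => ?_) b
      · exact (Fin.succ_ne_zero _)
      · intro h
        have := congrArg Fin.val h
        simp at this; omega
    have e1 := h1.mul' (bind hs hT') _ _ b1
    have e2 := (bind hs hT).mul' h2 _ _ b2
    convert add _ _ e1 e2 using 3 with Y I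
    simp only [HypersurfaceInvariants.dcov, cons_comp_cons, Fin.cons_zero, Fin.tail_cons,
      Finset.sum_mul, Finset.mul_sum, ← Finset.sum_add_distrib]
    refine Finset.sum_congr rfl fun c _ => ?_
    have := Y.X.cd_mul (Fin.castAdd l) (Fin.natAdd k) hbij c (T Y) (T' Y) (Fin.tail I)
    simp only [Function.comp_def] at this
    rw [this]
    simp only [Fin.tail, Function.comp_def]
    ring
  | @permute k p T hT h1 =>
    have e1 := h1.comp (Fin.cons 0 (Fin.succ ∘ p)) (bijective_of_injective
      (cons_zero_injective p.injective) (by simp))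
    convert e1 using 3 with Y I
    simp only [HypersurfaceInvariants.dcov, cons_comp_cons, Fin.cons_zero, Fin.tail_cons]
    refine Finset.sum_congr rfl fun c _ => ?_
    congr 1
    exact Y.X.cd_comp_equiv p c (T Y) (Fin.tail I)
  | @contract k T hT h1 =>
    -- Contraction acts on the first two indices while the derivative index also has to come first;
    -- `cycle3` reconciles the two conventions.
    have e1 := contract (k := k + 1) _ (h1.comp (cycle3 k) (cycle3_bijective k))
    convert e1 using 3 with Y I
    simp only [HypersurfaceInvariants.dcov, Y.X.cd_contract, Finset.mul_sum]
    rw [Finset.sum_comm]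
    refine Finset.sum_congr rfl fun p _ => ?_
    rw [Finset.sum_comm]
    refine Finset.sum_congr rfl fun q _ => Finset.sum_congr rfl fun c _ => ?_
    rw [cons_cons_comp_cycle3]
    simp only [Fin.cons_zero, Fin.tail_cons]
    ring

end

end HypersurfaceInvariants

namespace HypersurfaceInvariants

noncomputable section

/-! ### Tangential derivatives of hypersurface expressions -/

namespace MetricAlg

variable {d k : ℕ} {A : Type*} [CommRing A] [Algebra ℝ A] (X : MetricAlg d A)
  (n : (Fin 1 → Fin d) → A)

/-- The matrix `n_a n^b`. -/
def nn : Matrix (Fin d) (Fin d) A := X.raise (fun I => n (fun _ => I 0) * n (fun _ => I 1))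

/-- The tangential projection as a matrix. -/
def tangM : Matrix (Fin d) (Fin d) A := Matrix.of (X.tang n)

lemma nn_apply (a c : Fin d) : X.nn n a c = n (fun _ => a) * ∑ b, X.H c b * n (fun _ => b) := by
  simp only [nn, raise, Finset.mul_sum]
  exact Finset.sum_congr rfl fun b _ => by simp [X.H_symm c b]; ring

lemma tangM_eq : X.tangM n = 1 - X.nn n := by
  ext a b
  simp [tangM, tang, nn_apply, Matrix.one_apply]

/-- Exhibits the projection as the tensor `G - n ⊗ n` with an index raised, the form to which
`Gen.slot` applies. -/
lemma tangM_raise : X.tangM n = X.raise (fun I => X.G (I 0) (I 1)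
    - n (fun _ => I 0) * n (fun _ => I 1)) := by
  rw [tangM_eq, nn]
  ext a b
  simp only [raise, mul_sub, Finset.sum_sub_distrib, Matrix.sub_apply, Matrix.one_apply,
    Matrix.cons_val_zero, Matrix.cons_val_one]
  congr 1
  rw [← X.sum_G_H a b]
  exact Finset.sum_congr rfl fun c _ => mul_comm _ _

lemma slotM_nn_eq_zero_iff {j : Fin k} {T : (Fin k → Fin d) → A} :
    slotM (X.nn n) j T = 0 ↔ slotM (X.tangM n) j T = T := by
  have : ∀ J, slotM (X.tangM n) j T J = T J - slotM (X.nn n) j T J := by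
    intro J
    simp only [slotM, tangM_eq, Matrix.sub_apply, sub_mul, Finset.sum_sub_distrib]
    congr 1
    rw [Finset.sum_eq_single (J j)]
    · simp
    · intro c _ hc
      rw [Matrix.one_apply_ne (Ne.symm hc), zero_mul]
    · simp
  constructor
  · intro h
    funext J
    rw [this, h]; simp
  · intro h
    funext J
    have := this J
    rw [h] at this
    simpa using this.symm

variable (hn : ∑ c, n (fun _ => c) * ∑ b, X.H c b * n (fun _ => b) = 1)
include hn

lemma nn_mul_nn : X.nn n * X.nn n = X.nn n := by
  ext a b
  simp only [Matrix.mul_apply, nn_apply]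
  calc ∑ j, n (fun _ => a) * (∑ b, X.H j b * n fun _ => b) * (n (fun _ => j)
        * ∑ b_1, X.H b b_1 * n fun _ => b_1)
      = (∑ j, n (fun _ => j) * ∑ b, X.H j b * n fun _ => b) * (n (fun _ => a)
        * ∑ b_1, X.H b b_1 * n fun _ => b_1) := by
        rw [Finset.sum_mul]
        exact Finset.sum_congr rfl fun _ _ => by ring
    _ = _ := by rw [hn, one_mul]

lemma tangM_mul_tangM : X.tangM n * X.tangM n = X.tangM n := by
  rw [tangM_eq]
  have := X.nn_mul_nn n hn
  noncomm_ring
  rw [this]; abel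

/-- The hypothesis gives `n_p` times the claim for every `p`. A covector cannot be cancelled over a
ring, so one contracts once more with `n` and uses that it has length one. -/
lemma sum_up_of_slotM {j : Fin k} {T : (Fin k → Fin d) → A} (hT : slotM (X.nn n) j T = 0)
    (J : Fin k → Fin d) :
    ∑ c, (∑ b, X.H c b * n (fun _ => b)) * T (Function.update J j c) = 0 := by
  have h1 : ∀ p, n (fun _ => p) * ∑ c, (∑ b, X.H c b * n (fun _ => b)) * T (Function.update J j c)
      = 0 := by
    intro p
    have := congrFun hT (Function.update J j p)
    simp only [slotM, nn_apply, Function.update_self, Function.update_idem, Pi.zero_apply] at this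
    rw [← this, Finset.mul_sum]
    exact Finset.sum_congr rfl fun _ _ => by ring
  rw [← one_mul (∑ c, (∑ b, X.H c b * n (fun _ => b)) * T (Function.update J j c)), ← hn,
    Finset.sum_mul]
  refine Finset.sum_eq_zero fun p _ => ?_
  rw [mul_right_comm, h1, zero_mul]

/-- The normal part of the derivative of a tangential tensor. -/
lemma slotM_nn_cd {j : Fin k} {T : (Fin k → Fin d) → A} (hT : slotM (X.nn n) j T = 0)
    (a : Fin d) (J : Fin k → Fin d) :
    slotM (X.nn n) j (X.cd a T) J = - (n (fun _ => J j) *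
      ∑ b, ∑ c, X.H b c * (X.cd a n (fun _ => b) * T (Function.update J j c))) := by
  -- Differentiate the identity that the normal part of `T` vanishes: the normal part of the
  -- derivative of `T` is minus the derivative of `n ⊗ n` applied to `T`, and of its two terms the
  -- one contracting `n` into `T` vanishes.
  have h1 := X.cd_slotM_raise a (fun I => n (fun _ => I 0) * n (fun _ => I 1)) j T J
  have hm : ∀ I : Fin 2 → Fin d, X.cd a (fun I => n (fun _ => I 0) * n (fun _ => I 1)) I
      = X.cd a n (fun _ => I 0) * n (fun _ => I 1) + n (fun _ => I 0) * X.cd a n (fun _ => I 1) := by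
    intro I
    have hb : Function.Bijective (Sum.elim (![0] : Fin 1 → Fin 2) ![1]) := by
      refine bijective_of_injective ?_ (by simp)
      rw [Sum.elim_injective]
      exact ⟨fun a b _ => Subsingleton.elim _ _, fun a b _ => Subsingleton.elim _ _,
        fun a b => by fin_cases a; fin_cases b; simp⟩
    have e0 : ∀ I : Fin 2 → Fin d, I ∘ (![0] : Fin 1 → Fin 2) = fun _ => I 0 := by
      intro I; funext i; fin_cases i; rfl
    have e1 : ∀ I : Fin 2 → Fin d, I ∘ (![1] : Fin 1 → Fin 2) = fun _ => I 1 := by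
      intro I; funext i; fin_cases i; rfl
    have := X.cd_mul _ _ hb a n n I
    simpa only [e0, e1] using this
  have hz : X.cd a (slotM (X.raise (fun I => n (fun _ => I 0) * n (fun _ => I 1))) j T) J = 0 := by
    have : slotM (X.raise (fun I => n (fun _ => I 0) * n (fun _ => I 1))) j T = fun _ => 0 := hT
    rw [this]; simp [cd]
  rw [hz] at h1
  rw [nn, eq_neg_iff_add_eq_zero, h1, add_comm]
  congr 1
  simp only [slotM, raise, hm, Matrix.cons_val_zero, Matrix.cons_val_one, mul_add,
    Finset.sum_add_distrib, add_mul, Finset.sum_mul]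
  have e1 : ∑ x, ∑ x_1, X.H x_1 x * ((X.cd a n fun _ => J j) * n fun _ => x_1)
      * T (Function.update J j x) = 0 := by
    have := X.sum_up_of_slotM n hn hT J
    calc _ = (X.cd a n fun _ => J j) * ∑ c, (∑ b, X.H c b * n (fun _ => b))
          * T (Function.update J j c) := by
          rw [Finset.mul_sum]
          refine Finset.sum_congr rfl fun c _ => ?_
          rw [Finset.sum_mul, Finset.mul_sum]
          exact Finset.sum_congr rfl fun b _ => by rw [X.H_symm b c]; ring
      _ = 0 := by rw [this, mul_zero]
  rw [e1, zero_add, Finset.sum_comm, Finset.mul_sum]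
  refine Finset.sum_congr rfl fun b _ => ?_
  rw [Finset.mul_sum]
  exact Finset.sum_congr rfl fun c _ => by ring

end MetricAlg

end

end HypersurfaceInvariants

/-! ### Tangency of the derivatives of the second fundamental form, weights, and the Weingarten term
-/

namespace HypersurfaceInvariants

noncomputable section

section Slots

variable {d k : ℕ} {A : Type*} [CommRing A]

lemma slotM_slotM (M N : Matrix (Fin d) (Fin d) A) (j : Fin k) (T : (Fin k → Fin d) → A) :
    slotM M j (slotM N j T) = slotM (M * N) j T := by
  rw [← slotAct_single, ← slotAct_single, ← slotAct_single, slotAct_slotAct]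
  congr 1
  funext i
  split_ifs <;> simp

lemma slotM_comm (M N : Matrix (Fin d) (Fin d) A) {i j : Fin k} (hij : i ≠ j)
    (T : (Fin k → Fin d) → A) : slotM M i (slotM N j T) = slotM N j (slotM M i T) := by
  simp only [← slotAct_single, slotAct_slotAct]
  congr 1
  funext l
  by_cases h1 : l = i
  · subst h1; simp [hij]
  · simp [h1]

lemma slotM_slotAct_const {M : Matrix (Fin d) (Fin d) A} (hM : M * M = M) (j : Fin k)
    (T : (Fin k → Fin d) → A) :
    slotM M j (slotAct (fun _ => M) T) = slotAct (fun _ => M) T := by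
  rw [← slotAct_single, slotAct_slotAct]
  congr 1
  funext l
  split_ifs <;> simp [hM]

lemma slotAct_const_slotM {M : Matrix (Fin d) (Fin d) A} (hM : M * M = M) (j : Fin k)
    (T : (Fin k → Fin d) → A) :
    slotAct (fun _ => M) (slotM M j T) = slotAct (fun _ => M) T := by
  rw [← slotAct_single, slotAct_slotAct]
  congr 1
  funext l
  split_ifs <;> simp [hM]

lemma slotM_zero (M : Matrix (Fin d) (Fin d) A) (j : Fin k) :
    slotM M j (0 : (Fin k → Fin d) → A) = 0 := by
  funext J; simp [slotM]

end Slots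

namespace MetricAlg

variable {d k : ℕ} {A : Type*} [CommRing A] [Algebra ℝ A] (X : MetricAlg d A)
  (n : (Fin 1 → Fin d) → A)

/-- The iterated covariant derivative of a function. -/
def jet (f : A) : (j : ℕ) → (Fin j → Fin d) → A
  | 0 => fun _ => f
  | j + 1 => X.cov (jet f j)

lemma slotM_cov (M : Matrix (Fin d) (Fin d) A) (T : (Fin k → Fin d) → A) (I : Fin (k + 1) → Fin d) :
    slotM M 0 (X.cov T) I = ∑ c, M (I 0) c * X.cd c T (Fin.tail I) := by
  simp only [slotM, cov, Function.update_self]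
  refine Finset.sum_congr rfl fun c _ => ?_
  congr 2

lemma sff_eq : X.sff n = slotM (X.tangM n) 0 (X.cov n) := by
  funext I
  simp only [sff, slotM]
  refine Finset.sum_congr rfl fun c _ => ?_
  congr 2
  funext i
  fin_cases i <;> simp

variable (hn : ∑ c, n (fun _ => c) * ∑ b, X.H c b * n (fun _ => b) = 1)
include hn

/-- The derivative of `n·n = 1`, divided by two. -/
lemma sum_up_cd (a : Fin d) : ∑ c, (∑ b, X.H c b * n (fun _ => b)) * X.cd a n (fun _ => c) = 0 := by
  have hb : Function.Bijective (Sum.elim (![0] : Fin 1 → Fin 2) ![1]) := by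
    refine bijective_of_injective ?_ (by simp)
    rw [Sum.elim_injective]
    exact ⟨fun a b _ => Subsingleton.elim _ _, fun a b _ => Subsingleton.elim _ _,
      fun a b => by fin_cases a; fin_cases b; simp⟩
  have e0 : ∀ I : Fin 2 → Fin d, I ∘ (![0] : Fin 1 → Fin 2) = fun _ => I 0 := by
    intro I; funext i; fin_cases i; rfl
  have e1 : ∀ I : Fin 2 → Fin d, I ∘ (![1] : Fin 1 → Fin 2) = fun _ => I 1 := by
    intro I; funext i; fin_cases i; rfl
  have h1 := X.cd_contract (k := 0) a (fun I => n (fun _ => I 0) * n (fun _ => I 1)) Fin.elim0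
  have h2 := X.cd_mul _ _ hb a n n
  simp only [e0, e1] at h2
  simp only [h2, cd_scalar, Fin.cons_zero, Fin.cons_one, mul_add, Finset.sum_add_distrib] at h1
  have h3 : ∑ p, ∑ q, X.H p q * (n (fun _ => p) * n (fun _ => q)) = 1 := by
    rw [← hn]
    refine Finset.sum_congr rfl fun c _ => ?_
    rw [Finset.mul_sum]
    exact Finset.sum_congr rfl fun _ _ => by ring
  rw [h3, (X.D a).map_one_eq_zero] at h1
  have h4 : ∑ p, ∑ q, X.H p q * (X.cd a n (fun _ => p) * n (fun _ => q))
      = ∑ c, (∑ b, X.H c b * n (fun _ => b)) * X.cd a n (fun _ => c) := by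
    refine Finset.sum_congr rfl fun c _ => ?_
    rw [Finset.sum_mul]
    exact Finset.sum_congr rfl fun _ _ => by ring
  have h5 : ∑ p, ∑ q, X.H p q * (n (fun _ => p) * X.cd a n (fun _ => q))
      = ∑ c, (∑ b, X.H c b * n (fun _ => b)) * X.cd a n (fun _ => c) := by
    rw [Finset.sum_comm]
    refine Finset.sum_congr rfl fun c _ => ?_
    rw [Finset.sum_mul]
    exact Finset.sum_congr rfl fun b _ => by rw [X.H_symm b c]; ring
  rw [h4, h5] at h1
  linear_combination (-(∑ c, (∑ b, X.H c b * n (fun _ => b)) * X.cd a n (fun _ => c))) *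
    half_add_half (A := A) - algebraMap ℝ A (1 / 2) * h1

/-- For `II` itself the first slot is projected by definition and the second is tangential by
`sum_up_cd`, so symmetry of `II` is not needed. Higher derivatives are projected in all slots, and
the projection is idempotent. -/
lemma slotM_tangM_sffDeriv (l : ℕ) (j : Fin (2 + l)) :
    slotM (X.tangM n) j (X.sffDeriv n l) = X.sffDeriv n l := by
  cases l with
  | zero =>
    change slotM (X.tangM n) (k := 2) j (X.sff n) = X.sff n
    have h0 : slotM (X.tangM n) 0 (X.sff n) = X.sff n := by
      rw [sff_eq, slotM_slotM, X.tangM_mul_tangM n hn]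
    have h1 : slotM (X.tangM n) 1 (X.sff n) = X.sff n := by
      rw [← slotM_nn_eq_zero_iff, sff_eq, slotM_comm _ _ (by decide)]
      have : slotM (X.nn n) 1 (X.cov n) = 0 := by
        funext I
        have := X.sum_up_cd n hn (I 0)
        simp only [slotM, nn_apply, cov, Pi.zero_apply]
        rw [← mul_zero (n fun _ => I 1), ← this, Finset.mul_sum]
        refine Finset.sum_congr rfl fun c _ => ?_
        have e : Fin.tail (Function.update I 1 c) = fun _ => c := by
          funext i; fin_cases i; simp [Fin.tail]
        rw [e, Function.update_of_ne (by decide), mul_assoc]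
      rw [this, slotM_zero]
    have : ∀ j : Fin 2, slotM (X.tangM n) j (X.sff n) = X.sff n := by
      intro j; fin_cases j
      · exact h0
      · exact h1
    exact this j
  | succ l =>
    exact slotM_slotAct_const (X.tangM_mul_tangM n hn) _ _

end MetricAlg

/-- The unit conormal. -/
def nU (d : ℕ) : UF d 1 := fun Y J => Y.ρ * Y.X.D (J 0) Y.s

/-- The derivatives of the second fundamental form. -/
def sffU (d l : ℕ) : UF d (2 + l) := fun Y => Y.X.sffDeriv (nU d Y) l

/-- The derivatives of the curvature. -/
def riemU (d k : ℕ) : UF d (4 + k) := fun Y => Y.X.riemDeriv k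

/-- The derivatives of the defining function. -/
def jetU (d k : ℕ) : UF d k := fun Y => Y.X.jet Y.s k

/-- The tangential projection. -/
def tangU (d : ℕ) (Y : Geom d) : Matrix (Fin d) (Fin d) Y.A := Y.X.tangM (nU d Y)

lemma nU_unit {d : ℕ} (Y : Geom d) :
    ∑ c, nU d Y (fun _ => c) * ∑ b, Y.X.H c b * nU d Y (fun _ => b) = 1 := by
  rw [← Y.rho_sq, MetricAlg.gr, Finset.mul_sum]
  refine Finset.sum_congr rfl fun c _ => ?_
  rw [Finset.mul_sum, Finset.mul_sum]
  exact Finset.sum_congr rfl fun b _ => by simp only [nU]; ring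

/-- The hypersurface fields of weight at most `w`. -/
inductive HypAt {d : ℕ} (w : ℕ) : ∀ {k : ℕ}, UF d k → Prop
  | normal : HypAt w (nU d)
  -- The weight counts derivatives of the defining function: `II` contains two of them. The conormal
  -- is free in every weight.
  | sff (l : ℕ) (h : l + 2 ≤ w) : HypAt w (sffU d l)
  | riem (k : ℕ) (h : k + 3 ≤ w) : HypAt w (riemU d k)

/-- The jets of the defining function and of the curvature of weight at most `w`. -/
inductive JetAt {d : ℕ} (w : ℕ) : ∀ {k : ℕ}, UF d k → Prop
  -- Strict for the jets of `s` but not for the curvature: this is the class of errors made by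
  -- permuting the indices of `∇^w s`, which produces lower jets and at most `∇^(w-3) R`.
  | jet (j : ℕ) (h : j < w) : JetAt w (jetU d j)
  | riem (k : ℕ) (h : k + 3 ≤ w) : JetAt w (riemU d k)

lemma HypAt.mono {d w w' k : ℕ} (h : w ≤ w') {T : UF d k} (hT : HypAt w T) : HypAt w' T := by
  cases hT with
  | normal => exact normal
  | sff l hl => exact sff l (hl.trans h)
  | riem l hk => exact riem l (hk.trans h)

lemma JetAt.mono {d w w' k : ℕ} (h : w ≤ w') {T : UF d k} (hT : JetAt w T) : JetAt w' T := by
  cases hT with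
  | jet _ hl => exact jet _ (hl.trans_le h)
  | riem l hk => exact riem l (hk.trans h)

lemma Gen.hypMono {d w w' k : ℕ} (h : w ≤ w') {T : UF d k} (hT : Gen (HypAt w) T) :
    Gen (HypAt w') T := hT.bind fun T hT => atom T (hT.mono h)

lemma Gen.jetMono {d w w' k : ℕ} (h : w ≤ w') {T : UF d k} (hT : Gen (JetAt w) T) :
    Gen (JetAt w') T := hT.bind fun T hT => atom T (hT.mono h)

lemma Gen.tang {d k : ℕ} {At : ∀ {k : ℕ}, UF d k → Prop} (hn : Gen At (nU d)) {T : UF d k}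
    (hT : Gen At T) (j : Fin k) : Gen At (fun Y => slotM (tangU d Y) j (T Y)) := by
  have hb : Function.Bijective (Sum.elim (![0] : Fin 1 → Fin 2) ![1]) := by
    refine bijective_of_injective ?_ (by simp)
    rw [Sum.elim_injective]
    exact ⟨fun a b _ => Subsingleton.elim _ _, fun a b _ => Subsingleton.elim _ _,
      fun a b => by fin_cases a; fin_cases b; simp⟩
  have h1 := (metric.sub (hn.mul' hn _ _ hb)).slot hT j
  convert h1 using 4 with Y
  rw [tangU, MetricAlg.tangM_raise]
  congr 1

lemma dcov_eq {d k : ℕ} (M : ∀ Y : Geom d, Matrix (Fin d) (Fin d) Y.A) (T : UF d k) :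
    dcov M T = fun Y => slotM (M Y) 0 (Y.X.cov (T Y)) := by
  funext Y I
  rw [MetricAlg.slotM_cov]; rfl

/-- If a field agrees with its images under the action of a matrix on each slot up to a class of
fields, then it agrees with the image under the action on all slots. -/
lemma slotAct_congr {d k : ℕ} (C : UF d k → Prop) (M : ∀ Y : Geom d, Matrix (Fin d) (Fin d) Y.A)
    (hadd : ∀ T T' : UF d k, C T → C T' → C (fun Y J => T Y J + T' Y J))
    (hz : C (fun _ _ => 0))
    (hs : ∀ j (T : UF d k), C T → C (fun Y => slotM (M Y) j (T Y)))
    (T : UF d k) (hT : ∀ j, C (fun Y J => T Y J - slotM (M Y) j (T Y) J)) :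
    C (fun Y J => T Y J - slotAct (fun _ => M Y) (T Y) J) := by
  -- Telescoping over the set of slots on which the matrix already acts.
  have key : ∀ S : Finset (Fin k),
      C (fun Y J => T Y J - slotAct (fun i => if i ∈ S then M Y else 1) (T Y) J) := by
    intro S
    induction S using Finset.induction_on with
    | empty =>
      convert hz using 3 with Y J
      simp [slotAct_one]
    | insert j S hj ih =>
      convert hadd _ _ (hT j) (hs j _ ih) using 3 with Y J
      rw [slotM_sub, slotM_slotAct hj]
      ring
  simpa using key Finset.univ

lemma mul3_bijective {k : ℕ} (j : Fin k) : Function.Bijective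
    (Sum.elim (![j.succ.succ.succ] : Fin 1 → Fin (k + 3))
      (Sum.elim ![2, 0] (fun i : Fin k => if i = j then 1 else i.succ.succ.succ))) := by
  refine bijective_of_injective ?_ (by simp; omega)
  rw [Sum.elim_injective, Sum.elim_injective]
  refine ⟨fun a b _ => Subsingleton.elim _ _, ⟨?_, ?_, ?_⟩, ?_⟩
  · intro a b h
    fin_cases a <;> fin_cases b <;> simp_all [Fin.ext_iff, Nat.mod_eq_of_lt (show 2 < k + 3 by omega)]
  · intro a b h
    simp only at h
    split_ifs at h <;> simp_all [Fin.ext_iff]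
  · intro a b h
    fin_cases a <;> simp only [] at h <;> split_ifs at h <;> simp_all [Fin.ext_iff, Nat.mod_eq_of_lt (show 2 < k + 3 by omega)]
  · intro a b h
    have h' := congrArg Fin.val h
    fin_cases a
    rcases b with b | b
    · fin_cases b <;> simp [Nat.mod_eq_of_lt (show 2 < k + 3 by omega)] at h'
    · simp only [Sum.elim_inr] at h'
      split_ifs at h' with hb
      · simp at h'
      · simp at h'
        exact hb (Fin.ext h'.symm)

/-- The tangential derivative of a hypersurface field of weight `w` is one of weight `w + 1`. -/
lemma dcov_tang_sffU {d l w : ℕ} (h : l + 3 ≤ w) :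
    Gen (HypAt w) (dcov (tangU d) (sffU d l)) := by
  have hn : Gen (HypAt w) (nU d) := Gen.atom _ HypAt.normal
  have hsff : Gen (HypAt w) (sffU d l) := Gen.atom _ (HypAt.sff l (by omega))
  have hsff0 : Gen (HypAt w) (k := 2) (sffU d 0) := Gen.atom _ (HypAt.sff 0 (by omega))
  have hsff1 : Gen (HypAt w) (sffU d (l + 1)) := Gen.atom _ (HypAt.sff (l + 1) (by omega))
  set Z : UF d (2 + l + 1) := dcov (tangU d) (sffU d l) with hZ
  have hZe : ∀ Y, Z Y = slotM (tangU d Y) 0 (Y.X.cov (sffU d l Y)) := fun Y => by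
    rw [hZ, dcov_eq]
  have hall : ∀ Y, slotAct (fun _ => tangU d Y) (Z Y) = sffU d (l + 1) Y := by
    intro Y
    rw [hZe]
    exact slotAct_const_slotM (M := tangU d Y) (Y.X.tangM_mul_tangM _ (nU_unit Y)) 0 _
  -- `Z` is projected only in the derivative slot, whereas `∇̄^(l+1) II` is projected in all; their
  -- difference is examined one slot at a time.
  have key := slotAct_congr (C := fun T : UF d (2 + l + 1) => Gen (HypAt w) T) (tangU d)
    (fun T T' => Gen.add T T') hsff1.zero_of (fun j T hT => hn.tang hT j) Z ?_
  · convert Gen.add _ _ key hsff1 using 3 with Y J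
    rw [hall]; ring
  intro j
  refine Fin.cases ?_ (fun j => ?_) j
  · have hz : Gen (HypAt w) (k := 2 + l + 1) (fun (_ : Geom d) _ => 0) := hsff1.zero_of
    convert hz using 3 with Y J
    rw [hZe, slotM_slotM, show tangU d Y * tangU d Y = tangU d Y from
      Y.X.tangM_mul_tangM _ (nU_unit Y), sub_self]
  -- Weingarten term: as `∇̄^l II` is tangential, the normal part of its derivative in an old slot
  -- is minus `n` times the contraction of `II` with `∇̄^l II` (`slotM_nn_cd`).
  · have e1 := (Gen.contract _ (hn.mul3 hsff0 hsff _ _ _ (mul3_bijective j))).neg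
    convert e1 using 3 with Y I
    have hT0 : slotM (Y.X.nn (nU d Y)) j (sffU d l Y) = 0 :=
      (Y.X.slotM_nn_eq_zero_iff _).mpr (Y.X.slotM_tangM_sffDeriv _ (nU_unit Y) l j)
    have e2 : Z Y I - slotM (tangU d Y) j.succ (Z Y) I
        = slotM (Y.X.nn (nU d Y)) j.succ (Z Y) I := by
      have : ∀ M : Matrix (Fin d) (Fin d) Y.A, slotM (1 - M) j.succ (Z Y) I
          = Z Y I - slotM M j.succ (Z Y) I := by
        intro M
        simp only [slotM, Matrix.sub_apply, sub_mul, Finset.sum_sub_distrib]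
        congr 1
        rw [Finset.sum_eq_single (I j.succ)]
        · simp
        · intro c _ hc
          rw [Matrix.one_apply_ne (Ne.symm hc), zero_mul]
        · simp
      rw [← this, tangU, MetricAlg.tangM_eq, sub_sub_cancel]
    have e3 : slotM (Y.X.nn (nU d Y)) j.succ (Z Y) I
        = ∑ c, tangU d Y (I 0) c * slotM (Y.X.nn (nU d Y)) j (Y.X.cd c (sffU d l Y))
          (Fin.tail I) := by
      simp only [slotM, hZ, dcov, Finset.mul_sum]
      rw [Finset.sum_comm]
      refine Finset.sum_congr rfl fun c _ => Finset.sum_congr rfl fun b _ => ?_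
      rw [Function.update_of_ne (Fin.succ_ne_zero j).symm]
      have : Fin.tail (Function.update I j.succ b) = Function.update (Fin.tail I) j b :=
        Fin.tail_update_succ I j b
      rw [this]
      simp only [Fin.tail]
      ring
    rw [e2, e3]
    simp_rw [Y.X.slotM_nn_cd _ (nU_unit Y) hT0]
    have e4 : ∀ b c : Fin d, (Fin.cons b (Fin.cons c I) : Fin (2 + l + 3) → Fin d) ∘
        (fun i : Fin (2 + l) => if i = j then 1 else i.succ.succ.succ)
        = Function.update (Fin.tail I) j c := by
      intro b c
      funext i
      by_cases hi : i = j
      · subst hi; simp [Fin.cons_one]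
      · simp [hi, Fin.tail]
    have e5 : ∀ b c : Fin d, (Fin.cons b (Fin.cons c I) : Fin (2 + l + 3) → Fin d) ∘
        ![2, 0] = ![I 0, b] := by
      intro b c
      funext i
      fin_cases i <;> rfl
    have e6 : ∀ b c : Fin d, (Fin.cons b (Fin.cons c I) : Fin (2 + l + 3) → Fin d) ∘
        ![j.succ.succ.succ] = fun _ => I j.succ := by
      intro b c
      funext i
      fin_cases i; rfl
    simp_rw [e4, e5, e6]
    have e7 : ∀ b : Fin d, sffU d 0 Y ![I 0, b]
        = ∑ c, tangU d Y (I 0) c * Y.X.cd c (nU d Y) (fun _ => b) := by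
      intro b
      change Y.X.sff (nU d Y) ![I 0, b] = _
      simp only [MetricAlg.sff, Matrix.cons_val_zero, Matrix.cons_val_one]
      refine Finset.sum_congr rfl fun c _ => ?_
      congr 1
    simp_rw [e7]
    simp only [Finset.sum_mul, Finset.mul_sum, mul_neg, Finset.sum_neg_distrib]
    rw [neg_inj, Finset.sum_comm]
    refine Finset.sum_congr rfl fun b _ => ?_
    rw [Finset.sum_comm]
    refine Finset.sum_congr rfl fun c _ => Finset.sum_congr rfl fun e _ => ?_
    simp only [Fin.tail]
    ring

end

end HypersurfaceInvariants

namespace HypersurfaceInvariants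

noncomputable section

/-! ### Fields that are given by hypersurface expressions along the hypersurface -/

/-- The field is a hypersurface expression of weight `w` modulo the ideal. -/
def On {d : ℕ} (w : ℕ) {k : ℕ} (T : UF d k) : Prop :=
  ∃ T' : UF d k, Gen (HypAt w) T' ∧ ∀ Y I, T Y I - T' Y I ∈ Y.I

namespace On

variable {d w w' k l : ℕ}

lemma of_gen {T : UF d k} (hT : Gen (HypAt w) T) : On w T :=
  ⟨T, hT, fun Y I => by simp⟩

lemma mono (h : w ≤ w') {T : UF d k} (hT : On w T) : On w' T := by
  obtain ⟨T', h1, h2⟩ := hT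
  exact ⟨T', h1.hypMono h, h2⟩

lemma congr {T T' : UF d k} (hT : On w T) (h : ∀ Y I, T' Y I - T Y I ∈ Y.I) : On w T' := by
  obtain ⟨T'', h1, h2⟩ := hT
  refine ⟨T'', h1, fun Y I => ?_⟩
  have := Y.I.add_mem (h Y I) (h2 Y I)
  rwa [sub_add_sub_cancel] at this

/-- The class is closed under all operations. -/
lemma bind {At : ∀ {k : ℕ}, UF d k → Prop} (h : ∀ {k : ℕ} (T : UF d k), At T → On w T)
    {T : UF d k} (hT : Gen At T) : On w T := by
  induction hT with
  | atom T hT => exact h T hT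
  | const c => exact of_gen (Gen.const c)
  | metric => exact of_gen Gen.metric
  | add T T' _ _ h1 h2 =>
    obtain ⟨S, g1, e1⟩ := h1
    obtain ⟨S', g2, e2⟩ := h2
    refine ⟨_, Gen.add _ _ g1 g2, fun Y I => ?_⟩
    have := Y.I.add_mem (e1 Y I) (e2 Y I)
    convert this using 1; ring
  | mul T T' _ _ h1 h2 =>
    obtain ⟨S, g1, e1⟩ := h1
    obtain ⟨S', g2, e2⟩ := h2
    refine ⟨_, Gen.mul _ _ g1 g2, fun Y I => ?_⟩
    have := Y.I.add_mem
      (Y.I.mul_mem_left (T Y (fun i => I (Fin.castAdd _ i))) (e2 Y (fun i => I (Fin.natAdd _ i))))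
      (Y.I.mul_mem_left (S' Y (fun i => I (Fin.natAdd _ i))) (e1 Y (fun i => I (Fin.castAdd _ i))))
    convert this using 1; ring
  | permute p T _ h1 =>
    obtain ⟨S, g1, e1⟩ := h1
    exact ⟨_, Gen.permute p _ g1, fun Y I => e1 Y _⟩
  | contract T _ h1 =>
    obtain ⟨S, g1, e1⟩ := h1
    refine ⟨_, Gen.contract _ g1, fun Y I => ?_⟩
    simp only [← Finset.sum_sub_distrib, ← mul_sub]
    exact Y.I.sum_mem fun a _ => Y.I.sum_mem fun b _ => Y.I.mul_mem_left _ (e1 Y _)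

/-- To use the operations on `Gen`. -/
lemma of_self {T : UF d k} (hT : Gen (On w) T) : On w T := bind (fun _ h => h) hT

lemma add {T T' : UF d k} (hT : On w T) (hT' : On w T') : On w (fun Y I => T Y I + T' Y I) :=
  of_self (Gen.add _ _ (Gen.atom _ hT) (Gen.atom _ hT'))

lemma sub {T T' : UF d k} (hT : On w T) (hT' : On w T') : On w (fun Y I => T Y I - T' Y I) :=
  of_self ((Gen.atom _ hT).sub (Gen.atom _ hT'))

lemma smul {T : UF d k} (c : ℝ) (hT : On w T) : On w (fun Y I => algebraMap ℝ Y.A c * T Y I) :=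
  of_self ((Gen.atom _ hT).smul c)

lemma comp {T : UF d k} (hT : On w T) (α : Fin k → Fin l) (hα : Function.Bijective α) :
    On w (fun Y J => T Y (J ∘ α)) :=
  of_self ((Gen.atom _ hT).comp α hα)

lemma normal : On w (nU d) := of_gen (Gen.atom _ HypAt.normal)

lemma zero_of {T : UF d k} (hT : On w T) : On w (k := k) (fun (_ : Geom d) _ => 0) :=
  of_self (Gen.atom _ hT).zero_of

lemma tang {T : UF d k} (hT : On w T) (j : Fin k) : On w (fun Y => slotM (tangU d Y) j (T Y)) :=
  of_self ((Gen.atom _ normal).tang (Gen.atom _ hT) j)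

/-- Fields that vanish along the hypersurface. -/
lemma dcov_tang_mem (Y : Geom d) {T : (Fin k → Fin d) → Y.A} (hT : ∀ J, T J ∈ Y.I) (a : Fin d)
    (J : Fin k → Fin d) : ∑ c, tangU d Y a c * Y.X.cd c T J ∈ Y.I := by
  simp only [MetricAlg.cd, mul_sub, Finset.sum_sub_distrib]
  refine Y.I.sub_mem (Y.tangential _ (hT J) a) (Y.I.sum_mem fun c _ => Y.I.mul_mem_left _ ?_)
  exact Y.I.sum_mem fun j _ => Y.I.sum_mem fun e _ => Y.I.mul_mem_left _ (hT _)

/-- Well defined modulo the ideal because tangential derivatives preserve it (`dcov_tang_mem`). On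
the generators, `n` goes to `II`, `∇̄^l II` is handled by `dcov_tang_sffU`, and `∇^k R` becomes a
projected `∇^(k+1) R`; the product rule `Gen.dcov` does the rest. -/
lemma dcov_tang {T : UF d k} (hw : 1 ≤ w) (hT : On w T) : On (w + 1) (dcov (tangU d) T) := by
  obtain ⟨S, h1, h2⟩ := hT
  have hn : Gen (HypAt (w + 1)) (nU d) := Gen.atom _ HypAt.normal
  refine congr (of_gen (Gen.dcov (At := HypAt w) (At' := HypAt (w + 1)) (tangU d) hn.zero_of
    (fun T hT => Gen.atom _ (hT.mono (Nat.le_succ w))) (fun T hT => ?_) h1)) fun Y I => ?_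
  · cases hT with
    | normal =>
      have h0 : Gen (HypAt (w + 1)) (k := 2) (sffU d 0) := Gen.atom _ (HypAt.sff 0 (by omega))
      convert h0 using 1
      rw [dcov_eq]
      funext Y
      exact (Y.X.sff_eq (nU d Y)).symm
    | sff l hl => exact dcov_tang_sffU (by omega)
    | riem l hl =>
      rw [dcov_eq]
      exact hn.tang (Gen.atom (riemU d (l + 1)) (HypAt.riem (l + 1) (by omega))) 0
  · simp only [dcov, ← Finset.sum_sub_distrib, ← mul_sub]
    have := dcov_tang_mem Y (T := fun J => T Y J - S Y J) (fun J => h2 Y J) (I 0) (Fin.tail I)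
    simp only [Y.X.cd_sub] at this
    exact this

end On

/-! ### Jets of the defining function -/

/-- The full derivative of a universal field. -/
def covU {d k : ℕ} (T : UF d k) : UF d (k + 1) := fun Y => Y.X.cov (T Y)

/-- Makes the full derivative a case of `dcov`, so that the one product rule `Gen.dcov` serves both
for full and for tangential derivatives. -/
lemma covU_eq {d k : ℕ} (T : UF d k) :
    covU T = dcov (fun _ a b => if a = b then 1 else 0) T := by
  funext Y I
  simp [covU, dcov, MetricAlg.cov]

lemma Gen.jet {d j w : ℕ} (h : j < w) : Gen (JetAt w) (jetU d j) := atom _ (JetAt.jet j h)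

lemma Gen.covU_jet {d w k : ℕ} (hw : 1 ≤ w) {T : UF d k} (hT : Gen (JetAt w) T) :
    Gen (JetAt (w + 1)) (covU T) := by
  have h1 : Gen (JetAt (w + 1)) (jetU d 1) := Gen.jet (by omega)
  rw [covU_eq]
  refine Gen.dcov (At := JetAt w) _ h1.zero_of (fun T hT => Gen.atom _ (hT.mono (Nat.le_succ w)))
    (fun T hT => ?_) hT
  rw [← covU_eq]
  cases hT with
  | jet _ hl => exact Gen.atom (jetU d (_ + 1)) (JetAt.jet (_ + 1) (by omega))
  | riem l hl => exact Gen.atom (riemU d (l + 1)) (JetAt.riem (l + 1) (by omega))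

lemma riem_slot_bijective {k : ℕ} (j : Fin k) : Function.Bijective
    (Sum.elim (![2, 3, 1, j.succ.succ.succ.succ] : Fin 4 → Fin (k + 4))
      (fun i : Fin k => if i = j then 0 else i.succ.succ.succ.succ)) := by
  refine bijective_of_injective ?_ (by simp; omega)
  have m2 := Nat.mod_eq_of_lt (show 2 < k + 4 by omega)
  have m3 := Nat.mod_eq_of_lt (show 3 < k + 4 by omega)
  rw [Sum.elim_injective]
  refine ⟨?_, ?_, ?_⟩
  · intro a b h
    have h' := congrArg Fin.val h
    fin_cases a <;> fin_cases b <;> simp [m2, m3] at h' ⊢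
  · intro a b h
    simp only at h
    split_ifs at h <;> simp_all [Fin.ext_iff]
  · intro a b h
    have h' := congrArg Fin.val h
    by_cases hb : b = j
    · fin_cases a <;> simp [m2, m3, hb] at h'
    · have hb' : (b : ℕ) ≠ j := fun h => hb (Fin.ext h)
      fin_cases a <;> simp [m2, m3, hb] at h'
      omega

/-- The action of the curvature in the Ricci identity. -/
lemma Gen.ricci {d k : ℕ} {At : ∀ {k : ℕ}, UF d k → Prop} (hR : Gen At (k := 4) (riemU d 0))
    {T : UF d k} (hT : Gen At T) :
    Gen At (fun Y (I : Fin (k + 2) → Fin d) => - ∑ j, ∑ e, Y.X.riemUp (I 0) (I 1) e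
      (I (Fin.succ (Fin.succ j))) * T Y (Function.update (fun i => I i.succ.succ) j e)) := by
  rcases Nat.eq_zero_or_pos k with rfl | hk
  · simp only [Finset.univ_eq_empty, Finset.sum_empty, neg_zero]
    exact (Gen.metric (At := At)).zero_of
  have h0 : Gen At (k := k + 2) (fun (_ : Geom d) _ => 0) := by
    have h1 := (Gen.mul _ _ (Gen.metric (At := At)) hT).zero_of
    exact h1.comp (finCongr (by omega)) (finCongr _).bijective
  refine (Gen.sum Finset.univ h0 fun j _ => ?_).neg
  have h2 := contract (k := k + 2) _ (hR.mul' hT _ _ (riem_slot_bijective j))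
  convert h2 using 3 with Y I
  refine Finset.sum_congr rfl fun e _ => ?_
  rw [Y.X.riemUp_eq, Finset.sum_mul]
  refine Finset.sum_congr rfl fun f _ => ?_
  have e1 : (Fin.cons e (Fin.cons f I) : Fin (k + 4) → Fin d) ∘
      ![2, 3, 1, j.succ.succ.succ.succ] = ![I 0, I 1, f, I j.succ.succ] := by
    funext i
    fin_cases i <;> rfl
  have e2 : (Fin.cons e (Fin.cons f I) : Fin (k + 4) → Fin d) ∘
      (fun i : Fin k => if i = j then 0 else i.succ.succ.succ.succ)
      = Function.update (fun i => I i.succ.succ) j e := by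
    funext i
    by_cases hi : i = j
    · subst hi; simp
    · simp [hi]
  rw [e1, e2, mul_assoc]
  rfl

/-- The jets are symmetric up to lower order terms. -/
lemma jet_swap {d k : ℕ} (i : Fin k) :
    Gen (JetAt (k + 1)) (fun Y J => jetU d (k + 1) Y (J ∘ Equiv.swap i.castSucc i.succ)
      - jetU d (k + 1) Y J) := by
  induction k with
  | zero => exact i.elim0
  | succ k ih =>
    refine Fin.cases ?_ (fun i => ?_) i
    -- The Hessian is treated apart: it is exactly symmetric, and weight two leaves no room for a
    -- curvature term.
    · rcases Nat.eq_zero_or_pos k with rfl | hk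
      · have h0 : Gen (JetAt 2) (k := 2) (fun (_ : Geom d) _ => 0) :=
          (Gen.metric).zero_of
        convert h0 using 3 with Y J
        change Y.X.cov (Y.X.cov (fun _ => Y.s)) _ - Y.X.cov (Y.X.cov (fun _ => Y.s)) J = 0
        have h1 := Y.X.cov_cov_sub (fun _ : Fin 0 → Fin d => Y.s) (J 1) (J 0) Fin.elim0
        simp only [Finset.univ_eq_empty, Finset.sum_empty, neg_zero] at h1
        convert h1 using 3
        · funext i; fin_cases i <;> rfl
        · funext i; fin_cases i <;> rfl
      have hR : Gen (JetAt (k + 2)) (k := 4) (riemU d 0) := Gen.atom _ (JetAt.riem 0 (by omega))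
      have h1 := (hR.ricci (Gen.jet (d := d) (j := k) (by omega))).comp
        (Equiv.swap 0 1 : Equiv.Perm (Fin (k + 2))) (Equiv.bijective _)
      convert h1 using 3 with Y J
      have h2 := Y.X.cov_cov_sub (jetU d k Y) (J 1) (J 0) (fun i => J i.succ.succ)
      have e1 : (Fin.cons (J 1) (Fin.cons (J 0) fun i => J i.succ.succ) : Fin (k + 2) → Fin d)
          = J ∘ Equiv.swap (Fin.castSucc 0) (Fin.succ 0) := by
        funext i
        refine Fin.cases ?_ (fun i => Fin.cases ?_ (fun i => ?_) i) i
        · simp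
        · simp [Fin.cons_one]
        · rw [Function.comp_apply, Equiv.swap_apply_of_ne_of_ne]
          · rfl
          · simp [Fin.ext_iff]
          · simp [Fin.ext_iff]
      have e2 : (Fin.cons (J 0) (Fin.cons (J 1) fun i => J i.succ.succ) : Fin (k + 2) → Fin d)
          = J := by
        funext i
        refine Fin.cases ?_ (fun i => Fin.cases ?_ (fun i => ?_) i) i <;> rfl
      rw [e1, e2] at h2
      refine h2.trans ?_
      congr 1
    -- A transposition that fixes the first index happens under the outermost derivative, so the
    -- error is the derivative of the previous one and its weight rises by one.
    · have h1 := (ih i).covU_jet (by omega)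
      convert h1 using 3 with Y J
      simp only [covU, MetricAlg.cov, Y.X.cd_sub]
      have h2 := Y.X.cd_comp_equiv (Equiv.swap i.castSucc i.succ) (J 0) (jetU d (k + 1) Y)
        (Fin.tail J)
      rw [h2]
      change Y.X.cd _ _ _ - Y.X.cd _ _ _ = _
      congr 2
      · funext l
        simp only [Fin.tail, Function.comp_apply]
        congr 1
        rw [← Fin.succ_castSucc]
        exact (Function.Injective.swap_apply (Fin.succ_injective _) _ _ _)

/-- Adjacent transpositions generate the symmetric group, and the error of a product of permutations
is the sum of the two errors, one of them reindexed. -/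
lemma jet_perm {d k : ℕ} (p : Equiv.Perm (Fin (k + 2))) :
    Gen (JetAt (k + 2)) (fun Y J => jetU d (k + 2) Y (J ∘ p) - jetU d (k + 2) Y J) := by
  have hp : p ∈ Submonoid.closure
      (Set.range fun i : Fin (k + 1) => Equiv.swap i.castSucc i.succ) := by
    rw [Equiv.Perm.mclosure_swap_castSucc_succ]; trivial
  induction hp using Submonoid.closure_induction with
  | mem p h =>
    obtain ⟨i, rfl⟩ := h
    exact jet_swap i
  | one =>
    have h0 := (Gen.mul _ _ (Gen.jet (d := d) (j := k + 1) (w := k + 2) (by omega))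
      (Gen.jet (d := d) (j := 1) (w := k + 2) (by omega))).zero_of
    convert h0 using 3 with Y J
    simp
  | mul p q _ _ h1 h2 =>
    have h3 := Gen.add _ _ (h2.comp p p.bijective) h1
    convert h3 using 3 with Y J
    simp only [sub_add_sub_cancel]
    rfl

end

end HypersurfaceInvariants

namespace HypersurfaceInvariants

noncomputable section

/-! ### Normal derivatives -/

variable {d : ℕ}

/-- Contraction of the first index with the gradient of the defining function. -/
def ncon {k : ℕ} (T : UF d (k + 1)) : UF d k :=
  fun Y I => ∑ a, ∑ b, Y.X.H a b * (Y.X.D a Y.s * T Y (Fin.cons b I))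

/-- Contraction of all indices with the gradient of the defining function. -/
def ncons : {k : ℕ} → UF d k → UF d 0
  | 0, T => T
  | _ + 1, T => ncons (ncon T)

/-- The derivative of a scalar along the gradient of the defining function. -/
def nab (f : UF d 0) : UF d 0 := fun Y I => Y.X.gr Y.s (f Y I)

/-- The iterated covariant derivative. -/
def covIter (f : UF d 0) : (k : ℕ) → UF d k
  | 0 => f
  | k + 1 => covU (covIter f k)

lemma jetU_one (Y : Geom d) (I : Fin 1 → Fin d) : jetU d 1 Y I = Y.X.D (I 0) Y.s := by
  change Y.X.cov (fun _ => Y.s) I = _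
  rw [MetricAlg.cov, MetricAlg.cd_scalar]

lemma covU_jetU (k : ℕ) : covU (jetU d k) = jetU d (k + 1) := rfl

lemma nab_eq (f : UF d 0) : nab f = ncon (covU f) := by
  funext Y I
  simp only [nab, ncon, covU, MetricAlg.gr, MetricAlg.cov, MetricAlg.cd_scalar]
  refine Finset.sum_congr rfl fun a _ => Finset.sum_congr rfl fun b _ => ?_
  rw [mul_assoc]; rfl

lemma ncon_bijective (k : ℕ) :
    Function.Bijective (Sum.elim (![0] : Fin 1 → Fin (k + 1)) Fin.succ) := by
  refine bijective_of_injective ?_ (by simp; omega)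
  rw [Sum.elim_injective]
  refine ⟨fun a b _ => Subsingleton.elim _ _, Fin.succ_injective _, fun a b => ?_⟩
  fin_cases a
  exact (Fin.succ_ne_zero b).symm

lemma ncon_eq {k : ℕ} (T : UF d (k + 1)) : ncon T = fun Y I => ∑ a, ∑ b, Y.X.H a b *
    (jetU d 1 Y ((Fin.cons a (Fin.cons b I) : Fin (k + 2) → Fin d) ∘ ![0]) *
      T Y ((Fin.cons a (Fin.cons b I) : Fin (k + 2) → Fin d) ∘ Fin.succ)) := by
  funext Y I
  simp only [ncon, jetU_one]
  rfl

lemma Gen.ncon {At : ∀ {k : ℕ}, UF d k → Prop} (h1 : Gen At (jetU d 1)) {k : ℕ}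
    {T : UF d (k + 1)} (hT : Gen At T) : Gen At (ncon T) := by
  rw [ncon_eq]
  exact contract _ (h1.mul' hT _ _ (ncon_bijective (k + 1)))

lemma Gen.ncons {At : ∀ {k : ℕ}, UF d k → Prop} (h1 : Gen At (jetU d 1)) :
    ∀ {k : ℕ} {T : UF d k}, Gen At T → Gen At (ncons T)
  | 0, _, hT => hT
  | _ + 1, T, hT => (Gen.ncons h1 (T := HypersurfaceInvariants.ncon T) (Gen.ncon h1 hT) :)

lemma ncon_add {k : ℕ} (T T' : UF d (k + 1)) :
    ncon (fun Y I => T Y I + T' Y I) = fun Y I => ncon T Y I + ncon T' Y I := by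
  funext Y I
  simp only [ncon, mul_add, Finset.sum_add_distrib]

lemma ncons_add : ∀ {k : ℕ} (T T' : UF d k),
    ncons (fun Y I => T Y I + T' Y I) = fun Y I => ncons T Y I + ncons T' Y I
  | 0, _, _ => rfl
  | _ + 1, T, T' => by rw [ncons, ncon_add, ncons_add]; rfl

lemma ncon_smul {k : ℕ} (f : ∀ Y : Geom d, Y.A) (T : UF d (k + 1)) :
    ncon (fun Y I => f Y * T Y I) = fun Y I => f Y * ncon T Y I := by
  funext Y I
  simp only [ncon, Finset.mul_sum]
  exact Finset.sum_congr rfl fun _ _ => Finset.sum_congr rfl fun _ _ => by ring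

lemma ncons_smul : ∀ {k : ℕ} (f : ∀ Y : Geom d, Y.A) (T : UF d k),
    ncons (fun Y I => f Y * T Y I) = fun Y I => f Y * ncons T Y I
  | 0, _, _ => rfl
  | _ + 1, f, T => by rw [ncons, ncon_smul, ncons_smul]; rfl

/-- The error term in commuting a normal derivative with a normal contraction. -/
def nconErr {k : ℕ} (T : UF d (k + 1)) : UF d k :=
  ncon (fun Y I => ∑ p, ∑ q, Y.X.H p q * (jetU d 2 Y ![I 0, p] * T Y (Fin.cons q (Fin.tail I))))

/-- Product rule: the derivative falls either on `T` or on the gradient used in the contraction. The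
latter turns the gradient into a Hessian and leaves `T` undifferentiated. -/
lemma ncon_covU_ncon {k : ℕ} (T : UF d (k + 1)) :
    ncon (covU (ncon T)) = fun Y I => ncon (ncon (covU T)) Y I + nconErr T Y I := by
  have key : covU (ncon T) = fun Y I =>
      (∑ p, ∑ q, Y.X.H p q * (Y.X.D p Y.s * Y.X.cov (T Y) (Fin.cons (I 0)
        (Fin.cons q (Fin.tail I)))))
      + ∑ p, ∑ q, Y.X.H p q * (jetU d 2 Y ![I 0, p] * T Y (Fin.cons q (Fin.tail I))) := by
    funext Y I
    simp only [covU, MetricAlg.cov, ncon_eq]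
    obtain ⟨W, hW⟩ : ∃ W : (Fin (k + 2) → Fin d) → Y.A, W = fun J => jetU d 1 Y (J ∘ ![0]) *
      T Y (J ∘ Fin.succ) := ⟨_, rfl⟩
    have hc : ∀ J, Y.X.cd (I 0) W J = Y.X.cd (I 0) (jetU d 1 Y) (J ∘ ![0]) * T Y (J ∘ Fin.succ)
        + jetU d 1 Y (J ∘ ![0]) * Y.X.cd (I 0) (T Y) (J ∘ Fin.succ) := fun J => by
      rw [hW]; exact Y.X.cd_mul _ _ (ncon_bijective (k + 1)) (I 0) (jetU d 1 Y) (T Y) J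
    have h2 := Y.X.cd_contract (I 0) W (Fin.tail I)
    simp only [hc] at h2
    simp only [hW] at h2
    rw [h2, ← Finset.sum_add_distrib]
    refine Finset.sum_congr rfl fun p _ => ?_
    rw [← Finset.sum_add_distrib]
    refine Finset.sum_congr rfl fun q _ => ?_
    have e1 : jetU d 2 Y ![I 0, p] = Y.X.cd (I 0) (jetU d 1 Y)
        ((Fin.cons p (Fin.cons q (Fin.tail I)) : Fin (k + 2) → Fin d) ∘ ![0]) := by
      change Y.X.cov (jetU d 1 Y) _ = _
      rw [MetricAlg.cov]
      congr 1
      funext i; fin_cases i; rfl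
    have e2 : (Fin.cons p (Fin.cons q (Fin.tail I)) : Fin (k + 2) → Fin d) ∘ Fin.succ
        = Fin.cons q (Fin.tail I) := by
      funext i; rfl
    rw [e1, e2, jetU_one]
    simp only [Fin.cons_zero, Fin.tail_cons]
    have e3 : ((Fin.cons p (Fin.cons q (Fin.tail I)) : Fin (k + 2) → Fin d) ∘ ![0]) 0 = p := rfl
    rw [e3]
    ring
  rw [key, ncon_add]
  funext Y I
  congr 1
  simp only [ncon, Finset.mul_sum, Fin.cons_zero, Fin.tail_cons, covU]
  have : ∀ u : Fin d → Fin d → Fin d → Fin d → Y.A, ∑ a, ∑ b, ∑ p, ∑ q, u a b p q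
      = ∑ p, ∑ q, ∑ a, ∑ b, u a b p q := by
    intro u
    calc ∑ a, ∑ b, ∑ p, ∑ q, u a b p q = ∑ a, ∑ p, ∑ b, ∑ q, u a b p q :=
          Finset.sum_congr rfl fun _ _ => Finset.sum_comm
      _ = ∑ p, ∑ a, ∑ b, ∑ q, u a b p q := Finset.sum_comm
      _ = ∑ p, ∑ a, ∑ q, ∑ b, u a b p q :=
          Finset.sum_congr rfl fun _ _ => Finset.sum_congr rfl fun _ _ => Finset.sum_comm
      _ = ∑ p, ∑ q, ∑ a, ∑ b, u a b p q := Finset.sum_congr rfl fun _ _ => Finset.sum_comm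
  rw [this]
  exact Finset.sum_congr rfl fun _ _ => Finset.sum_congr rfl fun _ _ =>
    Finset.sum_congr rfl fun _ _ => Finset.sum_congr rfl fun _ _ => by ring

lemma Gen.nconErr {At : ∀ {k : ℕ}, UF d k → Prop} (h1 : Gen At (jetU d 1))
    (h2 : Gen At (jetU d 2)) {k : ℕ} {T : UF d (k + 1)} (hT : Gen At T) :
    Gen At (nconErr T) := by
  refine Gen.ncon h1 ?_
  have hb : Function.Bijective (Sum.elim (![2, 0] : Fin 2 → Fin (k + 3))
      (Fin.cons 1 (fun i => i.succ.succ.succ))) := by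
    refine bijective_of_injective ?_ (by simp; omega)
    have m2 := Nat.mod_eq_of_lt (show 2 < k + 3 by omega)
    rw [Sum.elim_injective]
    refine ⟨?_, ?_, ?_⟩
    · intro a b h
      have h' := congrArg Fin.val h
      fin_cases a <;> fin_cases b <;> simp [m2] at h' ⊢
    · rw [Fin.cons_injective_iff]
      refine ⟨?_, fun a b h => Fin.succ_injective _ (Fin.succ_injective _
          (Fin.succ_injective _ h))⟩
      rintro ⟨i, hi⟩
      have := congrArg Fin.val hi
      simp at this
    · intro a b h
      have h' := congrArg Fin.val h
      revert h'
      refine Fin.cases ?_ (fun b => ?_) b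
      · fin_cases a <;> simp [m2]
      · fin_cases a <;> simp [m2]
        try omega
  have h3 := contract (k := k + 1) _ (h2.mul' hT _ _ hb)
  convert h3 using 3 with Y I
  refine Finset.sum_congr rfl fun p _ => Finset.sum_congr rfl fun q _ => ?_
  have e1 : (Fin.cons p (Fin.cons q I) : Fin (k + 3) → Fin d) ∘ ![2, 0] = ![I 0, p] := by
    funext i; fin_cases i <;> rfl
  have e2 : (Fin.cons p (Fin.cons q I) : Fin (k + 3) → Fin d) ∘
      (Fin.cons 1 (fun i => i.succ.succ.succ)) = Fin.cons q (Fin.tail I) := by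
    funext i
    refine Fin.cases ?_ (fun i => ?_) i <;> rfl
  rw [e1, e2]

/-- The terms in which the derivative hits one of the contracted gradients contain only the Hessian
of `s` and `T` itself. Hence only the total contraction of the derivative of `T` carries new top
order information. -/
lemma nab_ncons {At : ∀ {k : ℕ}, UF d k → Prop} (h1 : Gen At (jetU d 1))
    (h2 : Gen At (jetU d 2)) : ∀ {k : ℕ} {T : UF d k}, Gen At T →
    Gen At (fun Y I => nab (ncons T) Y I - ncons (covU T) Y I)
  | 0, T, hT => by
    convert hT.zero_of using 3 with Y I
    rw [nab_eq]
    exact sub_self _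
  | k + 1, T, hT => by
    have e1 := nab_ncons h1 h2 (Gen.ncon h1 hT)
    have e2 : ncons (covU (ncon T)) = fun Y I => ncons (covU T) Y I + ncons (nconErr T) Y I := by
      have e0 : ncons (covU (ncon T)) = ncons (ncon (covU (ncon T))) := rfl
      rw [e0, ncon_covU_ncon, ncons_add]; rfl
    have e3 := Gen.add _ _ e1 (Gen.ncons h1 (Gen.nconErr h1 h2 hT))
    convert e3 using 3 with Y I
    rw [e2]
    change nab (ncons (ncon T)) Y I - _ = _
    ring

lemma Gen.nab {w : ℕ} (hw : 1 ≤ w) {f : UF d 0} (hf : Gen (JetAt w) f) :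
    Gen (JetAt (w + 1)) (nab f) := by
  rw [nab_eq]
  exact Gen.ncon (Gen.jet (by omega)) (hf.covU_jet hw)

lemma Gen.covIter {w : ℕ} (hw : 1 ≤ w) {f : UF d 0} (hf : Gen (JetAt w) f) :
    ∀ k, Gen (JetAt (w + k)) (covIter f k)
  | 0 => hf
  | k + 1 => (Gen.covIter hw hf k).covU_jet (by omega)

lemma Gen.nab_iter {w : ℕ} (hw : 1 ≤ w) {f : UF d 0} (hf : Gen (JetAt w) f) (k : ℕ) :
    Gen (JetAt (w + k)) (HypersurfaceInvariants.nab^[k] f) := by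
  induction k with
  | zero => exact hf
  | succ k ih =>
    rw [Function.iterate_succ_apply']
    exact ih.nab (by omega)

lemma nab_add (f g : UF d 0) : nab (fun Y I => f Y I + g Y I)
    = fun Y I => nab f Y I + nab g Y I := by
  funext Y I; simp only [nab, MetricAlg.gr_add]

lemma nab_sub (f g : UF d 0) : nab (fun Y I => f Y I - g Y I)
    = fun Y I => nab f Y I - nab g Y I := by
  have := nab_add (fun Y I => f Y I - g Y I) g
  simp only [sub_add_cancel] at this
  funext Y I
  have h := congrFun (congrFun this Y) I
  rw [eq_sub_iff_add_eq]
  exact h.symm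

lemma nab_mul (f g : UF d 0) : nab (fun Y I => f Y I * g Y I)
    = fun Y I => f Y I * nab g Y I + g Y I * nab f Y I := by
  funext Y I; simp only [nab, MetricAlg.gr_mul]

lemma nab_smul (c : ℝ) (g : UF d 0) : nab (fun Y I => algebraMap ℝ Y.A c * g Y I)
    = fun Y I => algebraMap ℝ Y.A c * nab g Y I := by
  funext Y I; simp only [nab, MetricAlg.gr_mul, MetricAlg.gr_algebraMap]; ring

lemma nab_iter_add (f g : UF d 0) (k : ℕ) : nab^[k] (fun Y I => f Y I + g Y I)
    = fun Y I => nab^[k] f Y I + nab^[k] g Y I := by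
  induction k with
  | zero => rfl
  | succ k ih => simp only [Function.iterate_succ_apply', ih, nab_add]

lemma nab_iter_smul (c : ℝ) (g : UF d 0) (k : ℕ) :
    nab^[k] (fun Y I => algebraMap ℝ Y.A c * g Y I)
    = fun Y I => algebraMap ℝ Y.A c * nab^[k] g Y I := by
  induction k with
  | zero => rfl
  | succ k ih => simp only [Function.iterate_succ_apply', ih, nab_smul]

/-- Iterated normal derivatives of a scalar are contractions of its covariant derivatives, up to
lower order terms. -/
lemma nab_iter_sub {w : ℕ} (hw : 3 ≤ w) {f : UF d 0} (hf : Gen (JetAt w) f) (k : ℕ) :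
    Gen (JetAt (w + k - 1)) (fun Y I => nab^[k] f Y I - ncons (covIter f k) Y I) := by
  induction k with
  | zero =>
    have h0 : Gen (JetAt (w + 0 - 1)) (k := 0) (fun (_ : Geom d) _ => 0) := (Gen.const 0).zero_of
    convert h0 using 3 with Y I
    exact sub_self _
  | succ k ih =>
    have h1 := ih.nab (by omega)
    have h2 := nab_ncons (At := JetAt (w + k)) (Gen.jet (d := d) (by omega))
      (Gen.jet (by omega)) (Gen.covIter (by omega) hf k)
    have h3 := Gen.add _ _ (h1.jetMono (w' := w + k) (by omega)) h2
    refine Gen.jetMono (w := w + k) (by omega) ?_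
    convert h3 using 3 with Y I
    rw [nab_sub, Function.iterate_succ_apply']
    simp only [sub_add_sub_cancel]
    rfl

/-- The square of the length of `ds`. -/
def uU (d : ℕ) : UF d 0 := fun Y _ => Y.X.gr Y.s Y.s

lemma uU_eq : uU d = ncon (jetU d 1) := by
  funext Y I
  simp only [uU, ncon, MetricAlg.gr, jetU_one, Fin.cons_zero, mul_assoc]

lemma jetU_two_symm (Y : Geom d) (a b : Fin d) : jetU d 2 Y ![a, b] = jetU d 2 Y ![b, a] := by
  have h1 := Y.X.cov_cov_sub (fun _ : Fin 0 → Fin d => Y.s) a b Fin.elim0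
  simp only [Finset.univ_eq_empty, Finset.sum_empty, neg_zero, sub_eq_zero] at h1
  change Y.X.cov (Y.X.cov (fun _ => Y.s)) _ = Y.X.cov (Y.X.cov (fun _ => Y.s)) _
  convert h1 using 2
  · funext i; fin_cases i <;> rfl
  · funext i; fin_cases i <;> rfl

/-- Each of the two gradients in `|ds|²` contributes one full contraction of the Hessian, by its
symmetry. This factor `2` is the first term of the decisive coefficient `2 - 2(k+1)/d`. -/
lemma nab_uU : nab (uU d) = fun Y I => 2 * ncons (jetU d 2) Y I := by
  rw [nab_eq, uU_eq, ncon_covU_ncon]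
  have : nconErr (jetU d 1) = ncons (jetU d 2) := by
    rw [nconErr, ncons, ncons, ncons]
    congr 1
    funext Y I
    simp only [ncon, jetU_one, Fin.cons_zero]
    rw [Finset.sum_comm]
    refine Finset.sum_congr rfl fun a _ => Finset.sum_congr rfl fun b _ => ?_
    rw [Y.X.H_symm b a, jetU_two_symm]
    have : (Fin.cons b I : Fin 2 → Fin d) = ![b, I 0] := by
      funext i; fin_cases i <;> rfl
    rw [this]; ring
  rw [this]
  funext Y I
  rw [two_mul]; rfl

lemma nab_iter_uU (k : ℕ) : Gen (JetAt (k + 2))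
    (fun Y I => nab^[k + 1] (uU d) Y I - 2 * ncons (jetU d (k + 2)) Y I) := by
  induction k with
  | zero =>
    have h0 : Gen (JetAt 2) (k := 0) (fun (_ : Geom d) _ => 0) := (Gen.const 0).zero_of
    convert h0 using 3 with Y I
    simp only [zero_add, Function.iterate_one, nab_uU, sub_self]
  | succ k ih =>
    have h1 := ih.nab (by omega)
    have h2 := (nab_ncons (At := JetAt (k + 3)) (Gen.jet (d := d) (by omega))
      (Gen.jet (by omega)) (Gen.jet (j := k + 2) (by omega))).smul 2
    have h3 := Gen.add _ _ h1 h2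
    convert h3 using 3 with Y I
    rw [nab_sub, Function.iterate_succ_apply' (n := k + 1)]
    have e : nab (fun Y I => 2 * ncons (jetU d (k + 2)) Y I)
        = fun Y I => 2 * nab (ncons (jetU d (k + 2))) Y I := by
      have := nab_smul 2 (ncons (jetU d (k + 2)))
      simpa only [map_ofNat] using this
    rw [e, covU_jetU]
    simp only [map_ofNat]
    ring

end

end HypersurfaceInvariants

namespace HypersurfaceInvariants

noncomputable section

/-! ### The normal derivatives of the equation -/

variable {d : ℕ}

/-- The Laplacian of the defining function. -/
def lapU (d : ℕ) : UF d 0 := fun Y _ => Y.X.lap Y.s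

/-- The scalar curvature. -/
def scU (d : ℕ) : UF d 0 := fun Y _ => Y.X.sc

/-- `S(s)`. -/
def yamU (d : ℕ) : UF d 0 := fun Y _ => Y.X.yam Y.s

lemma lapU_eq : lapU d = fun Y I => ∑ a, ∑ b, Y.X.H a b *
    jetU d 2 Y (Fin.cons a (Fin.cons b I)) := by
  funext Y I
  simp only [lapU, MetricAlg.lap]
  refine Finset.sum_congr rfl fun a _ => Finset.sum_congr rfl fun b _ => ?_
  have h1 : jetU d 2 Y (Fin.cons a (Fin.cons b I)) = Y.X.cd a (jetU d 1 Y) (Fin.cons b I) :=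
    MetricAlg.cov_cons _ _ _ _
  rw [h1, MetricAlg.cd]
  simp [jetU_one]

lemma scU_eq : scU d = fun Y I => ∑ a, ∑ b, Y.X.H a b * ∑ c, ∑ f, Y.X.H c f *
    riemU d 0 Y ((Fin.cons c (Fin.cons f (Fin.cons a (Fin.cons b I))) : Fin 4 → Fin d) ∘
      ![0, 2, 1, 3]) := by
  funext Y I
  simp only [scU, MetricAlg.sc, MetricAlg.ric, MetricAlg.riemUp_eq]
  refine Finset.sum_congr rfl fun a _ => Finset.sum_congr rfl fun b _ => ?_
  congr 1

lemma Gen.lapU : Gen (JetAt 3) (lapU d) := by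
  rw [lapU_eq]
  exact contract _ (Gen.jet (by omega))

lemma Gen.scU : Gen (JetAt 3) (scU d) := by
  rw [scU_eq]
  have h1 : Gen (JetAt 3) (k := 4) (riemU d 0) := Gen.atom _ (JetAt.riem 0 (by omega))
  exact contract (k := 0) _ (contract (k := 2) _ (h1.comp (![0, 2, 1, 3] : Fin 4 → Fin 4)
    (bijective_of_injective (by decide) (by simp))))

lemma Gen.mul0 {At : ∀ {k : ℕ}, UF d k → Prop} {f g : UF d 0} (hf : Gen At f) (hg : Gen At g) :
    Gen At (fun Y I => f Y I * g Y I) := by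
  have := hf.scalar_mul hg
  convert this using 5

lemma Gen.sU {w : ℕ} (hw : 1 ≤ w) : Gen (JetAt w) (k := 0) (fun (Y : Geom d) _ => Y.s) :=
  Gen.jet (j := 0) (by omega)

lemma Gen.uU {w : ℕ} (hw : 2 ≤ w) : Gen (JetAt w) (uU d) := by
  rw [uU_eq]
  exact Gen.ncon (Gen.jet (by omega)) (Gen.jet (by omega))

lemma nab_s_mul (h : UF d 0) : nab (fun Y I => Y.s * h Y I)
    = fun Y I => Y.s * nab h Y I + h Y I * uU d Y I := by
  rw [nab_mul (fun Y _ => Y.s) h]; rfl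

/-- For the curvature term of `S`. Each derivative spent on `s` is missing on `h`, so apart from the
multiple of `s` at most `m - 1` derivatives reach `h`, which gives weight `3 + (m - 1)`. -/
lemma nab_iter_s_mul {h : UF d 0} (hh : Gen (JetAt 3) h) (m : ℕ) :
    Gen (JetAt (m + 2)) (fun Y I => nab^[m] (fun Y I => Y.s * h Y I) Y I
      - Y.s * nab^[m] h Y I) := by
  induction m with
  | zero =>
    have h0 : Gen (JetAt 2) (k := 0) (fun (_ : Geom d) _ => 0) := (Gen.const 0).zero_of
    convert h0 using 3 with Y I
    simp
  | succ m ih =>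
    have h1 := ih.nab (by omega)
    have h2 := (hh.nab_iter (by omega) m).mul0 (Gen.uU (d := d) (by omega))
    refine (Gen.add _ _ h1 (h2.jetMono (w' := m + 3) (by omega))).jetMono (w' := m + 3)
      (by omega) |> fun h => ?_
    convert h using 3 with Y I
    rw [nab_sub, nab_s_mul, Function.iterate_succ_apply', Function.iterate_succ_apply']
    ring

/-- For the Laplacian term of `S`, of weight three. Here the terms with exactly one derivative on
`s` must be kept, and there are `k + 1` of them; the others contain a derivative of `|ds|²` and are
of lower order. -/
lemma nab_iter_s_mul' {f : UF d 0} (hf : Gen (JetAt 3) f) (k : ℕ) :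
    Gen (JetAt (k + 2)) (fun Y I => nab^[k + 1] (fun Y I => Y.s * f Y I) Y I
      - (Y.s * nab^[k + 1] f Y I + ((k : Y.A) + 1) * (uU d Y I * nab^[k] f Y I))) := by
  induction k with
  | zero =>
    have h0 : Gen (JetAt 2) (k := 0) (fun (_ : Geom d) _ => 0) := (Gen.const 0).zero_of
    convert h0 using 3 with Y I
    simp only [zero_add, Function.iterate_one, nab_s_mul, Function.iterate_zero, id]
    push_cast; ring
  | succ k ih =>
    have h1 := ih.nab (by omega)
    have h2 := ((hf.nab_iter (by omega) k).mul0 ((Gen.uU (d := d) le_rfl).nab (by omega)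
      |>.jetMono (w' := 3 + k) (by omega))).smul ((k : ℝ) + 1)
    have h3 := Gen.add _ _ h1 (h2.jetMono (w' := k + 3) (by omega))
    convert h3 using 3 with Y I
    have e : nab (fun Y I => ((k : Y.A) + 1) * (uU d Y I * nab^[k] f Y I))
        = fun Y I => ((k : Y.A) + 1) * nab (fun Y I => uU d Y I * nab^[k] f Y I) Y I := by
      have := nab_smul ((k : ℝ) + 1) (fun Y I => uU d Y I * nab^[k] f Y I)
      simpa only [map_add, map_natCast, map_one] using this
    rw [nab_sub, nab_add, nab_s_mul, e, nab_mul]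
    simp only [Function.iterate_succ_apply', map_add, map_natCast, map_one]
    push_cast
    ring

/-- Contraction commutes with differentiation, so only the order of the indices changes. The
permutation need not be known, since later both the normal part and the remainder of the jet
tolerate any permutation. -/
lemma covIter_lapU (m : ℕ) : ∃ ε : Equiv.Perm (Fin (m + 2)), covIter (lapU d) m
    = fun Y I => ∑ a, ∑ b, Y.X.H a b *
      jetU d (m + 2) Y ((Fin.cons a (Fin.cons b I) : Fin (m + 2) → Fin d) ∘ ε) := by
  induction m with
  | zero => exact ⟨1, lapU_eq⟩
  | succ m ih =>
    obtain ⟨ε, hε⟩ := ih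
    refine ⟨(Equiv.ofBijective _ (bijective_of_injective (cons_zero_injective ε.injective)
      (by simp))).trans (Equiv.ofBijective _ (cycle3_bijective m)), ?_⟩
    rw [covIter, hε]
    funext Y I
    rw [covU, MetricAlg.cov]
    have h1 := Y.X.cd_contract (I 0) (fun J => jetU d (m + 2) Y (J ∘ ε)) (Fin.tail I)
    refine h1.trans ?_
    refine Finset.sum_congr rfl fun p _ => Finset.sum_congr rfl fun q _ => ?_
    congr 1
    rw [Y.X.cd_comp_equiv]
    have h2 : ((Fin.cons p (Fin.cons q I) : Fin (m + 3) → Fin d) ∘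
        ((Equiv.ofBijective _ (bijective_of_injective (cons_zero_injective ε.injective)
      (by simp))).trans (Equiv.ofBijective _ (cycle3_bijective m))))
        = Fin.cons (I 0) ((Fin.cons p (Fin.cons q (Fin.tail I)) : Fin (m + 2) → Fin d) ∘ ε) := by
      have : ⇑((Equiv.ofBijective _ (bijective_of_injective (cons_zero_injective ε.injective)
        (by simp))).trans (Equiv.ofBijective _ (cycle3_bijective m)))
        = cycle3 m ∘ Fin.cons 0 (Fin.succ ∘ ε) := rfl
      rw [this, ← Function.comp_assoc, cons_cons_comp_cycle3, cons_comp_cons]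
      rfl
    rw [h2]
    exact (Y.X.cov_cons _ _ _).symm

/-- The normal derivatives of `S(s)` up to lower order terms and multiples of `s`. -/
lemma nab_iter_yamU (k : ℕ) : ∃ (ε : Equiv.Perm (Fin (k + 2))) (E W : UF d 0),
    Gen (JetAt (k + 2)) E ∧ ∀ Y I, nab^[k + 1] (yamU d) Y I = 2 * ncons (jetU d (k + 2)) Y I
      - algebraMap ℝ Y.A (2 / d) * ((k : Y.A) + 1) * (uU d Y I *
        ncons (fun Y (I : Fin k → Fin d) => ∑ a, ∑ b, Y.X.H a b * jetU d (k + 2) Y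
          ((Fin.cons a (Fin.cons b I) : Fin (k + 2) → Fin d) ∘ ε)) Y I)
      + E Y I + Y.s * W Y I := by
  obtain ⟨ε, hε⟩ := covIter_lapU (d := d) k
  set c : ℝ := 1 / (2 * ((d : ℝ) - 1)) with hc
  set g : UF d 0 := fun Y I => Y.s * scU d Y I with hg
  set f : UF d 0 := fun Y I => lapU d Y I + algebraMap ℝ Y.A c * g Y I with hf
  have hgG : Gen (JetAt 3) g := (Gen.sU (by omega)).mul0 Gen.scU
  have hfG : Gen (JetAt 3) f := Gen.add _ _ Gen.lapU (hgG.smul c)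
  have hy : yamU d = fun Y I => uU d Y I
      + algebraMap ℝ Y.A (-(2 / d)) * (Y.s * f Y I) := by
    funext Y I
    simp only [yamU, MetricAlg.yam, uU, hf, hg, lapU, scU, hc, map_neg]
    ring
  have hfk : nab^[k] f = fun Y I => nab^[k] (lapU d) Y I + algebraMap ℝ Y.A c * nab^[k] g Y I := by
    rw [hf, nab_iter_add, nab_iter_smul]
  have hyk : nab^[k + 1] (yamU d) = fun Y I => nab^[k + 1] (uU d) Y I
      + algebraMap ℝ Y.A (-(2 / d)) * nab^[k + 1] (fun Y I => Y.s * f Y I) Y I := by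
    rw [hy, nab_iter_add, nab_iter_smul]
  have hu := nab_iter_uU (d := d) k
  have hs := nab_iter_s_mul' hfG k
  have hsc := nab_iter_s_mul (Gen.scU (d := d)) k
  -- The `k`-th normal derivative of the Laplacian agrees with a contraction of `∇^(k+2) s` up to
  -- weight `3 + k - 1 = k + 2`, the weight admitted for the error.
  have hl := (nab_iter_sub (le_refl 3) (Gen.lapU (d := d)) k).jetMono (w' := k + 2) (by omega)
  have hE := Gen.add _ _ hu ((Gen.add _ _ hs
    (((Gen.uU (d := d) (w := k + 2) (by omega)).mul0
      (Gen.add _ _ hl (hsc.smul c))).smul ((k : ℝ) + 1))).smul (-(2 / d)))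
  refine ⟨ε, _, fun Y I => algebraMap ℝ Y.A (-(2 / d)) * (nab^[k + 1] f Y I
    + ((k : Y.A) + 1) * (uU d Y I * (algebraMap ℝ Y.A c * nab^[k] (scU d) Y I))), hE, ?_⟩
  intro Y I
  rw [hyk, hfk, ← hε]
  simp only [map_add, map_natCast, map_one, map_neg]
  ring

/-! ### The right-hand side of the equation -/

lemma nab_iter_apply (f : UF d 0) (k : ℕ) (Y : Geom d) (I : Fin 0 → Fin d) :
    nab^[k] f Y I = (Y.X.gr Y.s)^[k] (f Y I) := by
  induction k with
  | zero => rfl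
  | succ k ih => rw [Function.iterate_succ_apply', Function.iterate_succ_apply', ← ih]; rfl

lemma gr_pow (Y : Geom d) (j : ℕ) :
    Y.X.gr Y.s (Y.s ^ (j + 1)) = ((j : Y.A) + 1) * Y.s ^ j * Y.X.gr Y.s Y.s := by
  induction j with
  | zero => simp
  | succ j ih => rw [pow_succ, MetricAlg.gr_mul, ih]; push_cast; ring

/-- Each derivative lowers the power of `s` by one and contributes a factor `|ds|²`. The constant is
a product of consecutive integers, of which only positivity matters. -/
lemma gr_iter_pow_mul (k : ℕ) : ∀ j : ℕ, ∃ c : ℕ, 0 < c ∧ ∀ (Y : Geom d) (g : Y.A), ∃ q : Y.A,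
    (Y.X.gr Y.s)^[k] (Y.s ^ (j + k) * g) = Y.s ^ j * (c * Y.X.gr Y.s Y.s ^ k * g + Y.s * q) := by
  induction k with
  | zero =>
    intro j
    exact ⟨1, one_pos, fun Y g => ⟨0, by simp⟩⟩
  | succ k ih =>
    intro j
    obtain ⟨c, hc, h⟩ := ih (j + 1)
    refine ⟨(j + 1) * c, by positivity, fun Y g => ?_⟩
    obtain ⟨q, hq⟩ := h Y g
    refine ⟨((j : Y.A) + 1) * Y.X.gr Y.s Y.s * q
      + Y.X.gr Y.s (c * Y.X.gr Y.s Y.s ^ k * g + Y.s * q), ?_⟩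
    rw [Function.iterate_succ_apply', show j + (k + 1) = j + 1 + k by ring, hq, MetricAlg.gr_mul,
      gr_pow]
    push_cast
    ring

lemma gr_iter_add (Y : Geom d) (k : ℕ) (f g : Y.A) :
    (Y.X.gr Y.s)^[k] (f + g) = (Y.X.gr Y.s)^[k] f + (Y.X.gr Y.s)^[k] g := by
  induction k with
  | zero => rfl
  | succ k ih => simp only [Function.iterate_succ_apply', ih, MetricAlg.gr_add]

lemma gr_iter_one (Y : Geom d) (k : ℕ) : (Y.X.gr Y.s)^[k + 1] (1 : Y.A) = 0 := by
  induction k with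
  | zero =>
    have := Y.X.gr_algebraMap Y.s 1
    simpa using this
  | succ k ih =>
    rw [Function.iterate_succ_apply', ih]
    have := Y.X.gr_algebraMap Y.s 0
    simpa using this

end

end HypersurfaceInvariants

namespace HypersurfaceInvariants

noncomputable section

/-! ### The jets of the solution along the hypersurface -/

variable {d : ℕ}

lemma gr_sub_one_mem (Y : Geom d) : Y.X.gr Y.s Y.s - 1 ∈ Y.I := by
  have h : Y.X.gr Y.s Y.s - 1 = -(Y.X.gr Y.s Y.s * (1 + Y.ρ)) * (Y.ρ - 1) := by
    linear_combination Y.rho_sq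
  rw [h]
  exact Y.I.mul_mem_left _ Y.rho_mem

lemma pow_sub_one_mem {A : Type*} [CommRing A] {I : Ideal A} {x : A} (hx : x - 1 ∈ I) (k : ℕ) :
    x ^ k - 1 ∈ I :=
  I.mem_of_dvd (by simpa using sub_dvd_pow_sub_pow x 1 k) hx

/-- The contraction of `ds` with the unit conormal. -/
def thetaU (Y : Geom d) : Y.A := ∑ a, ∑ b, Y.X.H a b * (Y.X.D a Y.s * nU d Y (fun _ => b))

lemma thetaU_sub_one_mem (Y : Geom d) : thetaU Y - 1 ∈ Y.I := by
  have h1 : thetaU Y = Y.ρ * Y.X.gr Y.s Y.s := by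
    simp only [thetaU, MetricAlg.gr, nU, Finset.mul_sum]
    exact Finset.sum_congr rfl fun _ _ => Finset.sum_congr rfl fun _ _ => by ring
  have h : thetaU Y - 1 = -(Y.ρ * Y.X.gr Y.s Y.s) * (Y.ρ - 1) := by
    rw [h1]; linear_combination Y.rho_sq
  rw [h]
  exact Y.I.mul_mem_left _ Y.rho_mem

lemma On.of_mem {w k : ℕ} {T T' : UF d k} (hT' : On w T') (hT : ∀ Y J, T Y J ∈ Y.I) : On w T :=
  hT'.zero_of.congr fun Y J => by simpa using hT Y J

lemma On.const (w : ℕ) (c : ℝ) : On (d := d) w (k := 0) (fun Y _ => algebraMap ℝ Y.A c) :=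
  On.of_gen (Gen.const c)

lemma On.jet_zero (w : ℕ) : On w (jetU d 0) :=
  On.of_mem (On.const w 0) fun Y _ => Y.s_mem

lemma On.jet_one (w : ℕ) : On w (jetU d 1) :=
  On.normal.congr fun Y J => by
    rw [jetU_one, nU]
    have : Y.X.D (J 0) Y.s - Y.ρ * Y.X.D (J 0) Y.s = -Y.X.D (J 0) Y.s * (Y.ρ - 1) := by ring
    rw [this]
    exact Y.I.mul_mem_left _ Y.rho_mem

lemma On.ncons {w k : ℕ} {T : UF d k} (hT : On w T) : On w (ncons T) :=
  On.of_self (Gen.ncons (Gen.atom _ (On.jet_one w)) (Gen.atom _ hT))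

/-- The tensor powers of the conormal. -/
def nTen (d k : ℕ) : UF d k := fun Y I => ∏ j, nU d Y (fun _ => I j)

lemma nTen_succ (k : ℕ) (Y : Geom d) (I : Fin (k + 1) → Fin d) :
    nTen d (k + 1) Y I = nU d Y (fun _ => I 0) * nTen d k Y (Fin.tail I) := by
  simp only [nTen, Fin.prod_univ_succ]; rfl

lemma nTen_comp (k : ℕ) (Y : Geom d) (I : Fin k → Fin d) (p : Equiv.Perm (Fin k)) :
    nTen d k Y (I ∘ p) = nTen d k Y I :=
  Equiv.prod_comp p fun j => nU d Y (fun _ => I j)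

lemma Gen.nTen {At : ∀ {k : ℕ}, UF d k → Prop} (h : Gen At (nU d)) :
    ∀ k, Gen At (HypersurfaceInvariants.nTen d k)
  | 0 => by
    convert Gen.const 1 using 3 with Y I
    simp [HypersurfaceInvariants.nTen]
  | k + 1 => by
    have h1 := h.mul' (Gen.nTen h k) _ _ (ncon_bijective k)
    convert h1 using 3 with Y I
    rw [nTen_succ]
    congr 2
    funext i
    fin_cases i
    rfl

lemma ncons_nTen : ∀ (k : ℕ) (I : Fin 0 → Fin d) (Y : Geom d),
    ncons (nTen d k) Y I = thetaU Y ^ k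
  | 0, I, Y => by simp [ncons, nTen]
  | k + 1, I, Y => by
    have h : ncon (nTen d (k + 1)) = fun Y I => thetaU Y * nTen d k Y I := by
      funext Y I
      simp only [ncon, nTen_succ, thetaU, Finset.sum_mul, Fin.cons_zero, Fin.tail_cons]
      exact Finset.sum_congr rfl fun _ _ => Finset.sum_congr rfl fun _ _ => by ring
    rw [ncons, h, ncons_smul]
    change thetaU Y * ncons (nTen d k) Y I = _
    rw [ncons_nTen k, pow_succ']

lemma contract_nTen (k : ℕ) (Y : Geom d) (I : Fin k → Fin d) :
    ∑ a, ∑ b, Y.X.H a b * nTen d (k + 2) Y (Fin.cons a (Fin.cons b I)) = nTen d k Y I := by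
  rw [← one_mul (nTen d k Y I), ← nU_unit Y, Finset.sum_mul]
  refine Finset.sum_congr rfl fun a _ => ?_
  rw [Finset.mul_sum, Finset.sum_mul]
  refine Finset.sum_congr rfl fun b _ => ?_
  rw [nTen_succ, nTen_succ]
  simp only [Fin.cons_zero, Fin.tail_cons]
  ring

/-- The purely normal component of the jet. -/
def normalJet (d k : ℕ) : UF d 0 := fun Y _ => ∑ J : Fin k → Fin d,
  (∏ j, ∑ b, Y.X.H (J j) b * nU d Y (fun _ => b)) * jetU d k Y J

lemma slotAct_nn_jetU (k : ℕ) (Y : Geom d) (I : Fin k → Fin d) :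
    slotAct (fun _ => Y.X.nn (nU d Y)) (jetU d k Y) I
      = normalJet d k Y Fin.elim0 * nTen d k Y I := by
  simp only [slotAct, normalJet, nTen, MetricAlg.nn_apply, Finset.prod_mul_distrib,
    Finset.sum_mul]
  exact Finset.sum_congr rfl fun _ _ => by ring

lemma slotM_tangU_eq {k : ℕ} (Y : Geom d) (j : Fin k) (T : (Fin k → Fin d) → Y.A)
    (J : Fin k → Fin d) :
    slotM (tangU d Y) j T J = T J - slotM (Y.X.nn (nU d Y)) j T J := by
  simp only [tangU, slotM, MetricAlg.tangM_eq, Matrix.sub_apply, sub_mul,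
    Finset.sum_sub_distrib]
  congr 1
  rw [Finset.sum_eq_single (J j)]
  · simp
  · intro c _ hc
    rw [Matrix.one_apply_ne (Ne.symm hc), zero_mul]
  · simp

lemma Gen.on_of_jet {w k : ℕ} (h : ∀ j, j < w → On j (jetU d j)) {T : UF d k}
    (hT : Gen (JetAt w) T) : On w T := by
  refine On.bind (fun T hT => ?_) hT
  cases hT with
  | jet j hj => exact (h _ hj).mono hj.le
  | riem l hl => exact On.of_gen (Gen.atom _ (HypAt.riem l hl))

lemma slotM_comp_equiv {k : ℕ} {A : Type*} [CommRing A] (M : Matrix (Fin d) (Fin d) A)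
    (p : Equiv.Perm (Fin k)) (j : Fin k) (T : (Fin k → Fin d) → A) (J : Fin k → Fin d) :
    slotM M (p.symm j) T (J ∘ p) = slotM M j (fun J => T (J ∘ p)) J := by
  simp only [slotM, Function.comp_apply, Equiv.apply_symm_apply]
  refine Finset.sum_congr rfl fun c _ => ?_
  congr 2
  rw [← Function.update_comp_equiv]

/-- The jets are determined along the hypersurface, apart from their normal components. -/
lemma On.slotM_tang_jetU {k : ℕ} (h : ∀ j, j < k + 2 → On j (jetU d j)) (i : Fin (k + 2)) :
    On (k + 2) (fun Y => slotM (tangU d Y) i (jetU d (k + 2) Y)) := by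
  -- In the first slot this is the tangential derivative of `∇^(k+1) s`, known by hypothesis; any
  -- other slot is brought to the front by a transposition, at the cost of a lower order error.
  have h0 : On (k + 2) (fun Y => slotM (tangU d Y) 0 (jetU d (k + 2) Y)) := by
    have := On.dcov_tang (w := k + 1) (by omega) (h (k + 1) (by omega))
    rwa [dcov_eq] at this
  set p := Equiv.swap (0 : Fin (k + 2)) i
  have h1 := (jet_perm (d := d) p).on_of_jet h
  have h2 := h0.comp p p.bijective
  have h3 := h2.sub (h1.tang i)
  convert h3 using 3 with Y J
  have e0 : (0 : Fin (k + 2)) = p.symm i := by simp [p]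
  rw [e0, slotM_comp_equiv, slotM_sub]
  ring

/-- Since the tangential part in every single slot is known, the jet may be replaced by its
projection to `n` in all slots at once, which is the normal component times the tensor power of `n`.
-/
lemma On.jetU_sub {k : ℕ} (h : ∀ j, j < k + 2 → On j (jetU d j)) :
    On (k + 2) (fun Y J => jetU d (k + 2) Y J
      - normalJet d (k + 2) Y Fin.elim0 * nTen d (k + 2) Y J) := by
  have ht := On.slotM_tang_jetU h
  have h1 := slotAct_congr (On (k + 2)) (fun Y => Y.X.nn (nU d Y)) (fun _ _ => On.add)
    (ht 0).zero_of (fun j T hT => by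
      have := hT.sub (hT.tang j)
      convert this using 3 with Y J
      rw [slotM_tangU_eq]; ring) (jetU d (k + 2)) (fun j => by
      convert ht j using 3 with Y J
      rw [slotM_tangU_eq])
  simpa only [slotAct_nn_jetU] using h1

lemma On.contract_comp {w k : ℕ} {T : UF d (k + 2)} (hT : On w T) (p : Equiv.Perm (Fin (k + 2))) :
    On w (fun Y I => ∑ a, ∑ b, Y.X.H a b *
      T Y ((Fin.cons a (Fin.cons b I) : Fin (k + 2) → Fin d) ∘ p)) :=
  On.of_self (Gen.contract _ ((Gen.atom _ hT).comp p p.bijective))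

/-- The normal derivatives of the equation determine the normal components of the jets. -/
lemma nab_iter_yamU_mod {k : ℕ} (h : ∀ j, j < k + 2 → On j (jetU d j)) :
    ∃ N : UF d 0, On (k + 2) N ∧ ∀ Y I, nab^[k + 1] (yamU d) Y I
      - (algebraMap ℝ Y.A (2 - 2 / d * (k + 1)) * normalJet d (k + 2) Y Fin.elim0 + N Y I)
        ∈ Y.I := by
  obtain ⟨ε, E, W, hE, heq⟩ := nab_iter_yamU (d := d) k
  set y : ∀ Y : Geom d, Y.A := fun Y => normalJet d (k + 2) Y Fin.elim0 with hy
  -- Separate the unknown normal part `y n⊗⋯⊗n` from a known remainder `R`. The full contractions of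
  -- the unknown part, and those of its trace, equal `y` modulo the ideal, so the coefficient of `y`
  -- is `2 - (2/d)(k+1)`.
  set R : UF d (k + 2) := fun Y J => jetU d (k + 2) Y J - y Y * nTen d (k + 2) Y J with hR
  have hRon : On (k + 2) R := On.jetU_sub h
  have hj : jetU d (k + 2) = fun Y J => y Y * nTen d (k + 2) Y J + R Y J := by
    funext Y J; simp [hR]
  set R' : UF d k := fun Y I => ∑ a, ∑ b, Y.X.H a b *
      R Y ((Fin.cons a (Fin.cons b I) : Fin (k + 2) → Fin d) ∘ ε) with hR'
  have hR'on : On (k + 2) R' := hRon.contract_comp ε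
  have e1 : ncons (jetU d (k + 2)) = fun Y I => y Y * thetaU Y ^ (k + 2) + ncons R Y I := by
    rw [hj, ncons_add, ncons_smul]
    funext Y I
    change y Y * ncons (nTen d (k + 2)) Y I + ncons R Y I = _
    rw [ncons_nTen]
  have e2 : ncons (fun Y (I : Fin k → Fin d) => ∑ a, ∑ b, Y.X.H a b * jetU d (k + 2) Y
      ((Fin.cons a (Fin.cons b I) : Fin (k + 2) → Fin d) ∘ ε))
      = fun Y I => y Y * thetaU Y ^ k + ncons R' Y I := by
    have : (fun Y (I : Fin k → Fin d) => ∑ a, ∑ b, Y.X.H a b * jetU d (k + 2) Y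
      ((Fin.cons a (Fin.cons b I) : Fin (k + 2) → Fin d) ∘ ε))
      = fun Y I => y Y * nTen d k Y I + R' Y I := by
      funext Y I
      rw [← contract_nTen, hR', Finset.mul_sum, ← Finset.sum_add_distrib]
      refine Finset.sum_congr rfl fun a _ => ?_
      rw [Finset.mul_sum, ← Finset.sum_add_distrib]
      refine Finset.sum_congr rfl fun b _ => ?_
      have hJ : jetU d (k + 2) Y ((Fin.cons a (Fin.cons b I) : Fin (k + 2) → Fin d) ∘ ε)
          = y Y * nTen d (k + 2) Y (Fin.cons a (Fin.cons b I))
            + R Y ((Fin.cons a (Fin.cons b I) : Fin (k + 2) → Fin d) ∘ ε) := by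
        rw [← nTen_comp (k + 2) Y _ ε]
        exact congrFun (congrFun hj Y) _
      refine (congrArg (Y.X.H a b * ·) hJ).trans ?_
      ring
    rw [this, ncons_add, ncons_smul]
    funext Y I
    change y Y * ncons (nTen d k) Y I + ncons R' Y I = _
    rw [ncons_nTen]
  have hN := ((hRon.ncons.smul 2).sub (hR'on.ncons.smul (2 / d * (k + 1)))).add (hE.on_of_jet h)
  refine ⟨_, hN, fun Y I => ?_⟩
  rw [heq, e1, e2]
  have k1 := pow_sub_one_mem (thetaU_sub_one_mem Y) (k + 2)
  have k2 := pow_sub_one_mem (thetaU_sub_one_mem Y) k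
  have k3 := gr_sub_one_mem Y
  have k4 : Y.X.gr Y.s Y.s * (y Y * thetaU Y ^ k + ncons R' Y I) - (y Y + ncons R' Y I) ∈ Y.I := by
    have := Y.I.add_mem (Y.I.mul_mem_left (y Y * thetaU Y ^ k + ncons R' Y I) k3)
      (Y.I.mul_mem_left (y Y) k2)
    convert this using 1; ring
  have := Y.I.add_mem (Y.I.sub_mem (Y.I.mul_mem_left (2 * y Y) k1)
    (Y.I.mul_mem_left (algebraMap ℝ Y.A (2 / d) * ((k : Y.A) + 1)) k4))
    (Y.I.mul_mem_right (W Y I) Y.s_mem)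
  convert this using 1
  simp only [uU, map_sub, map_mul, map_add, map_natCast, map_one, map_ofNat]
  ring

/-- Fewer than `d` derivatives of `1 + s^d B` always leave a factor `s`. -/
lemma nab_iter_yamU_mem {k : ℕ} (hk : k + 1 < d) (Y : Geom d) (I : Fin 0 → Fin d) :
    nab^[k + 1] (yamU d) Y I ∈ Y.I := by
  obtain ⟨j, rfl⟩ : ∃ j, d = (j + 1) + (k + 1) := ⟨d - k - 2, by omega⟩
  rw [nab_iter_apply, yamU, Y.eqn, gr_iter_add, gr_iter_one, zero_add]
  obtain ⟨c, -, h⟩ := gr_iter_pow_mul (d := j + 1 + (k + 1)) (k + 1) (j + 1)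
  obtain ⟨q, hq⟩ := h Y Y.B
  rw [hq, pow_succ, mul_assoc]
  exact Y.I.mul_mem_left _ (Y.I.mul_mem_right _ Y.s_mem)

/-- Strong induction on the order. Up to order `d` the coefficient `2(d-k-1)/d` of the normal
component is nonzero while the differentiated equation vanishes along the hypersurface, so this
component can be solved for. -/
theorem On.jetU : ∀ j, j ≤ d → On j (jetU d j) := by
  intro j
  induction j using Nat.strong_induction_on with
  | _ j ih =>
    intro hj
    match j, ih, hj with
    | 0, _, _ => exact On.jet_zero 0
    | 1, _, _ => exact On.jet_one 1
    | k + 2, ih, hj =>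
      have h : ∀ j, j < k + 2 → On j (HypersurfaceInvariants.jetU d j) :=
        fun j hj' => ih j hj' (by omega)
      obtain ⟨N, hN, hmod⟩ := nab_iter_yamU_mod h
      have hc : (2 - 2 / (d : ℝ) * (k + 1)) ≠ 0 := by
        have hd : (0 : ℝ) < d := by exact_mod_cast (by omega : 0 < d)
        have : (k : ℝ) + 1 < d := by exact_mod_cast (by omega : k + 1 < d)
        have : 2 - 2 / (d : ℝ) * (k + 1) = 2 / d * (d - (k + 1)) := by field_simp
        rw [this]
        have : (0 : ℝ) < d - (k + 1) := by linarith
        positivity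
      set c := 2 - 2 / (d : ℝ) * (k + 1)
      have hy : On (k + 2) (normalJet d (k + 2)) := by
        refine (hN.smul (-c⁻¹)).congr fun Y I => ?_
        have h1 := Y.I.sub_mem (nab_iter_yamU_mem (k := k) (by omega) Y I) (hmod Y I)
        have h2 := Y.I.mul_mem_left (algebraMap ℝ Y.A c⁻¹) h1
        convert h2 using 1
        have hcc : algebraMap ℝ Y.A c⁻¹ * algebraMap ℝ Y.A c = 1 := by
          rw [← map_mul, inv_mul_cancel₀ hc, map_one]
        have hI : normalJet d (k + 2) Y I = normalJet d (k + 2) Y Fin.elim0 := rfl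
        rw [hI, map_neg]
        linear_combination (-normalJet d (k + 2) Y Fin.elim0) * hcc
      have hm := On.of_self ((Gen.atom (At := On (k + 2)) _ hy).scalar_mul
        (Gen.nTen (Gen.atom _ On.normal) (k + 2)))
      have := (On.jetU_sub h).add hm
      simpa using this

/-- The obstruction is a hypersurface expression. -/
theorem On.obstruction (hd : 2 ≤ d) : On (d + 1) (k := 0) (fun Y : Geom d => fun _ => Y.B) := by
  obtain ⟨m, rfl⟩ : ∃ m, d = m + 1 := ⟨d - 1, by omega⟩
  obtain ⟨N, hN, hmod⟩ := nab_iter_yamU_mod (d := m + 1) (k := m)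
    fun j hj => On.jetU j (by omega)
  obtain ⟨c, hc, h⟩ := gr_iter_pow_mul (d := m + 1) (m + 1) 0
  have hc' : (c : ℝ) ≠ 0 := by exact_mod_cast hc.ne'
  refine (hN.smul ((c : ℝ)⁻¹)).congr fun Y I => ?_
  have h1 := hmod Y I
  obtain ⟨q, hq⟩ := h Y Y.B
  rw [zero_add] at hq
  rw [nab_iter_apply, yamU, Y.eqn, gr_iter_add, gr_iter_one, zero_add, hq] at h1
  -- The critical order `k + 1 = d`: the jet of order `d + 1`, which the equation does not
  -- determine, disappears, and what is left is a positive multiple of `B` equal to known terms.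
  have h0 : (2 - 2 / ((m + 1 : ℕ) : ℝ) * (m + 1)) = 0 := by
    have : ((m : ℝ) + 1) ≠ 0 := by positivity
    push_cast; field_simp; ring
  rw [h0, map_zero, zero_mul, zero_add, pow_zero, one_mul] at h1
  have h2 := Y.I.mul_mem_left (algebraMap ℝ Y.A (c : ℝ)⁻¹) (Y.I.sub_mem h1
    (Y.I.add_mem (Y.I.mul_mem_left (c * Y.B) (pow_sub_one_mem (gr_sub_one_mem Y) (m + 1)))
      (Y.I.mul_mem_right q Y.s_mem)))
  convert h2 using 1
  have hcc : algebraMap ℝ Y.A (c : ℝ)⁻¹ * (c : Y.A) = 1 := by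
    rw [← map_natCast (algebraMap ℝ Y.A), ← map_mul, inv_mul_cancel₀ hc', map_one]
  linear_combination (-Y.B) * hcc

/-- Generated fields are values of expressions. -/
lemma Gen.exists_hypExpr {w k : ℕ} (hw : 3 ≤ w) {T : UF d k} (hT : Gen (HypAt w) T) :
    ∃ e : HypExpr k, e.OrderLE (w - 2) (w - 3) ∧ ∀ Y I, T Y I = e.ev Y.X (nU d Y) I := by
  induction hT with
  | atom T hT =>
    cases hT with
    | normal => exact ⟨.conormal, trivial, fun _ _ => rfl⟩
    | sff l hl => exact ⟨.secondFF l, (by omega : l ≤ w - 2), fun _ _ => rfl⟩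
    | riem l hl => exact ⟨.curvature l, (by omega : l ≤ w - 3), fun _ _ => rfl⟩
  | const c => exact ⟨.const c, trivial, fun _ _ => rfl⟩
  | metric => exact ⟨.metric, trivial, fun _ _ => rfl⟩
  | add T T' _ _ h1 h2 =>
    obtain ⟨e, o, he⟩ := h1
    obtain ⟨e', o', he'⟩ := h2
    exact ⟨.add e e', ⟨o, o'⟩, fun Y I => congrArg₂ (· + ·) (he Y I) (he' Y I)⟩
  | mul T T' _ _ h1 h2 =>
    obtain ⟨e, o, he⟩ := h1
    obtain ⟨e', o', he'⟩ := h2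
    exact ⟨.mul e e', ⟨o, o'⟩, fun Y I => congrArg₂ (· * ·) (he Y _) (he' Y _)⟩
  | permute p T _ h1 =>
    obtain ⟨e, o, he⟩ := h1
    exact ⟨.permute p e, o, fun Y I => he Y _⟩
  | contract T _ h1 =>
    obtain ⟨e, o, he⟩ := h1
    exact ⟨.contract e, o, fun Y I => by simp only [he]; rfl⟩

/-- The bounds come from weight `d + 1`: `ℓ + 2 ≤ d + 1` for `∇̄^ℓ II` and `k + 3 ≤ d + 1` for `∇^k
R`. -/
theorem exists_hypExpr_obstruction (hd : 2 ≤ d) : ∃ e : HypExpr 0,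
    e.OrderLE (d - 1) (d - 2) ∧ ∀ Y : Geom d, Y.B - e.ev Y.X (nU d Y) Fin.elim0 ∈ Y.I := by
  obtain ⟨T, hT, h⟩ := On.obstruction hd
  obtain ⟨e, o, he⟩ := hT.exists_hypExpr (by omega)
  exact ⟨e, o, fun Y => by rw [← he]; exact h Y _⟩

/-! ### Expressions for congruent conormals -/

lemma prod_sub_prod_mem {A : Type*} [CommRing A] {I : Ideal A} {ι : Type*} (S : Finset ι) {f g : ι → A} (h : ∀ i, f i - g i ∈ I) :
    ∏ i ∈ S, f i - ∏ i ∈ S, g i ∈ I := by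
  classical
  induction S using Finset.induction_on with
  | empty => simp
  | insert i S hi ih =>
    rw [Finset.prod_insert hi, Finset.prod_insert hi]
    have := I.add_mem (I.mul_mem_left (f i) ih) (I.mul_mem_right (∏ i ∈ S, g i) (h i))
    convert this using 1; ring

section Congruence

variable {A : Type*} [CommRing A] [Algebra ℝ A] (X : MetricAlg d A) {n n' : (Fin 1 → Fin d) → A}
  {I : Ideal A}

lemma tang_sub_mem (hn : ∀ J, n J - n' J ∈ I) (a b : Fin d) :
    X.tang n a b - X.tang n' a b ∈ I := by
  simp only [MetricAlg.tang]
  have h1 : ∑ c, X.H b c * n (fun _ => c) - ∑ c, X.H b c * n' (fun _ => c) ∈ I := by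
    rw [← Finset.sum_sub_distrib]
    refine I.sum_mem fun c _ => ?_
    rw [← mul_sub]
    exact I.mul_mem_left _ (hn _)
  have h2 := I.add_mem (I.mul_mem_left (-n (fun _ => a)) h1)
    (I.mul_mem_right (-∑ c, X.H b c * n' (fun _ => c)) (hn fun _ => a))
  convert h2 using 1; ring

/-- A matrix applied to the first slot of a derivative, when the derivatives in its directions
preserve the ideal. -/
lemma sum_cd_mem {M : Fin d → Fin d → A} (hM : ∀ f ∈ I, ∀ a, ∑ b, M a b * X.D b f ∈ I) {k : ℕ}
    {T : (Fin k → Fin d) → A} (hT : ∀ J, T J ∈ I) (a : Fin d) (J : Fin k → Fin d) :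
    ∑ c, M a c * X.cd c T J ∈ I := by
  simp only [MetricAlg.cd, mul_sub, Finset.sum_sub_distrib]
  refine I.sub_mem (hM _ (hT J) a) (I.sum_mem fun c _ => I.mul_mem_left _ ?_)
  exact I.sum_mem fun j _ => I.sum_mem fun e _ => I.mul_mem_left _ (hT _)

variable (hn : ∀ J, n J - n' J ∈ I)
  (ht : ∀ f ∈ I, ∀ a, ∑ b, X.tang n a b * X.D b f ∈ I)
include hn ht

/-- Two conormals that agree along the hypersurface have the same tangential derivatives there. This
allows passing from the conormal of the solution to that of the given defining function. -/
lemma sff_sub_mem (J : Fin 2 → Fin d) : X.sff n J - X.sff n' J ∈ I := by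
  have h1 := sum_cd_mem X ht (T := fun J => n J - n' J) hn (J 0) (fun _ => J 1)
  have h2 : ∑ c, (X.tang n (J 0) c - X.tang n' (J 0) c) * X.cd c n' (fun _ => J 1) ∈ I :=
    I.sum_mem fun c _ => I.mul_mem_right _ (tang_sub_mem X hn _ _)
  have h3 := I.add_mem h1 h2
  convert h3 using 1
  simp only [X.cd_sub, ← Finset.sum_add_distrib, MetricAlg.sff, ← Finset.sum_sub_distrib]
  refine Finset.sum_congr rfl fun c _ => ?_
  have e : ∀ m : (Fin 1 → Fin d) → A, X.cov m ![c, J 1] = X.cd c m (fun _ => J 1) := by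
    intro m
    rw [MetricAlg.cov]
    congr 1
    funext i; fin_cases i; rfl
  rw [e, e]; ring

lemma hyp_sub_mem {k : ℕ} {T T' : (Fin k → Fin d) → A} (hT : ∀ J, T J - T' J ∈ I)
    (J : Fin (k + 1) → Fin d) : X.hyp n T J - X.hyp n' T' J ∈ I := by
  -- Only the projection in the derivative slot matters: it makes the derivative of a field
  -- vanishing along the hypersurface vanish there. The other projections are mere coefficients.
  have h1 : ∑ K : Fin (k + 1) → Fin d, (∏ j, X.tang n (J j) (K j)) *
      X.cov (fun J => T J - T' J) K ∈ I := by
    have := fun K : Fin k → Fin d => sum_cd_mem X ht (T := fun J => T J - T' J) hT (J 0) K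
    have e : ∑ K : Fin (k + 1) → Fin d, (∏ j, X.tang n (J j) (K j)) *
        X.cov (fun J => T J - T' J) K = ∑ K : Fin k → Fin d, (∏ j, X.tang n (J j.succ) (K j)) *
        ∑ c, X.tang n (J 0) c * X.cd c (fun J => T J - T' J) K := by
      rw [← (Fin.consEquiv fun _ => Fin d).sum_comp, Fintype.sum_prod_type, Finset.sum_comm]
      refine Finset.sum_congr rfl fun K _ => ?_
      rw [Finset.mul_sum]
      refine Finset.sum_congr rfl fun c _ => ?_
      have hc : X.cov (fun J => T J - T' J) ((Fin.consEquiv fun _ => Fin d) (c, K))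
          = X.cd c (fun J => T J - T' J) K := X.cov_cons _ _ _
      rw [hc]
      simp only [Fin.consEquiv_apply, Fin.prod_univ_succ, Fin.cons_zero, Fin.cons_succ]
      ring
    rw [e]
    exact I.sum_mem fun K _ => I.mul_mem_left _ (this K)
  have h2 : ∑ K : Fin (k + 1) → Fin d, (∏ j, X.tang n (J j) (K j) - ∏ j, X.tang n' (J j) (K j))
      * X.cov T' K ∈ I :=
    I.sum_mem fun K _ => I.mul_mem_right _ (prod_sub_prod_mem _ fun j => tang_sub_mem X hn _ _)
  have h3 := I.add_mem h1 h2
  convert h3 using 1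
  simp only [MetricAlg.cov, X.cd_sub, ← Finset.sum_add_distrib, MetricAlg.hyp,
    ← Finset.sum_sub_distrib]
  exact Finset.sum_congr rfl fun K _ => by ring

lemma sffDeriv_sub_mem (l : ℕ) (J : Fin (2 + l) → Fin d) :
    X.sffDeriv n l J - X.sffDeriv n' l J ∈ I := by
  induction l with
  | zero => exact sff_sub_mem X hn ht J
  | succ l ih => exact hyp_sub_mem X hn ht ih J

/-- Along the hypersurface the value of an expression depends on the conormal only there. -/
lemma ev_sub_mem {k : ℕ} (e : HypExpr k) (J : Fin k → Fin d) : e.ev X n J - e.ev X n' J ∈ I := by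
  induction e with
  | const c => simp [HypExpr.ev]
  | metric => simp [HypExpr.ev]
  | conormal => exact hn J
  | secondFF l => exact sffDeriv_sub_mem X hn ht l J
  | curvature k => simp [HypExpr.ev]
  | add e f h1 h2 =>
    have := I.add_mem (h1 J) (h2 J)
    convert this using 1
    simp only [HypExpr.ev]; ring
  | mul e f h1 h2 =>
    have := I.add_mem (I.mul_mem_left (e.ev X n fun i => J (Fin.castAdd _ i))
      (h2 fun j => J (Fin.natAdd _ j)))
      (I.mul_mem_right (f.ev X n' fun j => J (Fin.natAdd _ j)) (h1 fun i => J (Fin.castAdd _ i)))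
    convert this using 1
    simp only [HypExpr.ev]; ring
  | permute p e h => exact h _
  | contract e h =>
    simp only [HypExpr.ev, ← Finset.sum_sub_distrib, ← mul_sub]
    exact I.sum_mem fun a _ => I.sum_mem fun b _ => I.mul_mem_left _ (h _)

end Congruence

end

end HypersurfaceInvariants

namespace HypersurfaceInvariants

noncomputable section

/-! ## Coordinate patches -/

variable {d : ℕ}

/-- The smooth functions on an open set of `ℝ^d`. -/
def SmAlg (U : TopologicalSpace.Opens (Model d)) : Subalgebra ℝ (U → ℝ) where
  carrier := {f | ∃ F : Model d → ℝ, ContDiffOn ℝ ∞ F U ∧ ∀ y : U, F y = f y}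
  mul_mem' := by
    rintro f g ⟨F, hF, eF⟩ ⟨K, hK, eK⟩
    exact ⟨fun y => F y * K y, hF.mul hK, fun y => by simp [eF, eK]⟩
  add_mem' := by
    rintro f g ⟨F, hF, eF⟩ ⟨K, hK, eK⟩
    exact ⟨fun y => F y + K y, hF.add hK, fun y => by simp [eF, eK]⟩
  algebraMap_mem' := fun r => ⟨fun _ => r, contDiffOn_const, fun _ => rfl⟩

namespace SmAlg

variable {U : TopologicalSpace.Opens (Model d)}

/-- The element given by a function on `ℝ^d`. -/
def mk (F : Model d → ℝ) (hF : ContDiffOn ℝ ∞ F (U : Set (Model d))) : SmAlg U := ⟨fun y => F y, F, hF, fun _ => rfl⟩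

/-- An extension to `ℝ^d`. -/
def rep (f : SmAlg U) : Model d → ℝ := f.2.choose

lemma contDiffOn_rep (f : SmAlg U) : ContDiffOn ℝ ∞ (rep f) U := f.2.choose_spec.1

/-- The function on `ℝ^d` restricts to the given element. -/
def Reps (F : Model d → ℝ) (f : SmAlg U) : Prop := ∀ y : U, F y = f.1 y

lemma reps_rep (f : SmAlg U) : Reps (rep f) f := f.2.choose_spec.2

lemma reps_mk (F : Model d → ℝ) (hF : ContDiffOn ℝ ∞ F (U : Set (Model d))) : Reps F (mk F hF) := fun _ => rfl

lemma Reps.eqOn {F F' : Model d → ℝ} {f : SmAlg U} (h : Reps F f) (h' : Reps F' f) :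
    Set.EqOn F F' U := fun y hy => (h ⟨y, hy⟩).trans (h' ⟨y, hy⟩).symm

lemma Reps.contDiffOn {F : Model d → ℝ} {f : SmAlg U} (h : Reps F f) : ContDiffOn ℝ ∞ F U :=
  (contDiffOn_rep f).congr (h.eqOn (reps_rep f))

lemma Reps.unique {F : Model d → ℝ} {f f' : SmAlg U} (h : Reps F f) (h' : Reps F f') : f = f' :=
  Subtype.ext (funext fun y => (h y).symm.trans (h' y))

lemma Reps.add {F F' : Model d → ℝ} {f f' : SmAlg U} (h : Reps F f) (h' : Reps F' f') :
    Reps (fun y => F y + F' y) (f + f') := fun y => by simp [h y, h' y]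

lemma Reps.sub {F F' : Model d → ℝ} {f f' : SmAlg U} (h : Reps F f) (h' : Reps F' f') :
    Reps (fun y => F y - F' y) (f - f') := fun y => by simp [h y, h' y]

lemma Reps.mul {F F' : Model d → ℝ} {f f' : SmAlg U} (h : Reps F f) (h' : Reps F' f') :
    Reps (fun y => F y * F' y) (f * f') := fun y => by simp [h y, h' y]

lemma reps_const (c : ℝ) : Reps (U := U) (fun _ => c) (algebraMap ℝ (SmAlg U) c) := fun _ => rfl

lemma Reps.sum {ι : Type*} {S : Finset ι} {F : ι → Model d → ℝ} {f : ι → SmAlg U}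
    (h : ∀ i ∈ S, Reps (F i) (f i)) : Reps (fun y => ∑ i ∈ S, F i y) (∑ i ∈ S, f i) := by
  intro y
  rw [AddSubmonoidClass.coe_finsetSum, Finset.sum_apply]
  exact Finset.sum_congr rfl fun i hi => h i hi y

lemma Reps.prod {ι : Type*} {S : Finset ι} {F : ι → Model d → ℝ} {f : ι → SmAlg U}
    (h : ∀ i ∈ S, Reps (F i) (f i)) : Reps (fun y => ∏ i ∈ S, F i y) (∏ i ∈ S, f i) := by
  intro y
  rw [SubmonoidClass.coe_finsetProd, Finset.prod_apply]
  exact Finset.prod_congr rfl fun i hi => h i hi y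

lemma Reps.pow {F : Model d → ℝ} {f : SmAlg U} (h : Reps F f) (k : ℕ) :
    Reps (fun y => F y ^ k) (f ^ k) := fun y => by simp [h y]

end SmAlg

open SmAlg

lemma contDiffOn_partialDeriv {U : Set (Model d)} (hU : IsOpen U) {F : Model d → ℝ}
    (hF : ContDiffOn ℝ ∞ F U) (a : Fin d) : ContDiffOn ℝ ∞ (partialDeriv a F) U :=
  (hF.fderiv_of_isOpen hU (by simp)).clm_apply contDiffOn_const

lemma partialDeriv_congr {U : Set (Model d)} (hU : IsOpen U) {F F' : Model d → ℝ}
    (h : Set.EqOn F F' U) (a : Fin d) : Set.EqOn (partialDeriv a F) (partialDeriv a F') U := by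
  intro y hy
  have : F =ᶠ[nhds y] F' := Filter.eventuallyEq_of_mem (hU.mem_nhds hy) h
  rw [partialDeriv, partialDeriv, this.fderiv_eq]

lemma differentiableAt_of_contDiffOn {U : Set (Model d)} (hU : IsOpen U) {F : Model d → ℝ}
    (hF : ContDiffOn ℝ ∞ F U) {y : Model d} (hy : y ∈ U) : DifferentiableAt ℝ F y :=
  (hF.contDiffAt (hU.mem_nhds hy)).differentiableAt (by simp)

lemma partialDeriv_add {F K : Model d → ℝ} {y : Model d} (hF : DifferentiableAt ℝ F y)
    (hK : DifferentiableAt ℝ K y) (a : Fin d) :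
    partialDeriv a (fun z => F z + K z) y = partialDeriv a F y + partialDeriv a K y := by
  simp [partialDeriv, fderiv_fun_add hF hK]

lemma partialDeriv_mul {F K : Model d → ℝ} {y : Model d} (hF : DifferentiableAt ℝ F y)
    (hK : DifferentiableAt ℝ K y) (a : Fin d) : partialDeriv a (fun z => F z * K z) y
      = F y * partialDeriv a K y + K y * partialDeriv a F y := by
  simp [partialDeriv, fderiv_fun_mul hF hK]

lemma partialDeriv_comm {U : Set (Model d)} (hU : IsOpen U) {F : Model d → ℝ}
    (hF : ContDiffOn ℝ ∞ F U) (a b : Fin d) {y : Model d} (hy : y ∈ U) :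
    partialDeriv a (partialDeriv b F) y = partialDeriv b (partialDeriv a F) y := by
  have h1 := hF.contDiffAt (hU.mem_nhds hy)
  have h2 : IsSymmSndFDerivAt ℝ F y := h1.isSymmSndFDerivAt (by
    simp only [minSmoothness_of_isRCLikeNormedField]; exact WithTop.coe_le_coe.mpr le_top)
  have h3 : DifferentiableAt ℝ (fderiv ℝ F) y :=
    (h1.fderiv_right (m := 1) (by norm_cast)).differentiableAt one_ne_zero
  have h4 : ∀ a b : Fin d, partialDeriv a (partialDeriv b F) y
      = fderiv ℝ (fderiv ℝ F) y (EuclideanSpace.single a 1) (EuclideanSpace.single b 1) := by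
    intro a b
    change fderiv ℝ (fun z => fderiv ℝ F z (EuclideanSpace.single b 1)) y _ = _
    rw [fderiv_clm_apply h3 (differentiableAt_const _)]
    simp
  rw [h4, h4, h2]

variable {U : TopologicalSpace.Opens (Model d)}

/-- The coordinate derivative on the algebra of smooth functions. -/
def dAlg (a : Fin d) : Derivation ℝ (SmAlg U) (SmAlg U) :=
  Derivation.mk'
    -- The derivative is taken of a chosen extension; on an open set it does not depend on the
    -- choice, by `partialDeriv_congr`.
    { toFun := fun f => SmAlg.mk (partialDeriv a (rep f)) (contDiffOn_partialDeriv U.2 (contDiffOn_rep f) a)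
      map_add' := fun f g => by
        apply Subtype.ext; funext y
        have h := partialDeriv_congr U.2 ((reps_rep (f + g)).eqOn ((reps_rep f).add (reps_rep g))) a y.2
        exact h.trans (partialDeriv_add (differentiableAt_of_contDiffOn U.2 (contDiffOn_rep f) y.2)
          (differentiableAt_of_contDiffOn U.2 (contDiffOn_rep g) y.2) a)
      map_smul' := fun c f => by
        apply Subtype.ext; funext y
        have hc : Set.EqOn (rep (c • f)) (fun z => c * rep f z) U :=
          (reps_rep (c • f)).eqOn fun y => by
            change c * (rep f) y = c * f.1 y
            rw [(reps_rep f) y]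
        have h := partialDeriv_congr U.2 hc a y.2
        refine h.trans ((partialDeriv_mul (differentiableAt_const c)
          (differentiableAt_of_contDiffOn U.2 (contDiffOn_rep f) y.2) a).trans ?_)
        simp [partialDeriv]
        exact Or.inl rfl }
    fun f g => by
      apply Subtype.ext; funext y
      have h := partialDeriv_congr U.2 ((reps_rep (f * g)).eqOn ((reps_rep f).mul (reps_rep g))) a y.2
      refine h.trans ((partialDeriv_mul (differentiableAt_of_contDiffOn U.2 (contDiffOn_rep f) y.2)
        (differentiableAt_of_contDiffOn U.2 (contDiffOn_rep g) y.2) a).trans ?_)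
      rw [(reps_rep f) y, (reps_rep g) y]
      rfl

lemma SmAlg.Reps.deriv {F : Model d → ℝ} {f : SmAlg U} (h : Reps F f) (a : Fin d) :
    Reps (partialDeriv a F) (dAlg a f) := fun y =>
  partialDeriv_congr U.2 (h.eqOn (reps_rep f)) a y.2

/-- A smooth Riemannian metric on an open set of `ℝ^d`. -/
structure SmoothMetricOn (U : Set (Model d)) (G : MatrixField d) : Prop where
  smooth : ∀ a b, ContDiffOn ℝ ∞ (fun z => G z a b) U
  posDef : ∀ y ∈ U, (G y).PosDef

namespace SmoothMetricOn

lemma mono {U V : Set (Model d)} {G : MatrixField d} (h : SmoothMetricOn U G) (hVU : V ⊆ U) :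
    SmoothMetricOn V G := ⟨fun a b => (h.smooth a b).mono hVU, fun y hy => h.posDef y (hVU hy)⟩

lemma symm {U : Set (Model d)} {G : MatrixField d} (h : SmoothMetricOn U G) {y : Model d}
    (hy : y ∈ U) (a b : Fin d) : G y a b = G y b a := by
  have := (h.posDef y hy).isHermitian.apply a b
  simpa using this.symm

lemma det_ne {U : Set (Model d)} {G : MatrixField d} (h : SmoothMetricOn U G) {y : Model d}
    (hy : y ∈ U) : (G y).det ≠ 0 :=
  ((Matrix.isUnit_iff_isUnit_det _).mp (h.posDef y hy).isUnit).ne_zero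

end SmoothMetricOn

lemma contDiffOn_det {E : Type*} [NormedAddCommGroup E] [NormedSpace ℝ E] {U : Set E}
    {M : E → Matrix (Fin d) (Fin d) ℝ} (h : ∀ a b, ContDiffOn ℝ ∞ (fun z => M z a b) U) :
    ContDiffOn ℝ ∞ (fun z => (M z).det) U := by
  simp only [Matrix.det_apply']
  exact ContDiffOn.sum fun p _ => contDiffOn_const.mul (contDiffOn_prod fun i _ => h _ _)

lemma contDiffOn_adjugate {E : Type*} [NormedAddCommGroup E] [NormedSpace ℝ E] {U : Set E}
    {M : E → Matrix (Fin d) (Fin d) ℝ} (h : ∀ a b, ContDiffOn ℝ ∞ (fun z => M z a b) U)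
    (a b : Fin d) : ContDiffOn ℝ ∞ (fun z => (M z).adjugate a b) U := by
  simp only [Matrix.adjugate_apply]
  refine contDiffOn_det fun i j => ?_
  by_cases hi : i = b
  · subst hi
    simp only [Matrix.updateRow_self]
    exact contDiffOn_const
  · simp only [Matrix.updateRow_ne hi]
    exact h i j

lemma inv_apply_eq (M : Matrix (Fin d) (Fin d) ℝ) (a b : Fin d) :
    M⁻¹ a b = M.det⁻¹ * M.adjugate a b := by
  rw [Matrix.inv_def, Matrix.smul_apply, Ring.inverse_eq_inv', smul_eq_mul]

lemma SmoothMetricOn.contDiffOn_inverse {U : Set (Model d)} {G : MatrixField d}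
    (h : SmoothMetricOn U G) (a b : Fin d) :
    ContDiffOn ℝ ∞ (fun z => inverseMetric G z a b) U := by
  simp only [inverseMetric, inv_apply_eq]
  exact ((contDiffOn_det h.smooth).inv fun y hy => h.det_ne hy).mul (contDiffOn_adjugate h.smooth a b)

/-- A metric on a patch as a metric over the algebra of smooth functions. -/
def metricAlg (G : MatrixField d) (h : SmoothMetricOn (U : Set (Model d)) G) :
    MetricAlg d (SmAlg U) where
  D := dAlg
  comm a b f := by
    apply Subtype.ext; funext y
    rw [← ((reps_rep f).deriv b).deriv a y, ← ((reps_rep f).deriv a).deriv b y]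
    exact partialDeriv_comm U.2 (contDiffOn_rep f) a b y.2
  G := Matrix.of fun a b => SmAlg.mk _ (h.smooth a b)
  H := Matrix.of fun a b => SmAlg.mk _ (h.contDiffOn_inverse a b)
  symm a b := Subtype.ext (funext fun y => h.symm y.2 a b)
  mul_inv := by
    refine Matrix.ext fun a b => ?_
    rw [Matrix.mul_apply]
    apply (Reps.sum fun c _ => (reps_mk _ (h.smooth a c)).mul
      (reps_mk _ (h.contDiffOn_inverse c b))).unique
    intro y
    change ∑ c, G y a c * inverseMetric G y c b = _
    rw [← Matrix.mul_apply, inverseMetric, Matrix.mul_nonsing_inv _ (h.det_ne y.2).isUnit]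
    by_cases hab : a = b
    · subst hab; simp
    · simp [Matrix.one_apply_ne hab]

/-! ### Coordinate tensor calculus as calculus over the algebra of smooth functions on a patch -/

section Transfer

variable {G : MatrixField d} (h : SmoothMetricOn (U : Set (Model d)) G)

lemma reps_G (a b : Fin d) : Reps (fun y => G y a b) ((metricAlg G h).G a b) :=
  reps_mk _ (h.smooth a b)

lemma reps_H (a b : Fin d) : Reps (fun y => inverseMetric G y a b) ((metricAlg G h).H a b) :=
  reps_mk _ (h.contDiffOn_inverse a b)

lemma reps_D {F : Model d → ℝ} {f : SmAlg U} (hf : Reps F f) (a : Fin d) :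
    Reps (partialDeriv a F) ((metricAlg G h).D a f) := hf.deriv a

lemma reps_chr (c a b : Fin d) : Reps (christoffel G c a b) ((metricAlg G h).chr c a b) :=
  (reps_const _).mul (Reps.sum fun e _ => (reps_H h c e).mul
    (((reps_D h (reps_G h b e) a).add (reps_D h (reps_G h a e) b)).sub (reps_D h (reps_G h a b) e)))

lemma reps_cov {k : ℕ} {T : TensorField d k} {T' : (Fin k → Fin d) → SmAlg U}
    (hT : ∀ I, Reps (T I) (T' I)) (I : Fin (k + 1) → Fin d) :
    Reps (covDeriv G T I) ((metricAlg G h).cov T' I) :=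
  (reps_D h (hT _) _).sub (Reps.sum fun _ _ => Reps.sum fun _ _ => (reps_chr h _ _ _).mul (hT _))

lemma reps_riemUp (a b c e : Fin d) :
    Reps (riemannUp G a b c e) ((metricAlg G h).riemUp a b c e) :=
  ((reps_D h (reps_chr h _ _ _) _).sub (reps_D h (reps_chr h _ _ _) _)).add
    (Reps.sum fun _ _ => ((reps_chr h _ _ _).mul (reps_chr h _ _ _)).sub
      ((reps_chr h _ _ _).mul (reps_chr h _ _ _)))

lemma reps_riemDeriv (k : ℕ) (I : Fin (4 + k) → Fin d) :
    Reps (riemannDeriv G k I) ((metricAlg G h).riemDeriv k I) := by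
  induction k with
  | zero =>
    exact (Reps.sum fun e _ => (reps_G h (I 2) e).mul (reps_riemUp h (I 0) (I 1) e (I 3)) :
      Reps (riemann G I) ((metricAlg G h).riem I))
  | succ k ih => exact reps_cov h ih I

lemma reps_sc : Reps (scalarCurvature G) (metricAlg G h).sc :=
  Reps.sum fun _ _ => Reps.sum fun _ _ => (reps_H h _ _).mul
    (Reps.sum fun _ _ => reps_riemUp h _ _ _ _)

variable {F : Model d → ℝ} {f : SmAlg U} (hf : Reps F f)
include hf

lemma reps_lap : Reps (laplacian G F) ((metricAlg G h).lap f) :=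
  Reps.sum fun _ _ => Reps.sum fun _ _ => (reps_H h _ _).mul
    ((reps_D h (reps_D h hf _) _).sub (Reps.sum fun _ _ => (reps_chr h _ _ _).mul (reps_D h hf _)))

lemma reps_gr : Reps (gradSq G F) ((metricAlg G h).gr f f) :=
  Reps.sum fun _ _ => Reps.sum fun _ _ => ((reps_H h _ _).mul (reps_D h hf _)).mul (reps_D h hf _)

lemma reps_yam : Reps (coordS G F) ((metricAlg G h).yam f) := by
  have := (reps_gr h hf).sub (((reps_const (2 / (d : ℝ))).mul hf).mul ((reps_lap h hf).add
    (((reps_const (1 / (2 * ((d : ℝ) - 1)))).mul (reps_sc h)).mul hf)))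
  refine fun y => Eq.trans ?_ (this y)
  rw [coordS]; ring

end Transfer

section TransferHyp

variable {G : MatrixField d} (h : SmoothMetricOn (U : Set (Model d)) G) {s : Model d → ℝ}
  {n : (Fin 1 → Fin d) → SmAlg U} (hn : ∀ I, Reps (conormal G s I) (n I))
include hn

lemma reps_tang (a b : Fin d) : Reps (tangProj G s a b) ((metricAlg G h).tang n a b) := by
  refine Reps.sub ?_ ((hn _).mul (Reps.sum fun _ _ => (reps_H h _ _).mul (hn _)))
  by_cases hab : a = b
  · simp only [if_pos hab]; exact fun _ => rfl
  · simp only [if_neg hab]; exact fun _ => rfl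

lemma reps_sffDeriv (l : ℕ) (I : Fin (2 + l) → Fin d) :
    Reps (secondFFDeriv G s l I) ((metricAlg G h).sffDeriv n l I) := by
  induction l with
  | zero =>
    exact (Reps.sum fun c _ => (reps_tang h hn (I 0) c).mul (reps_cov h hn ![c, I 1]) :
      Reps (secondFF G s I) ((metricAlg G h).sff n I))
  | succ l ih =>
    exact Reps.sum fun _ _ => (Reps.prod fun _ _ => reps_tang h hn _ _).mul (reps_cov h ih _)

lemma reps_ev {k : ℕ} (e : HypExpr k) (I : Fin k → Fin d) :
    Reps (e.eval G s I) (e.ev (metricAlg G h) n I) := by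
  induction e with
  | const c => exact reps_const c
  | metric => exact reps_G h _ _
  | conormal => exact hn I
  | secondFF l => exact reps_sffDeriv h hn l I
  | curvature k => exact reps_riemDeriv h k I
  | add e f h1 h2 => exact (h1 I).add (h2 I)
  | mul e f h1 h2 => exact (h1 _).mul (h2 _)
  | permute p e h1 => exact h1 _
  | contract e h1 =>
    exact Reps.sum fun _ _ => Reps.sum fun _ _ => (reps_H h _ _).mul (h1 _)

end TransferHyp

end

end HypersurfaceInvariants

namespace HypersurfaceInvariants

noncomputable section

/-! ### The obstruction in a coordinate patch -/

open SmAlg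

variable {d : ℕ}

/-- A function that vanishes on a regular level set has differential proportional to that of the
defining function. -/
lemma exists_fderiv_eq_smul {U : Set (Model d)} (hU : IsOpen U) {f σ : Model d → ℝ}
    (hf : ContDiffOn ℝ ∞ f U) (hσ : ContDiffOn ℝ ∞ σ U) (h : ∀ z ∈ U, σ z = 0 → f z = 0)
    {y : Model d} (hy : y ∈ U) (hy0 : σ y = 0) (hd : fderiv ℝ σ y ≠ 0) :
    ∃ c : ℝ, fderiv ℝ f y = c • fderiv ℝ σ y := by
  have h1 : HasStrictFDerivAt f (fderiv ℝ f y) y :=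
    (hf.contDiffAt (hU.mem_nhds hy)).hasStrictFDerivAt (by simp)
  have h2 : HasStrictFDerivAt σ (fderiv ℝ σ y) y :=
    (hσ.contDiffAt (hU.mem_nhds hy)).hasStrictFDerivAt (by simp)
  -- Since `f` is constant on the level set, every point is a constrained extremum, and Lagrange
  -- multipliers give the proportionality without straightening the hypersurface.
  have hext : IsLocalExtrOn f {x | σ x = σ y} y := by
    refine Or.inl ?_
    have : U ∈ nhdsWithin y {x | σ x = σ y} := mem_nhdsWithin_of_mem_nhds (hU.mem_nhds hy)
    filter_upwards [this, self_mem_nhdsWithin] with z hz hz'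
    rw [h y hy hy0, h z hz (hz'.trans hy0)]
  obtain ⟨a, b, hab, he⟩ := hext.exists_multipliers_of_hasStrictFDerivAt_1d h2 h1
  have hb : b ≠ 0 := by
    rintro rfl
    rw [zero_smul, add_zero, smul_eq_zero] at he
    rcases he with rfl | he
    · exact hab rfl
    · exact hd he
  refine ⟨-(b⁻¹ * a), ?_⟩
  have h3 : b • fderiv ℝ f y = -(a • fderiv ℝ σ y) := by
    rw [eq_neg_iff_add_eq_zero, add_comm]; exact he
  calc fderiv ℝ f y = b⁻¹ • (b • fderiv ℝ f y) := by rw [smul_smul, inv_mul_cancel₀ hb, one_smul]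
    _ = _ := by rw [h3, smul_neg, smul_smul, neg_smul]

lemma contDiffOn_gradSq {U : Set (Model d)} (hU : IsOpen U) {G : MatrixField d}
    (hG : SmoothMetricOn U G) {f : Model d → ℝ} (hf : ContDiffOn ℝ ∞ f U) :
    ContDiffOn ℝ ∞ (gradSq G f) U :=
  ContDiffOn.sum fun _ _ => ContDiffOn.sum fun _ _ => ((hG.contDiffOn_inverse _ _).mul
    (contDiffOn_partialDeriv hU hf _)).mul (contDiffOn_partialDeriv hU hf _)

lemma contDiffOn_conormal {U : Set (Model d)} (hU : IsOpen U) {G : MatrixField d}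
    (hG : SmoothMetricOn U G) {f : Model d → ℝ} (hf : ContDiffOn ℝ ∞ f U)
    (hp : ∀ y ∈ U, 0 < gradSq G f y) (I : Fin 1 → Fin d) :
    ContDiffOn ℝ ∞ (conormal G f I) U :=
  (contDiffOn_partialDeriv hU hf _).div
    ((contDiffOn_gradSq hU hG hf).sqrt fun y hy => (hp y hy).ne')
    fun y hy => (Real.sqrt_pos.mpr (hp y hy)).ne'

lemma coordS_of_eq_zero {G : MatrixField d} {f : Model d → ℝ} {y : Model d} (h : f y = 0) :
    coordS G f y = gradSq G f y := by
  rw [coordS, h]; ring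

lemma gradSq_of_partialDeriv_eq {G : MatrixField d} {f f' : Model d → ℝ} {y : Model d} {r : ℝ}
    (h : ∀ a, partialDeriv a f' y = r * partialDeriv a f y) :
    gradSq G f' y = r ^ 2 * gradSq G f y := by
  simp only [gradSq, h, Finset.mul_sum]
  exact Finset.sum_congr rfl fun _ _ => Finset.sum_congr rfl fun _ _ => by ring

lemma conormal_of_partialDeriv_eq {G : MatrixField d} {f f' : Model d → ℝ} {y : Model d} {r : ℝ}
    (hr : 0 < r) (h : ∀ a, partialDeriv a f' y = r * partialDeriv a f y) (I : Fin 1 → Fin d) :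
    conormal G f' I y = conormal G f I y := by
  rw [conormal, conormal, gradSq_of_partialDeriv_eq h, h, Real.sqrt_mul (sq_nonneg r),
    Real.sqrt_sq hr.le, mul_div_mul_left _ _ hr.ne']

variable {U : TopologicalSpace.Opens (Model d)}

/-- The functions that vanish on the zero locus of `σ`. -/
def vanishingIdeal (U : TopologicalSpace.Opens (Model d)) (σ : Model d → ℝ) : Ideal (SmAlg U) where
  carrier := {f | ∀ y : U, σ y = 0 → f.1 y = 0}
  add_mem' := fun {f g} hf hg y hy => by
    change f.1 y + g.1 y = 0
    rw [hf y hy, hg y hy, add_zero]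
  zero_mem' := fun _ _ => rfl
  smul_mem' := fun c f hf y hy => by
    change c.1 y * f.1 y = 0
    rw [hf y hy, mul_zero]

lemma mem_vanishingIdeal {σ : Model d → ℝ} {F : Model d → ℝ} {f : SmAlg U} (h : Reps F f) :
    f ∈ vanishingIdeal U σ ↔ ∀ y ∈ U, σ y = 0 → F y = 0 :=
  ⟨fun hf y hy hs => (h ⟨y, hy⟩).trans (hf ⟨y, hy⟩ hs),
    fun hf y hs => (h y).symm.trans (hf y y.2 hs)⟩

lemma sum_tangProj_mul {G : MatrixField d} {s : Model d → ℝ} {y : Model d}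
    (hp : 0 < gradSq G s y) (a : Fin d) :
    ∑ b, tangProj G s a b y * partialDeriv b s y = 0 := by
  have hq := Real.sqrt_pos.mpr hp
  have hq2 := Real.sq_sqrt hp.le
  have h1 : ∑ b, (conormal G s (fun _ => a) y *
      ∑ c, inverseMetric G y b c * conormal G s (fun _ => c) y) * partialDeriv b s y
      = partialDeriv a s y / Real.sqrt (gradSq G s y) ^ 2 * ∑ b, ∑ c,
        inverseMetric G y b c * partialDeriv b s y * partialDeriv c s y := by
    simp only [conormal]
    rw [Finset.mul_sum]
    refine Finset.sum_congr rfl fun b _ => ?_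
    rw [Finset.mul_sum, Finset.mul_sum, Finset.sum_mul]
    refine Finset.sum_congr rfl fun c _ => ?_
    field_simp
  rw [hq2, ← gradSq] at h1
  simp only [tangProj, sub_mul, Finset.sum_sub_distrib, h1, ite_mul, one_mul, zero_mul,
    Finset.sum_ite_eq, Finset.mem_univ, if_true]
  field_simp
  ring

/-- The algebraic model of a solution on a patch. -/
def patchGeom (G : MatrixField d) (hG : SmoothMetricOn (U : Set (Model d)) G) (σ B : Model d → ℝ)
    (hσ : ContDiffOn ℝ ∞ σ U) (hB : ContDiffOn ℝ ∞ B U) (hd : d ≠ 0)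
    (hp : ∀ y ∈ U, 0 < gradSq G σ y) (heq : ∀ y ∈ U, coordS G σ y = 1 + σ y ^ d * B y) : Geom d where
  A := SmAlg U
  X := metricAlg G hG
  s := SmAlg.mk σ hσ
  ρ := SmAlg.mk (fun y => (Real.sqrt (gradSq G σ y))⁻¹)
    (((contDiffOn_gradSq U.2 hG hσ).sqrt fun y hy => (hp y hy).ne').inv
      fun y hy => (Real.sqrt_pos.mpr (hp y hy)).ne')
  B := SmAlg.mk B hB
  I := vanishingIdeal U σ
  rho_sq := by
    refine (((reps_mk _ _).pow 2).mul (reps_gr hG (reps_mk σ hσ))).unique fun y => ?_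
    change (Real.sqrt (gradSq G σ y))⁻¹ ^ 2 * gradSq G σ y = 1
    rw [inv_pow, Real.sq_sqrt (hp y y.2).le, inv_mul_cancel₀ (hp y y.2).ne']
  rho_mem := by
    refine (mem_vanishingIdeal ((reps_mk _ _).sub (reps_const 1))).mpr fun y hy hs => ?_
    -- Along the hypersurface the equation reduces to `|dσ|² = 1`; here `d ≠ 0` is needed to have `0
    -- ^ d = 0`.
    have h1 := heq y hy
    rw [coordS_of_eq_zero hs, hs, zero_pow hd, zero_mul, add_zero] at h1
    simp [h1]
  s_mem := by
    rw [mem_vanishingIdeal (reps_mk _ _)]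
    exact fun _ _ h => h
  tangential := by
    intro f hf a
    have hn : ∀ J : Fin 1 → Fin d, Reps (conormal G σ J) (SmAlg.mk (fun y =>
        (Real.sqrt (gradSq G σ y))⁻¹) (((contDiffOn_gradSq U.2 hG hσ).sqrt
          fun y hy => (hp y hy).ne').inv fun y hy => (Real.sqrt_pos.mpr (hp y hy)).ne')
        * (metricAlg G hG).D (J 0) (SmAlg.mk σ hσ)) := fun J y => by
      refine Eq.trans ?_ (((reps_mk _ _).mul (reps_D hG (reps_mk σ hσ) (J 0))) y)
      rw [conormal, div_eq_inv_mul]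
    refine (mem_vanishingIdeal (Reps.sum fun b _ => (reps_tang hG hn a b).mul
      (reps_D hG (reps_rep f) b))).mpr fun y hy hs => ?_
    have hd0 : fderiv ℝ σ y ≠ 0 := by
      intro h0
      have := hp y hy
      simp [gradSq, partialDeriv, h0] at this
    obtain ⟨c, hc⟩ := exists_fderiv_eq_smul U.2 (contDiffOn_rep f) hσ
      ((mem_vanishingIdeal (reps_rep f)).mp hf) hy hs hd0
    have hb : ∀ b, partialDeriv b (rep f) y = c * partialDeriv b σ y := fun b => by
      simp [partialDeriv, hc]
    simp only [hb]
    rw [← mul_zero c, ← sum_tangProj_mul (hp y hy) a, Finset.mul_sum]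
    exact Finset.sum_congr rfl fun _ _ => by ring
  eqn := (reps_yam hG (reps_mk σ hσ)).unique fun y => by
    rw [heq y y.2]; rfl

/-- The obstruction in a patch is given by a universal expression. -/
theorem exists_hypExpr_patch (hd : 2 ≤ d) : ∃ e : HypExpr 0, e.OrderLE (d - 1) (d - 2) ∧
    ∀ (U : Set (Model d)), IsOpen U → ∀ G, SmoothMetricOn U G → ∀ s σ B : Model d → ℝ,
      ContDiffOn ℝ ∞ s U → ContDiffOn ℝ ∞ σ U → ContDiffOn ℝ ∞ B U →
      (∀ y ∈ U, s y = 0 ↔ σ y = 0) →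
      (∀ y ∈ U, s y = 0 → ∃ r : ℝ, 0 < r ∧ ∀ a, partialDeriv a σ y = r * partialDeriv a s y) →
      (∀ y ∈ U, coordS G σ y = 1 + σ y ^ d * B y) →
      ∀ y ∈ U, s y = 0 → B y = e.eval G s Fin.elim0 y := by
  obtain ⟨e, he, hB⟩ := exists_hypExpr_obstruction hd
  refine ⟨e, he, fun W hW G hGW s σ B hs hσ hBs hz ho heq y hy hy0 => ?_⟩
  -- Both conormals are needed as smooth fields, so the patch is shrunk to where neither
  -- differential vanishes. The point `y` survives because `|dσ| = 1` there and `dσ` is a multiple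
  -- of `ds`.
  have hV : IsOpen {z ∈ W | 0 < gradSq G s z ∧ 0 < gradSq G σ z} := by
    have h1 := (contDiffOn_gradSq hW hGW hs).continuousOn.isOpen_inter_preimage hW (isOpen_Ioi (a := 0))
    have h2 := (contDiffOn_gradSq hW hGW hσ).continuousOn.isOpen_inter_preimage hW
      (isOpen_Ioi (a := 0))
    have h3 : {z ∈ W | 0 < gradSq G s z ∧ 0 < gradSq G σ z}
        = (W ∩ gradSq G s ⁻¹' Set.Ioi 0) ∩ (W ∩ gradSq G σ ⁻¹' Set.Ioi 0) :=
      Set.ext fun z => ⟨fun h => ⟨⟨h.1, h.2.1⟩, h.1, h.2.2⟩, fun h => ⟨h.1.1, h.1.2, h.2.2⟩⟩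
    exact h3 ▸ h1.inter h2
  set U : TopologicalSpace.Opens (Model d) := ⟨_, hV⟩ with hU
  have hUW : (U : Set (Model d)) ⊆ W := fun z hz => hz.1
  have hG := hGW.mono hUW
  have hσ1 : ∀ z ∈ W, σ z = 0 → gradSq G σ z = 1 := fun z hz h0 => by
    have h1 := heq z hz
    rwa [coordS_of_eq_zero h0, h0, zero_pow (by omega), zero_mul, add_zero] at h1
  have hyU : y ∈ U := by
    have h1 := hσ1 y hy ((hz y hy).mp hy0)
    obtain ⟨r, hr, hra⟩ := ho y hy hy0
    have h2 := gradSq_of_partialDeriv_eq (G := G) hra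
    refine ⟨hy, ?_, by rw [h1]; exact one_pos⟩
    rw [h1] at h2
    by_contra hneg
    push Not at hneg
    nlinarith [mul_nonpos_of_nonneg_of_nonpos (sq_nonneg r) hneg]
  set Y : Geom d := patchGeom G hG σ B (hσ.mono hUW) (hBs.mono hUW) (by omega)
    (fun z hz => hz.2.2) (fun z hz => heq z (hUW hz)) with hY
  set n : (Fin 1 → Fin d) → SmAlg U := nU d Y with hnn
  have hn : ∀ J : Fin 1 → Fin d, Reps (conormal G σ J) (n J) := fun J z => by
    refine Eq.trans ?_ (((reps_mk _ _).mul (reps_D hG (reps_mk σ (hσ.mono hUW)) (J 0))) z)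
    rw [conormal, div_eq_inv_mul]
  set n' : (Fin 1 → Fin d) → SmAlg U := fun J => SmAlg.mk (conormal G s J)
    (contDiffOn_conormal U.2 hG (hs.mono hUW) (fun z hz => hz.2.1) J) with hn'
  have hn's : ∀ J, Reps (conormal G s J) (n' J) := fun J => reps_mk _ _
  have h1 : SmAlg.mk B (hBs.mono hUW) - e.ev (metricAlg G hG) n Fin.elim0
    ∈ vanishingIdeal U σ := hB Y
  -- The expression was found with the conormal of `σ`; along the hypersurface it agrees with that
  -- of `s`, so `ev_sub_mem` replaces one by the other.
  have h2 := ev_sub_mem (metricAlg G hG) (n := n) (n' := n') (I := vanishingIdeal U σ)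
    (fun J => (mem_vanishingIdeal ((hn J).sub (hn's J))).mpr fun z hzU hz0 => by
      obtain ⟨r, hr, hra⟩ := ho z (hUW hzU) ((hz z (hUW hzU)).mpr hz0)
      rw [conormal_of_partialDeriv_eq hr hra, sub_self]) Y.tangential e Fin.elim0
  have h3 := (vanishingIdeal U σ).add_mem h1 h2
  have h4 : Reps (fun z => B z - e.eval G s Fin.elim0 z)
      (SmAlg.mk B (hBs.mono hUW) - e.ev (metricAlg G hG) n Fin.elim0
        + (e.ev (metricAlg G hG) n Fin.elim0 - e.ev (metricAlg G hG) n' Fin.elim0)) := by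
    rw [sub_add_sub_cancel]
    exact (reps_mk B (hBs.mono hUW)).sub (reps_ev hG hn's e Fin.elim0)
  exact sub_eq_zero.mp ((mem_vanishingIdeal h4).mp h3 y hyU ((hz y hy).mp hy0))

end

end HypersurfaceInvariants

namespace HypersurfaceInvariants

noncomputable section

/-! ## Formal solutions of the equation `S(σ) = 1` -/

/-- An `ℝ`-algebra with a carré du champ operator `gr`, a Laplacian `lap` and a potential `pot`. -/
structure LaplaceAlg (A : Type*) [CommRing A] [Algebra ℝ A] where
  gr : A → A → A
  lap : A → A
  pot : A
  gr_comm : ∀ f g, gr f g = gr g f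
  gr_add : ∀ f g k, gr f (g + k) = gr f g + gr f k
  gr_mul : ∀ f g k, gr f (g * k) = g * gr f k + k * gr f g
  gr_algebraMap : ∀ f r, gr f (algebraMap ℝ A r) = 0
  lap_add : ∀ f g, lap (f + g) = lap f + lap g
  lap_mul : ∀ f g, lap (f * g) = f * lap g + g * lap f + 2 * gr f g
  lap_algebraMap : ∀ r, lap (algebraMap ℝ A r) = 0

namespace LaplaceAlg

variable {A : Type*} [CommRing A] [Algebra ℝ A] (X : LaplaceAlg A)

/-- `S(f) = |∇f|² - (2/d) f (Δ + c) f`. -/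
def yam (d : ℕ) (f : A) : A :=
  X.gr f f - algebraMap ℝ A (2 / d) * f * (X.lap f + X.pot * f)

lemma gr_one (f : A) : X.gr f 1 = 0 := by simpa using X.gr_algebraMap f 1

lemma lap_one : X.lap 1 = 0 := by simpa using X.lap_algebraMap 1

lemma gr_pow (f g : A) (j : ℕ) : X.gr f (g ^ (j + 1)) = (j + 1) * g ^ j * X.gr f g := by
  induction j with
  | zero => simp
  | succ j ih => rw [pow_succ, X.gr_mul, ih]; push_cast; ring

/-- Multiplying by `g` avoids the exponent `j - 1`. -/
lemma mul_lap_pow (g : A) (j : ℕ) : g * X.lap (g ^ (j + 1))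
    = (j + 1) * g ^ (j + 1) * X.lap g + j * (j + 1) * g ^ j * X.gr g g := by
  induction j with
  | zero => simp
  | succ j ih =>
    have : g * X.lap (g ^ (j + 1 + 1)) = g ^ (j + 2) * X.lap g + g * (g * X.lap (g ^ (j + 1)))
        + 2 * g * X.gr g (g ^ (j + 1)) := by
      rw [pow_succ g (j + 1), X.lap_mul, X.gr_comm (g ^ (j + 1)) g]; ring
    rw [this, ih, X.gr_pow]
    push_cast
    ring

/-- The values on a function of the form `σ (1 + a + a²)`. -/
lemma yam_mul (d : ℕ) (σ m : A) : X.yam d (σ * m) = m ^ 2 * X.yam d σ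
    + algebraMap ℝ A (2 - 4 / d) * (σ * m * X.gr σ m)
    + σ ^ 2 * X.gr m m - algebraMap ℝ A (2 / d) * (m * (σ ^ 2 * X.lap m)) := by
  have e1 : X.gr (σ * m) (σ * m) = m ^ 2 * X.gr σ σ + 2 * σ * m * X.gr σ m + σ ^ 2 * X.gr m m := by
    rw [X.gr_mul, X.gr_comm (σ * m) m, X.gr_comm (σ * m) σ, X.gr_mul, X.gr_mul, X.gr_comm m σ]
    ring
  have e2 : algebraMap ℝ A (2 - 4 / d) = 2 - 2 * algebraMap ℝ A (2 / d) := by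
    rw [show (2 - 4 / d : ℝ) = 2 - 2 * (2 / d) by ring, map_sub, map_mul, map_ofNat]
  rw [yam, yam, e1, e2, X.lap_mul]
  ring

/-- With `a = σ^(j+1) C`, the factor `1 + a` changes `S` by `c C σ^(j+1)` to leading order, where `c
= (2/d)(j+2)(d-(j+1))` is nonzero in the given range; hence `C = -E/c`. The summand `a²` is of order
`2j + 2 ≥ j + 2` and does no harm, but makes `1 + a + a²` positive everywhere, so that no cut-off is
needed. -/
lemma exists_step {d : ℕ} {j : ℕ} (hj : j + 1 < d) {σ E : A}
    (h : X.yam d σ = 1 + σ ^ (j + 1) * E) :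
    ∃ a B : A, X.yam d (σ * (1 + a + a ^ 2)) = 1 + σ ^ (j + 2) * B := by
  have hd : (d : ℝ) ≠ 0 := by
    have : 0 < d := by omega
    positivity
  have hc : 2 / (d : ℝ) * (j + 2) * (d - (j + 1)) ≠ 0 := by
    have : (0 : ℝ) < d - (j + 1) := by
      have : ((j + 1 : ℕ) : ℝ) < d := by exact_mod_cast hj
      push_cast at this; linarith
    positivity
  set c : ℝ := 2 / (d : ℝ) * (j + 2) * (d - (j + 1)) with hcdef
  have hcc : 2 + (2 - 4 / d) * ((j : ℝ) + 1) - 2 / d * (j * (j + 1)) = c := by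
    rw [hcdef]; field_simp; ring
  obtain ⟨C, hC⟩ : ∃ C : A, C = -(algebraMap ℝ A c⁻¹ * E) := ⟨_, rfl⟩
  have hEC : E + 2 * C + algebraMap ℝ A (2 - 4 / d) * ((j + 1) * C)
      - algebraMap ℝ A (2 / d) * (j * (j + 1) * C) = 0 := by
    have h1 := congrArg (algebraMap ℝ A) hcc
    simp only [map_add, map_sub, map_mul, map_natCast, map_one, map_ofNat] at h1
    have h2 : algebraMap ℝ A c * algebraMap ℝ A c⁻¹ = 1 := by
      rw [← map_mul, mul_inv_cancel₀ hc, map_one]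
    simp only [map_sub, map_ofNat]
    rw [hC]
    linear_combination (-(algebraMap ℝ A c⁻¹ * E)) * h1 - E * h2
  obtain ⟨P, hP⟩ : ∃ P : A, P = σ ^ j := ⟨_, rfl⟩
  obtain ⟨Q, hQ⟩ : ∃ Q : A, Q = σ ^ (j + 1) := ⟨_, rfl⟩
  have hQP : Q = P * σ := by rw [hQ, hP, pow_succ]
  have hPQ2 : σ ^ (j + 2) = P * σ ^ 2 := by rw [hP]; ring
  have gQ : ∀ f, X.gr f Q = (j + 1) * P * X.gr f σ := fun f => by rw [hQ, hP, X.gr_pow]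
  have lQ : σ * X.lap Q = (j + 1) * Q * X.lap σ + j * (j + 1) * P * X.gr σ σ := by
    rw [hQ, hP, X.mul_lap_pow]
  obtain ⟨F, hF⟩ : ∃ F : A, X.gr σ σ = 1 + σ * F := by
    refine ⟨P * E + algebraMap ℝ A (2 / d) * (X.lap σ + X.pot * σ), ?_⟩
    rw [yam, ← hQ, hQP] at h
    linear_combination h
  obtain ⟨a, ha⟩ : ∃ a : A, a = Q * C := ⟨_, rfl⟩
  obtain ⟨m, hm⟩ : ∃ m : A, m = 1 + a + a ^ 2 := ⟨_, rfl⟩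
  have ha' : a = P * σ * C := by rw [ha, hQP]
  have gm : ∀ f, X.gr f m = (1 + 2 * a) * X.gr f a := fun f => by
    rw [hm, pow_two, X.gr_add, X.gr_add, X.gr_one, X.gr_mul]; ring
  have lm : X.lap m = (1 + 2 * a) * X.lap a + 2 * X.gr a a := by
    rw [hm, pow_two, X.lap_add, X.lap_add, X.lap_one, X.lap_mul]; ring
  have ga : ∀ f, X.gr f a = P * (σ * X.gr f C + C * ((j + 1) * X.gr f σ)) := fun f => by
    rw [ha, X.gr_mul, gQ, hQP]; ring
  have la : σ ^ 2 * X.lap a = P * σ ^ 2 * (σ * X.lap C + (j + 1) * C * X.lap σ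
      + 2 * ((j + 1) * X.gr C σ)) + j * (j + 1) * C * (P * σ * X.gr σ σ) := by
    rw [ha, X.lap_mul, X.gr_comm Q C, gQ]
    linear_combination σ * C * lQ + (σ ^ 2 * X.lap C + σ * C * (j + 1) * X.lap σ) * hQP
  have hmm : m * (1 + 2 * a) = 1 + a * (3 + 3 * a + 2 * a ^ 2) := by rw [hm]; ring
  obtain ⟨R, hR⟩ : ∃ R : A, P * σ * X.gr σ σ * (m * (1 + 2 * a)) = P * σ + P * σ ^ 2 * R := by
    refine ⟨F + (P * C) * (3 + 3 * a + 2 * a ^ 2) * (1 + σ * F), ?_⟩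
    rw [hF, hmm]
    linear_combination (P * σ * (1 + σ * F) * (3 + 3 * a + 2 * a ^ 2)) * ha'
  refine ⟨a, P * C ^ 2 * (3 + 2 * a + a ^ 2) + E * (P * C) * ((1 + a) * (2 + a + a ^ 2))
    + algebraMap ℝ A (2 - 4 / d) * (m * (1 + 2 * a) * X.gr σ C + C * (j + 1) * R)
    + (1 + 2 * a) * ((1 + 2 * a) * (σ * X.gr a C + C * ((j + 1) * X.gr a σ)))
    - algebraMap ℝ A (2 / d) * (m * ((1 + 2 * a) * (σ * X.lap C + (j + 1) * C * X.lap σ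
      + 2 * ((j + 1) * X.gr C σ)) + 2 * (σ * X.gr a C + C * ((j + 1) * X.gr a σ)))
      + j * (j + 1) * C * R), ?_⟩
  rw [← hm, X.yam_mul, h, ← hQ, hPQ2, lm, X.gr_comm m m, gm m, X.gr_comm m a, gm a, gm σ, hQP]
  have t1 : m ^ 2 * (1 + P * σ * E) = 1 + (E + 2 * C) * (P * σ) + P * σ ^ 2 *
      (P * C ^ 2 * (3 + 2 * a + a ^ 2) + E * (P * C) * ((1 + a) * (2 + a + a ^ 2))) := by
    have : m ^ 2 = 1 + 2 * a + a ^ 2 * (3 + 2 * a + a ^ 2) := by rw [hm]; ring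
    have h2 : m ^ 2 - 1 = a * ((1 + a) * (2 + a + a ^ 2)) := by rw [hm]; ring
    linear_combination this + P * σ * E * h2 + (2 + (a + P * σ * C) * (3 + 2 * a + a ^ 2)
      + P * σ * E * ((1 + a) * (2 + a + a ^ 2))) * ha'
  have t2 : σ * m * ((1 + 2 * a) * X.gr σ a) = (j + 1) * C * (P * σ)
      + P * σ ^ 2 * (m * (1 + 2 * a) * X.gr σ C + C * (j + 1) * R) := by
    rw [ga σ]
    linear_combination C * (j + 1) * hR
  have t4 : m * (σ ^ 2 * ((1 + 2 * a) * X.lap a + 2 * X.gr a a)) = j * (j + 1) * C * (P * σ)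
      + P * σ ^ 2 * (m * ((1 + 2 * a) * (σ * X.lap C + (j + 1) * C * X.lap σ
      + 2 * ((j + 1) * X.gr C σ)) + 2 * (σ * X.gr a C + C * ((j + 1) * X.gr a σ)))
      + j * (j + 1) * C * R) := by
    rw [ga a]
    linear_combination m * (1 + 2 * a) * la + j * (j + 1) * C * hR
  rw [t1, t2, t4, ga a]
  linear_combination (P * σ) * hEC

/-- Starts from `s h` with `h = (|ds|² + s²)^(-1/2)`, for which `S = 1` along the hypersurface; the
summand `s²` keeps the root defined where `ds` vanishes away from it. Then `exists_step` is applied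
up to order `d`. Positivity enters only through the submonoid `Pos`, so the argument applies both on
a patch and on a manifold. -/
theorem exists_solution {d : ℕ} (hd : 0 < d) (Pos : Submonoid A)
    (h1 : ∀ a : A, 1 + a + a ^ 2 ∈ Pos) (hinv : ∀ m ∈ Pos, ∃ u, u * m = 1) {s h : A}
    (hh : h ∈ Pos) (hs : h ^ 2 * (X.gr s s + s ^ 2) = 1) :
    ∃ m ∈ Pos, ∃ B, X.yam d (s * m) = 1 + (s * m) ^ d * B := by
  have key : ∀ j, j + 1 ≤ d → ∃ m ∈ Pos, ∃ B, X.yam d (s * m) = 1 + (s * m) ^ (j + 1) * B := by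
    intro j
    induction j with
    | zero =>
      intro _
      obtain ⟨u, hu⟩ := hinv h hh
      refine ⟨h, hh, u * (-s * h ^ 2 + algebraMap ℝ A (2 - 4 / d) * (h * X.gr s h)
        + s * X.gr h h - algebraMap ℝ A (2 / d) * (h * (s * X.lap h))
        - h ^ 2 * algebraMap ℝ A (2 / d) * (X.lap s + X.pot * s)), ?_⟩
      rw [X.yam_mul, yam]
      linear_combination hs - (s * (-s * h ^ 2 + algebraMap ℝ A (2 - 4 / d) * (h * X.gr s h)
        + s * X.gr h h - algebraMap ℝ A (2 / d) * (h * (s * X.lap h))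
        - h ^ 2 * algebraMap ℝ A (2 / d) * (X.lap s + X.pot * s))) * hu
    | succ j ih =>
      intro hj
      obtain ⟨m, hm, B, hB⟩ := ih (by omega)
      obtain ⟨a, B', hB'⟩ := X.exists_step (by omega) hB
      obtain ⟨u, hu⟩ := hinv _ (h1 a)
      -- `exists_step` leaves a power of the old function; the inverse `u` of the new factor turns
      -- it into a power of the new one.
      refine ⟨m * (1 + a + a ^ 2), Pos.mul_mem hm (h1 a), u ^ (j + 2) * B', ?_⟩
      rw [← mul_assoc, hB', mul_pow _ (1 + a + a ^ 2)]
      have : u ^ (j + 2) * (1 + a + a ^ 2) ^ (j + 2) = 1 := by rw [← mul_pow, hu, one_pow]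
      linear_combination -((s * m) ^ (j + 2) * B') * this
  obtain ⟨k, rfl⟩ : ∃ k, d = k + 1 := ⟨d - 1, by omega⟩
  exact key k le_rfl

end LaplaceAlg

/-- The carré du champ and the Laplacian of a metric. -/
def MetricAlg.laplaceAlg {d : ℕ} {A : Type*} [CommRing A] [Algebra ℝ A] (X : MetricAlg d A) :
    LaplaceAlg A where
  gr := X.gr
  lap := X.lap
  pot := algebraMap ℝ A (1 / (2 * ((d : ℝ) - 1))) * X.sc
  gr_comm := X.gr_comm
  gr_add := X.gr_add
  gr_mul := X.gr_mul
  gr_algebraMap := X.gr_algebraMap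
  lap_add := X.lap_add
  lap_mul := X.lap_mul
  lap_algebraMap := X.lap_algebraMap

end

end HypersurfaceInvariants

namespace HypersurfaceInvariants

noncomputable section

/-! ## Changes of coordinates -/

open SmAlg

variable {d : ℕ}

/-- The metric `G'` on `V` is the pullback of the metric `G` on `U` under `Ψ`. -/
structure IsPullback (V U : Set (Model d)) (Ψ : Model d → Model d) (G' G : MatrixField d) :
    Prop where
  smooth : ContDiffOn ℝ ∞ Ψ V
  maps : Set.MapsTo Ψ V U
  eq : ∀ y ∈ V, ∀ a b, G' y a b = ∑ c, ∑ e, partialDeriv a (fun z => Ψ z c) y *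
    partialDeriv b (fun z => Ψ z e) y * G (Ψ y) c e

lemma IsPullback.mono {V V' U U' : Set (Model d)} {Ψ : Model d → Model d} {G' G : MatrixField d}
    (h : IsPullback V U Ψ G' G) (hV : V' ⊆ V) (hU : Set.MapsTo Ψ V' U') :
    IsPullback V' U' Ψ G' G :=
  ⟨h.smooth.mono hV, hU, fun y hy => h.eq y (hV hy)⟩

lemma contDiffOn_coord {V : Set (Model d)} {Ψ : Model d → Model d} (h : ContDiffOn ℝ ∞ Ψ V)
    (c : Fin d) : ContDiffOn ℝ ∞ (fun z => Ψ z c) V :=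
  contDiffOn_euclidean.mp h c

lemma partialDeriv_coord {Ψ : Model d → Model d} {y : Model d} (hΨ : DifferentiableAt ℝ Ψ y)
    (a b : Fin d) : partialDeriv a (fun z => Ψ z b) y
      = (fderiv ℝ Ψ y (EuclideanSpace.single a 1) : Model d) b := by
  have h2 : HasFDerivAt (fun z => Ψ z b)
      ((EuclideanSpace.proj b : Model d →L[ℝ] ℝ).comp (fderiv ℝ Ψ y)) y :=
    (EuclideanSpace.proj b : Model d →L[ℝ] ℝ).hasFDerivAt.comp y hΨ.hasFDerivAt
  rw [partialDeriv, h2.fderiv]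
  rfl

lemma partialDeriv_comp {F : Model d → ℝ} {Ψ : Model d → Model d} {y : Model d}
    (hF : DifferentiableAt ℝ F (Ψ y)) (hΨ : DifferentiableAt ℝ Ψ y) (a : Fin d) :
    partialDeriv a (fun z => F (Ψ z)) y
      = ∑ b, partialDeriv a (fun z => Ψ z b) y * partialDeriv b F (Ψ y) := by
  have h3 : fderiv ℝ (fun z => F (Ψ z)) y = (fderiv ℝ F (Ψ y)).comp (fderiv ℝ Ψ y) :=
    fderiv_comp y hF hΨ
  simp only [partialDeriv_coord hΨ]
  rw [partialDeriv, h3, ContinuousLinearMap.comp_apply]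
  conv_lhs => rw [← (EuclideanSpace.basisFun (Fin d) ℝ).sum_repr
    (fderiv ℝ Ψ y (EuclideanSpace.single a 1))]
  rw [map_sum]
  refine Finset.sum_congr rfl fun b _ => ?_
  rw [map_smul, smul_eq_mul]
  simp [partialDeriv]

variable {U V : TopologicalSpace.Opens (Model d)}

/-- The pullback of smooth functions. -/
def compAlg {Ψ : Model d → Model d} (hΨ : ContDiffOn ℝ ∞ Ψ V) (hm : Set.MapsTo Ψ V U) :
    SmAlg U →ₐ[ℝ] SmAlg V where
  toFun f := ⟨fun y => f.1 ⟨Ψ y, hm y.2⟩, fun z => rep f (Ψ z), (contDiffOn_rep f).comp hΨ hm,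
    fun y => reps_rep f ⟨Ψ y, hm y.2⟩⟩
  map_one' := rfl
  map_mul' _ _ := rfl
  map_zero' := rfl
  map_add' _ _ := rfl
  commutes' _ := rfl

lemma reps_compAlg {Ψ : Model d → Model d} (hΨ : ContDiffOn ℝ ∞ Ψ V) (hm : Set.MapsTo Ψ V U)
    {F : Model d → ℝ} {f : SmAlg U} (h : Reps F f) :
    Reps (fun y => F (Ψ y)) (compAlg hΨ hm f) := fun y => h ⟨Ψ y, hm y.2⟩

section Pullback

variable {Ψ : Model d → Model d} {G' G : MatrixField d} (h : IsPullback (V : Set (Model d)) U Ψ G' G)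
  (hG' : SmoothMetricOn (V : Set (Model d)) G') (hG : SmoothMetricOn (U : Set (Model d)) G)

/-- A pullback as a change of frames. -/
def IsPullback.frameChange :
    MetricAlg.FrameChange (metricAlg G' hG') (metricAlg G hG) (compAlg h.smooth h.maps) :=
  have hGG : (metricAlg G' hG').G = (Matrix.of fun a c => SmAlg.mk _ (contDiffOn_partialDeriv V.2
      (contDiffOn_coord h.smooth c) a)) * (metricAlg G hG).G.map (compAlg h.smooth h.maps)
      * (Matrix.of fun a c => SmAlg.mk _ (contDiffOn_partialDeriv V.2
      (contDiffOn_coord h.smooth c) a)).transpose := by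
    refine Matrix.ext fun a b => ?_
    refine (reps_G hG' a b).unique ?_
    simp only [Matrix.mul_apply]
    refine fun y => Eq.trans ?_ ((Reps.sum fun e _ => (Reps.sum fun c _ =>
      (reps_mk (partialDeriv a fun z => Ψ z c) (contDiffOn_partialDeriv V.2
        (contDiffOn_coord h.smooth c) a)).mul
      (reps_compAlg h.smooth h.maps (reps_G hG c e))).mul
      (reps_mk (partialDeriv b fun z => Ψ z e) (contDiffOn_partialDeriv V.2
        (contDiffOn_coord h.smooth e) b))) y)
    refine (h.eq y y.2 a b).trans ?_
    rw [Finset.sum_comm]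
    refine Finset.sum_congr rfl fun e _ => ?_
    rw [Finset.sum_mul]
    exact Finset.sum_congr rfl fun c _ => by ring
  { J := Matrix.of fun a c => SmAlg.mk _ (contDiffOn_partialDeriv V.2
      (contDiffOn_coord h.smooth c) a)
    -- The inverse Jacobian is read off from `G' = J G Jᵗ`, so `Ψ` need not be assumed invertible.
    K := (metricAlg G hG).G.map (compAlg h.smooth h.maps) * (Matrix.of fun a c => SmAlg.mk _
      (contDiffOn_partialDeriv V.2 (contDiffOn_coord h.smooth c) a)).transpose
        * (metricAlg G' hG').H
    JK := by
      rw [← Matrix.mul_assoc, ← Matrix.mul_assoc, ← hGG]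
      exact (metricAlg G' hG').mul_inv
    hD := fun a f => by
      refine (reps_D hG' (reps_compAlg h.smooth h.maps (reps_rep f)) a).unique ?_
      refine fun y => Eq.trans ?_ ((Reps.sum fun b _ => (reps_mk (partialDeriv a fun z => Ψ z b)
        (contDiffOn_partialDeriv V.2 (contDiffOn_coord h.smooth b) a)).mul
        (reps_compAlg h.smooth h.maps (reps_D hG (reps_rep f) b))) y)
      exact partialDeriv_comp
        (differentiableAt_of_contDiffOn U.2 (contDiffOn_rep f) (h.maps y.2))
        ((h.smooth.contDiffAt (V.2.mem_nhds y.2)).differentiableAt (by simp)) a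
    hG := hGG
    hJ := fun a b c => by
      refine (reps_D hG' (reps_mk _ (contDiffOn_partialDeriv V.2
        (contDiffOn_coord h.smooth c) b)) a).unique fun y => ?_
      refine Eq.trans ?_ (reps_D hG' (reps_mk _ (contDiffOn_partialDeriv V.2
        (contDiffOn_coord h.smooth c) a)) b y)
      exact partialDeriv_comm V.2 (contDiffOn_coord h.smooth c) a b y.2 }

end Pullback

section Invariance

variable {U V : Set (Model d)} (hU : IsOpen U) (hV : IsOpen V)
  {Ψ : Model d → Model d} {G' G : MatrixField d} (h : IsPullback V U Ψ G' G)
  (hG' : SmoothMetricOn V G') (hG : SmoothMetricOn U G)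
  {y : Model d} (hy : y ∈ V)
include hU hV h hG' hG hy

lemma scalarCurvature_comp : scalarCurvature G' y = scalarCurvature G (Ψ y) := by
  lift U to TopologicalSpace.Opens (Model d) using hU
  lift V to TopologicalSpace.Opens (Model d) using hV
  have h1 := reps_sc hG'
  rw [(h.frameChange hG' hG).sc_eq] at h1
  exact h1.eqOn (reps_compAlg h.smooth h.maps (reps_sc hG)) hy

variable {f : Model d → ℝ} (hf : ContDiffOn ℝ ∞ f U)
include hf

lemma gradSq_comp : gradSq G' (fun z => f (Ψ z)) y = gradSq G f (Ψ y) := by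
  lift U to TopologicalSpace.Opens (Model d) using hU
  lift V to TopologicalSpace.Opens (Model d) using hV
  have h1 := reps_gr hG' (reps_compAlg h.smooth h.maps (reps_mk f hf))
  rw [(h.frameChange hG' hG).gr_eq] at h1
  exact h1.eqOn (reps_compAlg h.smooth h.maps (reps_gr hG (reps_mk f hf))) hy

lemma laplacian_comp : laplacian G' (fun z => f (Ψ z)) y = laplacian G f (Ψ y) := by
  lift U to TopologicalSpace.Opens (Model d) using hU
  lift V to TopologicalSpace.Opens (Model d) using hV
  have h1 := reps_lap hG' (reps_compAlg h.smooth h.maps (reps_mk f hf))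
  rw [(h.frameChange hG' hG).lap_eq] at h1
  exact h1.eqOn (reps_compAlg h.smooth h.maps (reps_lap hG (reps_mk f hf))) hy

lemma coordS_comp : coordS G' (fun z => f (Ψ z)) y = coordS G f (Ψ y) := by
  rw [coordS, coordS, gradSq_comp hU hV h hG' hG hy hf, laplacian_comp hU hV h hG' hG hy hf,
    scalarCurvature_comp hU hV h hG' hG hy]

end Invariance

/-! ### Solutions in a patch -/

/-- The positive functions. -/
def posSubmonoid (U : TopologicalSpace.Opens (Model d)) : Submonoid (SmAlg U) where
  carrier := {f | ∀ y, 0 < f.1 y}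
  one_mem' _ := one_pos
  mul_mem' hf hg y := mul_pos (hf y) (hg y)

/-- Local solutions serve to recognize the value of the universal expression as an obstruction,
which is what makes it comparable between coordinate systems. -/
theorem exists_solution_patch (hd : 0 < d) {U : Set (Model d)} (hU : IsOpen U) {G : MatrixField d}
    (hG : SmoothMetricOn U G) {s : Model d → ℝ} (hs : ContDiffOn ℝ ∞ s U)
    (hp : ∀ y ∈ U, 0 < gradSq G s y) : ∃ m B : Model d → ℝ, ContDiffOn ℝ ∞ m U ∧
      ContDiffOn ℝ ∞ B U ∧ (∀ y ∈ U, 0 < m y) ∧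
      ∀ y ∈ U, coordS G (fun z => s z * m z) y = 1 + (s y * m y) ^ d * B y := by
  lift U to TopologicalSpace.Opens (Model d) using hU
  have hq : ∀ y ∈ U, 0 < gradSq G s y + s y ^ 2 := fun y hy => by
    have := hp y hy
    positivity
  have hh : ContDiffOn ℝ ∞ (fun y => (Real.sqrt (gradSq G s y + s y ^ 2))⁻¹) U :=
    (((contDiffOn_gradSq U.2 hG hs).add (hs.pow 2)).sqrt fun y hy => (hq y hy).ne').inv
      fun y hy => (Real.sqrt_pos.mpr (hq y hy)).ne'
  obtain ⟨m, hm, B, hB⟩ := (metricAlg G hG).laplaceAlg.exists_solution hd (posSubmonoid U)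
    (fun a y => by
      change 0 < 1 + a.1 y + a.1 y ^ 2
      nlinarith [sq_nonneg (a.1 y + 1 / 2)])
    (fun m hm => by
      have h0 : ∀ y ∈ U, rep m y ≠ 0 := fun y hy => by
        rw [reps_rep m ⟨y, hy⟩]; exact (hm _).ne'
      refine ⟨SmAlg.mk _ ((contDiffOn_rep m).inv h0), ?_⟩
      refine ((reps_mk _ _).mul (reps_rep m)).unique fun y => ?_
      exact inv_mul_cancel₀ (h0 y y.2))
    (s := SmAlg.mk s hs) (h := SmAlg.mk _ hh)
    (fun y => inv_pos.mpr (Real.sqrt_pos.mpr (hq y y.2)))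
    (by
      refine (((reps_mk _ hh).pow 2).mul ((reps_gr hG (reps_mk s hs)).add
        ((reps_mk s hs).pow 2))).unique fun y => ?_
      change (Real.sqrt (gradSq G s y + s y ^ 2))⁻¹ ^ 2 * (gradSq G s y + s y ^ 2) = 1
      rw [inv_pow, Real.sq_sqrt (hq y y.2).le, inv_mul_cancel₀ (hq y y.2).ne'])
  refine ⟨rep m, rep B, contDiffOn_rep m, contDiffOn_rep B, fun y hy => ?_, fun y hy => ?_⟩
  · rw [reps_rep m ⟨y, hy⟩]; exact hm _
  · have h1 := (reps_mk s hs).mul (reps_rep m)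
    have h2 := reps_yam hG h1
    have h3 : (metricAlg G hG).yam (SmAlg.mk s hs * m) = 1 + (SmAlg.mk s hs * m) ^ d * B := hB
    rw [h3] at h2
    exact h2.eqOn ((reps_const 1).add ((h1.pow d).mul (reps_rep B))) hy

/-! ### Invariance of the expression for the obstruction -/

lemma partialDeriv_sub_const (s : Model d → ℝ) (c : ℝ) (a : Fin d) :
    partialDeriv a (fun z => s z - c) = partialDeriv a s := by
  funext y; rw [partialDeriv, fderiv_sub_const, partialDeriv]

lemma gradSq_sub_const (G : MatrixField d) (s : Model d → ℝ) (c : ℝ) :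
    gradSq G (fun z => s z - c) = gradSq G s := by
  funext y; simp only [gradSq, partialDeriv_sub_const]

lemma conormal_sub_const (G : MatrixField d) (s : Model d → ℝ) (c : ℝ) :
    conormal G (fun z => s z - c) = conormal G s := by
  funext I y
  rw [conormal, conormal, partialDeriv_sub_const, gradSq_sub_const]

/-- An expression sees `s` only through its conormal. In particular `s` may be replaced by `s - c`,
which makes any given point lie on the zero locus. -/
lemma HypExpr.eval_congr {G : MatrixField d} {s s' : Model d → ℝ}
    (h : HypersurfaceInvariants.conormal G s = HypersurfaceInvariants.conormal G s') {k : ℕ}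
    (e : HypExpr k) : e.eval G s = e.eval G s' := by
  have ht : tangProj G s = tangProj G s' := by
    funext a b y; simp only [tangProj, h]
  have hl : ∀ l, secondFFDeriv G s l = secondFFDeriv G s' l := by
    intro l
    induction l with
    | zero =>
      funext I y
      simp only [secondFFDeriv, HypersurfaceInvariants.secondFF, ht, h]
    | succ l ih =>
      funext I y
      simp only [secondFFDeriv, hypDeriv, ht, ih]
  induction e with
  | const c => rfl
  | metric => rfl
  | conormal => exact h
  | secondFF l => exact hl l
  | curvature k => rfl
  | add e f h1 h2 => simp only [HypExpr.eval, h1, h2]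
  | mul e f h1 h2 => simp only [HypExpr.eval, h1, h2]
  | permute p e h1 => simp only [HypExpr.eval, h1]
  | contract e h1 => simp only [HypExpr.eval, h1]

/-- The expression gives the obstruction in all patches. -/
def IsObstructionExpr (d : ℕ) (e : HypExpr 0) : Prop :=
  ∀ (U : Set (Model d)), IsOpen U → ∀ G, SmoothMetricOn U G → ∀ s σ B : Model d → ℝ,
    ContDiffOn ℝ ∞ s U → ContDiffOn ℝ ∞ σ U → ContDiffOn ℝ ∞ B U →
    (∀ y ∈ U, s y = 0 ↔ σ y = 0) →
    (∀ y ∈ U, s y = 0 → ∃ r : ℝ, 0 < r ∧ ∀ a, partialDeriv a σ y = r * partialDeriv a s y) →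
    (∀ y ∈ U, coordS G σ y = 1 + σ y ^ d * B y) →
    ∀ y ∈ U, s y = 0 → B y = e.eval G s Fin.elim0 y

lemma IsObstructionExpr.eval_of_mul {e : HypExpr 0} (he : IsObstructionExpr d e)
    {U : Set (Model d)} (hU : IsOpen U) {G : MatrixField d} (hG : SmoothMetricOn U G)
    {s m B : Model d → ℝ} (hs : ContDiffOn ℝ ∞ s U) (hm : ContDiffOn ℝ ∞ m U)
    (hB : ContDiffOn ℝ ∞ B U) (hpos : ∀ y ∈ U, 0 < m y)
    (heq : ∀ y ∈ U, coordS G (fun z => s z * m z) y = 1 + (s y * m y) ^ d * B y)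
    {y : Model d} (hy : y ∈ U) (h0 : s y = 0) : B y = e.eval G s Fin.elim0 y := by
  refine he U hU G hG s (fun z => s z * m z) B hs (hs.mul hm) hB (fun z hz => ?_)
    (fun z hz hz0 => ⟨m z, hpos z hz, fun a => ?_⟩) heq y hy h0
  · simp [(hpos z hz).ne']
  · rw [partialDeriv_mul (differentiableAt_of_contDiffOn hU hs hz)
      (differentiableAt_of_contDiffOn hU hm hz), hz0, zero_mul, zero_add]

/-- Instead of following every tensor through the coordinate change, take a local solution for the
level set of `s` through the point. Its pullback is a solution for the pulled back data because `S`
is invariant, so the expression equals the same number `B` in both coordinate systems. -/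
theorem IsObstructionExpr.eval_comp (hd : 0 < d) {e : HypExpr 0} (he : IsObstructionExpr d e)
    {U V : Set (Model d)} (hU : IsOpen U) (hV : IsOpen V)
    {Ψ : Model d → Model d} {G' G : MatrixField d} (h : IsPullback V U Ψ G' G)
    (hG' : SmoothMetricOn V G') (hG : SmoothMetricOn U G) {s : Model d → ℝ}
    (hs : ContDiffOn ℝ ∞ s U) {y : Model d} (hy : y ∈ V) (hp : 0 < gradSq G s (Ψ y)) :
    e.eval G' (fun z => s (Ψ z)) Fin.elim0 y = e.eval G s Fin.elim0 (Ψ y) := by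
  set c := s (Ψ y)
  have hsc : ContDiffOn ℝ ∞ (fun z => s z - c) U := hs.sub contDiffOn_const
  have hgr := gradSq_sub_const G s c
  set W := U ∩ gradSq G s ⁻¹' Set.Ioi 0
  have hW : IsOpen W :=
    (contDiffOn_gradSq hU hG hs).continuousOn.isOpen_inter_preimage hU isOpen_Ioi
  have hWU : W ⊆ U := Set.inter_subset_left
  set V' := V ∩ Ψ ⁻¹' W
  have hV' : IsOpen V' := h.smooth.continuousOn.isOpen_inter_preimage hV hW
  have hVV : V' ⊆ V := Set.inter_subset_left
  have h' : IsPullback V' W Ψ G' G := h.mono hVV fun z hz => hz.2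
  have hGW := hG.mono hWU
  obtain ⟨m, B, hm, hB, hpos, heq⟩ := exists_solution_patch hd hW hGW (hsc.mono hWU)
    (fun z hz => by rw [hgr]; exact hz.2)
  have hyV : y ∈ V' := ⟨hy, h.maps hy, hp⟩
  have e1 := he.eval_of_mul hW hGW (hsc.mono hWU) hm hB hpos heq (h'.maps hyV) (sub_self c)
  have e2 := he.eval_of_mul hV' (hG'.mono hVV) (s := fun z => s (Ψ z) - c) (m := fun z => m (Ψ z))
    (B := fun z => B (Ψ z)) ((hsc.mono hWU).comp h'.smooth h'.maps) (hm.comp h'.smooth h'.maps)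
    (hB.comp h'.smooth h'.maps) (fun z hz => hpos _ (h'.maps hz))
    (fun z hz => (coordS_comp hW hV' h' (hG'.mono hVV) hGW hz ((hsc.mono hWU).mul hm)).trans
      (heq _ (h'.maps hz))) hyV (sub_self c)
  rw [e.eval_congr (conormal_sub_const G s c)] at e1
  rw [e.eval_congr (conormal_sub_const G' (fun z => s (Ψ z)) c)] at e2
  exact e2.symm.trans e1

end

end HypersurfaceInvariants

namespace HypersurfaceInvariants

noncomputable section

/-! ## Metrics on manifolds in charts -/

set_option linter.unusedSectionVars false

lemma bilin_expand {d : ℕ} (β : Model d →L[ℝ] Model d →L[ℝ] ℝ) (L : Model d →L[ℝ] Model d)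
    (v w : Model d) : β (L v) (L w) = ∑ a, ∑ b, v a * w b *
      β (L (EuclideanSpace.single a 1)) (L (EuclideanSpace.single b 1)) := by
  have h : ∀ v : Model d, v = ∑ a, v a • (EuclideanSpace.single a 1 : Model d) := fun v => by
    ext i; simp [Finset.sum_apply, Pi.single_apply]
  conv_lhs => rw [h v, h w]
  simp only [map_sum, map_smul, sum_apply, smul_apply,
    smul_eq_mul, Finset.mul_sum]
  rw [Finset.sum_comm]
  exact Finset.sum_congr rfl fun _ _ => Finset.sum_congr rfl fun _ _ => by ring

section Charts

variable {d : ℕ} {M : Type u} [TopologicalSpace M] [ChartedSpace (Model d) M]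
  [IsManifold (𝓡 d) ∞ M] {φ : OpenPartialHomeomorph M (Model d)}
  (hφ : φ ∈ IsManifold.maximalAtlas (𝓡 d) ∞ M)
include hφ

lemma contMDiffAt_coordVector {y : Model d} (hy : y ∈ φ.target) (a : Fin d) :
    ContMDiffAt (𝓡 d) (𝓡 d).tangent ∞ (fun z => TotalSpace.mk' (Model d)
      (E := fun x : M => TangentSpace (𝓡 d) x) (φ.symm z)
      (mfderiv (𝓡 d) (𝓡 d) φ.symm z (EuclideanSpace.single a 1 : Model d))) y := by
  have h1 := (contMDiffOn_symm_of_mem_maximalAtlas hφ).contMDiffOn_tangentMapWithin (m := ∞)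
    (by simp) φ.open_target.uniqueMDiffOn
  have h2 : ContMDiff (𝓡 d) (𝓡 d).tangent ∞ (fun z : Model d =>
      (⟨z, (EuclideanSpace.single a 1 : Model d)⟩ : TangentBundle (𝓡 d) (Model d))) := by
    intro z
    exact contMDiffAt_vectorSpace_iff_contDiffAt.mpr contDiffAt_const
  have h3 := h1.comp (s := φ.target) h2.contMDiffOn fun z hz => hz
  refine (h3.contMDiffAt (φ.open_target.mem_nhds hy)).congr_of_eventuallyEq ?_
  filter_upwards [φ.open_target.mem_nhds hy] with z hz
  simp only [Function.comp_apply, tangentMapWithin, mfderivWithin_of_isOpen φ.open_target hz]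

lemma mdifferentiableAt_symm {y : Model d} (hy : y ∈ φ.target) :
    MDifferentiableAt (𝓡 d) (𝓡 d) φ.symm y :=
  (contMDiffAt_symm_of_mem_maximalAtlas hφ hy).mdifferentiableAt (by simp)

lemma mdifferentiableAt_chart {x : M} (hx : x ∈ φ.source) :
    MDifferentiableAt (𝓡 d) (𝓡 d) φ x :=
  (contMDiffAt_of_mem_maximalAtlas hφ hx).mdifferentiableAt (by simp)

lemma mfderiv_symm_comp {y : Model d} (hy : y ∈ φ.target) (v : Model d) :
    mfderiv (𝓡 d) (𝓡 d) φ (φ.symm y) (mfderiv (𝓡 d) (𝓡 d) φ.symm y v) = v := by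
  have h1 := mfderiv_comp y (mdifferentiableAt_chart hφ (φ.map_target hy))
    (mdifferentiableAt_symm hφ hy)
  have h2 : φ ∘ φ.symm =ᶠ[nhds y] id := by
    filter_upwards [φ.open_target.mem_nhds hy] with z hz using φ.right_inv hz
  rw [h2.mfderiv_eq, mfderiv_id] at h1
  exact (congrArg (fun L : Model d →L[ℝ] Model d => L v) h1).symm

lemma smoothMetricOn_coordMetric (g : Metric d M) :
    SmoothMetricOn φ.target (coordMetric g φ) := by
  constructor
  · intro a b y hy
    apply ContDiffAt.contDiffWithinAt
    rw [← contMDiffAt_iff_contDiffAt]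
    have h1 := contMDiffAt_coordVector hφ hy a
    have h2 := contMDiffAt_coordVector hφ hy b
    have h0 : ContMDiffAt (𝓡 d) (𝓡 d) ∞ φ.symm y := contMDiffAt_symm_of_mem_maximalAtlas hφ hy
    have h3 := g.contMDiff.contMDiffAt.comp y h0
    have h4 := ContMDiffAt.clm_bundle_apply₂ (F₁ := Model d) (F₂ := Model d) (F₃ := ℝ)
      (E₃ := Bundle.Trivial M ℝ) h3 h1 h2
    simp only [contMDiffAt_totalSpace] at h4
    exact h4.2
  · intro y hy
    rw [Matrix.posDef_iff_dotProduct_mulVec]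
    refine ⟨?_, fun v hv => ?_⟩
    · ext a b
      simp only [Matrix.conjTranspose_apply, coordMetric, Matrix.of_apply, star_trivial]
      exact g.symm _ _ _
    · set w : Model d := WithLp.toLp 2 v
      have hw : w ≠ 0 := fun h => hv (by simpa [w] using h)
      have hw' : mfderiv (𝓡 d) (𝓡 d) φ.symm y w ≠ 0 := fun h => hw (by
        have := mfderiv_symm_comp hφ hy w
        rw [h, map_zero] at this
        exact this.symm)
      have hpos := g.pos _ _ hw'
      have hexp : g.inner (φ.symm y) (mfderiv (𝓡 d) (𝓡 d) φ.symm y w)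
          (mfderiv (𝓡 d) (𝓡 d) φ.symm y w) = star v ⬝ᵥ ((coordMetric g φ y).mulVec v) := by
        refine (bilin_expand (g.inner (φ.symm y)) (mfderiv (𝓡 d) (𝓡 d) φ.symm y) w w).trans ?_
        simp only [dotProduct, Matrix.mulVec, Finset.mul_sum]
        refine Finset.sum_congr rfl fun a _ => Finset.sum_congr rfl fun b _ => ?_
        simp only [coordMetric, Matrix.of_apply, star_trivial]
        exact (by intros; ring : ∀ p q r : ℝ, p * q * r = p * (r * q)) _ _ _
      rw [← hexp]; exact hpos

end Charts

section Isometry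

variable {d : ℕ} {M N : Type u} [TopologicalSpace M] [ChartedSpace (Model d) M]
  [IsManifold (𝓡 d) ∞ M] [TopologicalSpace N] [ChartedSpace (Model d) N]
  [IsManifold (𝓡 d) ∞ N] {F : M → N} (hF : ContMDiff (𝓡 d) (𝓡 d) ∞ F)
  {φ : OpenPartialHomeomorph M (Model d)} (hφ : φ ∈ IsManifold.maximalAtlas (𝓡 d) ∞ M)
  {ψ : OpenPartialHomeomorph N (Model d)} (hψ : ψ ∈ IsManifold.maximalAtlas (𝓡 d) ∞ N)
include hF

lemma isOpen_overlap : IsOpen (φ.target ∩ φ.symm ⁻¹' (F ⁻¹' ψ.source)) :=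
  φ.isOpen_inter_preimage_symm (hF.continuous.isOpen_preimage _ ψ.open_source)

include hφ hψ

lemma contDiffOn_overlap : ContDiffOn ℝ ∞ (fun z => ψ (F (φ.symm z)))
    (φ.target ∩ φ.symm ⁻¹' (F ⁻¹' ψ.source)) := by
  rw [← contMDiffOn_iff_contDiffOn]
  exact (contMDiffOn_of_mem_maximalAtlas hψ).comp (hF.comp_contMDiffOn
    ((contMDiffOn_symm_of_mem_maximalAtlas hφ).mono Set.inter_subset_left)) fun z hz => hz.2

/-- Local isometries in charts. -/
lemma isPullback_charts {g : Metric d N} {g' : Metric d M}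
    (hg : ∀ (x : M) (v w : TangentSpace (𝓡 d) x), g'.inner x v w =
      g.inner (F x) (mfderiv (𝓡 d) (𝓡 d) F x v) (mfderiv (𝓡 d) (𝓡 d) F x w)) :
    IsPullback (φ.target ∩ φ.symm ⁻¹' (F ⁻¹' ψ.source)) ψ.target (fun z => ψ (F (φ.symm z)))
      (coordMetric g' φ) (coordMetric g ψ) := by
  refine ⟨contDiffOn_overlap hF hφ hψ, fun z hz => ψ.map_source hz.2, fun y hy a b => ?_⟩
  set Ψ : Model d → Model d := fun z => ψ (F (φ.symm z)) with hΨ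
  have hV := isOpen_overlap (φ := φ) (ψ := ψ) hF
  have hΨd : DifferentiableAt ℝ Ψ y := ((contDiffOn_overlap hF hφ hψ).contDiffAt
    (hV.mem_nhds hy)).differentiableAt (by simp)
  have h1 := mfderiv_comp y ((hF (φ.symm y)).mdifferentiableAt (by simp))
    (mdifferentiableAt_symm hφ hy.1)
  have h2 := mfderiv_comp y (mdifferentiableAt_symm hψ (ψ.map_source hy.2))
    hΨd.mdifferentiableAt
  have h3 : ψ.symm ∘ Ψ =ᶠ[nhds y] F ∘ φ.symm := by
    filter_upwards [hV.mem_nhds hy] with z hz using ψ.left_inv hz.2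
  have h4 : ∀ v : Model d, (mfderiv (𝓡 d) (𝓡 d) F (φ.symm y)
      (mfderiv (𝓡 d) (𝓡 d) φ.symm y v) : Model d)
      = mfderiv (𝓡 d) (𝓡 d) ψ.symm (Ψ y) (fderiv ℝ Ψ y v) := fun v => by
    have h5 := h3.mfderiv_eq (I := 𝓡 d) (I' := 𝓡 d)
    rw [mfderiv_eq_fderiv] at h2
    exact congrArg (fun L : Model d →L[ℝ] Model d => L v) (h1.symm.trans (h5.symm.trans h2))
  have h6 : coordMetric g' φ y a b = g.inner (F (φ.symm y))
      (mfderiv (𝓡 d) (𝓡 d) F (φ.symm y)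
        (mfderiv (𝓡 d) (𝓡 d) φ.symm y (EuclideanSpace.single a 1 : Model d)))
      (mfderiv (𝓡 d) (𝓡 d) F (φ.symm y)
        (mfderiv (𝓡 d) (𝓡 d) φ.symm y (EuclideanSpace.single b 1 : Model d))) := hg _ _ _
  -- The two base points are equal but only propositionally so; the metric is transported between
  -- them as a bilinear form on the model space.
  have h7 : ∀ (p : N) (_ : p = ψ.symm (Ψ y)) (v w : Model d), (g.inner p v w : ℝ)
      = g.inner (ψ.symm (Ψ y)) v w := by
    rintro p rfl v w; rfl
  rw [h6]
  refine (h7 (F (φ.symm y)) (ψ.left_inv hy.2).symm _ _).trans ?_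
  rw [h4, h4]
  refine (bilin_expand (g.inner (ψ.symm (Ψ y))) (mfderiv (𝓡 d) (𝓡 d) ψ.symm (Ψ y)) _ _).trans ?_
  refine Finset.sum_congr rfl fun c _ => Finset.sum_congr rfl fun e _ => ?_
  rw [partialDeriv_coord hΨd, partialDeriv_coord hΨd]
  rfl

end Isometry

end

end HypersurfaceInvariants

namespace HypersurfaceInvariants

noncomputable section

/-! ## The operators on manifolds -/

set_option linter.unusedSectionVars false

open SmAlg

/-! ### Smoothness and product rules for the coordinate operators -/

section Patch

variable {d : ℕ}

/-- The inner product of the differentials of two functions, in coordinates. -/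
def coordGr (G : MatrixField d) (f k : Model d → ℝ) (y : Model d) : ℝ :=
  ∑ a, ∑ b, inverseMetric G y a b * partialDeriv a f y * partialDeriv b k y

lemma reps_coordGr {U : TopologicalSpace.Opens (Model d)} {G : MatrixField d}
    (h : SmoothMetricOn (U : Set (Model d)) G) {F K : Model d → ℝ} {f k : SmAlg U} (hf : Reps F f)
    (hk : Reps K k) : Reps (coordGr G F K) ((metricAlg G h).gr f k) :=
  Reps.sum fun _ _ => Reps.sum fun _ _ => ((reps_H h _ _).mul (reps_D h hf _)).mul (reps_D h hk _)

lemma reps_mk_congr {U : TopologicalSpace.Opens (Model d)} {F F' : Model d → ℝ}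
    (hF : ContDiffOn ℝ ∞ F U) (h : Set.EqOn F F' U) : Reps F' (SmAlg.mk F hF) :=
  fun y => (h y.2).symm

variable {U : Set (Model d)} (hU : IsOpen U) {G : MatrixField d} (hG : SmoothMetricOn U G)
include hU hG

lemma contDiffOn_coordGr {f k : Model d → ℝ} (hf : ContDiffOn ℝ ∞ f U) (hk : ContDiffOn ℝ ∞ k U) :
    ContDiffOn ℝ ∞ (coordGr G f k) U := by
  lift U to TopologicalSpace.Opens (Model d) using hU
  exact (reps_coordGr hG (reps_mk f hf) (reps_mk k hk)).contDiffOn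

lemma contDiffOn_laplacian {f : Model d → ℝ} (hf : ContDiffOn ℝ ∞ f U) :
    ContDiffOn ℝ ∞ (laplacian G f) U := by
  lift U to TopologicalSpace.Opens (Model d) using hU
  exact (reps_lap hG (reps_mk f hf)).contDiffOn

lemma contDiffOn_scalarCurvature : ContDiffOn ℝ ∞ (scalarCurvature G) U := by
  lift U to TopologicalSpace.Opens (Model d) using hU
  exact (reps_sc hG).contDiffOn

lemma coordGr_congr {f f' k k' : Model d → ℝ} (hf : ContDiffOn ℝ ∞ f U)
    (hk : ContDiffOn ℝ ∞ k U) (h : Set.EqOn f f' U) (h' : Set.EqOn k k' U) :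
    Set.EqOn (coordGr G f k) (coordGr G f' k') U := by
  lift U to TopologicalSpace.Opens (Model d) using hU
  exact (reps_coordGr hG (reps_mk f hf) (reps_mk k hk)).eqOn
    (reps_coordGr hG (reps_mk_congr hf h) (reps_mk_congr hk h'))

lemma laplacian_congr {f f' : Model d → ℝ} (hf : ContDiffOn ℝ ∞ f U) (h : Set.EqOn f f' U) :
    Set.EqOn (laplacian G f) (laplacian G f') U := by
  lift U to TopologicalSpace.Opens (Model d) using hU
  exact (reps_lap hG (reps_mk f hf)).eqOn (reps_lap hG (reps_mk_congr hf h))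

lemma coordS_congr {f f' : Model d → ℝ} (hf : ContDiffOn ℝ ∞ f U) (h : Set.EqOn f f' U) :
    Set.EqOn (coordS G f) (coordS G f') U := by
  lift U to TopologicalSpace.Opens (Model d) using hU
  exact (reps_yam hG (reps_mk f hf)).eqOn (reps_yam hG (reps_mk_congr hf h))

lemma gradSq_congr {f f' : Model d → ℝ} (hf : ContDiffOn ℝ ∞ f U) (h : Set.EqOn f f' U) :
    Set.EqOn (gradSq G f) (gradSq G f') U :=
  coordGr_congr hU hG hf hf h h

lemma HypExpr.eval_eqOn {k : ℕ} (e : HypExpr k) (I : Fin k → Fin d) {s s' : Model d → ℝ}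
    (hs : ContDiffOn ℝ ∞ s U) (hp : ∀ y ∈ U, 0 < gradSq G s y) (h : Set.EqOn s s' U) :
    Set.EqOn (e.eval G s I) (e.eval G s' I) U := by
  have h1 := gradSq_congr hU hG hs h
  have h2 : ∀ I, Set.EqOn (HypersurfaceInvariants.conormal G s I)
      (HypersurfaceInvariants.conormal G s' I) U := fun I y hy => by
    rw [HypersurfaceInvariants.conormal, HypersurfaceInvariants.conormal, h1 hy,
      partialDeriv_congr hU h _ hy]
  have h3 := contDiffOn_conormal hU hG hs hp
  lift U to TopologicalSpace.Opens (Model d) using hU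
  exact (reps_ev hG (fun I => reps_mk _ (h3 I)) e I).eqOn
    (reps_ev hG (fun I => reps_mk_congr (h3 I) (h2 I)) e I)

variable {f k l : Model d → ℝ} (hf : ContDiffOn ℝ ∞ f U) (hk : ContDiffOn ℝ ∞ k U)
  (hl : ContDiffOn ℝ ∞ l U) {y : Model d} (hy : y ∈ U)
include hf hk hy

lemma coordGr_comm : coordGr G f k y = coordGr G k f y := by
  lift U to TopologicalSpace.Opens (Model d) using hU
  have h := reps_coordGr hG (reps_mk f hf) (reps_mk k hk)
  rw [MetricAlg.gr_comm] at h
  exact h.eqOn (reps_coordGr hG (reps_mk k hk) (reps_mk f hf)) hy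

lemma laplacian_add : laplacian G (fun z => f z + k z) y = laplacian G f y + laplacian G k y := by
  lift U to TopologicalSpace.Opens (Model d) using hU
  have h := reps_lap hG ((reps_mk f hf).add (reps_mk k hk))
  rw [MetricAlg.lap_add] at h
  exact h.eqOn ((reps_lap hG (reps_mk f hf)).add (reps_lap hG (reps_mk k hk))) hy

lemma laplacian_mul : laplacian G (fun z => f z * k z) y
    = f y * laplacian G k y + k y * laplacian G f y + 2 * coordGr G f k y := by
  lift U to TopologicalSpace.Opens (Model d) using hU
  have h := reps_lap hG ((reps_mk f hf).mul (reps_mk k hk))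
  rw [MetricAlg.lap_mul] at h
  exact h.eqOn ((((reps_mk f hf).mul (reps_lap hG (reps_mk k hk))).add
    ((reps_mk k hk).mul (reps_lap hG (reps_mk f hf)))).add
    ((reps_const 2).mul (reps_coordGr hG (reps_mk f hf) (reps_mk k hk)))) hy

include hl

lemma coordGr_add : coordGr G f (fun z => k z + l z) y = coordGr G f k y + coordGr G f l y := by
  lift U to TopologicalSpace.Opens (Model d) using hU
  have h := reps_coordGr hG (reps_mk f hf) ((reps_mk k hk).add (reps_mk l hl))
  rw [MetricAlg.gr_add] at h
  exact h.eqOn ((reps_coordGr hG (reps_mk f hf) (reps_mk k hk)).add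
    (reps_coordGr hG (reps_mk f hf) (reps_mk l hl))) hy

lemma coordGr_mul : coordGr G f (fun z => k z * l z) y
    = k y * coordGr G f l y + l y * coordGr G f k y := by
  lift U to TopologicalSpace.Opens (Model d) using hU
  have h := reps_coordGr hG (reps_mk f hf) ((reps_mk k hk).mul (reps_mk l hl))
  rw [MetricAlg.gr_mul] at h
  exact h.eqOn (((reps_mk k hk).mul (reps_coordGr hG (reps_mk f hf) (reps_mk l hl))).add
    ((reps_mk l hl).mul (reps_coordGr hG (reps_mk f hf) (reps_mk k hk)))) hy

end Patch

lemma coordGr_const {d : ℕ} (G : MatrixField d) (f : Model d → ℝ) (r : ℝ) (y : Model d) :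
    coordGr G f (fun _ => r) y = 0 := by
  simp [coordGr, partialDeriv]

lemma laplacian_const {d : ℕ} (G : MatrixField d) (r : ℝ) (y : Model d) :
    laplacian G (fun _ => r) y = 0 := by
  have h : ∀ a : Fin d, partialDeriv a (fun _ : Model d => r) = fun _ => 0 := fun a => by
    funext z; simp [partialDeriv]
  simp only [laplacian, h]
  simp [partialDeriv]

section CompPatch

variable {d : ℕ} {U V : Set (Model d)} (hU : IsOpen U) (hV : IsOpen V)
  {Ψ : Model d → Model d} {G' G : MatrixField d} (h : IsPullback V U Ψ G' G)
  (hG' : SmoothMetricOn V G') (hG : SmoothMetricOn U G)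
  {y : Model d} (hy : y ∈ V) {f k : Model d → ℝ} (hf : ContDiffOn ℝ ∞ f U)
  (hk : ContDiffOn ℝ ∞ k U)
include hU hV h hG' hG hy hf hk

lemma coordGr_comp :
    coordGr G' (fun z => f (Ψ z)) (fun z => k (Ψ z)) y = coordGr G f k (Ψ y) := by
  lift U to TopologicalSpace.Opens (Model d) using hU
  lift V to TopologicalSpace.Opens (Model d) using hV
  have h1 := reps_coordGr hG' (reps_compAlg h.smooth h.maps (reps_mk f hf))
    (reps_compAlg h.smooth h.maps (reps_mk k hk))
  rw [(h.frameChange hG' hG).gr_eq] at h1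
  exact h1.eqOn (reps_compAlg h.smooth h.maps (reps_coordGr hG (reps_mk f hf) (reps_mk k hk))) hy

end CompPatch

/-! ### Local isometries between manifolds, read in charts -/

section Isometry

variable {d : ℕ} {M N : Type u} [TopologicalSpace M] [ChartedSpace (Model d) M]
  [IsManifold (𝓡 d) ∞ M] [TopologicalSpace N] [ChartedSpace (Model d) N]
  [IsManifold (𝓡 d) ∞ N]

lemma contDiffOn_coordFun {f : M → ℝ} (hf : ContMDiff (𝓡 d) 𝓘(ℝ, ℝ) ∞ f)
    {φ : OpenPartialHomeomorph M (Model d)} (hφ : φ ∈ IsManifold.maximalAtlas (𝓡 d) ∞ M) :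
    ContDiffOn ℝ ∞ (coordFun f φ) φ.target := by
  rw [← contMDiffOn_iff_contDiffOn]
  exact hf.comp_contMDiffOn (contMDiffOn_symm_of_mem_maximalAtlas hφ)

/-- `g'` is the pullback of `g` under the smooth map `F`. -/
structure IsLocalIsometry (F : M → N) (g' : Metric d M) (g : Metric d N) : Prop where
  smooth : ContMDiff (𝓡 d) (𝓡 d) ∞ F
  eq : ∀ (x : M) (v w : TangentSpace (𝓡 d) x), g'.inner x v w =
    g.inner (F x) (mfderiv (𝓡 d) (𝓡 d) F x v) (mfderiv (𝓡 d) (𝓡 d) F x w)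

/-- Applied to two charts of one manifold it gives independence of the chart, so changes of chart
and diffeomorphisms are covered by the same lemmas. -/
lemma isLocalIsometry_id (g : Metric d M) : IsLocalIsometry (fun x => x) g g := by
  refine ⟨contMDiff_id, fun x v w => ?_⟩
  have : mfderiv (𝓡 d) (𝓡 d) (fun x : M => x) x = ContinuousLinearMap.id ℝ _ := mfderiv_id
  rw [this]
  rfl

namespace IsLocalIsometry

variable {F : M → N} {g' : Metric d M} {g : Metric d N} (h : IsLocalIsometry F g' g)
  {φ : OpenPartialHomeomorph M (Model d)} (hφ : φ ∈ IsManifold.maximalAtlas (𝓡 d) ∞ M)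
  {ψ : OpenPartialHomeomorph N (Model d)} (hψ : ψ ∈ IsManifold.maximalAtlas (𝓡 d) ∞ N)
  {x : M} (hx : x ∈ φ.source) (hFx : F x ∈ ψ.source)

include h hφ hψ hx hFx

lemma mem_overlap : φ x ∈ φ.target ∩ φ.symm ⁻¹' (F ⁻¹' ψ.source) :=
  ⟨φ.map_source hx, by simpa [φ.left_inv hx] using hFx⟩

lemma smoothMetricOn_overlap :
    SmoothMetricOn (φ.target ∩ φ.symm ⁻¹' (F ⁻¹' ψ.source)) (coordMetric g' φ) :=
  (smoothMetricOn_coordMetric hφ g').mono Set.inter_subset_left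

lemma scalarCurvature_eq :
    scalarCurvature (coordMetric g' φ) (φ x) = scalarCurvature (coordMetric g ψ) (ψ (F x)) := by
  rw [scalarCurvature_comp ψ.open_target (isOpen_overlap h.smooth)
    (isPullback_charts h.smooth hφ hψ h.eq) (h.smoothMetricOn_overlap hφ hψ hx hFx)
    (smoothMetricOn_coordMetric hψ g) (h.mem_overlap hφ hψ hx hFx), φ.left_inv hx]

variable {f k : N → ℝ} (hf : ContMDiff (𝓡 d) 𝓘(ℝ, ℝ) ∞ f) (hk : ContMDiff (𝓡 d) 𝓘(ℝ, ℝ) ∞ k)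

include hf

lemma eqOn_overlap : Set.EqOn (coordFun (fun p => f (F p)) φ)
    (fun z => coordFun f ψ (ψ (F (φ.symm z)))) (φ.target ∩ φ.symm ⁻¹' (F ⁻¹' ψ.source)) :=
  fun z hz => by simp only [coordFun, ψ.left_inv hz.2]

lemma contDiffOn_coordFun_overlap : ContDiffOn ℝ ∞ (coordFun (fun p => f (F p)) φ)
    (φ.target ∩ φ.symm ⁻¹' (F ⁻¹' ψ.source)) :=
  (contDiffOn_coordFun (hf.comp h.smooth) hφ).mono Set.inter_subset_left

lemma laplacian_eq : laplacian (coordMetric g' φ) (coordFun (fun p => f (F p)) φ) (φ x)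
    = laplacian (coordMetric g ψ) (coordFun f ψ) (ψ (F x)) := by
  have hy := h.mem_overlap hφ hψ hx hFx
  rw [laplacian_congr (isOpen_overlap h.smooth) (h.smoothMetricOn_overlap hφ hψ hx hFx)
    (h.contDiffOn_coordFun_overlap hφ hψ hx hFx hf) (h.eqOn_overlap hφ hψ hx hFx hf) hy,
    laplacian_comp ψ.open_target (isOpen_overlap h.smooth)
    (isPullback_charts h.smooth hφ hψ h.eq) (h.smoothMetricOn_overlap hφ hψ hx hFx)
    (smoothMetricOn_coordMetric hψ g) hy (contDiffOn_coordFun hf hψ), φ.left_inv hx]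

lemma coordS_eq : coordS (coordMetric g' φ) (coordFun (fun p => f (F p)) φ) (φ x)
    = coordS (coordMetric g ψ) (coordFun f ψ) (ψ (F x)) := by
  have hy := h.mem_overlap hφ hψ hx hFx
  rw [coordS_congr (isOpen_overlap h.smooth) (h.smoothMetricOn_overlap hφ hψ hx hFx)
    (h.contDiffOn_coordFun_overlap hφ hψ hx hFx hf) (h.eqOn_overlap hφ hψ hx hFx hf) hy,
    coordS_comp ψ.open_target (isOpen_overlap h.smooth)
    (isPullback_charts h.smooth hφ hψ h.eq) (h.smoothMetricOn_overlap hφ hψ hx hFx)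
    (smoothMetricOn_coordMetric hψ g) hy (contDiffOn_coordFun hf hψ), φ.left_inv hx]

include hk in
lemma coordGr_eq : coordGr (coordMetric g' φ) (coordFun (fun p => f (F p)) φ)
    (coordFun (fun p => k (F p)) φ) (φ x)
    = coordGr (coordMetric g ψ) (coordFun f ψ) (coordFun k ψ) (ψ (F x)) := by
  have hy := h.mem_overlap hφ hψ hx hFx
  rw [coordGr_congr (isOpen_overlap h.smooth) (h.smoothMetricOn_overlap hφ hψ hx hFx)
    (h.contDiffOn_coordFun_overlap hφ hψ hx hFx hf) (h.contDiffOn_coordFun_overlap hφ hψ hx hFx hk)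
    (h.eqOn_overlap hφ hψ hx hFx hf) (h.eqOn_overlap hφ hψ hx hFx hk) hy,
    coordGr_comp ψ.open_target (isOpen_overlap h.smooth)
    (isPullback_charts h.smooth hφ hψ h.eq) (h.smoothMetricOn_overlap hφ hψ hx hFx)
    (smoothMetricOn_coordMetric hψ g) hy (contDiffOn_coordFun hf hψ) (contDiffOn_coordFun hk hψ),
    φ.left_inv hx]

lemma eval_eq (hd : 0 < d) {e : HypExpr 0} (he : IsObstructionExpr d e)
    (hp : 0 < gradSq (coordMetric g ψ) (coordFun f ψ) (ψ (F x))) :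
    e.eval (coordMetric g' φ) (coordFun (fun p => f (F p)) φ) Fin.elim0 (φ x)
    = e.eval (coordMetric g ψ) (coordFun f ψ) Fin.elim0 (ψ (F x)) := by
  have hy := h.mem_overlap hφ hψ hx hFx
  have hV := isOpen_overlap (φ := φ) (ψ := ψ) h.smooth
  have hs := h.contDiffOn_coordFun_overlap hφ hψ hx hFx hf
  have hG' := h.smoothMetricOn_overlap hφ hψ hx hFx
  have hp' : 0 < gradSq (coordMetric g' φ) (coordFun (fun p => f (F p)) φ) (φ x) :=
    hp.trans_eq (h.coordGr_eq hφ hψ hx hFx hf hf).symm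
  -- `eval_eqOn` needs a smooth conormal, hence the restriction to the open set where the
  -- differential does not vanish.
  set W := (φ.target ∩ φ.symm ⁻¹' (F ⁻¹' ψ.source)) ∩
    gradSq (coordMetric g' φ) (coordFun (fun p => f (F p)) φ) ⁻¹' Set.Ioi 0 with hWdef
  have hW : IsOpen W :=
    (contDiffOn_gradSq hV hG' hs).continuousOn.isOpen_inter_preimage hV isOpen_Ioi
  have hWV : W ⊆ _ := Set.inter_subset_left
  rw [e.eval_eqOn hW (hG'.mono hWV) Fin.elim0 (hs.mono hWV) (fun z hz => hz.2)
    ((h.eqOn_overlap hφ hψ hx hFx hf).mono hWV) ⟨hy, hp'⟩,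
    he.eval_comp hd ψ.open_target hV (isPullback_charts h.smooth hφ hψ h.eq) hG'
    (smoothMetricOn_coordMetric hψ g) (contDiffOn_coordFun hf hψ) hy
    (by rw [φ.left_inv hx]; exact hp), φ.left_inv hx]

end IsLocalIsometry

end Isometry

end

end HypersurfaceInvariants

namespace HypersurfaceInvariants

noncomputable section

/-! ## Solutions of the equation `S(σ) = 1` on manifolds -/

set_option linter.unusedSectionVars false

section Manifold

variable {d : ℕ} {M : Type u} [TopologicalSpace M] [ChartedSpace (Model d) M]
  [IsManifold (𝓡 d) ∞ M]

lemma chartAt_mem_maximalAtlas (x : M) :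
    chartAt (Model d) x ∈ IsManifold.maximalAtlas (𝓡 d) ∞ M :=
  IsManifold.chart_mem_maximalAtlas x

lemma contMDiff_of_chart {q : M → ℝ} (h : ∀ x₀ : M, ∃ Q : Model d → ℝ,
    ContDiffOn ℝ ∞ Q (chartAt (Model d) x₀).target ∧
    ∀ x ∈ (chartAt (Model d) x₀).source, q x = Q (chartAt (Model d) x₀ x)) :
    ContMDiff (𝓡 d) 𝓘(ℝ, ℝ) ∞ q := by
  intro x₀
  obtain ⟨Q, hQ, hq⟩ := h x₀
  have h1 := (contMDiffOn_iff_contDiffOn.mpr hQ).comp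
    (contMDiffOn_of_mem_maximalAtlas (chartAt_mem_maximalAtlas x₀))
    fun x hx => (chartAt (Model d) x₀).map_source hx
  exact (h1.congr hq).contMDiffAt
    ((chartAt (Model d) x₀).open_source.mem_nhds (mem_chart_source _ x₀))

variable (g : Metric d M)

/-- The inner product of the differentials of two functions. -/
def innerGrad (f k : M → ℝ) (x : M) : ℝ :=
  coordGr (coordMetric g (chartAt (Model d) x)) (coordFun f (chartAt (Model d) x))
    (coordFun k (chartAt (Model d) x)) (chartAt (Model d) x x)

/-- The Laplacian of a Riemannian manifold. -/
def manifoldLaplacian (f : M → ℝ) (x : M) : ℝ :=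
  laplacian (coordMetric g (chartAt (Model d) x)) (coordFun f (chartAt (Model d) x))
    (chartAt (Model d) x x)

/-- The scalar curvature of a Riemannian manifold. -/
def manifoldScalarCurvature (x : M) : ℝ :=
  scalarCurvature (coordMetric g (chartAt (Model d) x)) (chartAt (Model d) x x)

section Charts

variable {φ : OpenPartialHomeomorph M (Model d)} (hφ : φ ∈ IsManifold.maximalAtlas (𝓡 d) ∞ M)
  {x : M} (hx : x ∈ φ.source)
include hφ hx

lemma manifoldScalarCurvature_eq :
    manifoldScalarCurvature g x = scalarCurvature (coordMetric g φ) (φ x) :=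
  (isLocalIsometry_id g).scalarCurvature_eq (chartAt_mem_maximalAtlas x) hφ (mem_chart_source _ x) hx

variable {f k : M → ℝ} (hf : ContMDiff (𝓡 d) 𝓘(ℝ, ℝ) ∞ f) (hk : ContMDiff (𝓡 d) 𝓘(ℝ, ℝ) ∞ k)
include hf

lemma manifoldLaplacian_eq :
    manifoldLaplacian g f x = laplacian (coordMetric g φ) (coordFun f φ) (φ x) :=
  (isLocalIsometry_id g).laplacian_eq (chartAt_mem_maximalAtlas x) hφ (mem_chart_source _ x) hx hf

lemma yamabeS_eq : yamabeS g f x = coordS (coordMetric g φ) (coordFun f φ) (φ x) :=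
  (isLocalIsometry_id g).coordS_eq (chartAt_mem_maximalAtlas x) hφ (mem_chart_source _ x) hx hf

include hk

lemma innerGrad_eq : innerGrad g f k x
    = coordGr (coordMetric g φ) (coordFun f φ) (coordFun k φ) (φ x) :=
  (isLocalIsometry_id g).coordGr_eq (chartAt_mem_maximalAtlas x) hφ (mem_chart_source _ x) hx hf hk

end Charts

lemma contMDiff_scalarCurvature : ContMDiff (𝓡 d) 𝓘(ℝ, ℝ) ∞ (manifoldScalarCurvature g) :=
  contMDiff_of_chart fun x₀ => ⟨_, contDiffOn_scalarCurvature (chartAt (Model d) x₀).open_target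
    (smoothMetricOn_coordMetric (chartAt_mem_maximalAtlas x₀) g),
    fun _ hx => manifoldScalarCurvature_eq g (chartAt_mem_maximalAtlas x₀) hx⟩

lemma contMDiff_laplacian {f : M → ℝ} (hf : ContMDiff (𝓡 d) 𝓘(ℝ, ℝ) ∞ f) :
    ContMDiff (𝓡 d) 𝓘(ℝ, ℝ) ∞ (manifoldLaplacian g f) :=
  contMDiff_of_chart fun x₀ => ⟨_, contDiffOn_laplacian (chartAt (Model d) x₀).open_target
    (smoothMetricOn_coordMetric (chartAt_mem_maximalAtlas x₀) g)
    (contDiffOn_coordFun hf (chartAt_mem_maximalAtlas x₀)),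
    fun _ hx => manifoldLaplacian_eq g (chartAt_mem_maximalAtlas x₀) hx hf⟩

lemma contMDiff_innerGrad {f k : M → ℝ} (hf : ContMDiff (𝓡 d) 𝓘(ℝ, ℝ) ∞ f)
    (hk : ContMDiff (𝓡 d) 𝓘(ℝ, ℝ) ∞ k) : ContMDiff (𝓡 d) 𝓘(ℝ, ℝ) ∞ (innerGrad g f k) :=
  contMDiff_of_chart fun x₀ => ⟨_, contDiffOn_coordGr (chartAt (Model d) x₀).open_target
    (smoothMetricOn_coordMetric (chartAt_mem_maximalAtlas x₀) g)
    (contDiffOn_coordFun hf (chartAt_mem_maximalAtlas x₀))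
    (contDiffOn_coordFun hk (chartAt_mem_maximalAtlas x₀)),
    fun _ hx => innerGrad_eq g (chartAt_mem_maximalAtlas x₀) hx hf hk⟩

/-- The smooth functions on a Riemannian manifold. -/
def manifoldLaplaceAlg : LaplaceAlg (C^∞⟮𝓡 d, M; 𝓘(ℝ, ℝ), ℝ⟯) where
  gr f k := ⟨innerGrad g f k, contMDiff_innerGrad g f.contMDiff k.contMDiff⟩
  lap f := ⟨manifoldLaplacian g f, contMDiff_laplacian g f.contMDiff⟩
  pot := algebraMap ℝ _ (1 / (2 * ((d : ℝ) - 1))) *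
    ⟨manifoldScalarCurvature g, contMDiff_scalarCurvature g⟩
  gr_comm f k := by
    ext x
    have hφ := chartAt_mem_maximalAtlas (d := d) x
    exact coordGr_comm (chartAt (Model d) x).open_target (smoothMetricOn_coordMetric hφ g)
      (contDiffOn_coordFun f.contMDiff hφ) (contDiffOn_coordFun k.contMDiff hφ)
      (mem_chart_target _ x)
  gr_add f k l := by
    ext x
    have hφ := chartAt_mem_maximalAtlas (d := d) x
    exact coordGr_add (chartAt (Model d) x).open_target (smoothMetricOn_coordMetric hφ g)
      (contDiffOn_coordFun f.contMDiff hφ) (contDiffOn_coordFun k.contMDiff hφ)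
      (contDiffOn_coordFun l.contMDiff hφ) (mem_chart_target _ x)
  gr_mul f k l := by
    ext x
    have hφ := chartAt_mem_maximalAtlas (d := d) x
    have := coordGr_mul (chartAt (Model d) x).open_target (smoothMetricOn_coordMetric hφ g)
      (contDiffOn_coordFun f.contMDiff hφ) (contDiffOn_coordFun k.contMDiff hφ)
      (contDiffOn_coordFun l.contMDiff hφ) (mem_chart_target _ x)
    simp only [coordFun, (chartAt (Model d) x).left_inv (mem_chart_source _ x)] at this
    exact this
  gr_algebraMap f r := by
    ext x
    exact coordGr_const _ _ r _
  lap_add f k := by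
    ext x
    have hφ := chartAt_mem_maximalAtlas (d := d) x
    exact laplacian_add (chartAt (Model d) x).open_target (smoothMetricOn_coordMetric hφ g)
      (contDiffOn_coordFun f.contMDiff hφ) (contDiffOn_coordFun k.contMDiff hφ)
      (mem_chart_target _ x)
  lap_mul f k := by
    ext x
    have hφ := chartAt_mem_maximalAtlas (d := d) x
    have := laplacian_mul (chartAt (Model d) x).open_target (smoothMetricOn_coordMetric hφ g)
      (contDiffOn_coordFun f.contMDiff hφ) (contDiffOn_coordFun k.contMDiff hφ)
      (mem_chart_target _ x)
    simp only [coordFun, (chartAt (Model d) x).left_inv (mem_chart_source _ x)] at this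
    rw [← map_ofNat (algebraMap ℝ C^∞⟮𝓡 d, M; 𝓘(ℝ, ℝ), ℝ⟯) 2]
    exact this
  lap_algebraMap r := by
    ext x
    exact laplacian_const _ r _

lemma yam_manifoldLaplaceAlg (f : C^∞⟮𝓡 d, M; 𝓘(ℝ, ℝ), ℝ⟯) (x : M) :
    (manifoldLaplaceAlg g).yam d f x = yamabeS g f x := by
  have h1 : (manifoldLaplaceAlg g).yam d f x = innerGrad g f f x
      - 2 / d * f x * (manifoldLaplacian g f x
        + 1 / (2 * ((d : ℝ) - 1)) * manifoldScalarCurvature g x * f x) := rfl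
  have h2 : yamabeS g f x = innerGrad g f f x
      - 2 / d * coordFun f (chartAt (Model d) x) (chartAt (Model d) x x) *
      (manifoldLaplacian g f x + manifoldScalarCurvature g x / (2 * ((d : ℝ) - 1))
        * coordFun f (chartAt (Model d) x) (chartAt (Model d) x x)) := rfl
  rw [h1, h2, coordFun, (chartAt (Model d) x).left_inv (mem_chart_source _ x)]
  ring

end Manifold

/-! ### The differential in charts -/

lemma gradSq_nonneg {d : ℕ} {G : MatrixField d} {y : Model d} (h : (G y).PosDef)
    (f : Model d → ℝ) : 0 ≤ gradSq G f y := by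
  have := h.inv.posSemidef.dotProduct_mulVec_nonneg (fun a => partialDeriv a f y)
  refine this.trans_eq ?_
  simp only [gradSq, dotProduct, Matrix.mulVec, Finset.mul_sum, star_trivial, inverseMetric]
  exact Finset.sum_congr rfl fun a _ => Finset.sum_congr rfl fun b _ => by ring

lemma gradSq_pos {d : ℕ} {G : MatrixField d} {y : Model d} (h : (G y).PosDef)
    {f : Model d → ℝ} (hf : fderiv ℝ f y ≠ 0) : 0 < gradSq G f y := by
  have h0 : (fun a => partialDeriv a f y) ≠ 0 := fun h0 => hf <| by
    ext v
    have hv : v = ∑ a, v a • (EuclideanSpace.single a 1 : Model d) := by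
      ext i; simp [Finset.sum_apply, Pi.single_apply]
    rw [hv, map_sum]
    refine Finset.sum_eq_zero fun a _ => ?_
    rw [map_smul]
    have : partialDeriv a f y = 0 := congrFun h0 a
    rw [partialDeriv] at this
    rw [this, smul_zero]
  have := h.inv.dotProduct_mulVec_pos h0
  refine this.trans_eq ?_
  simp only [gradSq, dotProduct, Matrix.mulVec, Finset.mul_sum, star_trivial, inverseMetric]
  exact Finset.sum_congr rfl fun a _ => Finset.sum_congr rfl fun b _ => by ring

section Manifold

variable {d : ℕ} {M : Type u} [TopologicalSpace M] [ChartedSpace (Model d) M]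
  [IsManifold (𝓡 d) ∞ M] {φ : OpenPartialHomeomorph M (Model d)}
  (hφ : φ ∈ IsManifold.maximalAtlas (𝓡 d) ∞ M) {f : M → ℝ}
  (hf : ContMDiff (𝓡 d) 𝓘(ℝ, ℝ) ∞ f)
include hφ hf

lemma fderiv_coordFun {y : Model d} (hy : y ∈ φ.target) (v : Model d) :
    fderiv ℝ (coordFun f φ) y v
      = differential d f (φ.symm y) (mfderiv (𝓡 d) (𝓡 d) φ.symm y v) := by
  have h1 := mfderiv_comp y ((hf (φ.symm y)).mdifferentiableAt (by simp))
    (mdifferentiableAt_symm hφ hy)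
  rw [mfderiv_eq_fderiv] at h1
  exact congrArg (fun L : Model d →L[ℝ] ℝ => L v) h1

lemma differential_apply {x : M} (hx : x ∈ φ.source) (v : TangentSpace (𝓡 d) x) :
    differential d f x v = fderiv ℝ (coordFun f φ) (φ x) (mfderiv (𝓡 d) (𝓡 d) φ x v) := by
  have hd := ((contDiffOn_coordFun hf hφ).contDiffAt
    (φ.open_target.mem_nhds (φ.map_source hx))).differentiableAt (by simp)
  have h1 := mfderiv_comp x hd.mdifferentiableAt (mdifferentiableAt_chart hφ hx)
  have h2 : coordFun f φ ∘ φ =ᶠ[nhds x] f := by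
    filter_upwards [φ.open_source.mem_nhds hx] with z hz
    simp only [Function.comp_apply, coordFun, φ.left_inv hz]
  rw [h2.mfderiv_eq, mfderiv_eq_fderiv] at h1
  exact congrArg (fun L : Model d →L[ℝ] ℝ => L v) h1

lemma fderiv_coordFun_ne_zero {x : M} (hx : x ∈ φ.source) (h : differential d f x ≠ 0) :
    fderiv ℝ (coordFun f φ) (φ x) ≠ 0 := fun h0 => h <| by
  ext v
  rw [differential_apply hφ hf hx, h0]
  rfl

lemma gradSq_pos_of_differential (g : Metric d M) {x : M} (hx : x ∈ φ.source)
    (h : differential d f x ≠ 0) : 0 < gradSq (coordMetric g φ) (coordFun f φ) (φ x) :=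
  gradSq_pos ((smoothMetricOn_coordMetric hφ g).posDef _ (φ.map_source hx))
    (fderiv_coordFun_ne_zero hφ hf hx h)

end Manifold

end

end HypersurfaceInvariants

/-! ### Conformal covariance of `S` and its solutions on a manifold -/

namespace HypersurfaceInvariants

noncomputable section

set_option linter.unusedSectionVars false

open SmAlg

lemma coordS_conf {d : ℕ} (hd : 2 ≤ d) {U : Set (Model d)} (hU : IsOpen U) {G G' : MatrixField d}
    (hG : SmoothMetricOn U G) (hG' : SmoothMetricOn U G') {Ω f : Model d → ℝ}
    (hΩ : ContDiffOn ℝ ∞ Ω U) (hf : ContDiffOn ℝ ∞ f U) (hpos : ∀ y ∈ U, 0 < Ω y)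
    (heq : ∀ y ∈ U, ∀ a b, G' y a b = Ω y ^ 2 * G y a b) {y : Model d} (hy : y ∈ U) :
    coordS G' (fun z => Ω z * f z) y = coordS G f y := by
  lift U to TopologicalSpace.Opens (Model d) using hU
  have hκ : ContDiffOn ℝ ∞ (fun z => (Ω z)⁻¹) U := hΩ.inv fun z hz => (hpos z hz).ne'
  have h1 := reps_yam hG' ((reps_mk Ω hΩ).mul (reps_mk f hf))
  rw [MetricAlg.yam_conf (metricAlg G hG) (metricAlg G' hG') hd rfl (SmAlg.mk Ω hΩ)
    (SmAlg.mk _ hκ)] at h1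
  · exact h1.eqOn (reps_yam hG (reps_mk f hf)) hy
  · refine ((reps_mk Ω hΩ).mul (reps_mk _ hκ)).unique fun z => ?_
    exact mul_inv_cancel₀ (hpos z z.2).ne'
  · intro a b
    refine (reps_G hG' a b).unique fun z => ?_
    exact (heq z z.2 a b).trans (by
      exact (((reps_mk Ω hΩ).pow 2).mul (reps_G hG a b)) z)

section Manifold

variable {d : ℕ} {M : Type u} [TopologicalSpace M] [ChartedSpace (Model d) M]
  [IsManifold (𝓡 d) ∞ M]

lemma IsRescaling.yamabeS_mul (hd : 2 ≤ d) {g g' : Metric d M} {Ω : M → ℝ}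
    (h : IsRescaling Ω g g') {f : M → ℝ} (hf : ContMDiff (𝓡 d) 𝓘(ℝ, ℝ) ∞ f) (x : M) :
    yamabeS g' (fun z => Ω z * f z) x = yamabeS g f x := by
  have hφ := chartAt_mem_maximalAtlas (d := d) x
  exact coordS_conf hd (chartAt (Model d) x).open_target (smoothMetricOn_coordMetric hφ g)
    (smoothMetricOn_coordMetric hφ g') (contDiffOn_coordFun h.smooth hφ)
    (contDiffOn_coordFun hf hφ) (fun _ _ => h.pos _) (fun _ _ _ _ => h.eq _ _ _)
    (mem_chart_target _ x)

/-- The submonoid of positive smooth functions. -/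
def positiveFunctions (d : ℕ) (M : Type u) [TopologicalSpace M] [ChartedSpace (Model d) M] :
    Submonoid (C^∞⟮𝓡 d, M; 𝓘(ℝ, ℝ), ℝ⟯) where
  carrier := {f | ∀ x, 0 < f x}
  one_mem' _ := one_pos
  mul_mem' hf hk x := mul_pos (hf x) (hk x)

lemma contMDiff_inv_of_pos {f : M → ℝ} (hf : ContMDiff (𝓡 d) 𝓘(ℝ, ℝ) ∞ f) (h : ∀ x, 0 < f x) :
    ContMDiff (𝓡 d) 𝓘(ℝ, ℝ) ∞ fun x => (f x)⁻¹ := fun x =>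
  (contDiffAt_inv ℝ (h x).ne').contMDiffAt.comp x (hf x)

lemma contMDiff_sqrt_of_pos {f : M → ℝ} (hf : ContMDiff (𝓡 d) 𝓘(ℝ, ℝ) ∞ f) (h : ∀ x, 0 < f x) :
    ContMDiff (𝓡 d) 𝓘(ℝ, ℝ) ∞ fun x => Real.sqrt (f x) := fun x =>
  (Real.contDiffAt_sqrt (h x).ne').contMDiffAt.comp x (hf x)

/-- The singular Yamabe problem is solved to order `d` by a multiple of any defining function. -/
theorem exists_solution (hd : 0 < d) (g : Metric d M) {s : M → ℝ} (hs : IsDefiningFunction d s) :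
    ∃ m B : M → ℝ, ContMDiff (𝓡 d) 𝓘(ℝ, ℝ) ∞ m ∧ ContMDiff (𝓡 d) 𝓘(ℝ, ℝ) ∞ B ∧
      (∀ x, 0 < m x) ∧
      ∀ x, yamabeS g (fun z => s z * m z) x = 1 + (s x * m x) ^ d * B x := by
  -- On the zero locus the gradient term is positive because `s` is a defining function; elsewhere
  -- `s²` is.
  have hq : ∀ x, 0 < innerGrad g s s x + s x ^ 2 := fun x => by
    have hφ := chartAt_mem_maximalAtlas (d := d) x
    by_cases h0 : s x = 0
    · exact add_pos_of_pos_of_nonneg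
        (gradSq_pos_of_differential hφ hs.smooth g (mem_chart_source _ x) (hs.regular x h0))
        (sq_nonneg _)
    · have : 0 ≤ innerGrad g s s x := gradSq_nonneg
        ((smoothMetricOn_coordMetric hφ g).posDef _ (mem_chart_target _ x)) _
      positivity
  have hq' : ContMDiff (𝓡 d) 𝓘(ℝ, ℝ) ∞ fun x => innerGrad g s s x + s x ^ 2 :=
    (contMDiff_innerGrad g hs.smooth hs.smooth).add (hs.smooth.pow 2)
  have hh := contMDiff_inv_of_pos (contMDiff_sqrt_of_pos hq' hq)
    fun x => Real.sqrt_pos.mpr (hq x)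
  set S : C^∞⟮𝓡 d, M; 𝓘(ℝ, ℝ), ℝ⟯ := ⟨s, hs.smooth⟩ with hS
  set H : C^∞⟮𝓡 d, M; 𝓘(ℝ, ℝ), ℝ⟯ := ⟨_, hh⟩ with hH
  have h1 : ∀ a : C^∞⟮𝓡 d, M; 𝓘(ℝ, ℝ), ℝ⟯, 1 + a + a ^ 2 ∈ positiveFunctions d M := fun a x => by
    have : (1 + a + a ^ 2 : C^∞⟮𝓡 d, M; 𝓘(ℝ, ℝ), ℝ⟯) x = 1 + a x + a x ^ 2 := rfl
    rw [this]
    nlinarith [sq_nonneg (a x + 1 / 2)]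
  have h2 : ∀ m ∈ positiveFunctions d M, ∃ u, u * m = 1 := fun m hm =>
    ⟨⟨_, contMDiff_inv_of_pos m.contMDiff hm⟩, by
      ext x; exact inv_mul_cancel₀ (hm x).ne'⟩
  have h3 : H ∈ positiveFunctions d M := fun x => inv_pos.mpr (Real.sqrt_pos.mpr (hq x))
  have h4 : H ^ 2 * ((manifoldLaplaceAlg g).gr S S + S ^ 2) = 1 := by
    ext x
    have : (H ^ 2 * ((manifoldLaplaceAlg g).gr S S + S ^ 2)) x
        = (Real.sqrt (innerGrad g s s x + s x ^ 2))⁻¹ ^ 2 * (innerGrad g s s x + s x ^ 2) := rfl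
    rw [this, inv_pow, Real.sq_sqrt (hq x).le, inv_mul_cancel₀ (hq x).ne']
    rfl
  obtain ⟨m, hm, B, hB⟩ := (manifoldLaplaceAlg g).exists_solution hd _ h1 h2 h3 h4
  refine ⟨m, B, m.contMDiff, B.contMDiff, hm, fun x => ?_⟩
  have h5 : yamabeS g (fun z => s z * m z) x = (1 + (S * m) ^ d * B) x :=
    (yam_manifoldLaplaceAlg g (S * m) x).symm.trans (by rw [hB])
  rw [h5]
  rfl

/-! ### Densities -/

namespace IsRescaling

variable {g g' g'' : Metric d M} {Ω Ω' : M → ℝ}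

lemma refl (g : Metric d M) : IsRescaling (fun _ => 1) g g :=
  ⟨contMDiff_const, fun _ => one_pos, fun _ _ _ => by simp⟩

lemma symm (h : IsRescaling Ω g g') : IsRescaling (fun x => (Ω x)⁻¹) g' g :=
  ⟨contMDiff_inv_of_pos h.smooth h.pos, fun x => inv_pos.mpr (h.pos x), fun x v w => by
    rw [h.eq, ← mul_assoc, ← mul_pow, inv_mul_cancel₀ (h.pos x).ne', one_pow, one_mul]⟩

lemma trans (h : IsRescaling Ω g g') (h' : IsRescaling Ω' g' g'') :
    IsRescaling (fun x => Ω' x * Ω x) g g'' :=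
  ⟨h'.smooth.mul h.smooth, fun x => mul_pos (h'.pos x) (h.pos x), fun x v w => by
    rw [h'.eq, h.eq]; ring⟩

/-- Positive dimension supplies a nonzero tangent vector on which to compare the metrics. Uniqueness
of the factor makes a density prescribed in one scale satisfy the transformation law between any two
scales. -/
lemma unique (hd : 0 < d) (h : IsRescaling Ω g g') (h' : IsRescaling Ω' g g') (x : M) :
    Ω x = Ω' x := by
  obtain ⟨v, hv⟩ : ∃ v : TangentSpace (𝓡 d) x, v ≠ 0 := by
    refine ⟨(EuclideanSpace.single ⟨0, hd⟩ 1 : Model d), fun h0 => ?_⟩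
    have := congrArg (fun v : Model d => v ⟨0, hd⟩) h0
    simp only [PiLp.single_apply, if_true] at this
    exact one_ne_zero this
  have h1 := (h.eq x v v).symm.trans (h'.eq x v v)
  have h2 := mul_right_cancel₀ (g.pos x v hv).ne' h1
  exact (pow_left_inj₀ (h.pos x).le (h'.pos x).le two_ne_zero).mp h2

lemma contMDiff_rpow (h : IsRescaling Ω g g') (w : ℝ) :
    ContMDiff (𝓡 d) 𝓘(ℝ, ℝ) ∞ fun x => Ω x ^ w := fun x =>
  (Real.contDiffAt_rpow_const_of_ne (h.pos x).ne').contMDiffAt.comp x (h.smooth x)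

end IsRescaling

namespace ConformalStructure

variable (c : ConformalStructure d M)

lemma exists_isRescaling {g g' : Metric d M} (hg : g ∈ c.metrics) (hg' : g' ∈ c.metrics) :
    ∃ Ω, IsRescaling Ω g g' := by
  obtain ⟨g₀, h₀⟩ := c.isClass
  rw [h₀] at hg hg'
  obtain ⟨Ω, h⟩ := hg
  obtain ⟨Ω', h'⟩ := hg'
  exact ⟨_, h.symm.trans h'⟩

/-- The conformal class of a metric. -/
def ofMetric (g : Metric d M) : ConformalStructure d M where
  metrics := {g' | ∃ Ω, IsRescaling Ω g g'}
  isClass := ⟨g, rfl⟩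

variable {c} in
/-- The density that is given by a function in one scale. -/
lemma exists_density (hd : 0 < d) (g₀ : c.metrics) (w : ℝ) {f : M → ℝ}
    (hf : ContMDiff (𝓡 d) 𝓘(ℝ, ℝ) ∞ f) : ∃ F : Density c w,
      ∀ (g : c.metrics) (Ω : M → ℝ), IsRescaling Ω g₀.1 g.1 → ∀ x, F.toFun g x = Ω x ^ w * f x := by
  choose Ω hΩ using fun g : c.metrics => c.exists_isRescaling g₀.2 g.2
  refine ⟨⟨fun g x => Ω g x ^ w * f x, fun g => ((hΩ g).contMDiff_rpow w).mul hf,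
    fun g g' Ω' h x => ?_⟩, fun g Ω' h x => ?_⟩
  · rw [← ((hΩ g).trans h).unique hd (hΩ g') x, Real.mul_rpow (h.pos x).le ((hΩ g).pos x).le]
    ring
  · change Ω g x ^ w * f x = _
    rw [h.unique hd (hΩ g) x]

end ConformalStructure

end Manifold

end

end HypersurfaceInvariants

namespace HypersurfaceInvariants

noncomputable section

/-! ## Universal polynomials in the jets of the metric and the defining function -/

/-- A patch with a smooth metric and a smooth function without critical points. -/
structure IsRegularPatch {d : ℕ} (U : Set (Model d)) (G : MatrixField d) (s : Model d → ℝ) :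
    Prop where
  isOpen : IsOpen U
  metric : SmoothMetricOn U G
  smooth : ContDiffOn ℝ ∞ s U
  pos : ∀ y ∈ U, 0 < gradSq G s y

/-- A scalar that is given by a universal polynomial in the jet variables. -/
def IsJetPolynomial {d : ℕ} (T : MatrixField d → (Model d → ℝ) → Model d → ℝ) : Prop :=
  ∃ p : MvPolynomial (JetVar d) ℝ, ∀ U G s, IsRegularPatch U G s → ∀ y ∈ U,
    T G s y = MvPolynomial.eval (JetVar.val G s y) p

variable {d : ℕ}

lemma contDiffOn_partialDerivs {U : Set (Model d)} (hU : IsOpen U) {F : Model d → ℝ}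
    (hF : ContDiffOn ℝ ∞ F U) : ∀ L : List (Fin d), ContDiffOn ℝ ∞ (partialDerivs L F) U
  | [] => hF
  | a :: L => contDiffOn_partialDeriv hU (contDiffOn_partialDerivs hU hF L) a

lemma IsRegularPatch.contDiffOn_val {U : Set (Model d)} {G : MatrixField d} {s : Model d → ℝ}
    (h : IsRegularPatch U G s) (v : JetVar d) : ContDiffOn ℝ ∞ (fun y => v.val G s y) U := by
  cases v with
  | metric L b c => exact contDiffOn_partialDerivs h.isOpen (h.metric.smooth b c) L
  | detInv => exact (contDiffOn_det h.metric.smooth).inv fun y hy => h.metric.det_ne hy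
  | func L => exact contDiffOn_partialDerivs h.isOpen h.smooth L
  | normInv =>
    exact ((contDiffOn_gradSq h.isOpen h.metric h.smooth).sqrt fun y hy => (h.pos y hy).ne').inv
      fun y hy => (Real.sqrt_pos.mpr (h.pos y hy)).ne'

namespace IsJetPolynomial

variable {T T' : MatrixField d → (Model d → ℝ) → Model d → ℝ}

lemma contDiffOn (hT : IsJetPolynomial T) {U : Set (Model d)} {G : MatrixField d}
    {s : Model d → ℝ} (h : IsRegularPatch U G s) : ContDiffOn ℝ ∞ (T G s) U := by
  obtain ⟨p, hp⟩ := hT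
  refine ContDiffOn.congr ?_ (hp U G s h)
  clear hp
  induction p using MvPolynomial.induction_on with
  | C r => simpa using contDiffOn_const
  | add p q hp hq => simpa using hp.add hq
  | mul_X p v hp => simpa using hp.mul (h.contDiffOn_val v)

lemma congr (hT : IsJetPolynomial T)
    (h : ∀ U G s, IsRegularPatch U G s → ∀ y ∈ U, T' G s y = T G s y) : IsJetPolynomial T' := by
  obtain ⟨p, hp⟩ := hT
  exact ⟨p, fun U G s hr y hy => (h U G s hr y hy).trans (hp U G s hr y hy)⟩

lemma var (v : JetVar d) : IsJetPolynomial fun G s y => v.val G s y :=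
  ⟨MvPolynomial.X v, fun U G s _ y _ => by simp⟩

lemma const (r : ℝ) : IsJetPolynomial (d := d) fun _ _ _ => r :=
  ⟨MvPolynomial.C r, fun U G s _ y _ => by simp⟩

lemma add (h : IsJetPolynomial T) (h' : IsJetPolynomial T') :
    IsJetPolynomial fun G s y => T G s y + T' G s y := by
  obtain ⟨p, hp⟩ := h
  obtain ⟨q, hq⟩ := h'
  exact ⟨p + q, fun U G s hr y hy => by
    simp only [map_add, hp U G s hr y hy, hq U G s hr y hy]⟩

lemma mul (h : IsJetPolynomial T) (h' : IsJetPolynomial T') :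
    IsJetPolynomial fun G s y => T G s y * T' G s y := by
  obtain ⟨p, hp⟩ := h
  obtain ⟨q, hq⟩ := h'
  exact ⟨p * q, fun U G s hr y hy => by
    simp only [map_mul, hp U G s hr y hy, hq U G s hr y hy]⟩

lemma sub (h : IsJetPolynomial T) (h' : IsJetPolynomial T') :
    IsJetPolynomial fun G s y => T G s y - T' G s y :=
  (h.add ((const (-1)).mul h')).congr fun U G s _ y _ => by ring

variable {ι : Type*} {S : Finset ι} {t : ι → MatrixField d → (Model d → ℝ) → Model d → ℝ}

lemma sum (h : ∀ i ∈ S, IsJetPolynomial (t i)) :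
    IsJetPolynomial fun G s y => ∑ i ∈ S, t i G s y := by
  classical
  induction S using Finset.induction_on with
  | empty => simpa using const 0
  | insert i S hi ih =>
    simp only [Finset.sum_insert hi]
    exact (h i (Finset.mem_insert_self i S)).add
      (ih fun j hj => h j (Finset.mem_insert_of_mem hj))

lemma prod (h : ∀ i ∈ S, IsJetPolynomial (t i)) :
    IsJetPolynomial fun G s y => ∏ i ∈ S, t i G s y := by
  classical
  induction S using Finset.induction_on with
  | empty => simpa using const 1
  | insert i S hi ih =>
    simp only [Finset.prod_insert hi]
    exact (h i (Finset.mem_insert_self i S)).mul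
      (ih fun j hj => h j (Finset.mem_insert_of_mem hj))

end IsJetPolynomial

/-- A jet polynomial whose first derivatives are jet polynomials. -/
structure HasJetDeriv (T : MatrixField d → (Model d → ℝ) → Model d → ℝ) : Prop where
  poly : IsJetPolynomial T
  deriv : ∀ a, IsJetPolynomial fun G s => partialDeriv a (T G s)

namespace HasJetDeriv

open IsJetPolynomial

variable {T T' : MatrixField d → (Model d → ℝ) → Model d → ℝ}

lemma congr (hT : HasJetDeriv T)
    (h : ∀ U G s, IsRegularPatch U G s → ∀ y ∈ U, T' G s y = T G s y) : HasJetDeriv T' :=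
  ⟨hT.poly.congr h, fun a => (hT.deriv a).congr fun U G s hr _ hy =>
    partialDeriv_congr hr.isOpen (h U G s hr) a hy⟩

lemma const (r : ℝ) : HasJetDeriv (d := d) fun _ _ _ => r :=
  ⟨.const r, fun a => (IsJetPolynomial.const 0).congr fun U G s _ y _ => by simp [partialDeriv]⟩

lemma add (h : HasJetDeriv T) (h' : HasJetDeriv T') :
    HasJetDeriv fun G s y => T G s y + T' G s y :=
  ⟨h.poly.add h'.poly, fun a => ((h.deriv a).add (h'.deriv a)).congr fun _ _ _ hr _ hy =>
    partialDeriv_add (differentiableAt_of_contDiffOn hr.isOpen (h.poly.contDiffOn hr) hy)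
      (differentiableAt_of_contDiffOn hr.isOpen (h'.poly.contDiffOn hr) hy) a⟩

lemma mul (h : HasJetDeriv T) (h' : HasJetDeriv T') :
    HasJetDeriv fun G s y => T G s y * T' G s y :=
  ⟨h.poly.mul h'.poly, fun a => ((h.poly.mul (h'.deriv a)).add (h'.poly.mul (h.deriv a))).congr
    fun _ _ _ hr _ hy =>
      partialDeriv_mul (differentiableAt_of_contDiffOn hr.isOpen (h.poly.contDiffOn hr) hy)
        (differentiableAt_of_contDiffOn hr.isOpen (h'.poly.contDiffOn hr) hy) a⟩

variable {ι : Type*} {S : Finset ι} {t : ι → MatrixField d → (Model d → ℝ) → Model d → ℝ}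

lemma sum (h : ∀ i ∈ S, HasJetDeriv (t i)) : HasJetDeriv fun G s y => ∑ i ∈ S, t i G s y := by
  classical
  induction S using Finset.induction_on with
  | empty => simpa using const 0
  | insert i S hi ih =>
    simp only [Finset.sum_insert hi]
    exact (h i (Finset.mem_insert_self i S)).add
      (ih fun j hj => h j (Finset.mem_insert_of_mem hj))

lemma prod (h : ∀ i ∈ S, HasJetDeriv (t i)) : HasJetDeriv fun G s y => ∏ i ∈ S, t i G s y := by
  classical
  induction S using Finset.induction_on with
  | empty => simpa using const 1
  | insert i S hi ih =>
    simp only [Finset.prod_insert hi]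
    exact (h i (Finset.mem_insert_self i S)).mul
      (ih fun j hj => h j (Finset.mem_insert_of_mem hj))

lemma det {A : MatrixField d → (Model d → ℝ) → MatrixField d}
    (h : ∀ a b, HasJetDeriv fun G s y => A G s y a b) :
    HasJetDeriv fun G s y => (A G s y).det := by
  simp only [Matrix.det_apply']
  exact sum fun p _ => (const _).mul (prod fun i _ => h _ _)

lemma metric (L : List (Fin d)) (b c : Fin d) :
    HasJetDeriv fun G s y => (JetVar.metric L b c).val G s y :=
  ⟨var _, fun a => var (.metric (a :: L) b c)⟩

lemma func (L : List (Fin d)) : HasJetDeriv fun G s y => (JetVar.func L).val G s y :=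
  ⟨var _, fun a => var (.func (a :: L))⟩

lemma adjugate (a b : Fin d) :
    HasJetDeriv fun (G : MatrixField d) _ y => (G y).adjugate a b := by
  simp only [Matrix.adjugate_apply]
  refine det fun i j => ?_
  by_cases hi : i = b
  · subst hi
    simp only [Matrix.updateRow_self]
    exact const _
  · simp only [Matrix.updateRow_ne hi]
    exact metric [] i j

lemma detInv : HasJetDeriv (d := d) fun G s y => JetVar.detInv.val G s y := by
  refine ⟨var _, fun a => ?_⟩
  have hdet : HasJetDeriv (d := d) fun G _ y => (G y).det := det fun i j => metric [] i j
  refine ((IsJetPolynomial.const (-1)).mul (((var .detInv).mul (var .detInv)).mul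
    (hdet.deriv a))).congr fun U G s hr y hy => ?_
  have h1 := (differentiableAt_of_contDiffOn hr.isOpen (hdet.poly.contDiffOn hr) hy).hasFDerivAt
  have h2 := (hasDerivAt_inv (hr.metric.det_ne hy)).comp_hasFDerivAt y h1
  have h3 : partialDeriv a (fun z => JetVar.detInv.val G s z) y = _ :=
    congrArg (fun L : Model d →L[ℝ] ℝ => L (EuclideanSpace.single a 1)) h2.fderiv
  rw [h3]
  simp only [JetVar.val, partialDeriv, smul_apply, smul_eq_mul]
  ring

lemma inverseMetric (a b : Fin d) :
    HasJetDeriv fun G _ y => HypersurfaceInvariants.inverseMetric (d := d) G y a b := by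
  simp only [HypersurfaceInvariants.inverseMetric, inv_apply_eq]
  exact detInv.mul (adjugate a b)

lemma gradSq : HasJetDeriv (d := d) HypersurfaceInvariants.gradSq :=
  sum fun a _ => sum fun b _ => ((inverseMetric a b).mul (func [a])).mul (func [b])

lemma normInv : HasJetDeriv (d := d) fun G s y => JetVar.normInv.val G s y := by
  refine ⟨var _, fun a => ?_⟩
  -- This is `∂(|ds|⁻¹) = -½ |ds|⁻³ ∂(|ds|²)`, and `|ds|²` is itself a jet polynomial with
  -- differentiable expression, so the jet variables suffice.
  refine ((IsJetPolynomial.const (-1 / 2)).mul ((((var .normInv).mul (var .normInv)).mul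
    (var .normInv)).mul (gradSq.deriv a))).congr fun U G s hr y hy => ?_
  have h1 := (differentiableAt_of_contDiffOn hr.isOpen (gradSq.poly.contDiffOn hr) hy).hasFDerivAt
  have hq := Real.sqrt_pos.mpr (hr.pos y hy)
  have h2 := (hasDerivAt_inv hq.ne').comp_hasFDerivAt y
    ((Real.hasDerivAt_sqrt (hr.pos y hy).ne').comp_hasFDerivAt y h1)
  have h3 : partialDeriv a (fun z => JetVar.normInv.val G s z) y = _ :=
    congrArg (fun L : Model d →L[ℝ] ℝ => L (EuclideanSpace.single a 1)) h2.fderiv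
  rw [h3]
  simp only [JetVar.val, partialDeriv, smul_apply, smul_eq_mul]
  field_simp

lemma var (v : JetVar d) : HasJetDeriv fun G s y => v.val G s y := by
  cases v with
  | metric L b c => exact metric L b c
  | detInv => exact detInv
  | func L => exact func L
  | normInv => exact normInv

end HasJetDeriv

namespace IsJetPolynomial

/-- By the product rule it is enough to differentiate the variables. Derivatives of `g` and `s` are
again variables; `(det g)⁻¹` and `|ds|⁻¹` are treated in `HasJetDeriv.detInv` and
`HasJetDeriv.normInv`. Hence jet polynomials are closed under repeated differentiation. -/
lemma hasJetDeriv {T : MatrixField d → (Model d → ℝ) → Model d → ℝ} (h : IsJetPolynomial T) :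
    HasJetDeriv T := by
  obtain ⟨p, hp⟩ := h
  refine HasJetDeriv.congr ?_ hp
  clear hp
  induction p using MvPolynomial.induction_on with
  | C r => simpa using HasJetDeriv.const r
  | add p q hp hq => simpa using hp.add hq
  | mul_X p v hp => simpa using hp.mul (HasJetDeriv.var v)

lemma partialDeriv {T : MatrixField d → (Model d → ℝ) → Model d → ℝ} (h : IsJetPolynomial T)
    (a : Fin d) : IsJetPolynomial fun G s => partialDeriv a (T G s) := h.hasJetDeriv.deriv a

lemma metric (a b : Fin d) : IsJetPolynomial fun (G : MatrixField d) _ y => G y a b :=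
  var (.metric [] a b)

lemma inverseMetric (a b : Fin d) :
    IsJetPolynomial fun G _ y => HypersurfaceInvariants.inverseMetric (d := d) G y a b :=
  (HasJetDeriv.inverseMetric a b).poly

lemma christoffel (c a b : Fin d) :
    IsJetPolynomial fun G _ => HypersurfaceInvariants.christoffel (d := d) G c a b :=
  (const _).mul (sum fun e _ => (inverseMetric c e).mul
    ((((metric b e).partialDeriv a).add ((metric a e).partialDeriv b)).sub
      ((metric a b).partialDeriv e)))

lemma covDeriv {k : ℕ} {T : MatrixField d → (Model d → ℝ) → TensorField d k}
    (h : ∀ I, IsJetPolynomial fun G s => T G s I) (I : Fin (k + 1) → Fin d) :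
    IsJetPolynomial fun G s => HypersurfaceInvariants.covDeriv G (T G s) I :=
  ((h _).partialDeriv _).sub (sum fun _ _ => sum fun _ _ => (christoffel _ _ _).mul (h _))

lemma riemannUp (a b c e : Fin d) :
    IsJetPolynomial fun G _ => HypersurfaceInvariants.riemannUp (d := d) G a b c e :=
  (((christoffel _ _ _).partialDeriv _).sub ((christoffel _ _ _).partialDeriv _)).add
    (sum fun _ _ => ((christoffel _ _ _).mul (christoffel _ _ _)).sub
      ((christoffel _ _ _).mul (christoffel _ _ _)))

lemma riemannDeriv (k : ℕ) (I : Fin (4 + k) → Fin d) :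
    IsJetPolynomial fun G _ => HypersurfaceInvariants.riemannDeriv (d := d) G k I := by
  induction k with
  | zero =>
    exact (sum fun e _ => (metric (I 2) e).mul (riemannUp (I 0) (I 1) e (I 3)) :
      IsJetPolynomial fun G _ => riemann G I)
  | succ k ih => exact covDeriv ih I

lemma conormal (I : Fin 1 → Fin d) :
    IsJetPolynomial fun G s => HypersurfaceInvariants.conormal (d := d) G s I :=
  ((var (.func [I 0])).mul (var .normInv)).congr fun _ _ _ _ _ _ => div_eq_mul_inv _ _

lemma tangProj (a b : Fin d) :
    IsJetPolynomial fun G s => HypersurfaceInvariants.tangProj (d := d) G s a b :=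
  (const _).sub ((conormal _).mul (sum fun _ _ => (inverseMetric _ _).mul (conormal _)))

lemma secondFFDeriv (l : ℕ) (I : Fin (2 + l) → Fin d) :
    IsJetPolynomial fun G s => HypersurfaceInvariants.secondFFDeriv (d := d) G s l I := by
  induction l with
  | zero =>
    exact (sum fun c _ => (tangProj (I 0) c).mul (covDeriv conormal ![c, I 1]) :
      IsJetPolynomial fun G s => secondFF G s I)
  | succ l ih => exact sum fun _ _ => (prod fun _ _ => tangProj _ _).mul (covDeriv ih _)

end IsJetPolynomial

lemma HypExpr.isJetPolynomial {k : ℕ} (e : HypExpr k) (I : Fin k → Fin d) :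
    IsJetPolynomial fun G s => e.eval G s I := by
  induction e with
  | const c => exact .const c
  | metric => exact .metric _ _
  | conormal => exact .conormal I
  | secondFF l => exact .secondFFDeriv l I
  | curvature k => exact .riemannDeriv k I
  | add e f h1 h2 => exact (h1 I).add (h2 I)
  | mul e f h1 h2 => exact (h1 _).mul (h2 _)
  | permute p e h1 => exact h1 _
  | contract e h1 => exact .sum fun _ _ => .sum fun _ _ => (IsJetPolynomial.inverseMetric _ _).mul (h1 _)

end

end HypersurfaceInvariants

namespace HypersurfaceInvariants

noncomputable section

/-! ## The obstruction density -/

set_option linter.unusedSectionVars false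

section Manifold

variable {d : ℕ} {M : Type u} [TopologicalSpace M] [ChartedSpace (Model d) M]
  [IsManifold (𝓡 d) ∞ M]

namespace CompatiblyOriented

variable {s s' s'' : M → ℝ}

lemma symm (h : CompatiblyOriented d s s') : CompatiblyOriented d s' s :=
  ⟨fun x => (h.zeroLocus x).symm, fun x hx => by
    obtain ⟨r, hr, he⟩ := h.orientation x ((h.zeroLocus x).mpr hx)
    exact ⟨r⁻¹, inv_pos.mpr hr, by rw [he, smul_smul, inv_mul_cancel₀ hr.ne', one_smul]⟩⟩

lemma trans (h : CompatiblyOriented d s s') (h' : CompatiblyOriented d s' s'') :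
    CompatiblyOriented d s s'' :=
  ⟨fun x => (h.zeroLocus x).trans (h'.zeroLocus x), fun x hx => by
    obtain ⟨r, hr, he⟩ := h.orientation x hx
    obtain ⟨r', hr', he'⟩ := h'.orientation x ((h.zeroLocus x).mp hx)
    exact ⟨r' * r, mul_pos hr' hr, by rw [he', he, smul_smul]⟩⟩

end CompatiblyOriented

lemma differential_mul_of_eq_zero {s m : M → ℝ} (hs : ContMDiff (𝓡 d) 𝓘(ℝ, ℝ) ∞ s)
    (hm : ContMDiff (𝓡 d) 𝓘(ℝ, ℝ) ∞ m) {x : M} (h0 : s x = 0) :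
    differential d (fun z => s z * m z) x = m x • differential d s x := by
  have hφ := chartAt_mem_maximalAtlas (d := d) x
  have hx := mem_chart_source (Model d) x
  have hd : ∀ {f : M → ℝ}, ContMDiff (𝓡 d) 𝓘(ℝ, ℝ) ∞ f → DifferentiableAt ℝ
      (coordFun f (chartAt (Model d) x)) (chartAt (Model d) x x) := fun hf =>
    differentiableAt_of_contDiffOn (chartAt (Model d) x).open_target
      (contDiffOn_coordFun hf hφ) (mem_chart_target _ x)
  have h1 := fderiv_fun_mul (hd hs) (hd hm)
  have hl : ∀ f : M → ℝ, coordFun f (chartAt (Model d) x) (chartAt (Model d) x x) = f x :=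
    fun f => congrArg f ((chartAt (Model d) x).left_inv hx)
  rw [hl, hl, h0, zero_smul, zero_add] at h1
  have hsm : ContMDiff (𝓡 d) 𝓘(ℝ, ℝ) ∞ fun z => s z * m z := hs.mul hm
  ext v
  change differential d (fun z => s z * m z) x v = m x * differential d s x v
  rw [differential_apply hφ hsm hx, differential_apply hφ hs hx]
  exact congrArg (fun L : Model d →L[ℝ] ℝ => L _) h1

lemma IsDefiningFunction.mul {s m : M → ℝ} (hs : IsDefiningFunction d s)
    (hm : ContMDiff (𝓡 d) 𝓘(ℝ, ℝ) ∞ m) (hpos : ∀ x, 0 < m x) :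
    IsDefiningFunction d (fun z => s z * m z) ∧ CompatiblyOriented d s (fun z => s z * m z) := by
  have h0 : ∀ x, s x * m x = 0 ↔ s x = 0 := fun x => by simp [(hpos x).ne']
  refine ⟨⟨hs.smooth.mul hm, fun x hx => ?_⟩, fun x => (h0 x).symm, fun x hx =>
    ⟨m x, hpos x, differential_mul_of_eq_zero hs.smooth hm hx⟩⟩
  rw [differential_mul_of_eq_zero hs.smooth hm ((h0 x).mp hx)]
  exact smul_ne_zero (hpos x).ne' (hs.regular x ((h0 x).mp hx))

/-- A defining density of a hypersurface that solves the singular Yamabe problem to order `d`,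
with its remainder. -/
structure IsYamabeSolution {c : ConformalStructure d M} (s : M → ℝ) (σ : Density c 1)
    (B : Density c (-(d : ℝ))) : Prop where
  isDefining : IsDefiningDensity s σ
  eq : ∀ g x, yamabeS g.1 (σ.toFun g) x = 1 + σ.toFun g x ^ d * B.toFun g x

/-- Solve in one scale and extend both functions as densities. The equation persists in the other
scales since `S` is invariant and the factors `Ω^d` and `Ω^(-d)` of `σ^d` and `B` cancel. -/
theorem exists_isYamabeSolution (hd : 2 ≤ d) (c : ConformalStructure d M) {s : M → ℝ}
    (hs : IsDefiningFunction d s) :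
    ∃ (σ : Density c 1) (B : Density c (-(d : ℝ))), IsYamabeSolution s σ B := by
  have hd0 : 0 < d := by omega
  obtain ⟨g, hg⟩ : c.metrics.Nonempty := by
    obtain ⟨g, hg⟩ := c.isClass
    exact ⟨g, by rw [hg]; exact ⟨_, IsRescaling.refl g⟩⟩
  obtain ⟨m, B, hm, hB, hpos, heq⟩ := exists_solution hd0 g hs
  have hsm : ContMDiff (𝓡 d) 𝓘(ℝ, ℝ) ∞ fun z => s z * m z := hs.smooth.mul hm
  obtain ⟨σ, hσ⟩ := ConformalStructure.exists_density hd0 ⟨g, hg⟩ 1 hsm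
  obtain ⟨b, hb⟩ := ConformalStructure.exists_density hd0 ⟨g, hg⟩ (-(d : ℝ)) hB
  have hσ' : ∀ (g' : c.metrics) (Ω : M → ℝ), IsRescaling Ω g g'.1 →
      σ.toFun g' = fun z => Ω z * (s z * m z) := fun g' Ω h => funext fun x => by
    rw [hσ g' Ω h, Real.rpow_one]
  refine ⟨σ, b, fun g' => ?_, fun g' x => ?_⟩
  · obtain ⟨Ω, h⟩ := c.exists_isRescaling hg g'.2
    rw [hσ' g' Ω h, show (fun z => Ω z * (s z * m z)) = fun z => s z * (Ω z * m z) from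
      funext fun z => by ring]
    exact hs.mul (h.smooth.mul hm) fun x => mul_pos (h.pos x) (hpos x)
  · obtain ⟨Ω, h⟩ := c.exists_isRescaling hg g'.2
    rw [hb g' Ω h, hσ' g' Ω h, h.yamabeS_mul hd hsm, heq, mul_pow (Ω x),
      Real.rpow_neg (h.pos x).le, Real.rpow_natCast]
    have := (pow_pos (h.pos x) d).ne'
    field_simp

lemma IsYamabeSolution.of_compatiblyOriented {c : ConformalStructure d M} {s s' : M → ℝ}
    {σ : Density c 1} {B : Density c (-(d : ℝ))} (h : IsYamabeSolution s σ B)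
    (hs : CompatiblyOriented d s s') : IsYamabeSolution s' σ B :=
  ⟨fun g => ⟨(h.isDefining g).1, hs.symm.trans (h.isDefining g).2⟩, h.eq⟩

lemma IsYamabeSolution.eq_eval {c : ConformalStructure d M} {s : M → ℝ}
    {σ : Density c 1} {B : Density c (-(d : ℝ))} (h : IsYamabeSolution s σ B)
    (hs : ContMDiff (𝓡 d) 𝓘(ℝ, ℝ) ∞ s) {e : HypExpr 0} (he : IsObstructionExpr d e)
    (g : c.metrics) {φ : OpenPartialHomeomorph M (Model d)}
    (hφ : φ ∈ IsManifold.maximalAtlas (𝓡 d) ∞ M) {x : M} (hx : x ∈ φ.source) (h0 : s x = 0) :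
    B.toFun g x = e.eval (coordMetric g.1 φ) (coordFun s φ) Fin.elim0 (φ x) := by
  have hl : ∀ f : M → ℝ, coordFun f φ (φ x) = f x := fun f => congrArg f (φ.left_inv hx)
  rw [← hl (B.toFun g)]
  obtain ⟨hσ, ho⟩ := h.isDefining g
  refine he φ.target φ.open_target _ (smoothMetricOn_coordMetric hφ g.1) _
    (coordFun (σ.toFun g) φ) _ (contDiffOn_coordFun hs hφ) (contDiffOn_coordFun hσ.smooth hφ)
    (contDiffOn_coordFun (B.smooth g) hφ) (fun y _ => ho.zeroLocus _) (fun y hy hy0 => ?_)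
    (fun y hy => ?_) _ (φ.map_source hx) ((hl s).trans h0)
  · obtain ⟨r, hr, hrr⟩ := ho.orientation _ hy0
    refine ⟨r, hr, fun a => ?_⟩
    rw [partialDeriv, partialDeriv, fderiv_coordFun hφ hσ.smooth hy, fderiv_coordFun hφ hs hy, hrr]
    rfl
  · have := yamabeS_eq g.1 hφ (φ.map_target hy) hσ.smooth
    rw [φ.right_inv hy] at this
    exact this.symm.trans (h.eq g _)

/-- Uniqueness follows from universality: for every solution, `B` restricts to the value of the same
expression in the given `s` and `g`. -/
theorem existsUnique_isObstructionDensity (hd : 2 ≤ d) {e : HypExpr 0}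
    (he : IsObstructionExpr d e) (c : ConformalStructure d M) {s : M → ℝ}
    (hs : IsDefiningFunction d s) :
    ∃! b : c.metrics → {x : M // s x = 0} → ℝ, IsObstructionDensity c s b := by
  obtain ⟨σ, B, h⟩ := exists_isYamabeSolution hd c hs
  refine ⟨fun g x => B.toFun g x, ⟨σ, B, h.isDefining, h.eq, fun _ _ => rfl⟩, ?_⟩
  rintro b ⟨σ', B', h1, h2, h3⟩
  have h' : IsYamabeSolution s σ' B' := ⟨h1, h2⟩
  funext g x
  have hφ := chartAt_mem_maximalAtlas (d := d) x.1
  rw [h3, h'.eq_eval hs.smooth he g hφ (mem_chart_source _ _) x.2,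
    h.eq_eval hs.smooth he g hφ (mem_chart_source _ _) x.2]

lemma IsObstructionDensity.eq_eval {c : ConformalStructure d M} {s : M → ℝ}
    {b : c.metrics → {x : M // s x = 0} → ℝ} (hb : IsObstructionDensity c s b)
    (hs : IsDefiningFunction d s) {e : HypExpr 0} (he : IsObstructionExpr d e)
    (g : c.metrics) (x : {x : M // s x = 0}) {φ : OpenPartialHomeomorph M (Model d)}
    (hφ : φ ∈ IsManifold.maximalAtlas (𝓡 d) ∞ M) (hx : x.1 ∈ φ.source) :
    b g x = e.eval (coordMetric g.1 φ) (coordFun s φ) Fin.elim0 (φ x.1) := by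
  obtain ⟨σ, B, h1, h2, h3⟩ := hb
  rw [h3]
  exact IsYamabeSolution.eq_eval ⟨h1, h2⟩ hs.smooth he g hφ hx x.2

lemma differential_comp_eq_zero_iff {N : Type u} [TopologicalSpace N] [ChartedSpace (Model d) N]
    [IsManifold (𝓡 d) ∞ N] (F : M ≃ₘ^∞⟮𝓡 d, 𝓡 d⟯ N) {s : N → ℝ}
    (hs : ContMDiff (𝓡 d) 𝓘(ℝ, ℝ) ∞ s) (x : M) :
    differential d (fun z => s (F z)) x = 0 ↔ differential d s (F x) = 0 := by
  have h1 : differential d (fun z => s (F z)) x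
      = (differential d s (F x)).comp (mfderiv (𝓡 d) (𝓡 d) F x) :=
    mfderiv_comp x ((hs (F x)).mdifferentiableAt (by simp))
      ((F.contMDiff x).mdifferentiableAt (by simp))
  have h2 : Function.Surjective (mfderiv (𝓡 d) (𝓡 d) F x) :=
    (F.mfderivToContinuousLinearEquiv (by simp) x).surjective
  rw [h1]
  refine ⟨fun h => ?_, fun h => by rw [h]; rfl⟩
  ext v
  obtain ⟨w, rfl⟩ := h2 v
  exact congrArg (fun L : TangentSpace (𝓡 d) x →L[ℝ] ℝ => L w) h

end Manifold

open Classical in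
/-- The scalar assignment given by an expression, where `ds ≠ 0`. -/
def HypExpr.scalar {d : ℕ} (e : HypExpr 0) : ScalarAssignment.{u} d := fun _ _ _ _ g s x =>
  -- The cut-off value does not affect the hypersurface, where `ds ≠ 0`. The condition is invariant
  -- under diffeomorphisms, so naturality holds at every point.
  if differential d s x = 0 then 0 else
    e.eval (coordMetric g (chartAt (Model d) x)) (coordFun s (chartAt (Model d) x)) Fin.elim0
      (chartAt (Model d) x x)

section Scalar

variable {d : ℕ} {e : HypExpr 0} (he : IsObstructionExpr d e)
include he

lemma IsObstructionExpr.scalar_eq {M : Type u} [TopologicalSpace M] [ChartedSpace (Model d) M]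
    [IsManifold (𝓡 d) ∞ M] {c : ConformalStructure d M} {s : M → ℝ} {σ : Density c 1}
    {B : Density c (-(d : ℝ))} (h : IsYamabeSolution s σ B) (hs : IsDefiningFunction d s)
    (g : c.metrics) {x : M} (h0 : s x = 0) : e.scalar M g.1 s x = B.toFun g x := by
  rw [HypExpr.scalar, if_neg (hs.regular x h0),
    h.eq_eval hs.smooth he g (chartAt_mem_maximalAtlas x) (mem_chart_source _ x) h0]

/-- Naturality is the chart invariance of the expression along an isometry. Independence of the
defining function holds because a solution for `s` is also one for a compatibly oriented `s'`, so
both values equal the same `B`. The polynomial is a jet polynomial of the expression, and serves in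
every chart by chart invariance. -/
theorem IsObstructionExpr.isPreInvariant (hd : 2 ≤ d) :
    IsPreInvariant (e.scalar : ScalarAssignment.{u} d) := by
  have hd0 : 0 < d := by omega
  refine ⟨?_, ?_, ?_⟩
  · intro M N _ _ _ _ _ _ F g g' hg s hs x
    have hφ := chartAt_mem_maximalAtlas (d := d) x
    have hψ := chartAt_mem_maximalAtlas (d := d) (F x)
    have hiff := differential_comp_eq_zero_iff F hs.smooth x
    by_cases h : differential d s (F x) = 0
    · rw [HypExpr.scalar, HypExpr.scalar, if_pos h, if_pos (hiff.mpr h)]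
    · rw [HypExpr.scalar, HypExpr.scalar, if_neg h, if_neg (fun h' => h (hiff.mp h'))]
      have hF : IsLocalIsometry F g' g := ⟨F.contMDiff, hg⟩
      exact hF.eval_eq hφ hψ (mem_chart_source _ x) (mem_chart_source _ (F x)) hs.smooth hd0 he
        (gradSq_pos_of_differential hψ hs.smooth g (mem_chart_source _ (F x)) h)
  · intro M _ _ _ g s s' hs hs' h x hx
    obtain ⟨σ, B, hB⟩ := exists_isYamabeSolution hd (ConformalStructure.ofMetric g) hs
    have h1 := he.scalar_eq hB hs ⟨g, _, IsRescaling.refl g⟩ hx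
    have h2 := he.scalar_eq (hB.of_compatiblyOriented h) hs' ⟨g, _, IsRescaling.refl g⟩
      ((h.zeroLocus x).mp hx)
    exact h1.trans h2.symm
  · obtain ⟨p, hp⟩ := e.isJetPolynomial (d := d) Fin.elim0
    refine ⟨p, fun M _ _ _ g s hs φ hφ x hx h => ?_⟩
    have hpos := gradSq_pos_of_differential hφ hs.smooth g hx h
    rw [HypExpr.scalar, if_neg h]
    refine ((isLocalIsometry_id g).eval_eq (chartAt_mem_maximalAtlas x) hφ (mem_chart_source _ x)
      hx hs.smooth hd0 he hpos).trans ?_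
    have hG := smoothMetricOn_coordMetric hφ g
    have hsφ := contDiffOn_coordFun hs.smooth hφ
    exact hp (φ.target ∩ gradSq (coordMetric g φ) (coordFun s φ) ⁻¹' Set.Ioi 0) _ _
      ⟨(contDiffOn_gradSq φ.open_target hG hsφ).continuousOn.isOpen_inter_preimage φ.open_target
        isOpen_Ioi, hG.mono Set.inter_subset_left, hsφ.mono Set.inter_subset_left,
        fun y hy => hy.2⟩ _ ⟨φ.map_source hx, hpos⟩

/-- On the hypersurface both values are those of one density `B` in two scales of its conformal
class, so the weight is that of `B`. -/
theorem IsObstructionExpr.isConformalCovariant (hd : 2 ≤ d) :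
    IsConformalCovariant (-(d : ℝ)) (e.scalar : ScalarAssignment.{u} d) := by
  refine ⟨he.isPreInvariant hd, fun M _ _ _ g g' Ω h s hs x hx => ?_⟩
  obtain ⟨σ, B, hB⟩ := exists_isYamabeSolution hd (ConformalStructure.ofMetric g) hs
  rw [he.scalar_eq hB hs ⟨g, _, IsRescaling.refl g⟩ hx, he.scalar_eq hB hs ⟨g', Ω, h⟩ hx]
  exact B.rescale _ _ Ω h x

end Scalar

end

end HypersurfaceInvariants

theorem mainTheorem3 (d : ℕ) (hd : 3 ≤ d) :
    -- the obstruction density exists and is determined by the conformal embedding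
    (∀ (M : Type u) [TopologicalSpace M] [ChartedSpace (HypersurfaceInvariants.Model d) M]
        [IsManifold (𝓡 d) ∞ M] (c : HypersurfaceInvariants.ConformalStructure d M) (s : M → ℝ),
        HypersurfaceInvariants.IsDefiningFunction d s →
        ∃! b : c.metrics → {x : M // s x = 0} → ℝ,
          HypersurfaceInvariants.IsObstructionDensity c s b) ∧
    -- it is a conformal hypersurface invariant of weight `-d`
    (∃ P : HypersurfaceInvariants.ScalarAssignment.{u} d,
      HypersurfaceInvariants.IsConformalCovariant (-(d : ℝ)) P ∧
      ∀ (M : Type u) [TopologicalSpace M] [ChartedSpace (HypersurfaceInvariants.Model d) M]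
        [IsManifold (𝓡 d) ∞ M] (c : HypersurfaceInvariants.ConformalStructure d M) (s : M → ℝ),
        HypersurfaceInvariants.IsDefiningFunction d s →
        ∀ b, HypersurfaceInvariants.IsObstructionDensity c s b →
        ∀ (g : c.metrics) (x : {x : M // s x = 0}), b g x = P M g.1 s x.1) ∧
    -- in any scale it is a universal expression in the conormal, the derivatives of the second
    -- fundamental form, and the derivatives of the ambient curvature
    (∃ e : HypersurfaceInvariants.HypExpr 0, e.OrderLE (d - 1) (d - 2) ∧
      ∀ (M : Type u) [TopologicalSpace M] [ChartedSpace (HypersurfaceInvariants.Model d) M]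
        [IsManifold (𝓡 d) ∞ M] (c : HypersurfaceInvariants.ConformalStructure d M) (s : M → ℝ),
        HypersurfaceInvariants.IsDefiningFunction d s →
        ∀ b, HypersurfaceInvariants.IsObstructionDensity c s b →
        ∀ (g : c.metrics) (x : {x : M // s x = 0}),
        ∀ φ ∈ IsManifold.maximalAtlas (𝓡 d) ∞ M, x.1 ∈ φ.source →
          b g x = e.eval (HypersurfaceInvariants.coordMetric g.1 φ)
            (HypersurfaceInvariants.coordFun s φ) Fin.elim0 (φ x.1)) := by
  -- One expression serves all three claims: it forces uniqueness, defines the invariant, and is the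
  -- formula.
  obtain ⟨e, ho, he⟩ := HypersurfaceInvariants.exists_hypExpr_patch (d := d) (by omega)
  have he' : HypersurfaceInvariants.IsObstructionExpr d e := he
  refine ⟨fun M _ _ _ c s hs => HypersurfaceInvariants.existsUnique_isObstructionDensity
    (by omega) he' c hs, ⟨e.scalar, he'.isConformalCovariant (by omega), ?_⟩, e, ho, ?_⟩
  · intro M _ _ _ c s hs b hb g x
    rw [hb.eq_eval hs he' g x (HypersurfaceInvariants.chartAt_mem_maximalAtlas x.1)
      (mem_chart_source _ _), HypersurfaceInvariants.HypExpr.scalar, if_neg (hs.regular x.1 x.2)]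
  · intro M _ _ _ c s hs b hb g x φ hφ hx
    exact hb.eq_eval hs he' g x hφ hx
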